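/- **Setting.** Let $\mathcal A=\mathbb Z\mathbf 1\oplus\mathbb ZX$ with $X^2=0$, $\deg\mathbf 1=-1$, $\deg X=1$, be the graded Frobenius algebra with $\varepsilon(\mathbf 1)=0$, $\varepsilon(X)=1$, $\Delta(\mathbf 1)=\mathbf 1\otimes X+X\otimes\mathbf 1$, $\Delta(X)=X\otimes X$, and let $\mathcal F$ be its 2-dimensional TQFT, so $\mathcal F(M)=\mathcal A^{\otimes r}$ for a disjoint union $M$ of $r$ circles. For $0\le k\le n$ let $B^{n-k,k}$ be the set of crossingless matchings of $2n$ points on a line with no matching among the first $n-k$ points (left platform) and none among the last $k$ points (right platform); the other $n$ points are free. Write $W$ for reflection in the horizontal axis. Let $T$ be a flat tangle with $n$ bottom and $m$ top endpoints (closed circles allowed; $T$ is taken in Morse position, that is, as a composition of elementary cups and caps, as is possible up to isotopy). For $b\in B^{n-k,k}$ and $c\in B^{m-k-l,k+l}$ with $l=\frac{m-n}2$, let $W(c)Tb$ be the closed 1-manifold obtained by attaching the free points of $b$ and $c$ to the endpoints of $T$, joining platform points of $b$ and of $c$ at equal distance from the free points by vertical lines, and joining the remaining outermost left and right platform points of the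 diagram with more platform points to each other by nested arcs. Let $\widetilde{\mathcal F}(T)=\bigoplus_{k,b,c}\mathcal F(W(c)Tb)\{n\}$ ($\{n\}$ shifts degrees up by $n$), let $I(T)$ be the subgroup spanned by the summands for which some circle of $W(c)Tb$ meets a platform at least twice, together with the pure tensors with entries in $\{\mathbf 1,X\}$ that have the entry $X$ at some circle meeting a platform, and put $\mathcal F(T)=\widetilde{\mathcal F}(T)/I(T)$. Let $A^n=\mathcal F(\mathrm{id}_n)=\prod_{k=0}^nA^{n-k,k}$. The multiplication of $A^n$ and the left $A^m$- and right $A^n$-actions on $\mathcal F(T)$ are induced by the minimal (saddle) cobordisms $W(c)T_2d\sqcup W(d)T_1b\to W(c)T_2T_1b$ in which one or both tangles are identities; products of components with different middle diagrams are $0$. The unit of $A^n$ is $\sum_a 1_a$ with $1_a=\mathbf 1^{\otimes n}\in\mathcal F(W(a)a)$. **Proposition.** With these operations $A^n$ is an associative ring with unit and $\mathcal F(T)$ is a unital $(A^m,A^n)$-bimodule. For a flat tangle $T_1$ with $n$ bottom and $s$ top endpoints and a flat tangle $T_2$ with $s$ bottom and $m$ top endpoints there is a canonical isomorphism of $(A^m,A^n)$-bimodules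 $$\mathcal F(T_2)\otimes_{A^s}\mathcal F(T_1)\;\cong\;\mathcal F(T_2T_1).$$ It sends $x\otimes y$, for $x\in\mathcal F(W(c)T_2d)$ and $y\in\mathcal F(W(d)T_1b)$, to the class of the image of $x\otimes y$ under the minimal cobordism $W(c)T_2d\sqcup W(d)T_1b\to W(c)T_2T_1b$ (if $d$ has more platform points than both $b$ and $c$, then the target has in addition $\frac{s-\max(n,m)}2$ circles formed by closing arcs; they meet both platforms, and one takes the coefficient of their label $\mathbf 1$). With the above gradings this isomorphism is homogeneous of degree $\frac12\bigl(\max(n,s)+\max(s,m)-\max(n,m)-s\bigr)$. -/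

import Mathlib

open scoped TensorProduct

namespace FlatTangleBimodule

/-! ### Flat tangles -/

/-- Flat tangles with `n` bottom and `m` top endpoints, in Morse position with respect to the height
function: starting from `n` vertical strands, one successively inserts local minima (`cup T i`
creates a new arc whose two ends become the top endpoints number `i` and `i + 1`, counted from `0`)
and local maxima (`cap T i` joins the top endpoints number `i` and `i + 1`). Closed circles are
allowed. Up to planar isotopy every flat tangle is of this form. -/
inductive FlatTangle (n : ℕ) : ℕ → Type
  | id : FlatTangle n n
  | cup {m : ℕ} (T : FlatTangle n m) (i : Fin (m + 1)) : FlatTangle n (m + 2)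
  | cap {m : ℕ} (T : FlatTangle n (m + 2)) (i : Fin (m + 1)) : FlatTangle n m

namespace FlatTangle

/-- The concatenation `T₂ T₁`: `T₂` is stacked on top of `T₁`. -/
def comp {n s : ℕ} : {m : ℕ} → FlatTangle s m → FlatTangle n s → FlatTangle n m
  | _, .id, T₁ => T₁
  | _, .cup T₂ i, T₁ => .cup (T₂.comp T₁) i
  | _, .cap T₂ i, T₁ => .cap (T₂.comp T₁) i

/-- The pieces into which the tangle is cut at its local maxima: the `n` strands that start at the
bottom, and one piece for every local minimum. -/
def Piece {n : ℕ} : {m : ℕ} → FlatTangle n m → Type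
  | _, .id => Fin n
  | _, .cup T _ => Option T.Piece
  | _, .cap T _ => T.Piece

/-- The piece that contains a given bottom endpoint. -/
def bot {n : ℕ} : {m : ℕ} → (T : FlatTangle n m) → Fin n → T.Piece
  | _, .id, j => j
  | _, .cup T _, j => some (T.bot j)
  | _, .cap T _, j => T.bot j

/-- The piece that contains a given top endpoint. -/
def top {n : ℕ} : {m : ℕ} → (T : FlatTangle n m) → Fin m → T.Piece
  | _, .id, j => j
  | _, .cup (m := m) T i, j =>
      if h : j.val < i.val then some (T.top ⟨j.val, by omega⟩)
      else if h' : j.val ≤ i.val + 1 then none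
      else some (T.top ⟨j.val - 2, by omega⟩)
  | _, .cap (m := m) T i, j =>
      if j.val < i.val then T.top ⟨j.val, by omega⟩ else T.top ⟨j.val + 2, by omega⟩

/-- Two pieces are joined if their ends meet at a local maximum. -/
def Joined {n : ℕ} : {m : ℕ} → (T : FlatTangle n m) → T.Piece → T.Piece → Prop
  | _, .id, _, _ => False
  | _, .cup T _, u, v =>
      ∃ u' v' : T.Piece, u = (some u' : Option T.Piece) ∧ v = (some v' : Option T.Piece) ∧
        T.Joined u' v'
  | _, .cap T i, u, v => T.Joined u v ∨ (u = T.top i.castSucc ∧ v = T.top i.succ)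

/-- Every piece of `T₂ T₁` as a piece of `T₂` or of `T₁` (a piece of `T₁` that continues through
the middle level into `T₂` is sent to `T₁`). -/
def compPiece {n s : ℕ} : {m : ℕ} → (T₂ : FlatTangle s m) → (T₁ : FlatTangle n s) →
    (T₂.comp T₁).Piece → T₂.Piece ⊕ T₁.Piece
  | _, .id, _, v => Sum.inr v
  | _, .cup T₂ _, T₁, v =>
      Option.elim (α := (T₂.comp T₁).Piece) v (Sum.inl (none : Option T₂.Piece)) fun v' =>
        Sum.map (some : T₂.Piece → Option T₂.Piece) (fun w => w) (T₂.compPiece T₁ v')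
  | _, .cap T₂ _, T₁, v => T₂.compPiece T₁ v

theorem finite_piece {n m : ℕ} (T : FlatTangle n m) : Finite T.Piece := by
  induction T with
  | id => exact inferInstanceAs (Finite (Fin _))
  | cup T i ih => exact inferInstanceAs (Finite (Option T.Piece))
  | cap T i ih => exact ih

instance {n m : ℕ} (T : FlatTangle n m) : Finite T.Piece := T.finite_piece

end FlatTangle

/-! ### Crossingless matchings with platforms -/

/-- An element of the disjoint union of the sets `B^{n-k,k}`, `0 ≤ k ≤ n`: a crossingless matching
of `2n` points on a line without a matching among the first `n - k` points (the left platform) or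
among the last `k` points (the right platform). The other `n` points are free. -/
structure Diagram (n : ℕ) where
  k : ℕ
  k_le : k ≤ n
  arc : Fin (2 * n) → Fin (2 * n)
  arc_arc : ∀ i, arc (arc i) = i
  arc_ne : ∀ i, arc i ≠ i
  noncrossing : ∀ i j, ¬ (i < j ∧ j < arc i ∧ arc i < arc j)
  left_platform : ∀ i, i.val < n - k → ¬ (arc i).val < n - k
  right_platform : ∀ i, 2 * n - k ≤ i.val → ¬ 2 * n - k ≤ (arc i).val

namespace Diagram

theorem finite_diagram (n : ℕ) : Finite (Diagram n) :=
  Finite.of_injective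
    (fun b : Diagram n => ((⟨b.k, Nat.lt_succ_of_le b.k_le⟩ : Fin (n + 1)), b.arc))
    (by
      rintro ⟨k, _, arc, _⟩ ⟨k', _, arc', _⟩ h
      simp only [Prod.mk.injEq, Fin.mk.injEq] at h
      obtain ⟨rfl, rfl⟩ := h
      rfl)

instance (n : ℕ) : Finite (Diagram n) := finite_diagram n

/-- The two points lie on the same platform. -/
def SamePlatform {n : ℕ} (b : Diagram n) (i j : Fin (2 * n)) : Prop :=
  (i.val < n - b.k ∧ j.val < n - b.k) ∨ (2 * n - b.k ≤ i.val ∧ 2 * n - b.k ≤ j.val)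

/-- For `c ∈ B^{m-k',k'}` and `b ∈ B^{n-k,k}`: the condition `k' = k + (m - n) / 2`. -/
def Compatible {m n : ℕ} (c : Diagram m) (b : Diagram n) : Prop :=
  (m : ℤ) - 2 * c.k = n - 2 * b.k

end Diagram

/-! ### The closed 1-manifold `W(c) T b` and its circles -/

section Closure

variable {n m : ℕ}

/-- The pieces of `W(c) T b`: the `2m` points of `c`, the pieces of `T`, the `2n` points of `b`. -/
inductive Vertex (T : FlatTangle n m) : Type
  | upper (i : Fin (2 * m)) : Vertex T
  | strand (v : T.Piece) : Vertex T
  | lower (i : Fin (2 * n)) : Vertex T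

/-- How the pieces are joined in `W(c) T b`. The free points of `b` and `c` are attached to the
endpoints of `T`. The platform points of `b` and `c` at the same distance from the free points are
joined by vertical lines. If one of the two diagrams has more platform points, then its outermost
left and right platform points, which remain, are joined to each other by nested arcs. -/
inductive Edge (c : Diagram m) (T : FlatTangle n m) (b : Diagram n) : Vertex T → Vertex T → Prop
  | lowerArc (i : Fin (2 * n)) : Edge c T b (.lower i) (.lower (b.arc i))
  | upperArc (i : Fin (2 * m)) : Edge c T b (.upper i) (.upper (c.arc i))
  | tangle (u v : T.Piece) (h : T.Joined u v) : Edge c T b (.strand u) (.strand v)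
  | bot (i : Fin (2 * n)) (j : Fin n) (h : i.val = (n - b.k) + j.val) :
      Edge c T b (.lower i) (.strand (T.bot j))
  | top (i : Fin (2 * m)) (j : Fin m) (h : i.val = (m - c.k) + j.val) :
      Edge c T b (.upper i) (.strand (T.top j))
  | leftVertical (i : Fin (2 * n)) (i' : Fin (2 * m)) (hi : i.val < n - b.k)
      (hi' : i'.val < m - c.k) (h : (n - b.k) + i'.val = (m - c.k) + i.val) :
      Edge c T b (.lower i) (.upper i')
  | rightVertical (i : Fin (2 * n)) (i' : Fin (2 * m)) (hi : 2 * n - b.k ≤ i.val)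
      (hi' : 2 * m - c.k ≤ i'.val) (h : (2 * n - b.k) + i'.val = (2 * m - c.k) + i.val) :
      Edge c T b (.lower i) (.upper i')
  | lowerExtra (i j : Fin (2 * n)) (hi : i.val + (m - c.k) < n - b.k)
      (h : i.val + j.val + 1 = 2 * n) : Edge c T b (.lower i) (.lower j)
  | upperExtra (i j : Fin (2 * m)) (hi : i.val + (n - b.k) < m - c.k)
      (h : i.val + j.val + 1 = 2 * m) : Edge c T b (.upper i) (.upper j)

/-- The set of circles of `W(c) T b`. -/
def Circle (c : Diagram m) (T : FlatTangle n m) (b : Diagram n) : Type := Quot (Edge c T b)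

/-- The circle through a given piece. -/
def circleOf (c : Diagram m) (T : FlatTangle n m) (b : Diagram n) (v : Vertex T) : Circle c T b :=
  Quot.mk _ v

/-- Both pieces are points of one and the same platform of `c` or of `b`. -/
def SamePlatform (c : Diagram m) {T : FlatTangle n m} (b : Diagram n) : Vertex T → Vertex T → Prop
  | .upper i, .upper j => c.SamePlatform i j
  | .lower i, .lower j => b.SamePlatform i j
  | _, _ => False

/-- The standard basis of the Frobenius algebra `𝒜 = ℤ 1 ⊕ ℤ X`, `X² = 0`. -/
inductive Label : Type
  | one : Label
  | X : Label

/-- The standard basis of `F̃(T) = ⨁ F(W(c) T b){n}`, the sum over all `k` and all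
`b ∈ B^{n-k,k}`, `c ∈ B^{m-k-l,k+l}`, `l = (m - n) / 2`, where `F(W(c) T b)` is the tensor product
of one copy of `𝒜` for every circle of `W(c) T b`. -/
structure LabelledDiagram (T : FlatTangle n m) where
  c : Diagram m
  b : Diagram n
  compatible : c.Compatible b
  label : Circle c T b → Label

/-- The free abelian group `F̃(T)`. -/
abbrev FTilde (T : FlatTangle n m) : Type := LabelledDiagram T →₀ ℤ

/-- Either `W(c) T b` has a type III circle, that is a circle which meets one of the platforms at
least twice, or a circle that meets a platform carries the label `X`. -/
def LabelledDiagram.Killed {T : FlatTangle n m} (β : LabelledDiagram T) : Prop :=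
  (∃ u v : Vertex T, u ≠ v ∧ SamePlatform β.c β.b u v ∧
    circleOf β.c T β.b u = circleOf β.c T β.b v) ∨
  (∃ u : Vertex T, SamePlatform β.c β.b u u ∧ β.label (circleOf β.c T β.b u) = Label.X)

/-- The subgroup `I(T)` of `F̃(T)`. -/
noncomputable def I (T : FlatTangle n m) : Submodule ℤ (FTilde T) :=
  Submodule.span ℤ ((fun β => Finsupp.single β (1 : ℤ)) '' {β | β.Killed})

/-- The bimodule `F(T) = F̃(T) / I(T)`; the two actions are defined below. -/
abbrev F (T : FlatTangle n m) : Type := FTilde T ⧸ I T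

/-- The degree of a basis element of `F̃(T)`: `1` has degree `-1`, `X` has degree `1`, and the
grading is shifted up by `n`. -/
noncomputable def LabelledDiagram.degree {T : FlatTangle n m} (β : LabelledDiagram T) : ℤ :=
  ({z | β.label z = Label.X}.ncard : ℤ) - ({z | β.label z = Label.one}.ncard : ℤ) + n

/-- The homogeneous component of `F(T)` in degree `i`. -/
noncomputable def component (T : FlatTangle n m) (i : ℤ) : Submodule ℤ (F T) :=
  (Submodule.span ℤ ((fun β => Finsupp.single β (1 : ℤ)) '' {β | β.degree = i})).map (I T).mkQ

theorem finite_vertex (T : FlatTangle n m) : Finite (Vertex T) :=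
  Finite.of_surjective
    (fun x : Fin (2 * m) ⊕ T.Piece ⊕ Fin (2 * n) =>
      Sum.elim Vertex.upper (Sum.elim Vertex.strand Vertex.lower) x)
    (by
      rintro (i | v | i)
      · exact ⟨Sum.inl i, rfl⟩
      · exact ⟨Sum.inr (Sum.inl v), rfl⟩
      · exact ⟨Sum.inr (Sum.inr i), rfl⟩)

instance (T : FlatTangle n m) : Finite (Vertex T) := finite_vertex T

instance (c : Diagram m) (T : FlatTangle n m) (b : Diagram n) : Finite (Circle c T b) :=
  inferInstanceAs (Finite (Quot _))

end Closure

/-! ### Minimal cobordisms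

The minimal cobordism from `W(c) T₂ d ⊔ W(d) T₁ b` to `W(c) T b`, where `T` is the composite
`T₂ T₁`, or where one of `T₂`, `T₁` is an identity tangle and `T` is the other one. The map
`place` tells where the pieces of `T` lie in `T₂` and `T₁`. -/

section Cobordism

variable {n s m : ℕ} {T₂ : FlatTangle s m} {T₁ : FlatTangle n s} {T : FlatTangle n m}

/-- The inclusion of `W(c) T b` into the picture where `W(c) T₂ d` is put above `W(d) T₁ b`. -/
def placeVertex (place : T.Piece → T₂.Piece ⊕ T₁.Piece) : Vertex T → Vertex T₂ ⊕ Vertex T₁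
  | .upper i => Sum.inl (.upper i)
  | .lower i => Sum.inr (.lower i)
  | .strand v => Sum.map Vertex.strand Vertex.strand (place v)

/-- Two pieces are in one component of the cobordism if they are connected in `W(c) T₂ d`, in
`W(d) T₁ b`, along the gluing of `d` to `W(d)`, or in `W(c) T b`. -/
inductive SurfaceEdge (place : T.Piece → T₂.Piece ⊕ T₁.Piece)
    (c : Diagram m) (d : Diagram s) (b : Diagram n) :
    Vertex T₂ ⊕ Vertex T₁ → Vertex T₂ ⊕ Vertex T₁ → Prop
  | above (u v : Vertex T₂) (h : Edge c T₂ d u v) : SurfaceEdge place c d b (.inl u) (.inl v)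
  | below (u v : Vertex T₁) (h : Edge d T₁ b u v) : SurfaceEdge place c d b (.inr u) (.inr v)
  | glue (i : Fin (2 * s)) : SurfaceEdge place c d b (.inl (.lower i)) (.inr (.upper i))
  | out (u v : Vertex T) (h : Edge c T b u v) :
      SurfaceEdge place c d b (placeVertex place u) (placeVertex place v)

/-- The connected components of the cobordism. -/
def Surface (place : T.Piece → T₂.Piece ⊕ T₁.Piece)
    (c : Diagram m) (d : Diagram s) (b : Diagram n) : Type :=
  Quot (SurfaceEdge place c d b)

instance (place : T.Piece → T₂.Piece ⊕ T₁.Piece) (c : Diagram m) (d : Diagram s) (b : Diagram n) :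
    Finite (Surface place c d b) :=
  inferInstanceAs (Finite (Quot _))

/-- The saddles of the cobordism: one for every arc of `d` (given by its left endpoint), and, if
both `c` and `b` have more platform points than `d`, one for every pair of nested closing arcs
above and below that is turned into two vertical lines (given by its left point in `c`). -/
def Saddle (c : Diagram m) (d : Diagram s) (b : Diagram n) : Type :=
  {i : Fin (2 * s) // i < d.arc i} ⊕
  {i : Fin (2 * m) // i.val + (s - d.k) < m - c.k ∧ m - c.k ≤ i.val + (n - b.k)}

/-- If `d` has more platform points than `c` and than `b`, then the nested closing arcs at the
outermost platform points of `d` yield circles which are not part of `W(c) T b`. They are given by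
their left points. Each of them meets both platforms once. -/
def ExtraCircle (c : Diagram m) (d : Diagram s) (b : Diagram n) : Type :=
  {i : Fin (2 * s) // i.val + (m - c.k) < s - d.k ∧ i.val + (n - b.k) < s - d.k}

variable (place : T.Piece → T₂.Piece ⊕ T₁.Piece) (c : Diagram m) (d : Diagram s) (b : Diagram n)

/-- The component of the cobordism that contains a given piece. -/
def surfaceOf (v : Vertex T₂ ⊕ Vertex T₁) : Surface place c d b := Quot.mk _ v

/-- The component of the cobordism that contains a given saddle. -/
def saddleSurface : Saddle c d b → Surface place c d b
  | .inl i => surfaceOf place c d b (.inl (.lower i.1))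
  | .inr i => surfaceOf place c d b (.inl (.upper i.1))

/-- The boundary circles of the cobordism: the circles of `W(c) T₂ d` and of `W(d) T₁ b` (incoming),
the circles of `W(c) T b` and the extra circles (outgoing). -/
abbrev BoundaryCircle (T₂ : FlatTangle s m) (T₁ : FlatTangle n s) (T : FlatTangle n m)
    (c : Diagram m) (d : Diagram s) (b : Diagram n) : Type :=
  (Circle c T₂ d ⊕ Circle d T₁ b) ⊕ (Circle c T b ⊕ ExtraCircle c d b)

/-- The component of the cobordism that is bounded by a given circle. -/
def boundarySurface : BoundaryCircle T₂ T₁ T c d b → Surface place c d b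
  | .inl (.inl z) => Quot.map Sum.inl (fun u v h => SurfaceEdge.above u v h) z
  | .inl (.inr z) => Quot.map Sum.inr (fun u v h => SurfaceEdge.below u v h) z
  | .inr (.inl z) => Quot.map (placeVertex place) (fun u v h => SurfaceEdge.out u v h) z
  | .inr (.inr i) => surfaceOf place c d b (.inl (.lower i.1))

/-- Incoming circles with label `X`, outgoing circles with label `1`. The extra circles have the
label `1`. -/
def Charged {c : Diagram m} {d : Diagram s} {b : Diagram n} (l₂ : Circle c T₂ d → Label)
    (l₁ : Circle d T₁ b → Label) (l : Circle c T b → Label) : BoundaryCircle T₂ T₁ T c d b → Prop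
  | .inl (.inl z) => l₂ z = Label.X
  | .inl (.inr z) => l₁ z = Label.X
  | .inr (.inl z) => l z = Label.one
  | .inr (.inr _) => True

/-- The genus `g` of a component of the cobordism, from its Euler characteristic
`2 - 2g - #(boundary circles) = -#(saddles)`. -/
noncomputable def genus (j : Surface place c d b) : ℕ :=
  (2 + {x | saddleSurface place c d b x = j}.ncard -
    {x | boundarySurface place c d b x = j}.ncard) / 2

open Classical in
/-- The matrix coefficient, at given labels of the boundary circles, of the map that the TQFT of
the Frobenius algebra `𝒜` (with `ε(1) = 0`, `ε(X) = 1`, `Δ(1) = 1 ⊗ X + X ⊗ 1`, `Δ(X) = X ⊗ X`)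
assigns to the cobordism. A component of genus `g` acts as the multiplication of all its inputs,
then the multiplication by `(mΔ(1))^g = (2X)^g`, then the iterated comultiplication. Its
coefficient is therefore `2^g` if `g + #(incoming X) + #(outgoing 1) = 1`, and `0` otherwise. -/
noncomputable def coefficient {c : Diagram m} {d : Diagram s} {b : Diagram n}
    (l₂ : Circle c T₂ d → Label) (l₁ : Circle d T₁ b → Label) (l : Circle c T b → Label) : ℤ :=
  ∏ᶠ j : Surface place c d b,
    if genus place c d b j +
        {x | boundarySurface place c d b x = j ∧ Charged l₂ l₁ l x}.ncard = 1
    then 2 ^ genus place c d b j else 0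

open Classical in
/-- The product of two basis elements `x ∈ F(W(c) T₂ d)` and `y ∈ F(W(d') T₁ b)`: zero for
`d ≠ d'`, and induced by the minimal cobordism for `d = d'`. -/
noncomputable def mulBasis (β₂ : LabelledDiagram T₂) (β₁ : LabelledDiagram T₁) : FTilde T :=
  if h : β₂.b = β₁.c then
    ∑ᶠ l : Circle β₂.c T β₁.b → Label,
      Finsupp.single
        (⟨β₂.c, β₁.b, β₂.compatible.trans (by rw [h]; exact β₁.compatible), l⟩ : LabelledDiagram T)
        (coefficient place β₂.label (h ▸ β₁.label) l)
  else 0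

/-- The product `F̃(T₂) × F̃(T₁) → F̃(T)`. -/
noncomputable def mulTilde : FTilde T₂ →ₗ[ℤ] FTilde T₁ →ₗ[ℤ] FTilde T :=
  Finsupp.linearCombination ℤ fun β₂ =>
    Finsupp.linearCombination ℤ fun β₁ => mulBasis place β₂ β₁


/-! The product respects the subgroups `I(T)`. -/

section Descent

variable {place} {c} {d} {b}

theorem eq_of_charged {l₂ : Circle c T₂ d → Label} {l₁ : Circle d T₁ b → Label}
    {l : Circle c T b → Label} (h0 : coefficient place l₂ l₁ l ≠ 0)
    (x y : BoundaryCircle T₂ T₁ T c d b) (hx : Charged l₂ l₁ l x) (hy : Charged l₂ l₁ l y)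
    (hxy : boundarySurface place c d b x = boundarySurface place c d b y) : x = y := by
  classical
  have : Finite (ExtraCircle c d b) := inferInstanceAs (Finite (Subtype _))
  by_contra hne
  apply h0
  unfold coefficient
  refine finprod_eq_zero _ (boundarySurface place c d b y) ?_ (Set.toFinite _)
  rw [if_neg]
  intro h
  have h1 : {z | boundarySurface place c d b z = boundarySurface place c d b y ∧
      Charged l₂ l₁ l z}.ncard ≤ 1 := by omega
  rw [Set.ncard_le_one (Set.toFinite _)] at h1
  exact hne (h1 x ⟨hxy, hx⟩ y ⟨rfl, hy⟩)

/-- The component of the cobordism that contains a platform point of `W(c) T b` or an extra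
circle. -/
def tokenSurface (place : T.Piece → T₂.Piece ⊕ T₁.Piece) :
    Vertex T ⊕ ExtraCircle c d b → Surface place c d b
  | .inl u => surfaceOf place c d b (placeVertex place u)
  | .inr e => surfaceOf place c d b (.inl (.lower e.1))

/-- Two points of the same platform reappear in the output, or on extra circles. -/
def Tokens (place : T.Piece → T₂.Piece ⊕ T₁.Piece) (c : Diagram m) (d : Diagram s)
    (b : Diagram n) (v w : Vertex T₂ ⊕ Vertex T₁) : Prop :=
  ∃ z y : Vertex T ⊕ ExtraCircle c d b,
    tokenSurface place z = surfaceOf place c d b v ∧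
    tokenSurface place y = surfaceOf place c d b w ∧
    (v ≠ w → z ≠ y) ∧
    (∀ u, z = .inl u → SamePlatform c b u u) ∧ (∀ u, y = .inl u → SamePlatform c b u u) ∧
    (∀ u u', z = .inl u → y = .inl u' → SamePlatform c b u u')

theorem token_left_c (h : n - b.k ≤ m - c.k) (i : Fin (2 * s)) (hi : i.val < s - d.k) :
    (∃ i' : Fin (2 * m), i'.val < m - c.k ∧ i'.val + (s - d.k) = i.val + (m - c.k) ∧
      tokenSurface (c := c) (d := d) (b := b) place (.inl (.upper i')) =
        surfaceOf place c d b (.inl (.lower i))) ∨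
    (∃ e : ExtraCircle c d b, e.1 = i ∧
      tokenSurface place (.inr e) = surfaceOf place c d b (.inl (.lower i))) := by
  by_cases hx : i.val + (m - c.k) < s - d.k
  · exact Or.inr ⟨⟨i, hx, by omega⟩, rfl, rfl⟩
  · left
    refine ⟨⟨i.val + (m - c.k) - (s - d.k), by omega⟩, by simp; omega, by simp; omega, ?_⟩
    exact (Quot.sound (.above _ _ (.leftVertical _ _ hi (by simp; omega) (by simp; omega)))).symm

theorem token_right_c (hcd : c.Compatible d) (hdb : d.Compatible b)
    (h : n - b.k ≤ m - c.k) (i : Fin (2 * s)) (hi : 2 * s - d.k ≤ i.val) :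
    (∃ i' : Fin (2 * m), 2 * m - c.k ≤ i'.val ∧
      i'.val + (2 * s - d.k) = i.val + (2 * m - c.k) ∧
      tokenSurface (c := c) (d := d) (b := b) place (.inl (.upper i')) =
        surfaceOf place c d b (.inl (.lower i))) ∨
    (∃ e : ExtraCircle c d b, e.1.val + i.val + 1 = 2 * s ∧
      tokenSurface place (.inr e) = surfaceOf place c d b (.inl (.lower i))) := by
  have := c.k_le; have := d.k_le; have := b.k_le
  have hi2 := i.isLt
  unfold Diagram.Compatible at hcd hdb
  by_cases hx : i.val + (2 * m - c.k) < 2 * m + (2 * s - d.k)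
  · left
    refine ⟨⟨i.val + (2 * m - c.k) - (2 * s - d.k), by omega⟩, by simp; omega, by simp; omega, ?_⟩
    exact (Quot.sound (.above _ _ (.rightVertical _ _ hi (by simp; omega) (by simp; omega)))).symm
  · right
    refine ⟨⟨⟨2 * s - 1 - i.val, by omega⟩, by simp; omega, by simp; omega⟩, by simp; omega, ?_⟩
    exact Quot.sound (.above _ _ (.lowerExtra _ _ (by simp; omega) (by simp; omega)))

theorem token_left_b (h : m - c.k ≤ n - b.k) (i : Fin (2 * s)) (hi : i.val < s - d.k) :
    (∃ i' : Fin (2 * n), i'.val < n - b.k ∧ i'.val + (s - d.k) = i.val + (n - b.k) ∧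
      tokenSurface (c := c) (d := d) (b := b) place (.inl (.lower i')) =
        surfaceOf place c d b (.inl (.lower i))) ∨
    (∃ e : ExtraCircle c d b, e.1 = i ∧
      tokenSurface place (.inr e) = surfaceOf place c d b (.inl (.lower i))) := by
  by_cases hx : i.val + (n - b.k) < s - d.k
  · exact Or.inr ⟨⟨i, by omega, hx⟩, rfl, rfl⟩
  · left
    refine ⟨⟨i.val + (n - b.k) - (s - d.k), by omega⟩, by simp; omega, by simp; omega, ?_⟩
    refine Eq.trans ?_ (Quot.sound (.glue i)).symm
    exact Quot.sound (.below _ _ (.leftVertical _ _ (by simp; omega) hi (by simp; omega)))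

theorem token_right_b (hcd : c.Compatible d) (hdb : d.Compatible b)
    (h : m - c.k ≤ n - b.k) (i : Fin (2 * s)) (hi : 2 * s - d.k ≤ i.val) :
    (∃ i' : Fin (2 * n), 2 * n - b.k ≤ i'.val ∧
      i'.val + (2 * s - d.k) = i.val + (2 * n - b.k) ∧
      tokenSurface (c := c) (d := d) (b := b) place (.inl (.lower i')) =
        surfaceOf place c d b (.inl (.lower i))) ∨
    (∃ e : ExtraCircle c d b, e.1.val + i.val + 1 = 2 * s ∧
      tokenSurface place (.inr e) = surfaceOf place c d b (.inl (.lower i))) := by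
  have := c.k_le; have := d.k_le; have := b.k_le
  have hi2 := i.isLt
  unfold Diagram.Compatible at hcd hdb
  by_cases hx : i.val + (2 * n - b.k) < 2 * n + (2 * s - d.k)
  · left
    refine ⟨⟨i.val + (2 * n - b.k) - (2 * s - d.k), by omega⟩, by simp; omega, by simp; omega, ?_⟩
    refine Eq.trans ?_ (Quot.sound (.glue i)).symm
    exact Quot.sound (.below _ _ (.rightVertical _ _ (by simp; omega) hi (by simp; omega)))
  · right
    refine ⟨⟨⟨2 * s - 1 - i.val, by omega⟩, by simp; omega, by simp; omega⟩, by simp; omega, ?_⟩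
    exact Quot.sound (.above _ _ (.lowerExtra _ _ (by simp; omega) (by simp; omega)))

/-- Tokens of two points, from a relation `R` between tokens and the positions of the points. -/
theorem tokens_of {i j : Fin (2 * s)} (R : Vertex T ⊕ ExtraCircle c d b → ℕ → Prop)
    (hR : ∀ z p q, R z p → R z q → p = q)
    (hS : ∀ u u' p q, R (.inl u) p → R (.inl u') q → SamePlatform c b u u')
    (hi : ∃ z, tokenSurface place z = surfaceOf place c d b (.inl (.lower i)) ∧ R z i)
    (hj : ∃ z, tokenSurface place z = surfaceOf place c d b (.inl (.lower j)) ∧ R z j) :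
    Tokens place c d b (.inl (.lower i)) (.inl (.lower j)) := by
  obtain ⟨z, h1, h2⟩ := hi
  obtain ⟨y, g1, g2⟩ := hj
  refine ⟨z, y, h1, g1, fun hne he => ?_, ?_, ?_, ?_⟩
  · subst he
    exact hne (by rw [Fin.ext (hR z _ _ h2 g2)])
  · rintro u rfl
    exact hS u u _ _ h2 h2
  · rintro u rfl
    exact hS u u _ _ g2 g2
  · rintro u u' rfl rfl
    exact hS u u' _ _ h2 g2

theorem tokens_middle (hcd : c.Compatible d) (hdb : d.Compatible b) (i j : Fin (2 * s))
    (hij : d.SamePlatform i j) : Tokens place c d b (.inl (.lower i)) (.inl (.lower j)) := by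
  rcases le_total (n - b.k) (m - c.k) with h | h
  · rcases hij with ⟨hi, hj⟩ | ⟨hi, hj⟩
    · have key := fun i hi => token_left_c (place := place) (c := c) (d := d) (b := b) h i hi
      refine tokens_of (fun z p => Sum.elim (fun u => ∃ i', u = .upper i' ∧ i'.val < m - c.k ∧
        i'.val + (s - d.k) = p + (m - c.k)) (fun e => e.1.val = p) z) ?_ ?_ ?_ ?_
      · rintro (u | e) p q
        · rintro ⟨i', rfl, h1, h2⟩ ⟨j', hu, g1, g2⟩
          cases hu
          omega
        · rintro h1 h2
          exact h1.symm.trans h2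
      · rintro _ _ p q ⟨i', rfl, h1, h2⟩ ⟨j', rfl, g1, g2⟩
        exact Or.inl ⟨h1, g1⟩
      · rcases key i hi with ⟨i', h1, h2, h3⟩ | ⟨e, h1, h2⟩
        exacts [⟨_, h3, i', rfl, h1, h2⟩, ⟨_, h2, congrArg Fin.val h1⟩]
      · rcases key j hj with ⟨i', h1, h2, h3⟩ | ⟨e, h1, h2⟩
        exacts [⟨_, h3, i', rfl, h1, h2⟩, ⟨_, h2, congrArg Fin.val h1⟩]
    · have key := fun i hi => token_right_c (place := place) hcd hdb h i hi
      refine tokens_of (fun z p => Sum.elim (fun u => ∃ i', u = .upper i' ∧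
        2 * m - c.k ≤ i'.val ∧ i'.val + (2 * s - d.k) = p + (2 * m - c.k))
        (fun e => e.1.val + p + 1 = 2 * s) z) ?_ ?_ ?_ ?_
      · rintro (u | e) p q
        · rintro ⟨i', rfl, h1, h2⟩ ⟨j', hu, g1, g2⟩
          cases hu
          omega
        · intro (h1 : _ + _ + _ = _) (h2 : _ + _ + _ = _)
          omega
      · rintro _ _ p q ⟨i', rfl, h1, h2⟩ ⟨j', rfl, g1, g2⟩
        exact Or.inr ⟨h1, g1⟩
      · rcases key i hi with ⟨i', h1, h2, h3⟩ | ⟨e, h1, h2⟩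
        exacts [⟨_, h3, i', rfl, h1, h2⟩, ⟨_, h2, h1⟩]
      · rcases key j hj with ⟨i', h1, h2, h3⟩ | ⟨e, h1, h2⟩
        exacts [⟨_, h3, i', rfl, h1, h2⟩, ⟨_, h2, h1⟩]
  · rcases hij with ⟨hi, hj⟩ | ⟨hi, hj⟩
    · have key := fun i hi => token_left_b (place := place) (c := c) (d := d) (b := b) h i hi
      refine tokens_of (fun z p => Sum.elim (fun u => ∃ i', u = .lower i' ∧ i'.val < n - b.k ∧
        i'.val + (s - d.k) = p + (n - b.k)) (fun e => e.1.val = p) z) ?_ ?_ ?_ ?_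
      · rintro (u | e) p q
        · rintro ⟨i', rfl, h1, h2⟩ ⟨j', hu, g1, g2⟩
          cases hu
          omega
        · rintro h1 h2
          exact h1.symm.trans h2
      · rintro _ _ p q ⟨i', rfl, h1, h2⟩ ⟨j', rfl, g1, g2⟩
        exact Or.inl ⟨h1, g1⟩
      · rcases key i hi with ⟨i', h1, h2, h3⟩ | ⟨e, h1, h2⟩
        exacts [⟨_, h3, i', rfl, h1, h2⟩, ⟨_, h2, congrArg Fin.val h1⟩]
      · rcases key j hj with ⟨i', h1, h2, h3⟩ | ⟨e, h1, h2⟩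
        exacts [⟨_, h3, i', rfl, h1, h2⟩, ⟨_, h2, congrArg Fin.val h1⟩]
    · have key := fun i hi => token_right_b (place := place) hcd hdb h i hi
      refine tokens_of (fun z p => Sum.elim (fun u => ∃ i', u = .lower i' ∧
        2 * n - b.k ≤ i'.val ∧ i'.val + (2 * s - d.k) = p + (2 * n - b.k))
        (fun e => e.1.val + p + 1 = 2 * s) z) ?_ ?_ ?_ ?_
      · rintro (u | e) p q
        · rintro ⟨i', rfl, h1, h2⟩ ⟨j', hu, g1, g2⟩
          cases hu
          omega
        · intro (h1 : _ + _ + _ = _) (h2 : _ + _ + _ = _)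
          omega
      · rintro _ _ p q ⟨i', rfl, h1, h2⟩ ⟨j', rfl, g1, g2⟩
        exact Or.inr ⟨h1, g1⟩
      · rcases key i hi with ⟨i', h1, h2, h3⟩ | ⟨e, h1, h2⟩
        exacts [⟨_, h3, i', rfl, h1, h2⟩, ⟨_, h2, h1⟩]
      · rcases key j hj with ⟨i', h1, h2, h3⟩ | ⟨e, h1, h2⟩
        exacts [⟨_, h3, i', rfl, h1, h2⟩, ⟨_, h2, h1⟩]

theorem tokens_above (hcd : c.Compatible d) (hdb : d.Compatible b) (v w : Vertex T₂)
    (h : SamePlatform c d v w) : Tokens place c d b (.inl v) (.inl w) := by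
  rcases v with i | p | i <;> rcases w with j | q | j <;> try exact h.elim
  · refine ⟨.inl (.upper i), .inl (.upper j), rfl, rfl, fun hne he => ?_, ?_, ?_, ?_⟩
    · cases he
      exact hne rfl
    · rintro _ ⟨⟩
      exact h.imp (fun x => ⟨x.1, x.1⟩) (fun x => ⟨x.1, x.1⟩)
    · rintro _ ⟨⟩
      exact h.imp (fun x => ⟨x.2, x.2⟩) (fun x => ⟨x.2, x.2⟩)
    · rintro _ _ ⟨⟩ ⟨⟩
      exact h
  · exact tokens_middle hcd hdb i j h

theorem tokens_below (hcd : c.Compatible d) (hdb : d.Compatible b) (v w : Vertex T₁)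
    (h : SamePlatform d b v w) : Tokens place c d b (.inr v) (.inr w) := by
  rcases v with i | p | i <;> rcases w with j | q | j <;> try exact h.elim
  · obtain ⟨z, y, h1, h2, h3, h4⟩ := tokens_middle (place := place) hcd hdb i j h
    refine ⟨z, y, h1.trans (Quot.sound (.glue i)), h2.trans (Quot.sound (.glue j)),
      fun hne => h3 fun he => hne ?_, h4⟩
    cases he
    rfl
  · refine ⟨.inl (.lower i), .inl (.lower j), rfl, rfl, fun hne he => ?_, ?_, ?_, ?_⟩
    · cases he
      exact hne rfl
    · rintro _ ⟨⟩
      exact h.imp (fun x => ⟨x.1, x.1⟩) (fun x => ⟨x.1, x.1⟩)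
    · rintro _ ⟨⟩
      exact h.imp (fun x => ⟨x.2, x.2⟩) (fun x => ⟨x.2, x.2⟩)
    · rintro _ _ ⟨⟩ ⟨⟩
      exact h

theorem label_cases (a : Label) : a = Label.one ∨ a = Label.X := by
  cases a
  exacts [Or.inl rfl, Or.inr rfl]

/-- If an incoming circle through a platform point is labelled `X`, or if an incoming circle meets
a platform twice, then all outputs with a non-zero coefficient lie in `I(T)`. -/
theorem killed_of_tokens (hcb : c.Compatible b) {l₂ : Circle c T₂ d → Label}
    {l₁ : Circle d T₁ b → Label} {l : Circle c T b → Label} (h0 : coefficient place l₂ l₁ l ≠ 0)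
    (v w : Vertex T₂ ⊕ Vertex T₁) (ht : Tokens place c d b v w)
    (hvw : surfaceOf place c d b v = surfaceOf place c d b w)
    (h : v ≠ w ∨ ∃ x : Circle c T₂ d ⊕ Circle d T₁ b, Charged l₂ l₁ l (.inl x) ∧
      boundarySurface place c d b (.inl x) = surfaceOf place c d b v) :
    LabelledDiagram.Killed (⟨c, b, hcb, l⟩ : LabelledDiagram T) := by
  by_contra hk
  have hout : ∀ u : Vertex T, SamePlatform c b u u →
      Charged l₂ l₁ l (.inr (.inl (circleOf c T b u))) := fun u hu =>
    (label_cases _).resolve_right fun hX => hk (Or.inr ⟨u, hu, hX⟩)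
  have hs : ∀ u : Vertex T, boundarySurface (T₂ := T₂) (T₁ := T₁) place c d b
      (.inr (.inl (circleOf c T b u))) = surfaceOf place c d b (placeVertex place u) :=
    fun u => rfl
  have he : ∀ e : ExtraCircle c d b, boundarySurface (T₂ := T₂) (T₁ := T₁) place c d b
      (.inr (.inr e)) = surfaceOf place c d b (.inl (.lower e.1)) := fun e => rfl
  obtain ⟨z, y, h1, h2, h3, h4, h5, h6⟩ := ht
  rcases h with hne | ⟨x, hx, hxv⟩
  · have h3 := h3 hne
    have hzy := h1.trans (hvw.trans h2.symm)
    rcases z with u | e <;> rcases y with u' | e'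
    · have hq := eq_of_charged h0 _ _ (hout u (h4 u rfl)) (hout u' (h5 u' rfl))
        ((hs u).trans (hzy.trans (hs u').symm))
      refine hk (Or.inl ⟨u, u', fun hu => h3 (by rw [hu]), h6 u u' rfl rfl, ?_⟩)
      exact Sum.inl_injective (Sum.inr_injective hq)
    · have hq := eq_of_charged h0 _ (.inr (.inr e')) (hout u (h4 u rfl)) trivial
        ((hs u).trans (hzy.trans (he e').symm))
      cases hq
    · have hq := eq_of_charged h0 (.inr (.inr e)) _ trivial (hout u' (h5 u' rfl))
        ((he e).trans (hzy.trans (hs u').symm))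
      cases hq
    · have hq := eq_of_charged h0 (.inr (.inr e)) (.inr (.inr e')) trivial trivial
        ((he e).trans (hzy.trans (he e').symm))
      cases hq
      exact h3 rfl
  · rcases z with u | e
    · have hq := eq_of_charged h0 _ _ hx (hout u (h4 u rfl)) (hxv.trans (h1.symm.trans (hs u).symm))
      cases hq
    · have hq := eq_of_charged h0 _ (.inr (.inr e)) hx trivial (hxv.trans (h1.symm.trans (he e).symm))
      cases hq

variable (place)

theorem mulBasis_mem (β₂ : LabelledDiagram T₂) (β₁ : LabelledDiagram T₁)
    (h : β₂.Killed ∨ β₁.Killed) : mulBasis place β₂ β₁ ∈ I T := by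
  obtain ⟨c, d, hcd, l₂⟩ := β₂
  obtain ⟨d', b, hdb, l₁⟩ := β₁
  unfold mulBasis
  split_ifs with hd
  · replace hd : d = d' := hd
    subst hd
    refine finsum_induction (p := fun x => x ∈ I T) (I T).zero_mem
      (fun x y hx hy => (I T).add_mem hx hy) fun l => ?_
    by_cases h0 : coefficient place l₂ l₁ l = 0
    · change Finsupp.single _ (coefficient place l₂ l₁ l) ∈ I T
      rw [h0, Finsupp.single_zero]
      exact (I T).zero_mem
    · have hk : LabelledDiagram.Killed (⟨c, b, hcd.trans hdb, l⟩ : LabelledDiagram T) := by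
        rcases h with (⟨u, v, hne, hs, hc⟩ | ⟨u, hs, hX⟩) | (⟨u, v, hne, hs, hc⟩ | ⟨u, hs, hX⟩)
        · exact killed_of_tokens _ h0 _ _ (tokens_above hcd hdb u v hs)
            (congrArg (fun z => boundarySurface place c d b (.inl (.inl z))) hc)
            (Or.inl fun he => hne (Sum.inl_injective he))
        · exact killed_of_tokens _ h0 _ _ (tokens_above hcd hdb u u hs) rfl
            (Or.inr ⟨.inl _, hX, rfl⟩)
        · exact killed_of_tokens _ h0 _ _ (tokens_below hcd hdb u v hs)
            (congrArg (fun z => boundarySurface place c d b (.inl (.inr z))) hc)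
            (Or.inl fun he => hne (Sum.inr_injective he))
        · exact killed_of_tokens _ h0 _ _ (tokens_below hcd hdb u u hs) rfl
            (Or.inr ⟨.inr _, hX, rfl⟩)
      have := (I T).smul_mem (coefficient place l₂ l₁ l) (Submodule.subset_span ⟨_, hk, rfl⟩)
      rwa [Finsupp.smul_single, smul_eq_mul, mul_one] at this
  · exact (I T).zero_mem

theorem mulTilde_mem_left (x : FTilde T₂) (y : FTilde T₁) (hx : x ∈ I T₂) :
    mulTilde place x y ∈ I T := by
  induction hx using Submodule.span_induction with
  | mem x hx =>
    obtain ⟨β, hβ, rfl⟩ := hx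
    induction y using Finsupp.induction_linear with
    | zero => rw [map_zero]; exact (I T).zero_mem
    | add f g hf hg => rw [map_add]; exact (I T).add_mem hf hg
    | single a r =>
      simp only [mulTilde, Finsupp.linearCombination_single, one_smul]
      exact (I T).smul_mem _ (mulBasis_mem place _ _ (Or.inl hβ))
  | zero => rw [map_zero]; exact (I T).zero_mem
  | add x y _ _ hx hy => rw [map_add]; exact (I T).add_mem hx hy
  | smul a x _ hx => rw [map_smul]; exact (I T).smul_mem _ hx

theorem mulTilde_mem_right (x : FTilde T₂) (y : FTilde T₁) (hy : y ∈ I T₁) :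
    mulTilde place x y ∈ I T := by
  induction hy using Submodule.span_induction with
  | mem y hy =>
    obtain ⟨β, hβ, rfl⟩ := hy
    induction x using Finsupp.induction_linear with
    | zero => rw [map_zero]; exact (I T).zero_mem
    | add f g hf hg => rw [map_add]; exact (I T).add_mem hf hg
    | single a r =>
      simp only [mulTilde, Finsupp.linearCombination_single, one_smul, LinearMap.smul_apply]
      exact (I T).smul_mem _ (mulBasis_mem place _ _ (Or.inr hβ))
  | zero => rw [map_zero]; exact (I T).zero_mem
  | add x y _ _ hx hy => rw [map_add]; exact (I T).add_mem hx hy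
  | smul a x _ hx => rw [map_smul]; exact (I T).smul_mem _ hx

end Descent

/-- The product `F(T₂) × F(T₁) → F(T)` that is induced by the minimal cobordisms. -/
noncomputable def mulF : F T₂ →ₗ[ℤ] F T₁ →ₗ[ℤ] F T :=
  LinearMap.liftQ₂ (I T₂) (I T₁) ((mulTilde place).compr₂ (I T).mkQ)
    (fun x hx => LinearMap.ext fun y =>
      (Submodule.Quotient.mk_eq_zero _).2 (mulTilde_mem_left place x y hx))
    (fun y hy => LinearMap.ext fun x =>
      (Submodule.Quotient.mk_eq_zero _).2 (mulTilde_mem_right place x y hy))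

end Cobordism

/-! ### The rings `A^n`, the bimodules `F(T)` and their tensor products -/

/-- The ring `A^n = ∏_k A^{n-k,k}`, where `A^{n-k,k}` is the quotient by the ideal `I^{n-k,k}` of
the sum of all `F(W(b) a){n}`, `a, b ∈ B^{n-k,k}`. Here `W(b) a` is written as `W(b) id a` with the
identity tangle `id`. -/
def A (n : ℕ) : Type := F (FlatTangle.id : FlatTangle n n)

noncomputable instance (n : ℕ) : AddCommGroup (A n) :=
  inferInstanceAs (AddCommGroup (F (FlatTangle.id : FlatTangle n n)))

/-- The multiplication of `A^n` is induced by the minimal cobordisms from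
`W(c) a ⊔ W(a) b` to `W(c) b`. -/
noncomputable def mulA (n : ℕ) : A n →ₗ[ℤ] A n →ₗ[ℤ] A n :=
  mulF (T₂ := (FlatTangle.id : FlatTangle n n)) (T₁ := FlatTangle.id) (T := FlatTangle.id) Sum.inr

noncomputable instance (n : ℕ) : NonUnitalNonAssocRing (A n) where
  mul x y := mulA n x y
  left_distrib x y z := map_add (mulA n x) y z
  right_distrib x y z := LinearMap.map_add₂ (mulA n) x y z
  zero_mul x := LinearMap.map_zero₂ (mulA n) x
  mul_zero x := map_zero (mulA n x)

/-- The unit element of `A^n` is the sum over all `a` of `1_a = 1 ⊗ ⋯ ⊗ 1 ∈ F(W(a) a)`. -/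
noncomputable instance (n : ℕ) : One (A n) where
  one := (I (FlatTangle.id : FlatTangle n n)).mkQ
    (∑ᶠ a : Diagram n, Finsupp.single ⟨a, a, rfl, fun _ => Label.one⟩ 1)

section Bimodule

variable {n s m : ℕ}

/-- The left action of `A^m` on `F(T)`, induced by the minimal cobordisms from
`W(a) c ⊔ W(c) T b` to `W(a) T b`. -/
noncomputable def leftAct (T : FlatTangle n m) : A m →ₗ[ℤ] F T →ₗ[ℤ] F T :=
  mulF (T₂ := (FlatTangle.id : FlatTangle m m)) (T₁ := T) (T := T) Sum.inr

/-- The right action of `A^n` on `F(T)`, induced by the minimal cobordisms from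
`W(c) T b ⊔ W(b) a` to `W(c) T a`. -/
noncomputable def rightAct (T : FlatTangle n m) : F T →ₗ[ℤ] A n →ₗ[ℤ] F T :=
  mulF (T₂ := T) (T₁ := (FlatTangle.id : FlatTangle n n)) (T := T) Sum.inl

/-- The map `F(T₂) × F(T₁) → F(T₂ T₁)`, induced by the minimal cobordisms from
`W(c) T₂ d ⊔ W(d) T₁ b` to `W(c) T₂ T₁ b`. -/
noncomputable def composeF (T₂ : FlatTangle s m) (T₁ : FlatTangle n s) :
    F T₂ →ₗ[ℤ] F T₁ →ₗ[ℤ] F (T₂.comp T₁) :=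
  mulF (T₂.compPiece T₁)

/-- `A^n` is an associative ring with unit. -/
structure IsUnitalRing (n : ℕ) : Prop where
  mul_assoc : ∀ x y z : A n, x * y * z = x * (y * z)
  one_mul : ∀ x : A n, 1 * x = x
  mul_one : ∀ x : A n, x * 1 = x

/-- `F(T)` is a unital `(A^m, A^n)`-bimodule. -/
structure IsBimodule (T : FlatTangle n m) : Prop where
  mul_left : ∀ (a a' : A m) (x : F T), leftAct T (a * a') x = leftAct T a (leftAct T a' x)
  one_left : ∀ x : F T, leftAct T 1 x = x
  mul_right : ∀ (x : F T) (a a' : A n), rightAct T x (a * a') = rightAct T (rightAct T x a) a'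
  one_right : ∀ x : F T, rightAct T x 1 = x
  left_right : ∀ (a : A m) (x : F T) (a' : A n),
    rightAct T (leftAct T a x) a' = leftAct T a (rightAct T x a')

/-- The tensor product `F(T₂) ⊗_{A^s} F(T₁)`: the quotient of the tensor product over `ℤ` by all
`x a ⊗ y - x ⊗ a y`. -/
abbrev TensorF (T₂ : FlatTangle s m) (T₁ : FlatTangle n s) : Type :=
  (F T₂ ⊗[ℤ] F T₁) ⧸ Submodule.span ℤ
    {z : F T₂ ⊗[ℤ] F T₁ | ∃ (x : F T₂) (a : A s) (y : F T₁),
      z = rightAct T₂ x a ⊗ₜ[ℤ] y - x ⊗ₜ[ℤ] leftAct T₁ a y}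

/-- The element `x ⊗ y` of `F(T₂) ⊗_{A^s} F(T₁)`. -/
noncomputable def tensor {T₂ : FlatTangle s m} {T₁ : FlatTangle n s} (x : F T₂) (y : F T₁) : TensorF T₂ T₁ :=
  Submodule.Quotient.mk (x ⊗ₜ[ℤ] y)

end Bimodule

end FlatTangleBimodule

open FlatTangleBimodule

/-! A matrix coefficient of a minimal cobordism is a product over its components: `2 ^ g` if the
genus `g` plus the number of charged boundary circles (incoming `X`, outgoing `1`) is one, and zero
otherwise. To compose two cobordisms one sums over the labels of the circles along which they are
glued. Each such circle is a tube whose label charges exactly one of its two ends: `1` charges the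
end where the circle is outgoing, `X` the end where it is incoming. Summed over both choices, a tube
between different components joins them (`weight_merge`), and a tube from a component to itself adds
a handle and with it a factor two (`weight_self`). Hence a composite coefficient depends only on the
glued components, their Euler characteristics and the remaining charges (`exists_glue`).

Since `genus` is a truncated quotient, the Euler characteristics must be shown to belong to
orientable surfaces. Arcs of a crossingless matching join points of opposite parity, so parity
orients every `W(c) T b`, and its circles become the cycles of a permutation. A saddle composes this
permutation with a transposition, which splits one cycle or merges two. Thus a single saddle is a
pair of pants, and gluing these along cycles gives a genus in general (`cycCount_exact`,
`surface_exact`).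

For associativity (`coefficient_assoc`), both bracketings of a threefold product lead to the same
set of components, `Triple`. They differ only in the treatment of the closing arcs at the platforms:
additional saddles, extra circles, and extra circles that have to be glued to the second factor.
These contributions are compared level by level, where the level is the distance from the free
points; all that matters at a level is which of the four diagrams have platform points there.
Outputs in `I(T)` may be ignored, so circles of the output that meet a platform carry the label `1`.
Inserting identity tangles in one position yields the ring and module laws, the balancedness of the
product and its linearity on both sides. The unit law holds because the cobordisms involved only
attach circles labelled `1`, one saddle each.

For bijectivity the lower tangle `T₁` is studied, with `T₂` arbitrary. Given `b`, suppose that some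
`d` is adapted: no circle of `W(d) T₁ b` contains two arcs of `d` or closing arcs of `b`. Then each
component of the cobordism into `W(c) T b` has genus zero and exactly one outgoing circle. If the
circles of `W(d) T₁ b` at those arcs are labelled `1`, a product of basis elements is a basis
element, and each basis element outside `I(T)` factors uniquely in this way (`Factors`). The same
fact for `T₂ = id` shows that such products span the tensor product, and unique factorization gives
the inverse map (`HasAdapted.isFlat`).

Adapted diagrams exist for the elementary tangles. For the identity take `d = b`; for a minimum add
a small arc and an outermost arc; for a maximum join two neighbouring free points and delete the
outermost arc. The last construction fails only if the partners of the two points lie on one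
platform, and then every `W(c) T b` with this `b` is killed. The case of a general `T₁` follows
because bijectivity for all upper tangles passes to compositions (`tensorMap_bijective_of_triple`).
The degree is obtained by counting saddles and extra circles (`degree_of_coefficient`). -/

namespace FlatTangleBimodule

/-! ### Sums over fibres -/

open Classical in
/-- The sum of `f` over the fibre of `q` over `k`. -/
noncomputable def push {J K : Type} (q : J → K) (f : J → ℕ) (k : K) : ℕ :=
  ∑ᶠ j, if q j = k then f j else 0

open Classical in
theorem push_eq_sum {J K : Type} [Fintype J] (q : J → K) (f : J → ℕ) (k : K) :
    push q f k = ∑ j, if q j = k then f j else 0 :=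
  finsum_eq_sum_of_fintype _

theorem push_comp {I J K : Type} [Finite I] [Finite J] (p : I → J) (q : J → K) (f : I → ℕ) :
    push (fun i => q (p i)) f = push q (push p f) := by
  classical
  have := Fintype.ofFinite I
  have := Fintype.ofFinite J
  funext k
  simp only [push_eq_sum]
  calc (∑ i, if q (p i) = k then f i else 0)
      = ∑ i, ∑ j, if p i = j then (if q j = k then f i else 0) else 0 := by simp
    _ = ∑ j, ∑ i, if p i = j then (if q j = k then f i else 0) else 0 := Finset.sum_comm
    _ = _ := by
      refine Finset.sum_congr rfl fun j _ => ?_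
      split_ifs with h
      · rfl
      · simp

theorem push_sum {I J K : Type} [Finite I] [Finite J] (q : I ⊕ J → K) (f : I ⊕ J → ℕ) (k : K) :
    push q f k = push (fun i => q (.inl i)) (fun i => f (.inl i)) k +
      push (fun i => q (.inr i)) (fun i => f (.inr i)) k := by
  classical
  have := Fintype.ofFinite I
  have := Fintype.ofFinite J
  simp only [push_eq_sum]
  exact Fintype.sum_sum_type _

theorem push_add {J K : Type} [Finite J] (q : J → K) (f g : J → ℕ) (k : K) :
    push q (fun j => f j + g j) k = push q f k + push q g k := by
  classical
  have := Fintype.ofFinite J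
  simp only [push_eq_sum, ← Finset.sum_add_distrib]
  exact Finset.sum_congr rfl fun j _ => by split_ifs <;> rfl

theorem push_equiv {I J K : Type} (e : I ≃ J) (q : J → K) (f : J → ℕ) (k : K) :
    push (fun i => q (e i)) (fun i => f (e i)) k = push q f k := by
  classical
  exact finsum_comp_equiv e (f := fun j => if q j = k then f j else 0)

theorem push_of_isEmpty {J K : Type} [IsEmpty J] (q : J → K) (f : J → ℕ) (k : K) :
    push q f k = 0 := by
  unfold push
  exact finsum_of_isEmpty _

theorem push_one {J K : Type} [Finite J] (q : J → K) (k : K) :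
    push q (fun _ => 1) k = {j | q j = k}.ncard := by
  classical
  have := Fintype.ofFinite J
  rw [push_eq_sum, Set.ncard_eq_toFinset_card', Finset.sum_boole]
  simp

open Classical in
theorem push_ite {J K : Type} [Finite J] (q : J → K) (P : J → Prop) (k : K) :
    push q (fun j => if P j then 1 else 0) k = {j | q j = k ∧ P j}.ncard := by
  classical
  have := Fintype.ofFinite J
  rw [push_eq_sum, Set.ncard_eq_toFinset_card']
  simp only [← ite_and]
  rw [Finset.sum_boole]
  simp

theorem push_pos {J K : Type} [Finite J] (q : J → K) (f : J → ℕ) (j : J) :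
    f j ≤ push q f (q j) := by
  classical
  have := Fintype.ofFinite J
  rw [push_eq_sum]
  refine le_trans ?_ (Finset.single_le_sum (f := fun i => if q i = q j then f i else 0)
    (fun _ _ => Nat.zero_le _) (Finset.mem_univ j))
  simp

theorem sum_push {J K : Type} [Fintype J] [Fintype K] (q : J → K) (f : J → ℕ) :
    ∑ k, push q f k = ∑ j, f j := by
  classical
  simp only [push_eq_sum]
  rw [Finset.sum_comm]
  simp

/-! ### Weights and the gluing of components -/

/-- The matrix coefficient of a cobordism whose components have genus `g` and `ch` charged
boundary circles. -/
noncomputable def weight {J : Type} (g ch : J → ℕ) : ℤ :=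
  ∏ᶠ j, if g j + ch j = 1 then 2 ^ g j else 0

theorem weight_equiv {J K : Type} (e : J ≃ K) (g ch : K → ℕ) :
    weight (fun j => g (e j)) (fun j => ch (e j)) = weight g ch :=
  finprod_comp_equiv e (f := fun k => if g k + ch k = 1 then (2 : ℤ) ^ g k else 0)

theorem weight_eq_zero {J : Type} [Finite J] (g ch : J → ℕ) (j : J) (h : g j + ch j ≠ 1) :
    weight g ch = 0 :=
  finprod_eq_zero _ j (if_neg h) (Set.toFinite _)

theorem push_bijective {J K : Type} (q : J → K) (hq : Function.Bijective q) (f : J → ℕ) (j : J) :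
    push q f (q j) = f j := by
  classical
  unfold push
  rw [finsum_eq_single _ j fun i hi => if_neg fun h => hi (hq.1 h), if_pos rfl]

/-- Contracting a tube that joins two different components. -/
theorem weight_merge {J K : Type} [Finite J] [Finite K] (r : J → K) (a b : J) (hab : a ≠ b)
    (hr : Function.Surjective r) (hrab : r a = r b)
    (hinj : ∀ i j, r i = r j → i = j ∨ (i = a ∨ i = b) ∧ (j = a ∨ j = b)) (g ch : J → ℕ) :
    (weight g fun j => ch j + push (fun _ : Unit => a) (fun _ => 1) j) +
      (weight g fun j => ch j + push (fun _ : Unit => b) (fun _ => 1) j) =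
    weight (push r g) (push r ch) := by
  classical
  have := Fintype.ofFinite J
  have := Fintype.ofFinite K
  have h1 : ∀ x j : J, push (fun _ : Unit => x) (fun _ => 1) j = if x = j then 1 else 0 := by
    intro x j
    rw [push_eq_sum]
    simp
  simp only [h1, weight, finprod_eq_prod_of_fintype]
  have hfib : ∀ j, j ≠ a → j ≠ b → ∀ f, push r f (r j) = f j := by
    intro j ha hb f
    rw [push_eq_sum, Finset.sum_eq_single j]
    · simp
    · intro i _ hij
      rw [if_neg]
      intro h
      rcases hinj _ _ h with h | ⟨_, h | h⟩
      exacts [hij h, ha h, hb h]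
    · simp
  have hfab : ∀ f, push r f (r a) = f a + f b := by
    intro f
    rw [push_eq_sum, ← Finset.sum_subset (Finset.subset_univ {a, b}), Finset.sum_pair hab]
    · simp [hrab]
    · intro i _ hi
      rw [if_neg]
      intro h
      simp only [Finset.mem_insert, Finset.mem_singleton, not_or] at hi
      rcases hinj _ _ h with h | ⟨h | h, _⟩
      exacts [hi.1 h, hi.1 h, hi.2 h]
  have hprod : ∀ F : J → ℤ, ∏ j, F j = F a * F b * ∏ j ∈ Finset.univ.filter
      (fun j => j ≠ a ∧ j ≠ b), F j := by
    intro F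
    rw [← Finset.prod_pair hab, ← Finset.prod_filter_mul_prod_filter_not Finset.univ
      (fun j => j = a ∨ j = b)]
    congr 1
    · refine Finset.prod_congr ?_ fun _ _ => rfl
      ext j
      simp
    · refine Finset.prod_congr ?_ fun _ _ => rfl
      ext j
      simp
  have hprodK : ∀ F : K → ℤ, ∏ k, F k = F (r a) * ∏ j ∈ Finset.univ.filter
      (fun j => j ≠ a ∧ j ≠ b), F (r j) := by
    intro F
    rw [← Finset.mul_prod_erase Finset.univ F (Finset.mem_univ (r a))]
    congr 1
    symm
    refine Finset.prod_bij (fun j _ => r j) ?_ ?_ ?_ ?_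
    · intro j hj
      simp only [Finset.mem_filter, Finset.mem_univ, true_and, ne_eq] at hj
      simp only [Finset.mem_erase, Finset.mem_univ, and_true]
      intro h
      rcases hinj _ _ h with h | ⟨h | h, _⟩
      exacts [hj.1 h, hj.1 h, hj.2 h]
    · intro i hi j hj h
      simp only [Finset.mem_filter, Finset.mem_univ, true_and, ne_eq] at hi
      rcases hinj _ _ h with h | ⟨h | h, _⟩
      exacts [h, (hi.1 h).elim, (hi.2 h).elim]
    · intro k hk
      obtain ⟨j, rfl⟩ := hr k
      refine ⟨j, ?_, rfl⟩
      simp only [Finset.mem_erase, Finset.mem_univ, and_true] at hk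
      simp only [Finset.mem_filter, Finset.mem_univ, true_and]
      refine ⟨fun h => hk (by rw [h]), fun h => hk (by rw [h, hrab])⟩
    · intro _ _
      rfl
  rw [hprod, hprod, hprodK]
  have hrest : ∀ x, (x = a ∨ x = b) → ∏ j ∈ Finset.univ.filter (fun j => j ≠ a ∧ j ≠ b),
      (if g j + (ch j + if x = j then 1 else 0) = 1 then (2 : ℤ) ^ g j else 0) =
      ∏ j ∈ Finset.univ.filter (fun j => j ≠ a ∧ j ≠ b),
        if push r g (r j) + push r ch (r j) = 1 then (2 : ℤ) ^ push r g (r j) else 0 := by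
    intro x hx
    refine Finset.prod_congr rfl fun j hj => ?_
    simp only [Finset.mem_filter, Finset.mem_univ, true_and, ne_eq] at hj
    rw [hfib j hj.1 hj.2, hfib j hj.1 hj.2, if_neg (c := x = j), add_zero]
    rintro rfl
    exact hx.elim hj.1 hj.2
  rw [hrest a (.inl rfl), hrest b (.inr rfl), ← add_mul, hfab, hfab]
  congr 1
  simp only [if_true, if_neg hab, if_neg hab.symm, add_zero]
  -- If the joint total is one, one component has total zero and the other total one. The tube must
  -- be charged at the former, so exactly one of the two terms survives. If the joint total is not
  -- one, neither term survives.
  by_cases e : g a + g b + (ch a + ch b) = 1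
  · rw [if_pos e, pow_add]
    by_cases e1 : g a + ch a = 0
    · rw [if_pos (by omega), if_pos (by omega), if_neg (by omega), zero_mul, add_zero]
    · rw [if_neg (c := g a + (ch a + 1) = 1) (by omega), zero_mul, zero_add, if_pos (by omega),
        if_pos (by omega)]
  · rw [if_neg e]
    by_cases e1 : g a + ch a = 0
    · rw [if_pos (by omega), if_neg (by omega), if_neg (c := g a + ch a = 1) (by omega)]
      simp
    · by_cases e2 : g b + ch b = 0
      · rw [if_neg (c := g a + (ch a + 1) = 1) (by omega), if_neg (c := g a + ch a = 1) (by omega)]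
        simp
      · rw [if_neg (c := g a + (ch a + 1) = 1) (by omega),
          if_neg (c := g b + (ch b + 1) = 1) (by omega)]
        simp

/-- Contracting a tube that joins a component to itself. -/
theorem weight_self {J : Type} [Finite J] (a : J) (g ch : J → ℕ) :
    (weight g fun j => ch j + push (fun _ : Unit => a) (fun _ => 1) j) +
      (weight g fun j => ch j + push (fun _ : Unit => a) (fun _ => 1) j) =
    weight (fun j => g j + push (fun _ : Unit => a) (fun _ => 1) j) ch := by
  classical
  have := Fintype.ofFinite J
  have h1 : ∀ x j : J, push (fun _ : Unit => x) (fun _ => 1) j = if x = j then 1 else 0 := by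
    intro x j
    rw [push_eq_sum]
    simp
  simp only [h1, weight, finprod_eq_prod_of_fintype]
  rw [← Finset.mul_prod_erase Finset.univ _ (Finset.mem_univ a),
    ← Finset.mul_prod_erase Finset.univ _ (Finset.mem_univ a)]
  have : ∏ j ∈ Finset.univ.erase a,
      (if g j + (ch j + if a = j then 1 else 0) = 1 then (2 : ℤ) ^ g j else 0) =
      ∏ j ∈ Finset.univ.erase a, (if (g j + if a = j then 1 else 0) + ch j = 1 then
        (2 : ℤ) ^ (g j + if a = j then 1 else 0) else 0) := by
    refine Finset.prod_congr rfl fun j hj => ?_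
    rw [if_neg (c := a = j) (Ne.symm (Finset.ne_of_mem_erase hj)), add_zero, add_zero]
  rw [this, ← add_mul]
  congr 1
  simp only [if_true]
  -- Both labels of the tube give the same term. Their sum doubles it, which is the factor of one
  -- more handle.
  by_cases e : g a + (ch a + 1) = 1
  · rw [if_pos e, if_pos (by omega), pow_succ]
    ring
  · rw [if_neg e, if_neg (by omega), add_zero]

/-- The number of charges that the tubes contribute to a component: each tube `e` is charged at
its end `a e` or at its end `b e`. -/
noncomputable def tubeCharge {E J : Type} (a b : E → J) (x : E → Bool) (j : J) : ℕ :=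
  push (fun e => if x e then a e else b e) (fun _ => 1) j

/-- Induction on the number of tubes, with `J` varying since contracting a tube may remove a
component: the tube either adds a handle or merges two components. The last hypothesis on `q` says
that its fibres are generated by the tubes. In the formula for `G`, the number of tubes minus the
number of components plus one is the first Betti number of the graph along which the components are
glued. -/
theorem exists_glue_fin (N : ℕ) : ∀ {J K : Type} [Finite J] [Finite K] (a b : Fin N → J)
    (q : J → K) (_ : Function.Surjective q) (_ : ∀ e, q (a e) = q (b e))
    (_ : ∀ h : J → Prop, (∀ e, h (a e) ↔ h (b e)) → ∀ i j, q i = q j → h i → h j)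
    (g : J → ℕ), ∃ G : K → ℕ,
    (∀ k, G k + push q (fun _ => 1) k =
      push q g k + push (fun e => q (a e)) (fun _ => 1) k + 1) ∧
    ∀ ch : J → ℕ, ∑ x : Fin N → Bool, weight g (fun j => ch j + tubeCharge a b x j) =
      weight G (push q ch) := by
  induction N with
  | zero =>
    intro J K _ _ a b q hs _ hu g
    have hinj : Function.Injective q := fun i j h =>
      (hu (fun x => i = x) (fun e => e.elim0) i j h rfl)
    let e := Equiv.ofBijective q ⟨hinj, hs⟩
    refine ⟨push q g, fun k => ?_, fun ch => ?_⟩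
    · obtain ⟨j, rfl⟩ := hs k
      rw [push_bijective q ⟨hinj, hs⟩ (fun _ => 1), push_bijective q ⟨hinj, hs⟩ g,
        push_of_isEmpty (fun e => q (a e))]
    · rw [Fintype.sum_unique, ← weight_equiv e]
      have : ∀ f, (fun j => push q f (e j)) = f := fun f =>
        funext fun j => push_bijective q ⟨hinj, hs⟩ f j
      rw [this, this]
      congr 1
      funext j
      rw [tubeCharge, push_of_isEmpty, add_zero]
  | succ N ih =>
    intro J K _ _ a b q hs hq hu g
    have htube : ∀ (x : Bool) (xs : Fin N → Bool) j, tubeCharge a b (Fin.cons x xs) j =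
        tubeCharge (fun e => a e.succ) (fun e => b e.succ) xs j +
          push (fun _ : Unit => if x then a 0 else b 0) (fun _ => 1) j := by
      intro x xs j
      classical
      simp only [tubeCharge, push_eq_sum]
      rw [Fin.sum_univ_succ, add_comm]
      simp
    have hsum : ∀ F : (Fin (N + 1) → Bool) → ℤ, ∑ x, F x =
        ∑ xs, (F (Fin.cons true xs) + F (Fin.cons false xs)) := by
      intro F
      rw [← (Fin.consEquiv fun _ => Bool).sum_comp, Fintype.sum_prod_type_right]
      simp [Fin.consEquiv]
    have hedges : ∀ k, push (fun e => q (a e)) (fun _ => 1) k =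
        push (fun e : Fin N => q (a e.succ)) (fun _ => 1) k +
          push (fun _ : Unit => q (a 0)) (fun _ => 1) k := by
      intro k
      classical
      simp only [push_eq_sum]
      rw [Fin.sum_univ_succ, add_comm]
      simp
    by_cases hab : a 0 = b 0
    · obtain ⟨G, hG1, hG2⟩ := ih (fun e => a e.succ) (fun e => b e.succ) q hs
        (fun e => hq e.succ)
        (fun h hh => hu h (fun e => Fin.cases (by rw [hab]) hh e))
        (fun j => g j + push (fun _ : Unit => a 0) (fun _ => 1) j)
      refine ⟨G, fun k => ?_, fun ch => ?_⟩
      · have h1 := hG1 k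
        rw [push_add, ← push_comp] at h1
        rw [hedges]
        omega
      · rw [hsum, ← hG2]
        refine Finset.sum_congr rfl fun xs _ => ?_
        rw [← weight_self]
        simp only [htube, ← add_assoc, ← hab, ite_self]
    · classical
      -- The merged component is represented by `a 0`, and `b 0` is dropped.
      let r : J → {j // j ≠ b 0} := fun j => if h : j = b 0 then ⟨a 0, hab⟩ else ⟨j, h⟩
      have hrb : r (b 0) = ⟨a 0, hab⟩ := dif_pos rfl
      have hrn : ∀ j (h : j ≠ b 0), r j = ⟨j, h⟩ := fun j h => dif_neg h
      have hqr : ∀ j, q (r j).1 = q j := by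
        intro j
        by_cases h : j = b 0
        · rw [h, hrb]
          exact hq 0
        · rw [hrn j h]
      obtain ⟨G, hG1, hG2⟩ := ih (fun e => r (a e.succ)) (fun e => r (b e.succ))
        (fun j => q j.1)
        (fun k => by
          obtain ⟨j, rfl⟩ := hs k
          exact ⟨r j, hqr j⟩)
        (fun e => by
          rw [hqr, hqr]
          exact hq e.succ)
        (fun h hh i j hij hi => by
          have := hu (fun j => h (r j)) (fun e => by
            refine Fin.cases ?_ hh e
            rw [hrb, hrn _ hab]) i.1 j.1 hij
          rw [hrn _ i.2, hrn _ j.2] at this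
          exact this hi)
        (push r g)
      have hcomp : ∀ f : J → ℕ, push (fun j : {j // j ≠ b 0} => q j.1) (push r f) = push q f := by
        intro f
        rw [← push_comp]
        congr 1
        funext j
        exact hqr j
      have hr : Function.Surjective r := fun j => ⟨j.1, hrn _ j.2⟩
      have hrinj : ∀ i j, r i = r j →
          i = j ∨ (i = a 0 ∨ i = b 0) ∧ (j = a 0 ∨ j = b 0) := by
        intro i j hij
        by_cases hi : i = b 0 <;> by_cases hj : j = b 0
        · exact .inl (hi.trans hj.symm)
        · rw [hi, hrb, hrn j hj] at hij
          exact .inr ⟨.inr hi, .inl (Subtype.ext_iff.1 hij).symm⟩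
        · rw [hj, hrb, hrn i hi] at hij
          exact .inr ⟨.inl (Subtype.ext_iff.1 hij), .inr hj⟩
        · rw [hrn i hi, hrn j hj] at hij
          exact .inl (Subtype.ext_iff.1 hij)
      refine ⟨G, fun k => ?_, fun ch => ?_⟩
      · have h1 := hG1 k
        rw [hcomp] at h1
        have h2 : push q (fun _ => 1) k = push (fun j : {j // j ≠ b 0} => q j.1) (fun _ => 1) k +
            push (fun _ : Unit => q (a 0)) (fun _ => 1) k := by
          rw [hq 0]
          let e : {j // j ≠ b 0} ⊕ Unit ≃ J :=
            Equiv.ofBijective (Sum.elim Subtype.val fun _ => b 0) ⟨by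
              rintro (⟨i, hi⟩ | _) (⟨j, hj⟩ | _) h
              · exact congrArg Sum.inl (Subtype.ext h)
              · exact (hi h).elim
              · exact (hj h.symm).elim
              · rfl, fun j => by
              by_cases h : j = b 0
              · exact ⟨.inr (), h.symm⟩
              · exact ⟨.inl ⟨j, h⟩, rfl⟩⟩
          rw [← push_equiv e q (fun _ => 1), push_sum]
          rfl
        have h3 : (fun e : Fin N => q (r (a e.succ)).1) = fun e => q (a e.succ) :=
          funext fun e => hqr _
        rw [h3] at h1
        rw [hedges, h2]
        omega
      · have h2 := hG2 (push r ch)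
        rw [hcomp] at h2
        rw [hsum, ← h2]
        refine Finset.sum_congr rfl fun xs _ => ?_
        have h3 : (fun j => push r ch j +
            tubeCharge (fun e => r (a e.succ)) (fun e => r (b e.succ)) xs j) =
            push r fun j => ch j + tubeCharge (fun e => a e.succ) (fun e => b e.succ) xs j := by
          funext j
          rw [push_add]
          congr 1
          unfold tubeCharge
          rw [← push_comp]
          congr 1
          funext e
          split_ifs <;> rfl
        rw [h3, ← weight_merge r (a 0) (b 0) hab hr (by rw [hrb, hrn _ hab]) hrinj]
        simp only [htube, if_true, add_assoc, Bool.false_eq_true, if_false]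

/-- Gluing the components `J` along the tubes `E`. The components of the result are `K`. -/
theorem exists_glue {J K E : Type} [Finite J] [Finite K] [Fintype E] (a b : E → J) (q : J → K)
    (hs : Function.Surjective q) (hq : ∀ e, q (a e) = q (b e))
    (hu : ∀ h : J → Prop, (∀ e, h (a e) ↔ h (b e)) → ∀ i j, q i = q j → h i → h j)
    (g : J → ℕ) : ∃ G : K → ℕ,
    (∀ k, G k + push q (fun _ => 1) k =
      push q g k + push (fun e => q (a e)) (fun _ => 1) k + 1) ∧
    ∀ ch : J → ℕ, (∑ᶠ x : E → Bool, weight g (fun j => ch j + tubeCharge a b x j)) =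
      weight G (push q ch) := by
  classical
  let e := Fintype.equivFin E
  obtain ⟨G, h1, h2⟩ := exists_glue_fin (Fintype.card E) (fun x => a (e.symm x))
    (fun x => b (e.symm x)) q hs (fun x => hq _)
    (fun h hh => hu h fun x => by simpa using hh (e x)) g
  refine ⟨G, fun k => ?_, fun ch => ?_⟩
  · rw [h1, push_equiv e.symm (fun x => q (a x)) fun _ => 1]
  · rw [← h2, finsum_eq_sum_of_fintype, ← (e.symm.arrowCongr (Equiv.refl Bool)).sum_comp]
    refine Finset.sum_congr rfl fun x _ => ?_
    congr 1
    funext j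
    congr 1
    unfold tubeCharge
    rw [← push_equiv e.symm]
    congr 1
    funext i
    simp [Equiv.arrowCongr]

/-- Exactness of Euler characteristics: the components `J` of a cobordism with `σ` saddles and `β`
boundary circles have a genus. -/
def IsExact {J : Type} (σ β : J → ℕ) : Prop := ∀ j, ∃ g, 2 * g + β j = σ j + 2

/-- For exact data nothing is lost in the truncated subtraction and division that define `genus`. -/
theorem IsExact.genus_eq {J : Type} {σ β : J → ℕ} (h : IsExact σ β) (j : J) :
    2 * ((2 + σ j - β j) / 2) + β j = σ j + 2 := by
  obtain ⟨g, hg⟩ := h j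
  omega

/-- The result of gluing has a genus, too. -/
theorem glue_genus {J K E : Type} [Finite J] [Fintype E] (a : E → J) (q : J → K)
    (g σ β : J → ℕ) (h : ∀ j, 2 * g j + β j = σ j + 2) (G : K → ℕ)
    (hG : ∀ k, G k + push q (fun _ => 1) k =
      push q g k + push (fun e => q (a e)) (fun _ => 1) k + 1) (k : K) :
    2 * G k + push q β k = push q σ k + 2 * push (fun e => q (a e)) (fun _ => 1) k + 2 := by
  have h1 : push q (fun j => g j + g j + β j) k = push q (fun j => σ j + 1 + 1) k := by
    congr 1
    funext j
    have := h j
    omega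
  simp only [push_add] at h1
  have := hG k
  omega

/-! ### Cycles of permutations and saddles -/

/-- The cycles of a permutation. -/
def Cyc {Ω : Type} (π : Equiv.Perm Ω) : Type := Quotient (Equiv.Perm.SameCycle.setoid π)

def Cyc.mk {Ω : Type} (π : Equiv.Perm Ω) (x : Ω) : Cyc π := Quotient.mk _ x

instance {Ω : Type} [Finite Ω] (π : Equiv.Perm Ω) : Finite (Cyc π) :=
  inferInstanceAs (Finite (Quotient _))

theorem Cyc.mk_eq_iff {Ω : Type} {π : Equiv.Perm Ω} {x y : Ω} :
    Cyc.mk π x = Cyc.mk π y ↔ π.SameCycle x y :=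
  Quotient.eq

theorem Cyc.mk_surjective {Ω : Type} (π : Equiv.Perm Ω) : Function.Surjective (Cyc.mk π) :=
  Quotient.mk_surjective

theorem eq_of_sameCycle {Ω X : Type} {π : Equiv.Perm Ω} (f : Ω → X) (hf : ∀ x, f (π x) = f x)
    {x y : Ω} (h : π.SameCycle x y) : f x = f y := by
  obtain ⟨i, rfl⟩ := h
  have hn : ∀ (k : ℕ) x, f ((π ^ k) x) = f x := by
    intro k
    induction k with
    | zero => intro x; rfl
    | succ k ih => intro x; rw [pow_succ, Equiv.Perm.mul_apply, ih, hf]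
  cases i with
  | ofNat k => exact (hn k x).symm
  | negSucc k =>
    have := hn (k + 1) ((π ^ (Int.negSucc k)) x)
    rw [zpow_negSucc, ← Equiv.Perm.mul_apply, mul_inv_cancel] at this
    rw [zpow_negSucc]
    exact this

/-- A map that is constant along the permutation, as a map on the cycles. -/
def Cyc.lift {Ω X : Type} (π : Equiv.Perm Ω) (f : Ω → X) (hf : ∀ x, f (π x) = f x) :
    Cyc π → X :=
  Quotient.lift f fun _ _ h => eq_of_sameCycle f hf h

/-- From `u` the new permutation jumps to `π v` and then follows the old cycle of `v`. This cycle
avoids `u`, so the path continues undisturbed until it reaches `v`. -/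
theorem sameCycle_swap_of_not {Ω : Type} [Finite Ω] [DecidableEq Ω] (π : Equiv.Perm Ω) (u v : Ω)
    (h : ¬ π.SameCycle u v) : (π * Equiv.swap u v).SameCycle u v := by
  have hu : (π * Equiv.swap u v) u = π v := by simp
  have key : ∀ k : ℕ, (π * Equiv.swap u v).SameCycle u ((π ^ (k + 1)) v) := by
    intro k
    induction k with
    | zero =>
      rw [zero_add, pow_one, ← hu]
      exact ⟨1, by simp⟩
    | succ k ih =>
      by_cases hv : (π ^ (k + 1)) v = v
      · rw [pow_succ', Equiv.Perm.mul_apply, hv, ← hu]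
        exact ⟨1, by simp⟩
      · have hu' : (π ^ (k + 1)) v ≠ u := fun e => h (Equiv.Perm.SameCycle.symm ⟨(k + 1 : ℕ), by
          rw [zpow_natCast, e]⟩)
        rw [pow_succ', Equiv.Perm.mul_apply]
        refine ih.trans ⟨1, ?_⟩
        rw [zpow_one, Equiv.Perm.mul_apply, Equiv.swap_apply_of_ne_of_ne hu' hv]
  have := key (orderOf π - 1)
  rwa [Nat.sub_add_cancel (orderOf_pos π), pow_orderOf_eq_one] at this

/-- Let `k` be minimal with `(π ^ k) u = v`. The segment of points `(π ^ i) u`, `1 ≤ i ≤ k`, is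
invariant under the new permutation; it contains `v` but not `u`. -/
theorem not_sameCycle_swap {Ω : Type} [Finite Ω] [DecidableEq Ω] (π : Equiv.Perm Ω) (u v : Ω)
    (huv : u ≠ v) (h : π.SameCycle u v) : ¬ (π * Equiv.swap u v).SameCycle u v := by
  classical
  have hex : ∃ k : ℕ, (π ^ k) u = v := by
    obtain ⟨i, -, hi⟩ := h.exists_pow_eq'
    exact ⟨i, hi⟩
  obtain ⟨k, hk, hmin⟩ : ∃ k : ℕ, (π ^ k) u = v ∧ ∀ l < k, (π ^ l) u ≠ v :=
    ⟨Nat.find hex, Nat.find_spec hex, fun l hl => Nat.find_min hex hl⟩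
  have hk0 : k ≠ 0 := by
    rintro rfl
    exact huv hk
  have hnu : ∀ i, 1 ≤ i → i ≤ k → (π ^ i) u ≠ u := by
    intro i hi hik he
    refine hmin (k - i) (by omega) ?_
    have : (π ^ k) u = (π ^ (k - i)) ((π ^ i) u) := by
      rw [← Equiv.Perm.mul_apply, ← pow_add, Nat.sub_add_cancel hik]
    rw [he] at this
    rw [← this, hk]
  have hclosed : ∀ x, (∃ i, 1 ≤ i ∧ i ≤ k ∧ (π ^ i) u = x) →
      ∃ i, 1 ≤ i ∧ i ≤ k ∧ (π ^ i) u = (π * Equiv.swap u v) x := by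
    rintro x ⟨i, hi, hik, rfl⟩
    rcases Nat.lt_or_ge i k with hlt | hge
    · refine ⟨i + 1, by omega, by omega, ?_⟩
      rw [Equiv.Perm.mul_apply, Equiv.swap_apply_of_ne_of_ne (hnu i hi hik) (hmin i hlt), pow_succ',
        Equiv.Perm.mul_apply]
    · obtain rfl : i = k := le_antisymm hik hge
      refine ⟨1, le_refl _, by omega, ?_⟩
      rw [hk]
      simp
  intro hs
  obtain ⟨l, -, hl⟩ := hs.symm.exists_pow_eq'
  have hpow : ∀ l : ℕ, ∃ i, 1 ≤ i ∧ i ≤ k ∧ (π ^ i) u = ((π * Equiv.swap u v) ^ l) v := by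
    intro l
    induction l with
    | zero => exact ⟨k, by omega, le_refl _, hk⟩
    | succ l ih =>
      rw [pow_succ', Equiv.Perm.mul_apply]
      exact hclosed _ ih
  obtain ⟨i, hi, hik, he⟩ := hpow l
  exact hnu i hi hik (he.trans hl)

/-- The relation between two permutations which differ by saddles with feet `u s`, `v s`, and the
components of the corresponding cobordism. -/
structure SaddleData {Ω S J : Type} (π π' : Equiv.Perm Ω) (u v : S → Ω) (f : Ω → J) : Prop where
  inj : Function.Injective (Sum.elim u v)
  left : ∀ s, π' (u s) = π (v s)
  right : ∀ s, π' (v s) = π (u s)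
  other : ∀ x, (∀ s, x ≠ u s) → (∀ s, x ≠ v s) → π' x = π x
  surj : Function.Surjective f
  step : ∀ x, f (π x) = f x
  feet : ∀ s, f (u s) = f (v s)
  -- The fibres of `f` are no larger than the cycles and the saddles force.
  univ : ∀ h : Ω → Prop, (∀ x, h (π x) ↔ h x) → (∀ s, h (u s) ↔ h (v s)) →
    ∀ x y, f x = f y → h x → h y

theorem SaddleData.step' {Ω S J : Type} {π π' : Equiv.Perm Ω} {u v : S → Ω} {f : Ω → J}
    (h : SaddleData π π' u v f) (x : Ω) : f (π' x) = f x := by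
  by_cases hu : ∃ s, x = u s
  · obtain ⟨s, rfl⟩ := hu
    rw [h.left, h.step, h.feet]
  · by_cases hv : ∃ s, x = v s
    · obtain ⟨s, rfl⟩ := hv
      rw [h.right, h.step, h.feet]
    · rw [h.other x (fun s e => hu ⟨s, e⟩) (fun s e => hv ⟨s, e⟩), h.step]

/-- The number of cycles in the components. -/
noncomputable def cycCount {Ω J : Type} (π : Equiv.Perm Ω) (f : Ω → J)
    (hf : ∀ x, f (π x) = f x) : J → ℕ :=
  push (Cyc.lift π f hf) fun _ => 1

theorem cycCount_eq_one {Ω J : Type} [Finite Ω] (π : Equiv.Perm Ω) (f : Ω → J)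
    (hf : ∀ x, f (π x) = f x) (x : Ω) (h : ∀ y, f y = f x → π.SameCycle x y) :
    cycCount π f hf (f x) = 1 := by
  rw [cycCount, push_one, Set.ncard_eq_one]
  refine ⟨Cyc.mk π x, Set.ext fun z => ?_⟩
  obtain ⟨y, rfl⟩ := Cyc.mk_surjective π z
  refine ⟨fun hy => (Cyc.mk_eq_iff.2 (h y hy)).symm, ?_⟩
  intro hy
  rw [Set.mem_singleton_iff.1 hy]
  rfl

theorem cycCount_eq_two {Ω J : Type} [Finite Ω] (π : Equiv.Perm Ω) (f : Ω → J)
    (hf : ∀ x, f (π x) = f x) (u v : Ω) (huv : f u = f v) (hne : ¬ π.SameCycle u v)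
    (h : ∀ y, f y = f u → π.SameCycle u y ∨ π.SameCycle v y) :
    cycCount π f hf (f u) = 2 := by
  rw [cycCount, push_one, Set.ncard_eq_two]
  refine ⟨Cyc.mk π u, Cyc.mk π v, fun e => hne (Cyc.mk_eq_iff.1 e), Set.ext fun z => ?_⟩
  obtain ⟨y, rfl⟩ := Cyc.mk_surjective π z
  constructor
  · intro hy
    exact (h y hy).imp (fun h => (Cyc.mk_eq_iff.2 h).symm) fun h => (Cyc.mk_eq_iff.2 h).symm
  · rintro (hy | hy)
    · rw [hy]
      rfl
    · rw [hy]
      exact huv.symm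

/-- One saddle splits a cycle. -/
theorem cycCount_split {Ω J : Type} [Finite Ω] (π π' : Equiv.Perm Ω) (u v : Ω) (f : Ω → J)
    (h : SaddleData π π' (fun _ : Unit => u) (fun _ => v) f) (hs : π.SameCycle u v) (x : Ω) :
    cycCount π f h.step (f x) + cycCount π' f h.step' (f x) =
      push (fun _ : Unit => f u) (fun _ => 1) (f x) + 2 := by
  classical
  have huv : u ≠ v := fun e => by
    have := @h.inj (.inl ()) (.inr ()) e
    cases this
  have hπ' : π' = π * Equiv.swap u v := by
    ext y
    by_cases hu : y = u
    · rw [hu, h.left ()]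
      simp
    · by_cases hv : y = v
      · rw [hv, h.right ()]
        simp
      · rw [h.other y (fun _ => hu) (fun _ => hv), Equiv.Perm.mul_apply,
          Equiv.swap_apply_of_ne_of_ne hu hv]
  have hns : ¬ π'.SameCycle u v := by
    rw [hπ']
    exact not_sameCycle_swap π u v huv hs
  have h1 : cycCount π f h.step (f x) = 1 := by
    refine cycCount_eq_one _ _ _ _ fun y hy => ?_
    refine h.univ (π.SameCycle x) (fun z => Equiv.Perm.sameCycle_apply_right) (fun _ => ?_) x y
      hy.symm (Equiv.Perm.SameCycle.refl _ _)
    exact ⟨fun e => e.trans hs, fun e => e.trans hs.symm⟩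
  have hstep : ∀ P : Ω → Prop, (∀ z, P (π' z) ↔ P z) → (P u ↔ P v) → ∀ z, P (π z) ↔ P z := by
    intro P hP hPuv z
    by_cases hu : z = u
    · rw [hu, ← h.right (), hP]
      exact hPuv.symm
    · by_cases hv : z = v
      · rw [hv, ← h.left (), hP]
        exact hPuv
      · rw [← h.other z (fun _ => hu) (fun _ => hv), hP]
  have hsame : ∀ w z, π'.SameCycle w (π' z) ↔ π'.SameCycle w z :=
    fun w z => Equiv.Perm.sameCycle_apply_right
  rw [h1, push_eq_sum]
  -- The feet lie on one old cycle, so every component is a single old cycle. The component of the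
  -- saddle consists of two new cycles, any other component of one.
  by_cases hx : f u = f x
  · rw [← hx]
    rw [cycCount_eq_two π' f h.step' u v (h.feet ()) hns]
    · simp
    · intro y hy
      have hP : (π'.SameCycle u u ∨ π'.SameCycle v u) ↔ (π'.SameCycle u v ∨ π'.SameCycle v v) :=
        ⟨fun _ => .inr (.refl _ _), fun _ => .inl (.refl _ _)⟩
      refine h.univ (fun y => π'.SameCycle u y ∨ π'.SameCycle v y) ?_ (fun _ => hP) u y hy.symm
        (.inl (.refl _ _))
      exact hstep (fun y => π'.SameCycle u y ∨ π'.SameCycle v y)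
        (fun z => by rw [hsame, hsame]) hP
  · rw [cycCount_eq_one]
    · simp [hx]
    · intro y hy
      have hxu : ¬ π'.SameCycle x u := fun e => hx (eq_of_sameCycle f h.step' e).symm
      have hxv : ¬ π'.SameCycle x v := fun e =>
        hx ((h.feet ()).trans (eq_of_sameCycle f h.step' e).symm)
      have hP : π'.SameCycle x u ↔ π'.SameCycle x v :=
        ⟨fun e => (hxu e).elim, fun e => (hxv e).elim⟩
      exact h.univ (π'.SameCycle x) (hstep _ (hsame x) hP) (fun _ => hP) x y hy.symm (.refl _ _)

theorem SaddleData.symm {Ω S J : Type} {π π' : Equiv.Perm Ω} {u v : S → Ω} {f : Ω → J}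
    (h : SaddleData π π' u v f) : SaddleData π' π u v f where
  inj := h.inj
  left s := (h.right s).symm
  right s := (h.left s).symm
  other x h1 h2 := (h.other x h1 h2).symm
  surj := h.surj
  step := h.step'
  feet := h.feet
  univ P hP hf x y hxy := by
    refine h.univ P (fun z => ?_) hf x y hxy
    by_cases hu : ∃ s, z = u s
    · obtain ⟨s, rfl⟩ := hu
      rw [← h.right, hP]
      exact (hf s).symm
    · by_cases hv : ∃ s, z = v s
      · obtain ⟨s, rfl⟩ := hv
        rw [← h.left, hP]
        exact hf s
      · rw [← h.other z (fun s e => hu ⟨s, e⟩) (fun s e => hv ⟨s, e⟩), hP]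

/-- A single saddle is a pair of pants, and all other components are cylinders. The merging of two
cycles is a splitting read backwards. -/
theorem cycCount_saddle {Ω J : Type} [Finite Ω] (π π' : Equiv.Perm Ω) (u v : Ω) (f : Ω → J)
    (h : SaddleData π π' (fun _ : Unit => u) (fun _ => v) f) (j : J) :
    cycCount π f h.step j + cycCount π' f h.step' j =
      push (fun _ : Unit => f u) (fun _ => 1) j + 2 := by
  classical
  obtain ⟨x, rfl⟩ := h.surj j
  by_cases hs : π.SameCycle u v
  · exact cycCount_split π π' u v f h hs x
  · rw [add_comm]
    refine cycCount_split π' π u v f h.symm ?_ x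
    have hπ' : π' = π * Equiv.swap u v := by
      ext y
      by_cases hu : y = u
      · rw [hu, h.left ()]
        simp
      · by_cases hv : y = v
        · rw [hv, h.right ()]
          simp
        · rw [h.other y (fun _ => hu) (fun _ => hv), Equiv.Perm.mul_apply,
            Equiv.swap_apply_of_ne_of_ne hu hv]
    rw [hπ']
    exact sameCycle_swap_of_not π u v hs

/-- The cobordism is cut after its first saddle. The first part is a pair of pants together with
cylinders, the rest is exact by induction, and gluing along the intermediate cycles yields a genus
for the union. -/
theorem cycCount_exact_fin {Ω : Type} [Finite Ω] (N : ℕ) : ∀ {J : Type} [Finite J]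
    (π π' : Equiv.Perm Ω) (u v : Fin N → Ω) (f : Ω → J) (h : SaddleData π π' u v f),
    IsExact (push (fun s => f (u s)) fun _ => 1)
      (fun j => cycCount π f h.step j + cycCount π' f h.step' j) := by
  classical
  induction N with
  | zero =>
    intro J _ π π' u v f h j
    obtain ⟨x, rfl⟩ := h.surj j
    have hπ : π' = π := Equiv.ext fun x => h.other x (fun s => s.elim0) fun s => s.elim0
    subst hπ
    refine ⟨0, ?_⟩
    beta_reduce
    rw [cycCount_eq_one, push_of_isEmpty (fun s => f (u s))]
    exact fun y hy => h.univ (π'.SameCycle x) (fun z => Equiv.Perm.sameCycle_apply_right)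
      (fun s => s.elim0) x y hy.symm (.refl _ _)
  | succ N ih =>
    intro J _ π π' u v f h
    have huv : u 0 ≠ v 0 := fun e => by
      have := @h.inj (.inl 0) (.inr 0) e
      cases this
    have hne : ∀ s : Fin N, u s.succ ≠ u 0 ∧ u s.succ ≠ v 0 ∧ v s.succ ≠ u 0 ∧ v s.succ ≠ v 0 := by
      intro s
      refine ⟨fun e => ?_, fun e => ?_, fun e => ?_, fun e => ?_⟩
      · exact Fin.succ_ne_zero s (Sum.inl_injective (@h.inj (.inl s.succ) (.inl 0) e))
      · have := @h.inj (.inl s.succ) (.inr 0) e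
        cases this
      · have := @h.inj (.inr s.succ) (.inl 0) e
        cases this
      · exact Fin.succ_ne_zero s (Sum.inr_injective (@h.inj (.inr s.succ) (.inr 0) e))
    let π₁ : Equiv.Perm Ω := π * Equiv.swap (u 0) (v 0)
    have hπu : π₁ (u 0) = π (v 0) := by simp [π₁]
    have hπv : π₁ (v 0) = π (u 0) := by simp [π₁]
    have hπo : ∀ x, x ≠ u 0 → x ≠ v 0 → π₁ x = π x := fun x h1 h2 => by
      simp [π₁, Equiv.swap_apply_of_ne_of_ne h1 h2]
    -- `R₁` generates the components of the part with the first saddle only, `R₂` those of the part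
    -- with the other saddles, which starts from `π₁`.
    let R₁ : Ω → Ω → Prop := fun x y => y = π x ∨ (x = u 0 ∧ y = v 0)
    let R₂ : Ω → Ω → Prop := fun x y => y = π₁ x ∨ ∃ s : Fin N, x = u s.succ ∧ y = v s.succ
    let f₁ : Ω → Quot R₁ := Quot.mk R₁
    let f₂ : Ω → Quot R₂ := Quot.mk R₂
    have D₁ : SaddleData π π₁ (fun _ : Unit => u 0) (fun _ => v 0) f₁ :=
      { inj := by
          rintro (_ | _) (_ | _) e
          exacts [rfl, (huv e).elim, (huv e.symm).elim, rfl]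
        left := fun _ => hπu
        right := fun _ => hπv
        other := fun x h1 h2 => hπo x (h1 ()) (h2 ())
        surj := Quot.mk_surjective
        step := fun x => (Quot.sound (.inl rfl)).symm
        feet := fun _ => Quot.sound (.inr ⟨rfl, rfl⟩)
        univ := fun P h1 h2 x y hxy => by
          let P' : Quot R₁ → Prop := Quot.lift P (by
            rintro a b (rfl | ⟨rfl, rfl⟩)
            · exact propext (h1 a).symm
            · exact propext (h2 ()))
          have : P' (f₁ x) = P' (f₁ y) := congrArg P' hxy
          exact this.mp }
    have D₂ : SaddleData π₁ π' (fun s : Fin N => u s.succ) (fun s => v s.succ) f₂ :=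
      { inj := by
          rintro (s | s) (t | t) e
          · have := @h.inj (.inl s.succ) (.inl t.succ) e
            exact congrArg _ (Fin.succ_injective _ (Sum.inl_injective this))
          · have := @h.inj (.inl s.succ) (.inr t.succ) e
            cases this
          · have := @h.inj (.inr s.succ) (.inl t.succ) e
            cases this
          · have := @h.inj (.inr s.succ) (.inr t.succ) e
            exact congrArg _ (Fin.succ_injective _ (Sum.inr_injective this))
        left := fun s => by rw [h.left, hπo _ (hne s).2.2.1 (hne s).2.2.2]
        right := fun s => by rw [h.right, hπo _ (hne s).1 (hne s).2.1]
        other := fun x h1 h2 => by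
          by_cases hu : x = u 0
          · rw [hu, h.left, hπu]
          · by_cases hv : x = v 0
            · rw [hv, h.right, hπv]
            · rw [hπo x hu hv]
              exact h.other x (fun s => Fin.cases hu h1 s) (fun s => Fin.cases hv h2 s)
        surj := Quot.mk_surjective
        step := fun x => (Quot.sound (.inl rfl)).symm
        feet := fun s => Quot.sound (.inr ⟨s, rfl, rfl⟩)
        univ := fun P h1 h2 x y hxy => by
          let P' : Quot R₂ → Prop := Quot.lift P (by
            rintro a b (rfl | ⟨s, rfl, rfl⟩)
            · exact propext (h1 a).symm
            · exact propext (h2 s))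
          have : P' (f₂ x) = P' (f₂ y) := congrArg P' hxy
          exact this.mp }
    have hstep₁ : ∀ x, f (π₁ x) = f x := by
      intro x
      by_cases hu : x = u 0
      · rw [hu, hπu, h.step, h.feet]
      · by_cases hv : x = v 0
        · rw [hv, hπv, h.step, h.feet]
        · rw [hπo x hu hv, h.step]
    let q₁ : Quot R₁ → J := Quot.lift f (by
      rintro a b (rfl | ⟨rfl, rfl⟩)
      · exact (h.step a).symm
      · exact h.feet 0)
    let q₂ : Quot R₂ → J := Quot.lift f (by
      rintro a b (rfl | ⟨s, rfl, rfl⟩)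
      · exact (hstep₁ a).symm
      · exact h.feet s.succ)
    let q : Quot R₁ ⊕ Quot R₂ → J := Sum.elim q₁ q₂
    let a : Cyc π₁ → Quot R₁ ⊕ Quot R₂ := fun z => .inl (Cyc.lift π₁ f₁ D₁.step' z)
    let b : Cyc π₁ → Quot R₁ ⊕ Quot R₂ := fun z => .inr (Cyc.lift π₁ f₂ D₂.step z)
    have := Fintype.ofFinite (Cyc π₁)
    have E₂ := ih π₁ π' _ _ f₂ D₂
    choose g₂ hg₂ using E₂
    -- Each cycle of `π₁` is a tube from its component in the first part to its component in the
    -- second. Only the formula for `G` is needed, not the statement about weights.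
    obtain ⟨G, hG, -⟩ := exists_glue a b q
      (fun j => by
        obtain ⟨x, rfl⟩ := h.surj j
        exact ⟨.inl (f₁ x), rfl⟩)
      (fun z => by
        obtain ⟨x, rfl⟩ := Cyc.mk_surjective _ z
        rfl)
      (fun P hP => by
        have h12 : ∀ x, P (.inl (f₁ x)) ↔ P (.inr (f₂ x)) := fun x => hP (Cyc.mk π₁ x)
        have key : ∀ x y, f x = f y → P (.inl (f₁ x)) → P (.inl (f₁ y)) := by
          refine h.univ (fun x => P (.inl (f₁ x))) (fun x => ?_) fun s => ?_
          · rw [D₁.step]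
          · refine Fin.cases ?_ (fun s => ?_) s
            · exact iff_of_eq (congrArg (fun z => P (.inl z)) (D₁.feet ()))
            · rw [h12, h12]
              exact iff_of_eq (congrArg (fun z => P (.inr z)) (D₂.feet s))
        have hrep : ∀ z, ∃ x, f x = q z ∧ (P z ↔ P (.inl (f₁ x))) := by
          rintro (z | z) <;> obtain ⟨x, rfl⟩ := Quot.mk_surjective z
          exacts [⟨x, rfl, Iff.rfl⟩, ⟨x, rfl, (h12 x).symm⟩]
        intro i j hij
        obtain ⟨x, hx, hPx⟩ := hrep i
        obtain ⟨y, hy, hPy⟩ := hrep j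
        rw [hPx, hPy]
        exact key x y (by rw [hx, hy, hij]))
      (Sum.elim (fun _ => 0) g₂)
    intro j
    refine ⟨G j, ?_⟩
    have hcyc : ∀ (R : Ω → Ω → Prop) (τ : Equiv.Perm Ω) (hR : ∀ x, Quot.mk R (τ x) = Quot.mk R x)
        (p : Quot R → J) (hp : ∀ x, p (Quot.mk R x) = f x) (hf : ∀ x, f (τ x) = f x),
        push p (cycCount τ (Quot.mk R) hR) = cycCount τ f hf := by
      intro R τ hR p hp hf
      unfold cycCount
      rw [← push_comp]
      congr 1
      funext z
      obtain ⟨x, rfl⟩ := Cyc.mk_surjective _ z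
      exact hp x
    have key := glue_genus a q _
      (Sum.elim (push (fun _ : Unit => f₁ (u 0)) fun _ => 1)
        (push (fun s : Fin N => f₂ (u s.succ)) fun _ => 1))
      (Sum.elim (fun j => cycCount π f₁ D₁.step j + cycCount π₁ f₁ D₁.step' j)
        (fun j => cycCount π₁ f₂ D₂.step j + cycCount π' f₂ D₂.step' j)) (by
        rintro (j | j)
        · have := cycCount_saddle π π₁ (u 0) (v 0) f₁ D₁ j
          simp only [Sum.elim_inl]
          omega
        · exact hg₂ j) G hG j
    rw [push_sum, push_sum] at key
    simp only [Sum.elim_inl, Sum.elim_inr, push_add] at key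
    have e1 : push (fun i => q (.inl i)) (cycCount π f₁ D₁.step) = cycCount π f h.step :=
      hcyc R₁ π D₁.step q₁ (fun _ => rfl) _
    have e2 : push (fun i => q (.inl i)) (cycCount π₁ f₁ D₁.step') = cycCount π₁ f hstep₁ :=
      hcyc R₁ π₁ D₁.step' q₁ (fun _ => rfl) _
    have e3 : push (fun i => q (.inr i)) (cycCount π₁ f₂ D₂.step) = cycCount π₁ f hstep₁ :=
      hcyc R₂ π₁ D₂.step q₂ (fun _ => rfl) _
    have e4 : push (fun i => q (.inr i)) (cycCount π' f₂ D₂.step') = cycCount π' f h.step' :=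
      hcyc R₂ π' D₂.step' q₂ (fun _ => rfl) _
    rw [e1, e2, e3, e4, ← push_comp, ← push_comp] at key
    have e5 : push (fun e => q (a e)) (fun _ => 1) = cycCount π₁ f hstep₁ := by
      unfold cycCount
      congr 1
      funext z
      obtain ⟨x, rfl⟩ := Cyc.mk_surjective _ z
      rfl
    have e6 : push (fun s => f (u s)) (fun _ => 1) j = push (fun _ : Unit => f (u 0)) (fun _ => 1) j
        + push (fun s : Fin N => f (u s.succ)) (fun _ => 1) j := by
      simp only [push_eq_sum]
      rw [Fin.sum_univ_succ]
      simp
    have e7 : (fun i : Unit => q (.inl (f₁ (u 0)))) = fun _ : Unit => f (u 0) := rfl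
    have e8 : (fun s : Fin N => q (.inr (f₂ (u s.succ)))) = fun s => f (u s.succ) := rfl
    rw [e5, e7, e8] at key
    rw [e6]
    beta_reduce
    omega

theorem cycCount_exact {Ω S J : Type} [Finite Ω] [Finite S] [Finite J] (π π' : Equiv.Perm Ω)
    (u v : S → Ω) (f : Ω → J) (h : SaddleData π π' u v f) :
    IsExact (push (fun s => f (u s)) fun _ => 1)
      (fun j => cycCount π f h.step j + cycCount π' f h.step' j) := by
  have := Fintype.ofFinite S
  let e := (Fintype.equivFin S).symm
  have h' : SaddleData π π' (fun s => u (e s)) (fun s => v (e s)) f :=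
    { inj := by
        have : Sum.elim (fun s => u (e s)) (fun s => v (e s)) =
            Sum.elim u v ∘ Equiv.sumCongr e e := by
          funext x
          rcases x with x | x <;> rfl
        rw [this]
        exact h.inj.comp (Equiv.injective _)
      left := fun s => h.left _
      right := fun s => h.right _
      other := fun x h1 h2 => h.other x (fun s => by simpa using h1 (e.symm s))
        (fun s => by simpa using h2 (e.symm s))
      surj := h.surj
      step := h.step
      feet := fun s => h.feet _
      univ := fun P h1 h2 => h.univ P h1 fun s => by simpa using h2 (e.symm s) }
  intro j
  obtain ⟨g, hg⟩ := cycCount_exact_fin _ π π' _ _ f h' j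
  refine ⟨g, ?_⟩
  rw [← push_equiv e (fun s => f (u s)) fun _ => 1]
  exact hg

/-! ### Orientations -/

namespace FlatTangle

variable {n m : ℕ}

/-- The orientation of a flat tangle for which the endpoints with even numbers point upwards, and
its reversal for `p = false`: the piece `u` is followed by the piece `v`. -/
def Flow (p : Bool) : {m : ℕ} → (T : FlatTangle n m) → T.Piece → T.Piece → Prop
  | _, .id, _, _ => False
  | _, .cup T _, u, v =>
      ∃ u' v' : T.Piece, u = (some u' : Option T.Piece) ∧ v = (some v' : Option T.Piece) ∧
        T.Flow p u' v'
  | _, .cap (m := m) T i, u, v => T.Flow p u v ∨ ∃ a b : Fin (m + 2),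
      i.val ≤ a.val ∧ a.val ≤ i.val + 1 ∧ i.val ≤ b.val ∧ b.val ≤ i.val + 1 ∧ a.val ≠ b.val ∧
        decide (Even a.val) = p ∧ u = T.top a ∧ v = T.top b

theorem flow_not (p : Bool) : {m : ℕ} → (T : FlatTangle n m) → (u v : T.Piece) →
    T.Flow p u v → T.Flow (!p) v u
  | _, .id, _, _, h => h
  | _, .cup T _, _, _, h => by
      obtain ⟨u', v', hu, hv, h⟩ := h
      exact ⟨v', u', hv, hu, flow_not p T u' v' h⟩
  | _, .cap T i, _, _, h => by
      rcases h with h | ⟨a, b, h1, h2, h3, h4, h5, h6, hu, hv⟩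
      · exact .inl (flow_not p T _ _ h)
      refine .inr ⟨b, a, h3, h4, h1, h2, h5.symm, ?_, hv, hu⟩
      rw [← h6]
      have : Even b.val ↔ ¬ Even a.val := by
        rw [Nat.even_iff, Nat.even_iff]
        omega
      rw [← decide_not]
      exact decide_eq_decide.2 this

theorem Flow.joined {p : Bool} : {m : ℕ} → {T : FlatTangle n m} → {u v : T.Piece} →
    T.Flow p u v → T.Joined u v ∨ T.Joined v u
  | _, .id, _, _, h => h.elim
  | _, .cup T _, _, _, h => by
      obtain ⟨u', v', hu, hv, h⟩ := h
      exact h.joined.imp (fun h => ⟨u', v', hu, hv, h⟩) fun h => ⟨v', u', hv, hu, h⟩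
  | _, .cap T i, _, _, h => by
      rcases h with h | ⟨a, b, h1, h2, h3, h4, h5, h6, hu, hv⟩
      · exact h.joined.imp .inl .inl
      by_cases h : a.val = i.val
      · have ha : a = i.castSucc := Fin.ext h
        have hb : b = i.succ := Fin.ext (by simp; omega)
        exact .inl (.inr ⟨by rw [hu, ha], by rw [hv, hb]⟩)
      · have ha : a = i.succ := Fin.ext (by simp; omega)
        have hb : b = i.castSucc := Fin.ext (by simp; omega)
        exact .inr (.inr ⟨by rw [hv, hb], by rw [hu, ha]⟩)

theorem Joined.flow : {m : ℕ} → {T : FlatTangle n m} → {u v : T.Piece} →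
    T.Joined u v → T.Flow true u v ∨ T.Flow true v u
  | _, .id, _, _, h => h.elim
  | _, .cup T _, _, _, h => by
      obtain ⟨u', v', hu, hv, h⟩ := h
      exact h.flow.imp (fun h => ⟨u', v', hu, hv, h⟩) fun h => ⟨v', u', hv, hu, h⟩
  | _, .cap T i, _, _, h => by
      rcases h with h | ⟨hu, hv⟩
      · exact h.flow.imp .inl .inl
      by_cases h : Even i.val
      · exact .inl (.inr ⟨i.castSucc, i.succ, by simp, by simp, by simp, by simp, by simp,
          by simpa using h, hu, hv⟩)
      · exact .inr (.inr ⟨i.succ, i.castSucc, by simp, by simp, by simp, by simp, by simp,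
          by simpa [Nat.even_add_one] using h, hv, hu⟩)

/-- Where the orientation continues at the end of a piece. -/
def Exit (p : Bool) (T : FlatTangle n m) (v : T.Piece) : T.Piece ⊕ Fin m ⊕ Fin n → Prop
  | .inl w => T.Flow p v w
  | .inr (.inl j) => T.top j = v ∧ decide (Even j.val) = p
  | .inr (.inr j) => T.bot j = v ∧ decide (Even j.val) ≠ p

theorem decide_even_succ (k : ℕ) : decide (Even (k + 1)) = !decide (Even k) := by
  rw [← decide_not]
  exact decide_eq_decide.2 Nat.even_add_one

theorem decide_even_add_two (k : ℕ) : decide (Even (k + 2)) = decide (Even k) := by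
  simp [Nat.even_add]

theorem top_cup_lt (T : FlatTangle n m) (i : Fin (m + 1)) (j : Fin (m + 2)) (h : j.val < i.val) :
    (T.cup i).top j = (some (T.top ⟨j.val, by omega⟩) : Option T.Piece) :=
  dif_pos h

theorem top_cup_mid (T : FlatTangle n m) (i : Fin (m + 1)) (j : Fin (m + 2)) (h : i.val ≤ j.val)
    (h' : j.val ≤ i.val + 1) : (T.cup i).top j = (none : Option T.Piece) :=
  (dif_neg (by omega)).trans (dif_pos h')

theorem top_cup_gt (T : FlatTangle n m) (i : Fin (m + 1)) (j : Fin (m + 2))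
    (h : i.val + 1 < j.val) :
    (T.cup i).top j = (some (T.top ⟨j.val - 2, by omega⟩) : Option T.Piece) :=
  (dif_neg (by omega)).trans (dif_neg (by omega))

theorem top_cap_lt (T : FlatTangle n (m + 2)) (i : Fin (m + 1)) (j : Fin m) (h : j.val < i.val) :
    (T.cap i).top j = T.top ⟨j.val, by omega⟩ :=
  if_pos h

theorem top_cap_ge (T : FlatTangle n (m + 2)) (i : Fin (m + 1)) (j : Fin m) (h : i.val ≤ j.val) :
    (T.cap i).top j = T.top ⟨j.val + 2, by omega⟩ :=
  if_neg (by omega)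

/-- Every piece has exactly one exit. -/
theorem exists_exit (p : Bool) : {m : ℕ} → (T : FlatTangle n m) → (v : T.Piece) →
    ∃ x, T.Exit p v x ∧ ∀ y, T.Exit p v y → y = x
  | _, .id, v => by
      change Fin n at v
      by_cases h : decide (Even v.val) = p
      · refine ⟨.inr (.inl v), ⟨rfl, h⟩, ?_⟩
        rintro (w | j | j) hy
        · exact hy.elim
        · obtain ⟨rfl, -⟩ := hy
          rfl
        · obtain ⟨rfl, hj⟩ := hy
          exact (hj h).elim
      · refine ⟨.inr (.inr v), ⟨rfl, h⟩, ?_⟩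
        rintro (w | j | j) hy
        · exact hy.elim
        · obtain ⟨rfl, hj⟩ := hy
          exact (h hj).elim
        · obtain ⟨rfl, -⟩ := hy
          rfl
  | _, .cup (m := m) T i, none => by
      -- The two ends of the new minimum have neighbouring numbers, so exactly one of them has the
      -- parity at which the orientation leaves.
      have key : ∃ a : Fin (m + 2), i.val ≤ a.val ∧ a.val ≤ i.val + 1 ∧ decide (Even a.val) = p := by
        by_cases h : decide (Even i.val) = p
        · exact ⟨i.castSucc, by simp, by simp, h⟩
        · refine ⟨i.succ, by simp, by simp, ?_⟩
          rw [Fin.val_succ, decide_even_succ]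
          revert h
          cases p <;> cases decide (Even i.val) <;> simp
      obtain ⟨a, h1, h2, h3⟩ := key
      refine ⟨.inr (.inl a), ⟨top_cup_mid T i a h1 h2, h3⟩, ?_⟩
      rintro (w | j | j) hy
      · obtain ⟨u', v', hu, -⟩ := hy
        cases hu
      · obtain ⟨hj, hp⟩ := hy
        rcases Nat.lt_or_ge j.val i.val with h | h
        · rw [top_cup_lt T i j h] at hj
          cases hj
        · rcases Nat.lt_or_ge (i.val + 1) j.val with h' | h'
          · rw [top_cup_gt T i j h'] at hj
            cases hj
          · refine congrArg (fun x => Sum.inr (Sum.inl x)) (Fin.ext ?_)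
            by_contra hne
            have : j.val = a.val + 1 ∨ a.val = j.val + 1 := by omega
            rcases this with e | e
            · rw [e, decide_even_succ, h3] at hp
              cases p <;> simp at hp
            · rw [e, decide_even_succ, hp] at h3
              cases p <;> simp at h3
      · obtain ⟨hj, -⟩ := hy
        cases hj
  | _, .cup (m := m) T i, some v => by
      obtain ⟨x, hx, hux⟩ := exists_exit p T v
      have hinj : ∀ w w' : T.Piece, (some w : Option T.Piece) = (some w' : Option T.Piece) →
        w = w' := fun w w' e => Option.some.inj e
      -- Top endpoints from number `i` on are shifted by two, which preserves the parity and thus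
      -- the orientation.
      let F : T.Piece ⊕ Fin m ⊕ Fin n → (T.cup i).Piece ⊕ Fin (m + 2) ⊕ Fin n := fun y' =>
        match y' with
        | .inl w => .inl (some w : Option T.Piece)
        | .inr (.inl j) => .inr (.inl (if h : j.val < i.val then ⟨j.val, by omega⟩
            else ⟨j.val + 2, by omega⟩))
        | .inr (.inr j) => .inr (.inr j)
      have huniq : ∀ y, (T.cup i).Exit p (some v : Option T.Piece) y →
          ∃ y', T.Exit p v y' ∧ y = F y' := by
        rintro (w | j | j) hy
        · obtain ⟨u', v', hu, hv, h⟩ := hy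
          cases hu
          exact ⟨.inl v', h, congrArg Sum.inl hv⟩
        · obtain ⟨hj, hp⟩ := hy
          rcases Nat.lt_or_ge j.val i.val with h | h
          · rw [top_cup_lt T i j h] at hj
            refine ⟨.inr (.inl ⟨j.val, by omega⟩), ⟨hinj _ _ hj, hp⟩, ?_⟩
            simp [F, h]
          · rcases Nat.lt_or_ge (i.val + 1) j.val with h' | h'
            · rw [top_cup_gt T i j h'] at hj
              refine ⟨.inr (.inl ⟨j.val - 2, by omega⟩), ⟨hinj _ _ hj, ?_⟩, ?_⟩
              · rw [← hp]
                change decide (Even (j.val - 2)) = _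
                rw [← decide_even_add_two, Nat.sub_add_cancel (by omega)]
              · have : ¬ (j.val - 2 < i.val) := by omega
                simp only [F, this, dite_false]
                refine congrArg (fun x => Sum.inr (Sum.inl x)) (Fin.ext ?_)
                simp
                omega
            · rw [top_cup_mid T i j h h'] at hj
              cases hj
        · obtain ⟨hj, hp⟩ := hy
          exact ⟨.inr (.inr j), ⟨hinj _ _ hj, hp⟩, rfl⟩
      refine ⟨F x, ?_, fun y hy => ?_⟩
      rotate_left
      · obtain ⟨y', hy', rfl⟩ := huniq y hy
        rw [hux y' hy']
      · rcases x with w | j | j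
        · exact ⟨v, w, rfl, rfl, hx⟩
        · obtain ⟨hj, hp⟩ := hx
          simp only [F]
          split_ifs with h
          · refine ⟨?_, hp⟩
            rw [top_cup_lt T i _ h]
            exact congrArg some hj
          · refine ⟨?_, ?_⟩
            · rw [top_cup_gt T i _ (by simp; omega)]
              exact congrArg some hj
            · rw [← hp]
              exact decide_even_add_two _
        · obtain ⟨hj, hp⟩ := hx
          exact ⟨congrArg some hj, hp⟩
  | _, .cap (m := m) T i, v => by
      obtain ⟨x, hx, hux⟩ := exists_exit p T v
      -- An exit in the capped tangle comes from the unique exit `x` of `T`: if `x` is one of the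
      -- two ends that the maximum joins, the orientation continues into the piece at the other end,
      -- and otherwise `x` is only renumbered.
      have hback : ∀ y, (T.cap i).Exit p v y →
          (∃ w, y = .inl w ∧ (x = .inl w ∨ ∃ a b : Fin (m + 2), x = .inr (.inl a) ∧
            i.val ≤ a.val ∧ a.val ≤ i.val + 1 ∧ i.val ≤ b.val ∧ b.val ≤ i.val + 1 ∧
            a.val ≠ b.val ∧ w = T.top b)) ∨
          (∃ j : Fin m, y = .inr (.inl j) ∧ ∃ a : Fin (m + 2), x = .inr (.inl a) ∧
            (j.val < i.val ∧ a.val = j.val ∨ i.val ≤ j.val ∧ a.val = j.val + 2)) ∨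
          (∃ j, y = .inr (.inr j) ∧ x = .inr (.inr j)) := by
        rintro (w | j | j) hy
        · refine .inl ⟨w, rfl, ?_⟩
          rcases hy with h | ⟨a, b, h1, h2, h3, h4, h5, h6, hu, hv⟩
          · exact .inl (hux (.inl w) h).symm
          · exact .inr ⟨a, b, (hux (.inr (.inl a)) ⟨hu.symm, h6⟩).symm, h1, h2, h3, h4, h5, hv⟩
        · refine .inr (.inl ⟨j, rfl, ?_⟩)
          obtain ⟨hj, hp⟩ := hy
          rcases Nat.lt_or_ge j.val i.val with h | h
          · rw [top_cap_lt T i j h] at hj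
            exact ⟨⟨j.val, by omega⟩, (hux (.inr (.inl ⟨j.val, by omega⟩)) ⟨hj, hp⟩).symm,
              .inl ⟨h, rfl⟩⟩
          · rw [top_cap_ge T i j h] at hj
            exact ⟨⟨j.val + 2, by omega⟩, (hux (.inr (.inl ⟨j.val + 2, by omega⟩)) ⟨hj, by
              rw [← hp]
              exact decide_even_add_two _⟩).symm, .inr ⟨h, rfl⟩⟩
        · exact .inr (.inr ⟨j, rfl, (hux (.inr (.inr j)) hy).symm⟩)
      rcases x with w | a | j
      · refine ⟨.inl w, .inl hx, fun y hy => ?_⟩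
        rcases hback y hy with ⟨w', rfl, h | ⟨_, _, h, _⟩⟩ | ⟨_, rfl, _, h, _⟩ | ⟨_, rfl, h⟩ <;>
          cases h
        rfl
      · obtain ⟨ha, hp⟩ := hx
        by_cases hmid : i.val ≤ a.val ∧ a.val ≤ i.val + 1
        · obtain ⟨b, hb1, hb2, hb3⟩ : ∃ b : Fin (m + 2), i.val ≤ b.val ∧ b.val ≤ i.val + 1 ∧
              a.val ≠ b.val := by
            by_cases h : a.val = i.val
            · exact ⟨i.succ, by simp, by simp, by simp; omega⟩
            · exact ⟨i.castSucc, by simp, by simp, by simp; omega⟩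
          refine ⟨.inl (T.top b), .inr ⟨a, b, hmid.1, hmid.2, hb1, hb2, hb3, hp, ha.symm, rfl⟩,
            fun y hy => ?_⟩
          rcases hback y hy with ⟨w', rfl, h | ⟨a', b', h, g1, g2, g3, g4, g5, rfl⟩⟩ |
            ⟨j, rfl, a', h, g⟩ | ⟨_, rfl, h⟩
          · cases h
          · cases h
            have : b' = b := Fin.ext (by omega)
            rw [this]
          · cases h
            omega
          · cases h
        · have key : ∃ j : Fin m, (j.val < i.val ∧ a.val = j.val ∨
              i.val ≤ j.val ∧ a.val = j.val + 2) := by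
            rcases Nat.lt_or_ge a.val i.val with h | h
            · exact ⟨⟨a.val, by omega⟩, .inl ⟨h, rfl⟩⟩
            · exact ⟨⟨a.val - 2, by omega⟩, .inr ⟨by simp; omega, by simp; omega⟩⟩
          obtain ⟨j, hj⟩ := key
          refine ⟨.inr (.inl j), ?_, fun y hy => ?_⟩
          · rcases hj with ⟨h1, h2⟩ | ⟨h1, h2⟩
            · refine ⟨?_, by rw [← hp, h2]⟩
              rw [top_cap_lt T i j h1, ← ha]
              exact congrArg T.top (Fin.ext h2.symm)
            · refine ⟨?_, by rw [← hp, h2, decide_even_add_two]⟩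
              rw [top_cap_ge T i j h1, ← ha]
              exact congrArg T.top (Fin.ext h2.symm)
          · rcases hback y hy with ⟨w', rfl, h | ⟨a', b', h, g1, g2, g3, g4, g5, rfl⟩⟩ |
              ⟨j', rfl, a', h, g⟩ | ⟨_, rfl, h⟩
            · cases h
            · cases h
              omega
            · cases h
              have : j' = j := Fin.ext (by omega)
              rw [this]
            · cases h
      · refine ⟨.inr (.inr j), hx, fun y hy => ?_⟩
        rcases hback y hy with ⟨w', rfl, h | ⟨_, _, h, _⟩⟩ | ⟨_, rfl, _, h, _⟩ | ⟨_, rfl, h⟩ <;>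
          cases h
        rfl

end FlatTangle

/-! ### Parity of arcs and colours of points -/

namespace Diagram

/-- Arcs join points of opposite parity. -/
theorem arc_parity {n : ℕ} (b : Diagram n) (i : Fin (2 * n)) :
    Even (b.arc i).val ↔ ¬ Even i.val := by
  have key : ∀ i, i < b.arc i → (Even (b.arc i).val ↔ ¬ Even i.val) := by
    intro i hi
    -- No arc crosses the one at `i`, so `b.arc` is a fixed point free involution of the points
    -- strictly below it, and their number is even.
    have h0 : ∑ j ∈ Finset.Ioo i (b.arc i), (1 : ZMod 2) = 0 := by
      refine Finset.sum_involution (fun j _ => b.arc j) (fun _ _ => rfl)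
        (fun j _ _ => b.arc_ne j) (fun j hj => ?_) (fun j _ => b.arc_arc j)
      rw [Finset.mem_Ioo] at hj ⊢
      have h1 := b.noncrossing i j
      have h2 := b.noncrossing (b.arc j) i
      rw [b.arc_arc] at h2
      have h3 : b.arc j ≠ i := fun e => by
        rw [← e, b.arc_arc] at hj
        exact lt_irrefl _ hj.2
      have h4 : b.arc j ≠ b.arc i := fun e => by
        have := congrArg b.arc e
        rw [b.arc_arc, b.arc_arc] at this
        rw [this] at hj
        exact lt_irrefl _ hj.1
      constructor
      · by_contra h
        exact h2 ⟨lt_of_le_of_ne (not_lt.1 h) h3, hj.1, hj.2⟩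
      · by_contra h
        exact h1 ⟨hj.1, hj.2, lt_of_le_of_ne (not_lt.1 h) h4.symm⟩
    rw [Finset.sum_const, nsmul_one, ZMod.natCast_eq_zero_iff_even, Fin.card_Ioo] at h0
    rw [Nat.even_iff] at h0 ⊢
    rw [Nat.even_iff]
    have : i.val < (b.arc i).val := hi
    omega
  rcases lt_trichotomy i (b.arc i) with h | h | h
  · exact key i h
  · exact (b.arc_ne i h.symm).elim
  · have := key (b.arc i) (by rwa [b.arc_arc])
    rw [b.arc_arc] at this
    tauto

/-- The colour of a point: free points have the parity of their number among the free points. -/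
def colour {n : ℕ} (b : Diagram n) (i : Fin (2 * n)) : Bool := decide (Even (i.val + (n - b.k)))

theorem colour_arc {n : ℕ} (b : Diagram n) (i : Fin (2 * n)) :
    b.colour (b.arc i) = !b.colour i := by
  have := b.arc_parity i
  unfold colour
  rw [← decide_not]
  refine decide_eq_decide.2 ?_
  rw [Nat.even_add, Nat.even_add]
  tauto

end Diagram

/-! ### The orientation of the closed 1-manifold -/

section Directed

variable {n m : ℕ}

/-- The orientation of `W(c) T b`, and its reversal for `p = false`. -/
inductive Dir (p : Bool) (c : Diagram m) (T : FlatTangle n m) (b : Diagram n) :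
    Vertex T → Vertex T → Prop
  | lowerArc (i : Fin (2 * n)) (h : b.colour i ≠ p) : Dir p c T b (.lower i) (.lower (b.arc i))
  | upperArc (i : Fin (2 * m)) (h : c.colour i = p) : Dir p c T b (.upper i) (.upper (c.arc i))
  | tangle (u v : T.Piece) (h : T.Flow p u v) : Dir p c T b (.strand u) (.strand v)
  | botUp (i : Fin (2 * n)) (j : Fin n) (h : i.val = (n - b.k) + j.val)
      (hp : decide (Even j.val) = p) : Dir p c T b (.lower i) (.strand (T.bot j))
  | botDown (i : Fin (2 * n)) (j : Fin n) (h : i.val = (n - b.k) + j.val)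
      (hp : decide (Even j.val) ≠ p) : Dir p c T b (.strand (T.bot j)) (.lower i)
  | topUp (i : Fin (2 * m)) (j : Fin m) (h : i.val = (m - c.k) + j.val)
      (hp : decide (Even j.val) = p) : Dir p c T b (.strand (T.top j)) (.upper i)
  | topDown (i : Fin (2 * m)) (j : Fin m) (h : i.val = (m - c.k) + j.val)
      (hp : decide (Even j.val) ≠ p) : Dir p c T b (.upper i) (.strand (T.top j))
  | leftUp (i : Fin (2 * n)) (i' : Fin (2 * m)) (hi : i.val < n - b.k)
      (hi' : i'.val < m - c.k) (h : (n - b.k) + i'.val = (m - c.k) + i.val)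
      (hp : b.colour i = p) : Dir p c T b (.lower i) (.upper i')
  | leftDown (i : Fin (2 * n)) (i' : Fin (2 * m)) (hi : i.val < n - b.k)
      (hi' : i'.val < m - c.k) (h : (n - b.k) + i'.val = (m - c.k) + i.val)
      (hp : b.colour i ≠ p) : Dir p c T b (.upper i') (.lower i)
  | rightUp (i : Fin (2 * n)) (i' : Fin (2 * m)) (hi : 2 * n - b.k ≤ i.val)
      (hi' : 2 * m - c.k ≤ i'.val) (h : (2 * n - b.k) + i'.val = (2 * m - c.k) + i.val)
      (hp : b.colour i = p) : Dir p c T b (.lower i) (.upper i')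
  | rightDown (i : Fin (2 * n)) (i' : Fin (2 * m)) (hi : 2 * n - b.k ≤ i.val)
      (hi' : 2 * m - c.k ≤ i'.val) (h : (2 * n - b.k) + i'.val = (2 * m - c.k) + i.val)
      (hp : b.colour i ≠ p) : Dir p c T b (.upper i') (.lower i)
  | lowerExtra (i j : Fin (2 * n))
      (hi : i.val + (m - c.k) < n - b.k ∨ j.val + (m - c.k) < n - b.k)
      (h : i.val + j.val + 1 = 2 * n) (hp : b.colour i = p) : Dir p c T b (.lower i) (.lower j)
  | upperExtra (i j : Fin (2 * m))
      (hi : i.val + (n - b.k) < m - c.k ∨ j.val + (n - b.k) < m - c.k)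
      (h : i.val + j.val + 1 = 2 * m) (hp : c.colour i ≠ p) : Dir p c T b (.upper i) (.upper j)

variable {c : Diagram m} {T : FlatTangle n m} {b : Diagram n}

theorem Dir.circle_eq {p : Bool} {u v : Vertex T} (h : Dir p c T b u v) :
    circleOf c T b u = circleOf c T b v := by
  cases h with
  | lowerArc i h => exact Quot.sound (.lowerArc i)
  | upperArc i h => exact Quot.sound (.upperArc i)
  | tangle u v h =>
    exact h.joined.elim (fun h => Quot.sound (.tangle _ _ h))
      fun h => (Quot.sound (.tangle _ _ h)).symm
  | botUp i j h hp => exact Quot.sound (.bot i j h)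
  | botDown i j h hp => exact (Quot.sound (.bot i j h)).symm
  | topUp i j h hp => exact (Quot.sound (.top i j h)).symm
  | topDown i j h hp => exact Quot.sound (.top i j h)
  | leftUp i i' hi hi' h hp => exact Quot.sound (.leftVertical i i' hi hi' h)
  | leftDown i i' hi hi' h hp => exact (Quot.sound (.leftVertical i i' hi hi' h)).symm
  | rightUp i i' hi hi' h hp => exact Quot.sound (.rightVertical i i' hi hi' h)
  | rightDown i i' hi hi' h hp => exact (Quot.sound (.rightVertical i i' hi hi' h)).symm
  | lowerExtra i j hi h hp =>
    exact hi.elim (fun hi => Quot.sound (.lowerExtra i j hi h))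
      fun hi => (Quot.sound (.lowerExtra j i hi (by omega))).symm
  | upperExtra i j hi h hp =>
    exact hi.elim (fun hi => Quot.sound (.upperExtra i j hi h))
      fun hi => (Quot.sound (.upperExtra j i hi (by omega))).symm

theorem bool_eq_not {x y : Bool} : x = !y ↔ x ≠ y := by
  cases x <;> cases y <;> simp

theorem colour_add_odd {b : Diagram n} {i j : Fin (2 * n)} (h : i.val + j.val + 1 = 2 * n) :
    b.colour j = !b.colour i := by
  unfold Diagram.colour
  rw [← decide_not]
  refine decide_eq_decide.2 ?_
  rw [Nat.even_iff, Nat.even_iff]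
  omega

/-- This makes the successor for `p = false` the predecessor for `p = true`, and so turns the unique
successors into a permutation. -/
theorem Dir.reverse {p : Bool} {u v : Vertex T} (h : Dir p c T b u v) :
    Dir (!p) c T b v u := by
  cases h with
  | lowerArc i h =>
    have := Dir.lowerArc (c := c) (T := T) (p := !p) (b.arc i)
      (by rw [b.colour_arc]; simpa using h)
    rwa [b.arc_arc] at this
  | upperArc i h =>
    have := Dir.upperArc (b := b) (T := T) (p := !p) (c.arc i)
      (by rw [c.colour_arc]; simpa using h)
    rwa [c.arc_arc] at this
  | tangle u v h => exact .tangle _ _ (T.flow_not p u v h)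
  | botUp i j h hp => exact .botDown i j h (by simp [hp])
  | botDown i j h hp => exact .botUp i j h (bool_eq_not.2 hp)
  | topUp i j h hp => exact .topDown i j h (by simp [hp])
  | topDown i j h hp => exact .topUp i j h (bool_eq_not.2 hp)
  | leftUp i i' hi hi' h hp => exact .leftDown i i' hi hi' h (by simp [hp])
  | leftDown i i' hi hi' h hp => exact .leftUp i i' hi hi' h (bool_eq_not.2 hp)
  | rightUp i i' hi hi' h hp => exact .rightDown i i' hi hi' h (by simp [hp])
  | rightDown i i' hi hi' h hp => exact .rightUp i i' hi hi' h (bool_eq_not.2 hp)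
  | lowerExtra i j hi h hp =>
    exact .lowerExtra j i hi.symm (by omega) (by rw [colour_add_odd h, hp])
  | upperExtra i j hi h hp =>
    exact .upperExtra j i hi.symm (by omega) (by
      rw [colour_add_odd h]
      simpa using hp)

/-- On the left the offset of the two platforms enters the difference of the positions twice. On the
right the parity also uses that `m - n` is even, which follows from compatibility. -/
theorem colour_vertical (hcb : c.Compatible b) {i : Fin (2 * n)} {i' : Fin (2 * m)}
    (h : (n - b.k) + i'.val = (m - c.k) + i.val ∨
      (2 * n - b.k) + i'.val = (2 * m - c.k) + i.val) : b.colour i = c.colour i' := by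
  have := c.k_le
  have := b.k_le
  unfold Diagram.Compatible at hcb
  unfold Diagram.colour
  refine decide_eq_decide.2 ?_
  rw [Nat.even_iff, Nat.even_iff]
  omega

theorem colour_free {b : Diagram n} {i : Fin (2 * n)} {j : Fin n} (h : i.val = (n - b.k) + j.val) :
    b.colour i = decide (Even j.val) := by
  unfold Diagram.colour
  refine decide_eq_decide.2 ?_
  rw [Nat.even_iff, Nat.even_iff]
  omega

/-- A point of `b` or `c` has two ends: its arc on one side, and on the other side a strand of `T`,
a vertical line or a closing arc. The colour decides by which of them the orientation leaves. For
strands the claim is `exists_exit`. -/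
theorem exists_dir (hcb : c.Compatible b) (p : Bool) (u : Vertex T) :
    ∃ v, Dir p c T b u v ∧ ∀ w, Dir p c T b u w → w = v := by
  have := c.k_le
  have := b.k_le
  have hcb' := hcb
  unfold Diagram.Compatible at hcb'
  rcases u with i | v | i
  · have := i.isLt
    by_cases hp : c.colour i = p
    · refine ⟨_, .upperArc i hp, ?_⟩
      intro w h
      cases h with
      | upperArc => rfl
      | topDown _ j h hp' => exact (hp' (by rw [← colour_free h, hp])).elim
      | leftDown i' _ _ _ h hp' => exact (hp' (by rw [colour_vertical hcb (.inl h), hp])).elim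
      | rightDown i' _ _ _ h hp' => exact (hp' (by rw [colour_vertical hcb (.inr h), hp])).elim
      | upperExtra _ j _ _ hp' => exact (hp' hp).elim
    · by_cases h1 : i.val < m - c.k
      · by_cases h2 : i.val + (n - b.k) < m - c.k
        · refine ⟨_, .upperExtra i ⟨2 * m - 1 - i.val, by omega⟩ (.inl h2) (by simp; omega) hp, ?_⟩
          intro w h
          cases h with
          | upperArc _ h => exact (hp h).elim
          | topDown _ j h hp' => omega
          | leftDown i' _ _ _ h hp' => omega
          | rightDown i' _ _ _ h hp' => omega
          | upperExtra _ j _ _ hp' => exact congrArg Vertex.upper (Fin.ext (by simp; omega))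
        · have hpar : (n - b.k) + i.val = (m - c.k) + (i.val + (n - b.k) - (m - c.k)) := by omega
          refine ⟨_, .leftDown ⟨i.val + (n - b.k) - (m - c.k), by omega⟩ i (by simp; omega) h1
            (by simpa using hpar) ?_, ?_⟩
          · rw [colour_vertical hcb (i' := i) (.inl (by simpa using hpar))]
            exact hp
          · intro w h
            cases h with
            | upperArc _ h => exact (hp h).elim
            | topDown _ j h hp' => omega
            | leftDown i' _ _ _ h hp' => exact congrArg Vertex.lower (Fin.ext (by simp; omega))
            | rightDown i' _ _ _ h hp' => omega
            | upperExtra _ j _ _ hp' => omega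
      · by_cases h2 : i.val < (m - c.k) + m
        · refine ⟨_, .topDown i ⟨i.val - (m - c.k), by omega⟩ (by simp; omega) ?_, ?_⟩
          · rw [← colour_free (b := c) (i := i) (by simp; omega)]
            exact hp
          · intro w h
            cases h with
            | upperArc _ h => exact (hp h).elim
            | topDown _ j h hp' =>
              exact congrArg (fun x => Vertex.strand (T.top x)) (Fin.ext (by simp; omega))
            | leftDown i' _ _ _ h hp' => omega
            | rightDown i' _ _ _ h hp' => omega
            | upperExtra _ j _ _ hp' => omega
        · by_cases h3 : 2 * m - 1 - i.val + (n - b.k) < m - c.k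
          · refine ⟨_, .upperExtra i ⟨2 * m - 1 - i.val, by omega⟩ (.inr h3) (by simp; omega) hp, ?_⟩
            intro w h
            cases h with
            | upperArc _ h => exact (hp h).elim
            | topDown _ j h hp' => omega
            | leftDown i' _ _ _ h hp' => omega
            | rightDown i' _ _ _ h hp' => omega
            | upperExtra _ j _ _ hp' => exact congrArg Vertex.upper (Fin.ext (by simp; omega))
          · have hpar : (2 * n - b.k) + i.val =
              (2 * m - c.k) + (i.val + (2 * n - b.k) - (2 * m - c.k)) := by omega
            refine ⟨_, .rightDown ⟨i.val + (2 * n - b.k) - (2 * m - c.k), by omega⟩ i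
              (by simp; omega) (by omega) (by simpa using hpar) ?_, ?_⟩
            · rw [colour_vertical hcb (i' := i) (.inr (by simpa using hpar))]
              exact hp
            · intro w h
              cases h with
              | upperArc _ h => exact (hp h).elim
              | topDown _ j h hp' => omega
              | leftDown i' _ _ _ h hp' => omega
              | rightDown i' _ _ _ h hp' => exact congrArg Vertex.lower (Fin.ext (by simp; omega))
              | upperExtra _ j _ _ hp' => omega
  · obtain ⟨x, hx, hux⟩ := T.exists_exit p v
    have hex : ∃ w, Dir p c T b (.strand v) w := by
      rcases x with w | j | j
      · exact ⟨_, .tangle v w hx⟩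
      · obtain ⟨rfl, hp⟩ := hx
        exact ⟨_, .topUp ⟨(m - c.k) + j.val, by omega⟩ j rfl hp⟩
      · obtain ⟨rfl, hp⟩ := hx
        exact ⟨_, .botDown ⟨(n - b.k) + j.val, by omega⟩ j rfl hp⟩
    obtain ⟨w, hw⟩ := hex
    refine ⟨w, hw, ?_⟩
    let F : T.Piece ⊕ Fin m ⊕ Fin n → Vertex T := Sum.elim .strand (Sum.elim
      (fun j => .upper ⟨(m - c.k) + j.val, by omega⟩)
      (fun j => .lower ⟨(n - b.k) + j.val, by omega⟩))
    have key : ∀ w, Dir p c T b (.strand v) w → w = F x := by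
      intro w h
      generalize hv : Vertex.strand v = v' at h
      cases h with
      | tangle u w h =>
        cases hv
        rw [← hux (.inl w) h]
        rfl
      | topUp i j h hp =>
        cases hv
        rw [← hux (.inr (.inl j)) ⟨rfl, hp⟩]
        exact congrArg Vertex.upper (Fin.ext h)
      | botDown i j h hp =>
        cases hv
        rw [← hux (.inr (.inr j)) ⟨rfl, hp⟩]
        exact congrArg Vertex.lower (Fin.ext h)
      | lowerArc | upperArc | botUp | topDown | leftUp | leftDown | rightUp | rightDown
      | lowerExtra | upperExtra => cases hv
    intro w' hw'
    rw [key w' hw', key w hw]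
  · have := i.isLt
    by_cases hp : b.colour i = p
    · by_cases h1 : i.val < n - b.k
      · by_cases h2 : i.val + (m - c.k) < n - b.k
        · refine ⟨_, .lowerExtra i ⟨2 * n - 1 - i.val, by omega⟩ (.inl h2) (by simp; omega) hp, ?_⟩
          intro w h
          cases h with
          | lowerArc _ h => exact (h hp).elim
          | botUp _ j h hp' => omega
          | leftUp _ i' _ _ h hp' => omega
          | rightUp _ i' _ _ h hp' => omega
          | lowerExtra _ j _ _ hp' => exact congrArg Vertex.lower (Fin.ext (by simp; omega))
        · refine ⟨_, .leftUp i ⟨i.val + (m - c.k) - (n - b.k), by omega⟩ h1 (by simp; omega)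
            (by simp; omega) hp, ?_⟩
          intro w h
          cases h with
          | lowerArc _ h => exact (h hp).elim
          | botUp _ j h hp' => omega
          | leftUp _ i' _ _ h hp' => exact congrArg Vertex.upper (Fin.ext (by simp; omega))
          | rightUp _ i' _ _ h hp' => omega
          | lowerExtra _ j _ _ hp' => omega
      · by_cases h2 : i.val < (n - b.k) + n
        · refine ⟨_, .botUp i ⟨i.val - (n - b.k), by omega⟩ (by simp; omega) ?_, ?_⟩
          · rw [← colour_free (b := b) (i := i) (by simp; omega)]
            exact hp
          · intro w h
            cases h with
            | lowerArc _ h => exact (h hp).elim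
            | botUp _ j h hp' =>
              exact congrArg (fun x => Vertex.strand (T.bot x)) (Fin.ext (by simp; omega))
            | leftUp _ i' _ _ h hp' => omega
            | rightUp _ i' _ _ h hp' => omega
            | lowerExtra _ j _ _ hp' => omega
        · by_cases h3 : 2 * n - 1 - i.val + (m - c.k) < n - b.k
          · refine ⟨_, .lowerExtra i ⟨2 * n - 1 - i.val, by omega⟩ (.inr h3) (by simp; omega) hp, ?_⟩
            intro w h
            cases h with
            | lowerArc _ h => exact (h hp).elim
            | botUp _ j h hp' => omega
            | leftUp _ i' _ _ h hp' => omega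
            | rightUp _ i' _ _ h hp' => omega
            | lowerExtra _ j _ _ hp' => exact congrArg Vertex.lower (Fin.ext (by simp; omega))
          · refine ⟨_, .rightUp i ⟨i.val + (2 * m - c.k) - (2 * n - b.k), by omega⟩
              (by omega) (by simp; omega) (by simp; omega) hp, ?_⟩
            intro w h
            cases h with
            | lowerArc _ h => exact (h hp).elim
            | botUp _ j h hp' => omega
            | leftUp _ i' _ _ h hp' => omega
            | rightUp _ i' _ _ h hp' => exact congrArg Vertex.upper (Fin.ext (by simp; omega))
            | lowerExtra _ j _ _ hp' => omega
    · refine ⟨_, .lowerArc i hp, ?_⟩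
      intro w h
      cases h with
      | lowerArc => rfl
      | botUp _ j h hp' => exact (hp (by rw [colour_free h, hp'])).elim
      | leftUp _ i' _ _ h hp' => exact (hp hp').elim
      | rightUp _ i' _ _ h hp' => exact (hp hp').elim
      | lowerExtra _ j _ _ hp' => exact (hp hp').elim

/-- The permutation of the pieces of `W(c) T b` along the orientation. -/
theorem exists_rho (T : FlatTangle n m) (hcb : c.Compatible b) :
    ∃ ρ : Equiv.Perm (Vertex T), ∀ u v, Dir true c T b u v ↔ ρ u = v := by
  choose f hf hf' using exists_dir (T := T) hcb true
  choose g hg hg' using exists_dir (T := T) hcb false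
  refine ⟨⟨f, g, fun u => ?_, fun u => ?_⟩, fun u v => ⟨fun h => (hf' u v h).symm, ?_⟩⟩
  · exact (hg' _ _ (hf u).reverse).symm
  · exact (hf' _ _ (hg u).reverse).symm
  · rintro rfl
    exact hf u

/-- The permutation of the pieces of `W(c) T b` along the orientation. -/
noncomputable def rho (T : FlatTangle n m) (hcb : c.Compatible b) : Equiv.Perm (Vertex T) :=
  (exists_rho T hcb).choose

theorem rho_iff (hcb : c.Compatible b) (u v : Vertex T) :
    Dir true c T b u v ↔ rho T hcb u = v :=
  (exists_rho T hcb).choose_spec u v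

/-- Every connection is traversed by the orientation in one of the two directions. Hence the
circles, defined by identifying connected pieces, are the cycles of `rho`. -/
theorem Edge.rho {u v : Vertex T} (h : Edge c T b u v) (hcb : c.Compatible b) :
    rho T hcb u = v ∨ rho T hcb v = u := by
  rw [← rho_iff, ← rho_iff]
  have key : ∀ x : Bool, x = true ∨ x ≠ true := fun x => by cases x <;> simp
  cases h with
  | lowerArc i =>
    rcases key (b.colour i) with h | h
    · right
      have := Dir.lowerArc (c := c) (T := T) (p := true) (b.arc i) (by rw [b.colour_arc, h]; simp)
      rwa [b.arc_arc] at this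
    · exact .inl (.lowerArc i h)
  | upperArc i =>
    rcases key (c.colour i) with h | h
    · exact .inl (.upperArc i h)
    · right
      have := Dir.upperArc (b := b) (T := T) (p := true) (c.arc i) (by
        rw [c.colour_arc]; simpa using h)
      rwa [c.arc_arc] at this
  | tangle u v h => exact h.flow.imp (.tangle _ _) (.tangle _ _)
  | bot i j h => exact (key _).imp (.botUp i j h) (.botDown i j h)
  | top i j h => exact ((key _).imp (.topUp i j h) (.topDown i j h)).symm
  | leftVertical i i' hi hi' h => exact (key _).imp (.leftUp i i' hi hi' h) (.leftDown i i' hi hi' h)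
  | rightVertical i i' hi hi' h =>
    exact (key _).imp (.rightUp i i' hi hi' h) (.rightDown i i' hi hi' h)
  | lowerExtra i j hi h =>
    rcases key (b.colour i) with hp | hp
    · exact .inl (.lowerExtra i j (.inl hi) h hp)
    · exact .inr (.lowerExtra j i (.inr hi) (by omega) (by
        rw [colour_add_odd h]; simpa using hp))
  | upperExtra i j hi h =>
    rcases key (c.colour i) with hp | hp
    · exact .inr (.upperExtra j i (.inr hi) (by omega) (by
        rw [colour_add_odd h]; simp [hp]))
    · exact .inl (.upperExtra i j (.inl hi) h hp)

theorem circleOf_rho (hcb : c.Compatible b) (u : Vertex T) :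
    circleOf c T b (rho T hcb u) = circleOf c T b u :=
  (((rho_iff hcb u _).2 rfl).circle_eq).symm

end Directed

/-! ### Gluing tangles, and maps on the pieces of a cobordism -/

section Gluing

variable {n s m : ℕ}

/-- The ends of the two tangles that meet at the middle level. -/
inductive Mid (T₂ : FlatTangle s m) (T₁ : FlatTangle n s) :
    T₂.Piece ⊕ T₁.Piece → T₂.Piece ⊕ T₁.Piece → Prop
  | mk (j : Fin s) : Mid T₂ T₁ (.inl (T₂.bot j)) (.inr (T₁.top j))

/-- The tangle `T` is obtained by putting `T₂` on top of `T₁`. -/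
structure Gluing (T₂ : FlatTangle s m) (T₁ : FlatTangle n s) (T : FlatTangle n m)
    (place : T.Piece → T₂.Piece ⊕ T₁.Piece) where
  q : T₂.Piece ⊕ T₁.Piece → T.Piece
  q_place : ∀ v, q (place v) = v
  -- Several pieces of the two tangles may form one piece of `T`. The map `place` selects one of
  -- them, and the others are reached from it through the middle level.
  place_q : ∀ x, Relation.EqvGen (Mid T₂ T₁) (place (q x)) x
  mid : ∀ j, q (.inl (T₂.bot j)) = q (.inr (T₁.top j))
  top : ∀ j, q (.inl (T₂.top j)) = T.top j
  bot : ∀ j, q (.inr (T₁.bot j)) = T.bot j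
  joined : ∀ u v, T.Joined u v ↔
    (∃ u' v', T₂.Joined u' v' ∧ q (.inl u') = u ∧ q (.inl v') = v) ∨
    (∃ u' v', T₁.Joined u' v' ∧ q (.inr u') = u ∧ q (.inr v') = v)

variable {T₂ : FlatTangle s m} {T₁ : FlatTangle n s} {T : FlatTangle n m}
  {place : T.Piece → T₂.Piece ⊕ T₁.Piece} {c : Diagram m} {d : Diagram s} {b : Diagram n}

/-- A map that identifies what is connected after the saddle moves. -/
structure Respects (c : Diagram m) (d : Diagram s) (b : Diagram n) {X : Type}
    (f : Vertex T₂ ⊕ Vertex T₁ → X) : Prop where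
  upperArc : ∀ i, f (.inl (.upper i)) = f (.inl (.upper (c.arc i)))
  lowerArc : ∀ i, f (.inr (.lower i)) = f (.inr (.lower (b.arc i)))
  joined₂ : ∀ u v, T₂.Joined u v → f (.inl (.strand u)) = f (.inl (.strand v))
  joined₁ : ∀ u v, T₁.Joined u v → f (.inr (.strand u)) = f (.inr (.strand v))
  top₂ : ∀ (i : Fin (2 * m)) (j : Fin m), i.val = (m - c.k) + j.val →
    f (.inl (.upper i)) = f (.inl (.strand (T₂.top j)))
  bot₂ : ∀ (i : Fin (2 * s)) (j : Fin s), i.val = (s - d.k) + j.val →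
    f (.inl (.lower i)) = f (.inl (.strand (T₂.bot j)))
  top₁ : ∀ (i : Fin (2 * s)) (j : Fin s), i.val = (s - d.k) + j.val →
    f (.inr (.upper i)) = f (.inr (.strand (T₁.top j)))
  bot₁ : ∀ (i : Fin (2 * n)) (j : Fin n), i.val = (n - b.k) + j.val →
    f (.inr (.lower i)) = f (.inr (.strand (T₁.bot j)))
  left₂ : ∀ (i : Fin (2 * s)) (i' : Fin (2 * m)), i.val < s - d.k → i'.val < m - c.k →
    (s - d.k) + i'.val = (m - c.k) + i.val → f (.inl (.lower i)) = f (.inl (.upper i'))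
  right₂ : ∀ (i : Fin (2 * s)) (i' : Fin (2 * m)), 2 * s - d.k ≤ i.val → 2 * m - c.k ≤ i'.val →
    (2 * s - d.k) + i'.val = (2 * m - c.k) + i.val → f (.inl (.lower i)) = f (.inl (.upper i'))
  left₁ : ∀ (i : Fin (2 * n)) (i' : Fin (2 * s)), i.val < n - b.k → i'.val < s - d.k →
    (n - b.k) + i'.val = (s - d.k) + i.val → f (.inr (.lower i)) = f (.inr (.upper i'))
  right₁ : ∀ (i : Fin (2 * n)) (i' : Fin (2 * s)), 2 * n - b.k ≤ i.val → 2 * s - d.k ≤ i'.val →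
    (2 * n - b.k) + i'.val = (2 * s - d.k) + i.val → f (.inr (.lower i)) = f (.inr (.upper i'))
  lowerExtra₂ : ∀ i : Fin (2 * s), i.val + (m - c.k) < s - d.k →
    f (.inl (.lower i)) = f (.inl (.lower i.rev))
  -- A closing arc of `c` above the platforms of `d` survives only if `b` has no platform point at
  -- its level. Otherwise a saddle turns it, together with the closing arc of `b`, into the two
  -- vertical lines of `leftSaddle` and `rightSaddle`.
  upperExtra₂ : ∀ i : Fin (2 * m), i.val + (s - d.k) < m - c.k → i.val + (n - b.k) < m - c.k →
    f (.inl (.upper i)) = f (.inl (.upper i.rev))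
  lowerExtra₁ : ∀ i : Fin (2 * n), i.val + (s - d.k) < n - b.k → i.val + (m - c.k) < n - b.k →
    f (.inr (.lower i)) = f (.inr (.lower i.rev))
  upperExtra₁ : ∀ i : Fin (2 * s), i.val + (n - b.k) < s - d.k →
    f (.inr (.upper i)) = f (.inr (.upper i.rev))
  glue : ∀ i, f (.inl (.lower i)) = f (.inr (.upper i))
  leftSaddle : ∀ (i : Fin (2 * n)) (i' : Fin (2 * m)), i.val < n - b.k → i'.val < m - c.k →
    (n - b.k) + i'.val = (m - c.k) + i.val → i'.val + (s - d.k) < m - c.k →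
    f (.inr (.lower i)) = f (.inl (.upper i'))
  rightSaddle : ∀ (i : Fin (2 * n)) (i' : Fin (2 * m)), i.val < n - b.k → i'.val < m - c.k →
    (n - b.k) + i'.val = (m - c.k) + i.val → i'.val + (s - d.k) < m - c.k →
    f (.inr (.lower i.rev)) = f (.inl (.upper i'.rev))

theorem Respects.mid {X : Type} {f : Vertex T₂ ⊕ Vertex T₁ → X} (h : Respects c d b f)
    {x y : T₂.Piece ⊕ T₁.Piece} (hxy : Relation.EqvGen (Mid T₂ T₁) x y) :
    f (Sum.map Vertex.strand Vertex.strand x) = f (Sum.map Vertex.strand Vertex.strand y) := by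
  have := d.k_le
  induction hxy with
  | rel x y h' =>
    obtain ⟨j⟩ := h'
    have hj : ((⟨(s - d.k) + j.val, by omega⟩ : Fin (2 * s))).val = (s - d.k) + j.val := rfl
    exact (h.bot₂ _ j hj).symm.trans ((h.glue _).trans (h.top₁ _ j hj))
  | refl => rfl
  | symm _ _ _ ih => exact ih.symm
  | trans _ _ _ _ _ h1 h2 => exact h1.trans h2

theorem eq_rev {k : ℕ} {i j : Fin (2 * k)} (h : i.val + j.val + 1 = 2 * k) : j = i.rev :=
  Fin.ext (by rw [Fin.val_rev]; omega)

/-- A map that respects the connections of the surgered picture respects those of `W(c) T b`. -/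
theorem Respects.out {X : Type} {f : Vertex T₂ ⊕ Vertex T₁ → X} (h : Respects c d b f)
    (G : Gluing T₂ T₁ T place) (hcd : c.Compatible d) (hdb : d.Compatible b)
    {u v : Vertex T} (huv : Edge c T b u v) :
    f (placeVertex place u) = f (placeVertex place v) := by
  have hc := c.k_le
  have hd := d.k_le
  have hb := b.k_le
  have hstr : ∀ x, f (placeVertex place (.strand (G.q x))) =
      f (Sum.map Vertex.strand Vertex.strand x) := fun x => h.mid (G.place_q x)
  unfold Diagram.Compatible at hcd hdb
  cases huv with
  | lowerArc i => exact h.lowerArc i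
  | upperArc i => exact h.upperArc i
  | tangle u v huv =>
    rcases (G.joined u v).1 huv with ⟨u', v', h', rfl, rfl⟩ | ⟨u', v', h', rfl, rfl⟩
    · rw [hstr, hstr]
      exact h.joined₂ _ _ h'
    · rw [hstr, hstr]
      exact h.joined₁ _ _ h'
  | bot i j hij =>
    rw [← G.bot, hstr]
    exact h.bot₁ i j hij
  | top i j hij =>
    rw [← G.top, hstr]
    exact h.top₂ i j hij
  | leftVertical i i' hi hi' hii =>
    -- A vertical line of `W(c) T b` passes through the platform of `d` if this reaches the level;
    -- otherwise it was created by a saddle.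
    by_cases hlev : i'.val + (s - d.k) < m - c.k
    · exact h.leftSaddle i i' hi hi' hii hlev
    · let x : Fin (2 * s) := ⟨i'.val + (s - d.k) - (m - c.k), by omega⟩
      have hx : x.val = i'.val + (s - d.k) - (m - c.k) := rfl
      exact (h.left₁ i x hi (by omega) (by omega)).trans ((h.glue x).symm.trans
        (h.left₂ x i' (by omega) hi' (by omega)))
  | rightVertical i i' hi hi' hii =>
    have hi2 := i.isLt
    have hi2' := i'.isLt
    have e1 := Fin.val_rev i
    have e2 := Fin.val_rev i'
    by_cases hlev : i'.rev.val + (s - d.k) < m - c.k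
    · have := h.rightSaddle i.rev i'.rev (by omega) (by omega) (by omega) hlev
      rwa [Fin.rev_rev, Fin.rev_rev] at this
    · let x : Fin (2 * s) := ⟨i'.val + (2 * s - d.k) - (2 * m - c.k), by omega⟩
      have hx : x.val = i'.val + (2 * s - d.k) - (2 * m - c.k) := rfl
      exact (h.right₁ i x hi (by omega) (by omega)).trans ((h.glue x).symm.trans
        (h.right₂ x i' (by omega) hi' (by omega)))
  | lowerExtra i j hi hij =>
    obtain rfl := eq_rev hij
    by_cases hlev : i.val + (s - d.k) < n - b.k
    · exact h.lowerExtra₁ i hlev hi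
    · let x : Fin (2 * s) := ⟨i.val + (s - d.k) - (n - b.k), by omega⟩
      have hx : x.val = i.val + (s - d.k) - (n - b.k) := rfl
      have e1 := Fin.val_rev i
      have e2 := Fin.val_rev x
      exact (h.left₁ i x (by omega) (by omega) (by omega)).trans ((h.glue x).symm.trans
        ((h.lowerExtra₂ x (by omega)).trans ((h.glue x.rev).trans
          (h.right₁ i.rev x.rev (by omega) (by omega) (by omega)).symm)))
  | upperExtra i j hi hij =>
    obtain rfl := eq_rev hij
    by_cases hlev : i.val + (s - d.k) < m - c.k
    · exact h.upperExtra₂ i hlev hi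
    · let x : Fin (2 * s) := ⟨i.val + (s - d.k) - (m - c.k), by omega⟩
      have hx : x.val = i.val + (s - d.k) - (m - c.k) := rfl
      have e1 := Fin.val_rev i
      have e2 := Fin.val_rev x
      exact (h.left₂ x i (by omega) (by omega) (by omega)).symm.trans ((h.glue x).trans
        ((h.upperExtra₁ x (by omega)).trans ((h.glue x.rev).symm.trans
          (h.right₂ x.rev i.rev (by omega) (by omega) (by omega)))))

/-- Maps on the components of the cobordism: the relations along `W(c) T b` follow from the
others, up to the vertical lines that arise from closing arcs. -/
theorem surface_respects {X : Type}
    (f : Vertex T₂ ⊕ Vertex T₁ → X)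
    (h₂ : ∀ u v, Edge c T₂ d u v → f (.inl u) = f (.inl v))
    (h₁ : ∀ u v, Edge d T₁ b u v → f (.inr u) = f (.inr v))
    (hg : ∀ i, f (.inl (.lower i)) = f (.inr (.upper i)))
    (hl : ∀ (i : Fin (2 * n)) (i' : Fin (2 * m)), i.val < n - b.k → i'.val < m - c.k →
      (n - b.k) + i'.val = (m - c.k) + i.val → i'.val + (s - d.k) < m - c.k →
      f (.inr (.lower i)) = f (.inl (.upper i'))) :
    Respects c d b f := by
  have hc := c.k_le
  have hd := d.k_le
  have hb := b.k_le
  exact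
  { upperArc := fun i => h₂ _ _ (.upperArc i)
    lowerArc := fun i => h₁ _ _ (.lowerArc i)
    joined₂ := fun u v h => h₂ _ _ (.tangle u v h)
    joined₁ := fun u v h => h₁ _ _ (.tangle u v h)
    top₂ := fun i j h => h₂ _ _ (.top i j h)
    bot₂ := fun i j h => h₂ _ _ (.bot i j h)
    top₁ := fun i j h => h₁ _ _ (.top i j h)
    bot₁ := fun i j h => h₁ _ _ (.bot i j h)
    left₂ := fun i i' hi hi' h => h₂ _ _ (.leftVertical i i' hi hi' h)
    right₂ := fun i i' hi hi' h => h₂ _ _ (.rightVertical i i' hi hi' h)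
    left₁ := fun i i' hi hi' h => h₁ _ _ (.leftVertical i i' hi hi' h)
    right₁ := fun i i' hi hi' h => h₁ _ _ (.rightVertical i i' hi hi' h)
    lowerExtra₂ := fun i h => h₂ _ _ (.lowerExtra i i.rev h (by rw [Fin.val_rev]; omega))
    upperExtra₂ := fun i h _ => h₂ _ _ (.upperExtra i i.rev h (by rw [Fin.val_rev]; omega))
    lowerExtra₁ := fun i h _ => h₁ _ _ (.lowerExtra i i.rev h (by rw [Fin.val_rev]; omega))
    upperExtra₁ := fun i h => h₁ _ _ (.upperExtra i i.rev h (by rw [Fin.val_rev]; omega))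
    glue := hg
    leftSaddle := hl
    -- The right vertical line joins the same closing arcs as the left one.
    rightSaddle := fun i i' hi hi' h hlev => by
      rw [← h₁ _ _ (.lowerExtra i i.rev (by omega) (by rw [Fin.val_rev]; omega)),
        ← h₂ _ _ (.upperExtra i' i'.rev hlev (by rw [Fin.val_rev]; omega))]
      exact hl i i' hi hi' h hlev }

/-- To define a map on the components of the cobordism it suffices to look at the incoming circles,
the gluing at the middle, and the left vertical lines that saddles create. All connections of the
outgoing manifold are consequences. -/
theorem surface_edge_eq (G : Gluing T₂ T₁ T place) (hcd : c.Compatible d) (hdb : d.Compatible b)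
    {X : Type} (f : Vertex T₂ ⊕ Vertex T₁ → X)
    (h₂ : ∀ u v, Edge c T₂ d u v → f (.inl u) = f (.inl v))
    (h₁ : ∀ u v, Edge d T₁ b u v → f (.inr u) = f (.inr v))
    (hg : ∀ i, f (.inl (.lower i)) = f (.inr (.upper i)))
    (hl : ∀ (i : Fin (2 * n)) (i' : Fin (2 * m)), i.val < n - b.k → i'.val < m - c.k →
      (n - b.k) + i'.val = (m - c.k) + i.val → i'.val + (s - d.k) < m - c.k →
      f (.inr (.lower i)) = f (.inl (.upper i'))) (x y : Vertex T₂ ⊕ Vertex T₁)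
    (hxy : SurfaceEdge place c d b x y) : f x = f y := by
  cases hxy with
  | above u v h => exact h₂ _ _ h
  | below u v h => exact h₁ _ _ h
  | glue i => exact hg i
  | out u v h => exact (surface_respects f h₂ h₁ hg hl).out G hcd hdb h

/-! ### The circles after the saddle moves -/

/-- The circle of `W(c) T b`, or the extra circle, through a point of the middle diagram. -/
noncomputable def midCircle (G : Gluing T₂ T₁ T place) (hcd : c.Compatible d)
    (hdb : d.Compatible b) (i : Fin (2 * s)) : Circle c T b ⊕ ExtraCircle c d b :=
  if h : i.val < s - d.k then
    if hc : s - d.k ≤ i.val + (m - c.k) then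
      .inl (circleOf c T b (.upper ⟨i.val + (m - c.k) - (s - d.k), by omega⟩))
    else if hb : s - d.k ≤ i.val + (n - b.k) then
      .inl (circleOf c T b (.lower ⟨i.val + (n - b.k) - (s - d.k), by omega⟩))
    else .inr ⟨i, by omega, by omega⟩
  else if h : i.val < s - d.k + s then
    .inl (circleOf c T b (.strand (G.q (.inl (T₂.bot ⟨i.val - (s - d.k), by omega⟩)))))
  else if hc : s - d.k ≤ i.rev.val + (m - c.k) then
    .inl (circleOf c T b (.upper (Fin.rev ⟨i.rev.val + (m - c.k) - (s - d.k), by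
      have := c.k_le; have := d.k_le; have := i.isLt; have := Fin.val_rev i
      unfold Diagram.Compatible at hcd
      omega⟩)))
  else if hb : s - d.k ≤ i.rev.val + (n - b.k) then
    .inl (circleOf c T b (.lower (Fin.rev ⟨i.rev.val + (n - b.k) - (s - d.k), by
      have := b.k_le; have := d.k_le; have := i.isLt; have := Fin.val_rev i
      unfold Diagram.Compatible at hdb
      omega⟩)))
  else .inr ⟨i.rev, by omega, by omega⟩

section

variable (G : Gluing T₂ T₁ T place) (hcd : c.Compatible d) (hdb : d.Compatible b)
include G hcd hdb

theorem midCircle_left_c (i : Fin (2 * s)) (i' : Fin (2 * m)) (h : i.val < s - d.k)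
    (h' : (s - d.k) + i'.val = (m - c.k) + i.val) :
    midCircle G hcd hdb i = .inl (circleOf c T b (.upper i')) := by
  unfold midCircle
  rw [dif_pos h, dif_pos (by omega)]
  have : (⟨i.val + (m - c.k) - (s - d.k), by omega⟩ : Fin (2 * m)) = i' :=
    Fin.ext (by simp; omega)
  rw [this]

theorem midCircle_left_b (i : Fin (2 * s)) (i' : Fin (2 * n)) (h : i.val < s - d.k)
    (hc : i.val + (m - c.k) < s - d.k)
    (h' : (s - d.k) + i'.val = (n - b.k) + i.val) :
    midCircle G hcd hdb i = .inl (circleOf c T b (.lower i')) := by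
  unfold midCircle
  rw [dif_pos h, dif_neg (by omega), dif_pos (by omega)]
  have : (⟨i.val + (n - b.k) - (s - d.k), by omega⟩ : Fin (2 * n)) = i' :=
    Fin.ext (by simp; omega)
  rw [this]

theorem midCircle_left_extra (i : ExtraCircle c d b) :
    midCircle G hcd hdb i.1 = .inr i := by
  have := i.2
  unfold midCircle
  rw [dif_pos (by omega), dif_neg (by omega), dif_neg (by omega)]
  rfl

theorem midCircle_free (i : Fin (2 * s)) (j : Fin s) (h : i.val = (s - d.k) + j.val) :
    midCircle G hcd hdb i = .inl (circleOf c T b (.strand (G.q (.inl (T₂.bot j))))) := by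
  unfold midCircle
  rw [dif_neg (by omega), dif_pos (by omega)]
  have : (⟨i.val - (s - d.k), by omega⟩ : Fin s) = j := Fin.ext (by simp; omega)
  rw [this]

theorem midCircle_right_c (i : Fin (2 * s)) (i' : Fin (2 * m)) (h : 2 * s - d.k ≤ i.val)
    (h' : (s - d.k) + i'.rev.val = (m - c.k) + i.rev.val) :
    midCircle G hcd hdb i = .inl (circleOf c T b (.upper i')) := by
  have := d.k_le
  unfold midCircle
  rw [dif_neg (by omega), dif_neg (by omega), dif_pos (by omega)]
  have hlt : i.rev.val + (m - c.k) - (s - d.k) < 2 * m := by omega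
  have : Fin.rev (⟨i.rev.val + (m - c.k) - (s - d.k), hlt⟩ : Fin (2 * m)) = i' := by
    rw [← Fin.rev_rev i']
    exact congrArg Fin.rev (Fin.ext (by simp only; omega))
  rw [this]

theorem midCircle_right_b (i : Fin (2 * s)) (i' : Fin (2 * n)) (h : 2 * s - d.k ≤ i.val)
    (hc : i.rev.val + (m - c.k) < s - d.k)
    (h' : (s - d.k) + i'.rev.val = (n - b.k) + i.rev.val) :
    midCircle G hcd hdb i = .inl (circleOf c T b (.lower i')) := by
  have := d.k_le
  unfold midCircle
  rw [dif_neg (by omega), dif_neg (by omega), dif_neg (by omega), dif_pos (by omega)]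
  have hlt : i.rev.val + (n - b.k) - (s - d.k) < 2 * n := by omega
  have : Fin.rev (⟨i.rev.val + (n - b.k) - (s - d.k), hlt⟩ : Fin (2 * n)) = i' := by
    rw [← Fin.rev_rev i']
    exact congrArg Fin.rev (Fin.ext (by simp only; omega))
  rw [this]

theorem midCircle_right_extra (i : ExtraCircle c d b) :
    midCircle G hcd hdb i.1.rev = .inr i := by
  have := i.2
  have := d.k_le
  have := c.k_le
  have := Fin.val_rev i.1
  have hcd' := hcd
  unfold Diagram.Compatible at hcd'
  unfold midCircle
  rw [dif_neg (by omega), dif_neg (by omega), dif_neg (by rw [Fin.rev_rev]; omega),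
    dif_neg (by rw [Fin.rev_rev]; omega)]
  exact congrArg Sum.inr (Subtype.ext (Fin.rev_rev _))

/-- The circle of `W(c) T b`, or the extra circle, through a piece. -/
noncomputable def outMap : Vertex T₂ ⊕ Vertex T₁ → Circle c T b ⊕ ExtraCircle c d b
  | .inl (.upper i) => .inl (circleOf c T b (.upper i))
  | .inl (.strand v) => .inl (circleOf c T b (.strand (G.q (.inl v))))
  | .inl (.lower i) => midCircle G hcd hdb i
  | .inr (.upper i) => midCircle G hcd hdb i
  | .inr (.strand v) => .inl (circleOf c T b (.strand (G.q (.inr v))))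
  | .inr (.lower i) => .inl (circleOf c T b (.lower i))

theorem outMap_place (v : Vertex T) :
    outMap G hcd hdb (placeVertex place v) = .inl (circleOf c T b v) := by
  rcases v with i | v | i
  · rfl
  · have : ∀ x, outMap G hcd hdb (Sum.map Vertex.strand Vertex.strand x) =
        .inl (circleOf c T b (.strand (G.q x))) := by
      rintro (x | x) <;> rfl
    change outMap G hcd hdb (Sum.map Vertex.strand Vertex.strand (place v)) = _
    rw [this, G.q_place]
  · rfl

/-- Each connection of the surgered picture either becomes a connection of `W(c) T b` or stays
within one extra circle. The cases depend on which platforms reach the level in question. -/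
theorem outMap_respects : Respects c d b (outMap G hcd hdb) := by
  have hc := c.k_le
  have hd := d.k_le
  have hb := b.k_le
  have hcd' := hcd
  have hdb' := hdb
  unfold Diagram.Compatible at hcd' hdb'
  have hl₂ : ∀ (i : Fin (2 * s)) (i' : Fin (2 * m)), i.val < s - d.k → i'.val < m - c.k →
    (s - d.k) + i'.val = (m - c.k) + i.val →
    outMap G hcd hdb (.inl (.lower i)) = outMap G hcd hdb (.inl (.upper i')) :=
    fun i i' hi _ h => midCircle_left_c G hcd hdb i i' hi h
  have hr₂ : ∀ (i : Fin (2 * s)) (i' : Fin (2 * m)), 2 * s - d.k ≤ i.val → 2 * m - c.k ≤ i'.val →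
    (2 * s - d.k) + i'.val = (2 * m - c.k) + i.val →
    outMap G hcd hdb (.inl (.lower i)) = outMap G hcd hdb (.inl (.upper i')) := by
    intro i i' hi _ h
    have := Fin.val_rev i
    have := Fin.val_rev i'
    exact midCircle_right_c G hcd hdb i i' hi (by omega)
  have hl₁ : ∀ (i : Fin (2 * n)) (i' : Fin (2 * s)), i.val < n - b.k → i'.val < s - d.k →
    (n - b.k) + i'.val = (s - d.k) + i.val →
    outMap G hcd hdb (.inr (.lower i)) = outMap G hcd hdb (.inr (.upper i')) := by
    intro i i' hi hi' h
    by_cases hlev : i'.val + (m - c.k) < s - d.k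
    · exact (midCircle_left_b G hcd hdb i' i hi' hlev (by omega)).symm
    · let x : Fin (2 * m) := ⟨i'.val + (m - c.k) - (s - d.k), by omega⟩
      have hx : x.val = i'.val + (m - c.k) - (s - d.k) := rfl
      refine Eq.trans ?_ (midCircle_left_c G hcd hdb i' x hi' (by omega)).symm
      exact congrArg Sum.inl (Quot.sound (.leftVertical i x hi (by omega) (by omega)))
  have hr₁ : ∀ (i : Fin (2 * n)) (i' : Fin (2 * s)), 2 * n - b.k ≤ i.val → 2 * s - d.k ≤ i'.val →
    (2 * n - b.k) + i'.val = (2 * s - d.k) + i.val →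
    outMap G hcd hdb (.inr (.lower i)) = outMap G hcd hdb (.inr (.upper i')) := by
    intro i i' hi hi' h
    have e1 := Fin.val_rev i
    have e2 := Fin.val_rev i'
    have e3 := i.isLt
    have e4 := i'.isLt
    by_cases hlev : i'.rev.val + (m - c.k) < s - d.k
    · exact (midCircle_right_b G hcd hdb i' i hi' hlev (by omega)).symm
    · let x : Fin (2 * m) := ⟨i'.val + (2 * m - c.k) - (2 * s - d.k), by omega⟩
      have hx : x.val = i'.val + (2 * m - c.k) - (2 * s - d.k) := rfl
      have e3 := Fin.val_rev x
      refine Eq.trans ?_ (midCircle_right_c G hcd hdb i' x hi' (by omega)).symm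
      exact congrArg Sum.inl (Quot.sound (.rightVertical i x hi (by omega) (by omega)))
  have hextra : ∀ i : Fin (2 * s), i.val + (m - c.k) < s - d.k → i.val + (n - b.k) < s - d.k →
      midCircle G hcd hdb i = midCircle G hcd hdb i.rev := fun i h h' =>
    (midCircle_left_extra G hcd hdb ⟨i, h, h'⟩).trans
      (midCircle_right_extra G hcd hdb ⟨i, h, h'⟩).symm
  exact
  { upperArc := fun i => congrArg Sum.inl (Quot.sound (.upperArc i))
    lowerArc := fun i => congrArg Sum.inl (Quot.sound (.lowerArc i))
    joined₂ := fun u v h => congrArg Sum.inl (Quot.sound (.tangle _ _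
      ((G.joined _ _).2 (.inl ⟨u, v, h, rfl, rfl⟩))))
    joined₁ := fun u v h => congrArg Sum.inl (Quot.sound (.tangle _ _
      ((G.joined _ _).2 (.inr ⟨u, v, h, rfl, rfl⟩))))
    top₂ := fun i j h => by
      change Sum.inl _ = Sum.inl (circleOf c T b (.strand (G.q (.inl (T₂.top j)))))
      rw [G.top]
      exact congrArg Sum.inl (Quot.sound (.top i j h))
    bot₂ := fun i j h => midCircle_free G hcd hdb i j h
    top₁ := fun i j h => by
      refine (midCircle_free G hcd hdb i j h).trans ?_
      rw [G.mid]
      rfl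
    bot₁ := fun i j h => by
      change Sum.inl _ = Sum.inl (circleOf c T b (.strand (G.q (.inr (T₁.bot j)))))
      rw [G.bot]
      exact congrArg Sum.inl (Quot.sound (.bot i j h))
    left₂ := hl₂
    right₂ := hr₂
    left₁ := hl₁
    right₁ := hr₁
    lowerExtra₂ := fun i h => by
      by_cases hlev : i.val + (n - b.k) < s - d.k
      · exact hextra i h hlev
      · let x : Fin (2 * n) := ⟨i.val + (n - b.k) - (s - d.k), by omega⟩
        have hx : x.val = i.val + (n - b.k) - (s - d.k) := rfl
        have e1 := Fin.val_rev i
        have e2 := Fin.val_rev x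
        refine (hl₁ x i (by omega) (by omega) (by omega)).symm.trans
          (Eq.trans ?_ (hr₁ x.rev i.rev (by omega) (by omega) (by omega)))
        exact congrArg Sum.inl (Quot.sound (.lowerExtra x x.rev (by omega) (by omega)))
    upperExtra₂ := fun i h h' => congrArg Sum.inl
      (Quot.sound (.upperExtra i i.rev h' (by rw [Fin.val_rev]; omega)))
    lowerExtra₁ := fun i h h' => congrArg Sum.inl
      (Quot.sound (.lowerExtra i i.rev h' (by rw [Fin.val_rev]; omega)))
    upperExtra₁ := fun i h => by
      by_cases hlev : i.val + (m - c.k) < s - d.k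
      · exact hextra i hlev h
      · let x : Fin (2 * m) := ⟨i.val + (m - c.k) - (s - d.k), by omega⟩
        have hx : x.val = i.val + (m - c.k) - (s - d.k) := rfl
        have e1 := Fin.val_rev i
        have e2 := Fin.val_rev x
        refine (hl₂ i x (by omega) (by omega) (by omega)).trans
          (Eq.trans ?_ (hr₂ i.rev x.rev (by omega) (by omega) (by omega)).symm)
        exact congrArg Sum.inl (Quot.sound (.upperExtra x x.rev (by omega) (by omega)))
    glue := fun i => rfl
    leftSaddle := fun i i' hi hi' h _ =>
      congrArg Sum.inl (Quot.sound (.leftVertical i i' hi hi' h))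
    rightSaddle := fun i i' hi hi' h hlev => by
      have e1 := Fin.val_rev i
      have e2 := Fin.val_rev i'
      exact congrArg Sum.inl (Quot.sound (.rightVertical i.rev i'.rev (by omega) (by omega)
        (by omega))) }

end

end Gluing

/-! ### The saddle moves as a permutation -/

section Saddles

variable {n s m : ℕ} {T₂ : FlatTangle s m} {T₁ : FlatTangle n s} {T : FlatTangle n m}
  {place : T.Piece → T₂.Piece ⊕ T₁.Piece} {c : Diagram m} {d : Diagram s} {b : Diagram n}

/-- The point of `b` at the level of a closing arc of `c` that is removed by a saddle. -/
def saddleLower (i : {i : Fin (2 * m) // i.val + (s - d.k) < m - c.k ∧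
    m - c.k ≤ i.val + (n - b.k)}) : Fin (2 * n) :=
  ⟨i.1.val + (n - b.k) - (m - c.k), by have := i.2; omega⟩

/-- The foot of a saddle in `W(c) T₂ d`. -/
def foot₂ : Saddle c d b → Vertex T₂ ⊕ Vertex T₁
  | .inl i => .inl (.lower (if d.colour i.1 = true then d.arc i.1 else i.1))
  | .inr i => .inl (.upper (if c.colour i.1 = true then i.1.rev else i.1))

/-- The foot of a saddle in `W(d) T₁ b`. -/
def foot₁ : Saddle c d b → Vertex T₂ ⊕ Vertex T₁
  | .inl i => .inr (.upper (if d.colour i.1 = true then i.1 else d.arc i.1))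
  | .inr i => .inr (.lower (if c.colour i.1 = true then saddleLower i else (saddleLower i).rev))

/-- The points at which a saddle is attached. -/
def IsFoot (c : Diagram m) (d : Diagram s) (b : Diagram n) : Vertex T₂ ⊕ Vertex T₁ → Prop
  | .inl (.lower i) => d.colour i ≠ true
  | .inr (.upper i) => d.colour i = true
  | .inl (.upper i) => c.colour i ≠ true ∧
      ((i.val + (s - d.k) < m - c.k ∧ m - c.k ≤ i.val + (n - b.k)) ∨
        (i.rev.val + (s - d.k) < m - c.k ∧ m - c.k ≤ i.rev.val + (n - b.k)))
  | .inr (.lower i) => b.colour i = true ∧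
      ((i.val + (s - d.k) < n - b.k ∧ n - b.k ≤ i.val + (m - c.k)) ∨
        (i.rev.val + (s - d.k) < n - b.k ∧ n - b.k ≤ i.rev.val + (m - c.k)))
  | .inl (.strand _) => False
  | .inr (.strand _) => False

theorem colour_rev {b : Diagram n} (i : Fin (2 * n)) : b.colour i.rev = !b.colour i :=
  colour_add_odd (by rw [Fin.val_rev]; omega)

theorem colour_saddleLower (hcd : c.Compatible d) (hdb : d.Compatible b)
    (i : {i : Fin (2 * m) // i.val + (s - d.k) < m - c.k ∧ m - c.k ≤ i.val + (n - b.k)}) :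
    b.colour (saddleLower i) = c.colour i.1 := by
  have hi := i.2
  refine colour_vertical (hcd.trans hdb) (.inl ?_)
  change _ = (m - c.k) + (i.1.val + (n - b.k) - (m - c.k))
  omega

theorem bool_cases (x : Bool) : x = true ∨ x ≠ true := by cases x <;> simp

theorem eq_arc_of_mem {i i' : Fin (2 * s)} (hi : i < d.arc i) (hi' : i' < d.arc i')
    (h : i = i' ∨ i = d.arc i') : i = i' := by
  rcases h with h | h
  · exact h
  · rw [h, d.arc_arc] at hi
    exact absurd hi hi'.asymm

theorem isFoot_foot₂ (x : Saddle c d b) :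
    IsFoot c d b (foot₂ (T₂ := T₂) (T₁ := T₁) x) := by
  rcases x with i | i
  · change d.colour _ ≠ true
    split_ifs with h
    · rw [d.colour_arc, h]
      simp
    · exact h
  · have := i.2
    change c.colour _ ≠ true ∧ _
    split_ifs with h
    · refine ⟨by rw [colour_rev, h]; simp, .inr ?_⟩
      rw [Fin.rev_rev]
      exact this
    · exact ⟨h, .inl this⟩

theorem isFoot_foot₁ (hcd : c.Compatible d) (hdb : d.Compatible b) (x : Saddle c d b) :
    IsFoot c d b (foot₁ (T₂ := T₂) (T₁ := T₁) x) := by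
  rcases x with i | i
  · change d.colour _ = true
    split_ifs with h
    · exact h
    · rw [d.colour_arc]
      simpa using h
  · have hi := i.2
    have hv : (saddleLower i).val = i.1.val + (n - b.k) - (m - c.k) := rfl
    have hcol := colour_saddleLower hcd hdb i
    change b.colour _ = true ∧ _
    split_ifs with h
    · exact ⟨by rw [hcol, h], .inl (by omega)⟩
    · refine ⟨by rw [colour_rev, hcol]; simpa using h, .inr ?_⟩
      rw [Fin.rev_rev]
      omega

/-- The feet are the points from which the orientation enters an arc that a saddle removes;
therefore they are recognized by their colours, and, for closing arcs, by their levels. -/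
theorem exists_foot (hcd : c.Compatible d) (hdb : d.Compatible b) (x : Vertex T₂ ⊕ Vertex T₁)
    (hx : IsFoot c d b x) : ∃ y : Saddle c d b, x = foot₂ y ∨ x = foot₁ y := by
  have key : ∀ i, ∃ i' : {i : Fin (2 * s) // i < d.arc i}, i = i'.1 ∨ i = d.arc i'.1 := by
    intro i
    rcases lt_trichotomy i (d.arc i) with h | h | h
    · exact ⟨⟨i, h⟩, .inl rfl⟩
    · exact (d.arc_ne i h.symm).elim
    · exact ⟨⟨d.arc i, by rwa [d.arc_arc]⟩, .inr (d.arc_arc i).symm⟩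
  rcases x with (i | v | i) | (i | v | i)
  · obtain ⟨h1, h2 | h2⟩ := hx
    · refine ⟨.inr ⟨i, h2⟩, .inl ?_⟩
      simp [foot₂, h1]
    · refine ⟨.inr ⟨i.rev, h2⟩, .inl ?_⟩
      have : c.colour i.rev = true := by rw [colour_rev]; simpa using h1
      simp [foot₂, this]
  · exact hx.elim
  · obtain ⟨i', rfl | rfl⟩ := key i
    · refine ⟨.inl i', .inl ?_⟩
      have : d.colour i'.1 ≠ true := hx
      simp [foot₂, this]
    · refine ⟨.inl i', .inl ?_⟩
      have : d.colour (d.arc i'.1) ≠ true := hx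
      rw [d.colour_arc] at this
      have : d.colour i'.1 = true := by simpa using this
      simp [foot₂, this]
  · obtain ⟨i', rfl | rfl⟩ := key i
    · refine ⟨.inl i', .inr ?_⟩
      have : d.colour i'.1 = true := hx
      simp [foot₁, this]
    · refine ⟨.inl i', .inr ?_⟩
      have : d.colour (d.arc i'.1) = true := hx
      rw [d.colour_arc] at this
      have : d.colour i'.1 ≠ true := by simpa using this
      simp [foot₁, this]
  · exact hx.elim
  · obtain ⟨h1, h2⟩ := hx
    have main : ∀ i' : Fin (2 * n), i'.val + (s - d.k) < n - b.k → n - b.k ≤ i'.val + (m - c.k) →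
        ∃ y : {i : Fin (2 * m) // i.val + (s - d.k) < m - c.k ∧ m - c.k ≤ i.val + (n - b.k)},
          saddleLower y = i' := by
      intro i' h3 h4
      refine ⟨⟨⟨i'.val + (m - c.k) - (n - b.k), by omega⟩, ?_⟩, Fin.ext ?_⟩
      · change i'.val + (m - c.k) - (n - b.k) + _ < _ ∧ _ ≤ i'.val + (m - c.k) - (n - b.k) + _
        omega
      · change i'.val + (m - c.k) - (n - b.k) + (n - b.k) - (m - c.k) = _
        omega
    rcases h2 with ⟨h3, h4⟩ | ⟨h3, h4⟩
    · obtain ⟨y, rfl⟩ := main i h3 h4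
      refine ⟨.inr y, .inr ?_⟩
      rw [colour_saddleLower hcd hdb] at h1
      simp [foot₁, h1]
    · obtain ⟨y, hy⟩ := main i.rev h3 h4
      have hcol := colour_saddleLower hcd hdb y
      rw [hy, colour_rev, h1] at hcol
      refine ⟨.inr y, .inr ?_⟩
      simp [foot₁, ← hcol, hy]

theorem foot_injective : Function.Injective
    (Sum.elim (foot₂ (T₂ := T₂) (T₁ := T₁) (c := c) (d := d) (b := b))
      (foot₁ (T₂ := T₂) (T₁ := T₁) (c := c) (d := d) (b := b))) := by
  have h2 : ∀ i i' : {i : Fin (2 * s) // i < d.arc i},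
      (if d.colour i.1 = true then d.arc i.1 else i.1) =
        (if d.colour i'.1 = true then d.arc i'.1 else i'.1) → i = i' := by
    intro i i' h
    refine Subtype.ext (eq_arc_of_mem i.2 i'.2 ?_)
    split_ifs at h
    · exact .inl (by rw [← d.arc_arc i.1, h, d.arc_arc])
    · exact .inr (by rw [← d.arc_arc i.1, h])
    · exact .inr h
    · exact .inl h
  have h1 : ∀ i i' : {i : Fin (2 * s) // i < d.arc i},
      (if d.colour i.1 = true then i.1 else d.arc i.1) =
        (if d.colour i'.1 = true then i'.1 else d.arc i'.1) → i = i' := by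
    intro i i' h
    refine Subtype.ext (eq_arc_of_mem i.2 i'.2 ?_)
    split_ifs at h
    · exact .inl h
    · exact .inr h
    · exact .inr (by rw [← d.arc_arc i.1, h])
    · exact .inl (by rw [← d.arc_arc i.1, h, d.arc_arc])
  have h3 : ∀ (k : ℕ) (i i' : Fin (2 * k)) (p p' : Prop) [Decidable p] [Decidable p'],
      i.val < k → i'.val < k →
      (if p then i.rev else i) = (if p' then i'.rev else i') → i = i' := by
    intro k i i' p p' _ _ hi hi' h
    have e1 := Fin.val_rev i
    have e2 := Fin.val_rev i'
    have := congrArg Fin.val h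
    refine Fin.ext ?_
    split_ifs at this <;> omega
  rintro ((i | i) | (i | i)) ((i' | i') | (i' | i')) h
  · exact congrArg (fun x => Sum.inl (Sum.inl x)) (h2 i i' (Vertex.lower.inj (Sum.inl.inj h)))
  · exact nomatch Sum.inl.inj h
  · exact nomatch h
  · exact nomatch h
  · exact nomatch Sum.inl.inj h
  · have := h3 m i.1 i'.1 _ _ (by have := i.2; omega) (by have := i'.2; omega)
      (Vertex.upper.inj (Sum.inl.inj h))
    exact congrArg (fun x => Sum.inl (Sum.inr x)) (Subtype.ext this)
  · exact nomatch h
  · exact nomatch h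
  · exact nomatch h
  · exact nomatch h
  · exact congrArg (fun x => Sum.inr (Sum.inl x)) (h1 i i' (Vertex.upper.inj (Sum.inr.inj h)))
  · exact nomatch Sum.inr.inj h
  · exact nomatch h
  · exact nomatch h
  · exact nomatch Sum.inr.inj h
  · have hi := i.2
    have hi' := i'.2
    have e1 : (saddleLower i).val = i.1.val + (n - b.k) - (m - c.k) := rfl
    have e2 : (saddleLower i').val = i'.1.val + (n - b.k) - (m - c.k) := rfl
    have h' : (if ¬ c.colour i.1 = true then (saddleLower i).rev else saddleLower i) =
        (if ¬ c.colour i'.1 = true then (saddleLower i').rev else saddleLower i') := by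
      rw [ite_not, ite_not]
      exact Vertex.lower.inj (Sum.inr.inj h)
    have := congrArg Fin.val (h3 n (saddleLower i) (saddleLower i') _ _ (by omega) (by omega) h')
    exact congrArg (fun x => Sum.inr (Sum.inr x)) (Subtype.ext (Fin.ext (by omega)))

instance : Finite (Saddle c d b) := inferInstanceAs (Finite (_ ⊕ _))

instance : Finite (ExtraCircle c d b) := inferInstanceAs (Finite (Subtype _))

theorem exists_swap (hcd : c.Compatible d) (hdb : d.Compatible b) :
    ∃ σ : Equiv.Perm (Vertex T₂ ⊕ Vertex T₁),
      (∀ x : Saddle c d b, σ (foot₂ x) = foot₁ x ∧ σ (foot₁ x) = foot₂ x) ∧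
      ∀ x, ¬ IsFoot c d b x → σ x = x := by
  classical
  let ι : Saddle c d b ⊕ Saddle c d b ↪ Vertex T₂ ⊕ Vertex T₁ :=
    ⟨Sum.elim foot₂ foot₁, foot_injective⟩
  refine ⟨Equiv.Perm.viaEmbedding (Equiv.sumComm _ _) ι, fun x => ⟨?_, ?_⟩, fun x hx => ?_⟩
  · exact Equiv.Perm.viaEmbedding_apply (Equiv.sumComm _ _) ι (.inl x)
  · exact Equiv.Perm.viaEmbedding_apply (Equiv.sumComm _ _) ι (.inr x)
  · refine Equiv.Perm.viaEmbedding_apply_of_notMem _ ι x ?_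
    rintro ⟨y | y, rfl⟩
    · exact hx (isFoot_foot₂ y)
    · exact hx (isFoot_foot₁ hcd hdb y)

variable (T₂ T₁) in
/-- The exchange of the feet of the saddles. -/
noncomputable def footSwap (hcd : c.Compatible d) (hdb : d.Compatible b) :
    Equiv.Perm (Vertex T₂ ⊕ Vertex T₁) :=
  (exists_swap hcd hdb).choose

variable (T₂ T₁) in
/-- The orientation before the saddle moves. -/
noncomputable def inPerm (hcd : c.Compatible d) (hdb : d.Compatible b) :
    Equiv.Perm (Vertex T₂ ⊕ Vertex T₁) :=
  Equiv.sumCongr (rho T₂ hcd) (rho T₁ hdb)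

variable (T₂ T₁) in
/-- The orientation after the saddle moves. -/
noncomputable def outPerm (hcd : c.Compatible d) (hdb : d.Compatible b) :
    Equiv.Perm (Vertex T₂ ⊕ Vertex T₁) :=
  inPerm T₂ T₁ hcd hdb * footSwap T₂ T₁ hcd hdb

section

variable (hcd : c.Compatible d) (hdb : d.Compatible b)

theorem outPerm_foot₂ (x : Saddle c d b) :
    outPerm T₂ T₁ hcd hdb (foot₂ x) = inPerm T₂ T₁ hcd hdb (foot₁ x) :=
  congrArg (inPerm T₂ T₁ hcd hdb) ((exists_swap hcd hdb).choose_spec.1 x).1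

theorem outPerm_foot₁ (x : Saddle c d b) :
    outPerm T₂ T₁ hcd hdb (foot₁ x) = inPerm T₂ T₁ hcd hdb (foot₂ x) :=
  congrArg (inPerm T₂ T₁ hcd hdb) ((exists_swap hcd hdb).choose_spec.1 x).2

theorem outPerm_other (x : Vertex T₂ ⊕ Vertex T₁) (hx : ¬ IsFoot c d b x) :
    outPerm T₂ T₁ hcd hdb x = inPerm T₂ T₁ hcd hdb x :=
  congrArg (inPerm T₂ T₁ hcd hdb) ((exists_swap hcd hdb).choose_spec.2 x hx)

/-- The image has the same position as `foot₂`. So exchanging the feet of the saddle before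
following the orientation replaces an arc of `d` and its mirror image by two vertical lines. -/
theorem rho_foot₁_arc (i : {i : Fin (2 * s) // i < d.arc i}) :
    inPerm T₂ T₁ hcd hdb (foot₁ (c := c) (b := b) (.inl i)) =
      .inr (.upper (if d.colour i.1 = true then d.arc i.1 else i.1)) := by
  refine congrArg Sum.inr ((rho_iff hdb _ _).1 ?_)
  split_ifs with h
  · exact .upperArc _ h
  · have := Dir.upperArc (p := true) (T := T₁) (b := b) (d.arc i.1)
      (by rw [d.colour_arc]; simpa using h)
    rwa [d.arc_arc] at this

theorem rho_foot₂_arc (i : {i : Fin (2 * s) // i < d.arc i}) :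
    inPerm T₂ T₁ hcd hdb (foot₂ (c := c) (b := b) (.inl i)) =
      .inl (.lower (if d.colour i.1 = true then i.1 else d.arc i.1)) := by
  refine congrArg Sum.inl ((rho_iff hcd _ _).1 ?_)
  split_ifs with h
  · have := Dir.lowerArc (p := true) (T := T₂) (c := c) (d.arc i.1)
      (by rw [d.colour_arc, h]; simp)
    rwa [d.arc_arc] at this
  · exact .lowerArc _ h

theorem rho_foot₂_level (i : {i : Fin (2 * m) // i.val + (s - d.k) < m - c.k ∧
    m - c.k ≤ i.val + (n - b.k)}) :
    inPerm T₂ T₁ hcd hdb (foot₂ (c := c) (b := b) (.inr i)) =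
      .inl (.upper (if c.colour i.1 = true then i.1 else i.1.rev)) := by
  refine congrArg Sum.inl ((rho_iff hcd _ _).1 ?_)
  have := Fin.val_rev i.1
  split_ifs with h
  · exact .upperExtra _ _ (.inr i.2.1) (by omega) (by rw [colour_rev, h]; simp)
  · exact .upperExtra _ _ (.inl i.2.1) (by omega) h

theorem rho_foot₁_level (i : {i : Fin (2 * m) // i.val + (s - d.k) < m - c.k ∧
    m - c.k ≤ i.val + (n - b.k)}) :
    inPerm T₂ T₁ hcd hdb (foot₁ (c := c) (b := b) (.inr i)) =
      .inr (.lower (if c.colour i.1 = true then (saddleLower i).rev else saddleLower i)) := by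
  refine congrArg Sum.inr ((rho_iff hdb _ _).1 ?_)
  have hi := i.2
  have := Fin.val_rev (saddleLower i)
  have hv : (saddleLower i).val = i.1.val + (n - b.k) - (m - c.k) := rfl
  have hcol := colour_saddleLower hcd hdb i
  split_ifs with h
  · exact .lowerExtra _ _ (.inl (by omega)) (by omega) (by rw [hcol, h])
  · exact .lowerExtra _ _ (.inr (by omega)) (by omega) (by rw [colour_rev, hcol]; simpa using h)

/-- A map that respects the connections after the saddle moves is constant along the new
orientation. -/
theorem Respects.outPerm {X : Type} {f : Vertex T₂ ⊕ Vertex T₁ → X} (h : Respects c d b f)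
    (x : Vertex T₂ ⊕ Vertex T₁) : f (outPerm T₂ T₁ hcd hdb x) = f x := by
  have hc := c.k_le
  have hd := d.k_le
  have hb := b.k_le
  have hcd' := hcd
  have hdb' := hdb
  unfold Diagram.Compatible at hcd' hdb'
  have hsad : ∀ i : {i : Fin (2 * m) // i.val + (s - d.k) < m - c.k ∧
      m - c.k ≤ i.val + (n - b.k)},
      f (.inr (.lower (saddleLower i))) = f (.inl (.upper i.1)) ∧
      f (.inr (.lower (saddleLower i).rev)) = f (.inl (.upper i.1.rev)) := by
    intro i
    have hi := i.2
    have hv : (saddleLower i).val = i.1.val + (n - b.k) - (m - c.k) := rfl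
    exact ⟨h.leftSaddle _ _ (by omega) (by omega) (by omega) (by omega),
      h.rightSaddle _ _ (by omega) (by omega) (by omega) (by omega)⟩
  by_cases hx : IsFoot c d b x
  · obtain ⟨y, rfl | rfl⟩ := exists_foot hcd hdb x hx
    · rw [outPerm_foot₂]
      rcases y with i | i
      · rw [rho_foot₁_arc]
        exact (h.glue _).symm
      · rw [rho_foot₁_level]
        have := hsad i
        change _ = f (.inl (.upper _))
        split_ifs
        · exact this.2
        · exact this.1
    · rw [outPerm_foot₁]
      rcases y with i | i
      · rw [rho_foot₂_arc]
        exact h.glue _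
      · rw [rho_foot₂_level]
        have := hsad i
        change _ = f (.inr (.lower _))
        split_ifs
        · exact this.1.symm
        · exact this.2.symm
  · rw [outPerm_other hcd hdb x hx]
    rcases x with x | x
    · change f (.inl (rho T₂ hcd x)) = _
      have hdir := (rho_iff hcd x _).2 rfl
      generalize rho T₂ hcd x = y at hdir
      cases hdir with
      | lowerArc i hi => exact (hx hi).elim
      | upperArc i hi => exact (h.upperArc i).symm
      | tangle u v huv => exact huv.joined.elim (fun e => (h.joined₂ _ _ e).symm) (h.joined₂ _ _)
      | botUp i j hij hp => exact (h.bot₂ i j hij).symm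
      | botDown i j hij hp => exact h.bot₂ i j hij
      | topUp i j hij hp => exact h.top₂ i j hij
      | topDown i j hij hp => exact (h.top₂ i j hij).symm
      | leftUp i i' hi hi' hii hp => exact (h.left₂ i i' hi hi' hii).symm
      | leftDown i i' hi hi' hii hp => exact h.left₂ i i' hi hi' hii
      | rightUp i i' hi hi' hii hp => exact (h.right₂ i i' hi hi' hii).symm
      | rightDown i i' hi hi' hii hp => exact h.right₂ i i' hi hi' hii
      | lowerExtra i j hi hij hp =>
        obtain rfl := eq_rev hij
        rcases hi with hi | hi
        · exact (h.lowerExtra₂ i hi).symm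
        · have := h.lowerExtra₂ _ hi
          rwa [Fin.rev_rev] at this
      | upperExtra i j hi hij hp =>
        obtain rfl := eq_rev hij
        rcases hi with hi | hi
        · exact (h.upperExtra₂ i hi (by
            by_contra hlev
            exact hx ⟨hp, .inl ⟨hi, by omega⟩⟩)).symm
        · have := h.upperExtra₂ _ hi (by
            by_contra hlev
            exact hx ⟨hp, .inr ⟨hi, by omega⟩⟩)
          rwa [Fin.rev_rev] at this
    · change f (.inr (rho T₁ hdb x)) = _
      have hdir := (rho_iff hdb x _).2 rfl
      generalize rho T₁ hdb x = y at hdir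
      cases hdir with
      | lowerArc i hi => exact (h.lowerArc i).symm
      | upperArc i hi => exact (hx hi).elim
      | tangle u v huv => exact huv.joined.elim (fun e => (h.joined₁ _ _ e).symm) (h.joined₁ _ _)
      | botUp i j hij hp => exact (h.bot₁ i j hij).symm
      | botDown i j hij hp => exact h.bot₁ i j hij
      | topUp i j hij hp => exact h.top₁ i j hij
      | topDown i j hij hp => exact (h.top₁ i j hij).symm
      | leftUp i i' hi hi' hii hp => exact (h.left₁ i i' hi hi' hii).symm
      | leftDown i i' hi hi' hii hp => exact h.left₁ i i' hi hi' hii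
      | rightUp i i' hi hi' hii hp => exact (h.right₁ i i' hi hi' hii).symm
      | rightDown i i' hi hi' hii hp => exact h.right₁ i i' hi hi' hii
      | lowerExtra i j hi hij hp =>
        obtain rfl := eq_rev hij
        rcases hi with hi | hi
        · exact (h.lowerExtra₁ i hi (by
            by_contra hlev
            exact hx ⟨hp, .inl ⟨hi, by omega⟩⟩)).symm
        · have := h.lowerExtra₁ _ hi (by
            by_contra hlev
            exact hx ⟨hp, .inr ⟨hi, by omega⟩⟩)
          rwa [Fin.rev_rev] at this
      | upperExtra i j hi hij hp =>
        obtain rfl := eq_rev hij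
        rcases hi with hi | hi
        · exact (h.upperExtra₁ i hi).symm
        · have := h.upperExtra₁ _ hi
          rwa [Fin.rev_rev] at this

theorem mk_outPerm (x : Vertex T₂ ⊕ Vertex T₁) :
    Cyc.mk (outPerm T₂ T₁ hcd hdb) (outPerm T₂ T₁ hcd hdb x) = Cyc.mk _ x :=
  Cyc.mk_eq_iff.2 (Equiv.Perm.SameCycle.symm ⟨1, rfl⟩)

theorem mk_of_dir₂ {x y : Vertex T₂} (h : Dir true c T₂ d x y) 
    (hx : ¬ IsFoot c d b (.inl x : Vertex T₂ ⊕ Vertex T₁)) :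
    Cyc.mk (outPerm T₂ T₁ hcd hdb) (.inl x) = Cyc.mk _ (.inl y) := by
  rw [← mk_outPerm hcd hdb (.inl x), outPerm_other hcd hdb _ hx, ← (rho_iff hcd x y).1 h]
  rfl

theorem mk_of_dir₁ {x y : Vertex T₁} (h : Dir true d T₁ b x y) 
    (hx : ¬ IsFoot c d b (.inr x : Vertex T₂ ⊕ Vertex T₁)) :
    Cyc.mk (outPerm T₂ T₁ hcd hdb) (.inr x) = Cyc.mk _ (.inr y) := by
  rw [← mk_outPerm hcd hdb (.inr x), outPerm_other hcd hdb _ hx, ← (rho_iff hdb x y).1 h]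
  rfl

theorem mk_foot₂ (x : Saddle c d b) {y : Vertex T₂ ⊕ Vertex T₁}
    (h : inPerm T₂ T₁ hcd hdb (foot₁ x) = y) :
    Cyc.mk (outPerm T₂ T₁ hcd hdb) (foot₂ x) = Cyc.mk _ y := by
  rw [← mk_outPerm hcd hdb (foot₂ x), outPerm_foot₂, h]

theorem mk_foot₁ (x : Saddle c d b) {y : Vertex T₂ ⊕ Vertex T₁}
    (h : inPerm T₂ T₁ hcd hdb (foot₂ x) = y) :
    Cyc.mk (outPerm T₂ T₁ hcd hdb) (foot₁ x) = Cyc.mk _ y := by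
  rw [← mk_outPerm hcd hdb (foot₁ x), outPerm_foot₁, h]

/-- The cycles of the new orientation respect the connections after the saddle moves. -/
theorem mk_outPerm_respects : Respects c d b (Cyc.mk (outPerm T₂ T₁ hcd hdb)) := by
  have hc := c.k_le
  have hd := d.k_le
  have hb := b.k_le
  have hcd' := hcd
  have hdb' := hdb
  unfold Diagram.Compatible at hcd' hdb'
  have hsad : ∀ i : {i : Fin (2 * m) // i.val + (s - d.k) < m - c.k ∧
      m - c.k ≤ i.val + (n - b.k)},
      Cyc.mk (outPerm T₂ T₁ hcd hdb) (.inr (.lower (saddleLower i))) =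
        Cyc.mk _ (.inl (.upper i.1)) ∧
      Cyc.mk (outPerm T₂ T₁ hcd hdb) (.inr (.lower (saddleLower i).rev)) =
        Cyc.mk _ (.inl (.upper i.1.rev)) := by
    intro i
    have e2 := mk_foot₂ (T₂ := T₂) (T₁ := T₁) hcd hdb (.inr i) (rho_foot₁_level hcd hdb i)
    have e1 := mk_foot₁ (T₂ := T₂) (T₁ := T₁) hcd hdb (.inr i) (rho_foot₂_level hcd hdb i)
    unfold foot₂ at e2
    unfold foot₁ at e1
    by_cases h : c.colour i.1 = true
    · simp only [h, if_true] at e1 e2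
      exact ⟨e1, e2.symm⟩
    · simp only [h] at e1 e2
      exact ⟨e2.symm, e1⟩
  exact
  { upperArc := fun i => by
      rcases bool_cases (c.colour i) with h | h
      · exact mk_of_dir₂ hcd hdb (.upperArc i h) fun hx => hx.1 h
      · have h' : c.colour (c.arc i) = true := by rw [c.colour_arc]; simpa using h
        have := mk_of_dir₂ (T₁ := T₁) hcd hdb (.upperArc (T := T₂) (c.arc i) h') fun hx => hx.1 h'
        rw [c.arc_arc] at this
        exact this.symm
    lowerArc := fun i => by
      rcases bool_cases (b.colour i) with h | h
      · have h' : b.colour (b.arc i) ≠ true := by rw [b.colour_arc, h]; simp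
        have := mk_of_dir₁ (T₂ := T₂) hcd hdb (.lowerArc (T := T₁) (b.arc i) h') fun hx => h' hx.1
        rw [b.arc_arc] at this
        exact this.symm
      · exact mk_of_dir₁ hcd hdb (.lowerArc i h) fun hx => h hx.1
    joined₂ := fun u v h => h.flow.elim
      (fun h => mk_of_dir₂ hcd hdb (.tangle _ _ h) fun hx => hx.elim)
      fun h => (mk_of_dir₂ hcd hdb (.tangle _ _ h) fun hx => hx.elim).symm
    joined₁ := fun u v h => h.flow.elim
      (fun h => mk_of_dir₁ hcd hdb (.tangle _ _ h) fun hx => hx.elim)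
      fun h => (mk_of_dir₁ hcd hdb (.tangle _ _ h) fun hx => hx.elim).symm
    top₂ := fun i j h => by
      have e := Fin.val_rev i
      rcases bool_cases (decide (Even j.val)) with hp | hp
      · exact (mk_of_dir₂ hcd hdb (.topUp i j h hp) fun hx => hx.elim).symm
      · refine mk_of_dir₂ hcd hdb (.topDown i j h hp) ?_
        rintro ⟨-, hx | hx⟩ <;> omega
    bot₂ := fun i j h => by
      rcases bool_cases (decide (Even j.val)) with hp | hp
      · exact mk_of_dir₂ hcd hdb (.botUp i j h hp) fun hx => hx (by rw [colour_free h, hp])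
      · exact (mk_of_dir₂ hcd hdb (.botDown i j h hp) fun hx => hx.elim).symm
    top₁ := fun i j h => by
      rcases bool_cases (decide (Even j.val)) with hp | hp
      · exact (mk_of_dir₁ hcd hdb (.topUp i j h hp) fun hx => hx.elim).symm
      · exact mk_of_dir₁ hcd hdb (.topDown i j h hp) fun hx => hp (by rw [← colour_free h]; exact hx)
    bot₁ := fun i j h => by
      have e := Fin.val_rev i
      rcases bool_cases (decide (Even j.val)) with hp | hp
      · refine mk_of_dir₁ hcd hdb (.botUp i j h hp) ?_
        rintro ⟨-, hx | hx⟩ <;> omega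
      · exact (mk_of_dir₁ hcd hdb (.botDown i j h hp) fun hx => hx.elim).symm
    left₂ := fun i i' hi hi' h => by
      have e := Fin.val_rev i'
      rcases bool_cases (d.colour i) with hp | hp
      · exact mk_of_dir₂ hcd hdb (.leftUp i i' hi hi' h hp) fun hx => hx hp
      · refine (mk_of_dir₂ hcd hdb (.leftDown i i' hi hi' h hp) ?_).symm
        rintro ⟨-, hx | hx⟩ <;> omega
    right₂ := fun i i' hi hi' h => by
      have e := Fin.val_rev i'
      rcases bool_cases (d.colour i) with hp | hp
      · exact mk_of_dir₂ hcd hdb (.rightUp i i' hi hi' h hp) fun hx => hx hp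
      · refine (mk_of_dir₂ hcd hdb (.rightDown i i' hi hi' h hp) ?_).symm
        rintro ⟨-, hx | hx⟩ <;> omega
    left₁ := fun i i' hi hi' h => by
      have e := Fin.val_rev i
      have hcol := colour_vertical hdb (.inl h)
      rcases bool_cases (b.colour i) with hp | hp
      · refine mk_of_dir₁ hcd hdb (.leftUp i i' hi hi' h hp) ?_
        rintro ⟨-, hx | hx⟩ <;> omega
      · exact (mk_of_dir₁ hcd hdb (.leftDown i i' hi hi' h hp) fun hx => hp (hcol.trans hx)).symm
    right₁ := fun i i' hi hi' h => by
      have e := Fin.val_rev i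
      have hcol := colour_vertical hdb (.inr h)
      rcases bool_cases (b.colour i) with hp | hp
      · refine mk_of_dir₁ hcd hdb (.rightUp i i' hi hi' h hp) ?_
        rintro ⟨-, hx | hx⟩ <;> omega
      · exact (mk_of_dir₁ hcd hdb (.rightDown i i' hi hi' h hp) fun hx => hp (hcol.trans hx)).symm
    lowerExtra₂ := fun i h => by
      have e := Fin.val_rev i
      rcases bool_cases (d.colour i) with hp | hp
      · exact mk_of_dir₂ hcd hdb (.lowerExtra i i.rev (.inl h) (by omega) hp) fun hx => hx hp
      · have hp' : d.colour i.rev = true := by rw [colour_rev]; simpa using hp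
        exact (mk_of_dir₂ hcd hdb (.lowerExtra i.rev i (.inr h) (by omega) hp')
          fun hx => hx hp').symm
    upperExtra₂ := fun i h h' => by
      have e := Fin.val_rev i
      rcases bool_cases (c.colour i) with hp | hp
      · have hp' : c.colour i.rev ≠ true := by rw [colour_rev, hp]; simp
        refine (mk_of_dir₂ hcd hdb (.upperExtra i.rev i (.inr h) (by omega) hp') ?_).symm
        rintro ⟨-, hx | hx⟩
        · omega
        · rw [Fin.rev_rev] at hx
          omega
      · refine mk_of_dir₂ hcd hdb (.upperExtra i i.rev (.inl h) (by omega) hp) ?_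
        rintro ⟨-, hx | hx⟩ <;> omega
    lowerExtra₁ := fun i h h' => by
      have e := Fin.val_rev i
      rcases bool_cases (b.colour i) with hp | hp
      · refine mk_of_dir₁ hcd hdb (.lowerExtra i i.rev (.inl h) (by omega) hp) ?_
        rintro ⟨-, hx | hx⟩ <;> omega
      · have hp' : b.colour i.rev = true := by rw [colour_rev]; simpa using hp
        refine (mk_of_dir₁ hcd hdb (.lowerExtra i.rev i (.inr h) (by omega) hp') ?_).symm
        rintro ⟨-, hx | hx⟩
        · omega
        · rw [Fin.rev_rev] at hx
          omega
    upperExtra₁ := fun i h => by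
      have e := Fin.val_rev i
      rcases bool_cases (d.colour i) with hp | hp
      · have hp' : d.colour i.rev ≠ true := by rw [colour_rev, hp]; simp
        exact (mk_of_dir₁ hcd hdb (.upperExtra i.rev i (.inr h) (by omega) hp') hp').symm
      · exact mk_of_dir₁ hcd hdb (.upperExtra i i.rev (.inl h) (by omega) hp) hp
    glue := fun i => by
      have key : ∀ i' : {i : Fin (2 * s) // i < d.arc i},
          Cyc.mk (outPerm T₂ T₁ hcd hdb) (.inl (.lower i'.1)) = Cyc.mk _ (.inr (.upper i'.1)) ∧
          Cyc.mk (outPerm T₂ T₁ hcd hdb) (.inl (.lower (d.arc i'.1))) =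
            Cyc.mk _ (.inr (.upper (d.arc i'.1))) := by
        intro i'
        have e2 := mk_foot₂ (T₂ := T₂) (T₁ := T₁) hcd hdb (.inl i') (rho_foot₁_arc hcd hdb i')
        have e1 := mk_foot₁ (T₂ := T₂) (T₁ := T₁) hcd hdb (.inl i') (rho_foot₂_arc hcd hdb i')
        unfold foot₂ at e2
        unfold foot₁ at e1
        by_cases h : d.colour i'.1 = true
        · simp only [h, if_true] at e1 e2
          exact ⟨e1.symm, e2⟩
        · simp only [h] at e1 e2
          exact ⟨e2, e1.symm⟩
      rcases lt_trichotomy i (d.arc i) with h | h | h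
      · exact (key ⟨i, h⟩).1
      · exact (d.arc_ne i h.symm).elim
      · have := (key ⟨d.arc i, by rwa [d.arc_arc]⟩).2
        simpa only [d.arc_arc] using this
    leftSaddle := fun i i' hi hi' h hlev => by
      have := (hsad ⟨i', hlev, by omega⟩).1
      have hv : saddleLower (⟨i', hlev, by omega⟩ : {i : Fin (2 * m) //
          i.val + (s - d.k) < m - c.k ∧ m - c.k ≤ i.val + (n - b.k)}) = i :=
        Fin.ext (by simp only [saddleLower]; omega)
      rwa [hv] at this
    rightSaddle := fun i i' hi hi' h hlev => by
      have := (hsad ⟨i', hlev, by omega⟩).2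
      have hv : saddleLower (⟨i', hlev, by omega⟩ : {i : Fin (2 * m) //
          i.val + (s - d.k) < m - c.k ∧ m - c.k ≤ i.val + (n - b.k)}) = i :=
        Fin.ext (by simp only [saddleLower]; omega)
      rwa [hv] at this }

/-! ### Euler characteristics of cobordisms -/

/-- The incoming circles are the cycles of the old orientation. -/
noncomputable def inEquiv : Cyc (inPerm T₂ T₁ hcd hdb) ≃ Circle c T₂ d ⊕ Circle d T₁ b where
  toFun := Cyc.lift _ (Sum.map (circleOf c T₂ d) (circleOf d T₁ b)) (by
    rintro (x | x)
    · exact congrArg Sum.inl (circleOf_rho hcd x)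
    · exact congrArg Sum.inr (circleOf_rho hdb x))
  invFun := Sum.elim
    (Quot.lift (fun x => Cyc.mk _ (.inl x)) fun u v h => Cyc.mk_eq_iff.2 ((h.rho hcd).elim
      (fun e => ⟨1, congrArg Sum.inl e⟩)
      fun e => Equiv.Perm.SameCycle.symm ⟨1, congrArg Sum.inl e⟩))
    (Quot.lift (fun x => Cyc.mk _ (.inr x)) fun u v h => Cyc.mk_eq_iff.2 ((h.rho hdb).elim
      (fun e => ⟨1, congrArg Sum.inr e⟩)
      fun e => Equiv.Perm.SameCycle.symm ⟨1, congrArg Sum.inr e⟩))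
  left_inv z := by
    obtain ⟨x | x, rfl⟩ := Cyc.mk_surjective _ z <;> rfl
  right_inv z := by
    rcases z with z | z <;> obtain ⟨x, rfl⟩ := Quot.mk_surjective z <;> rfl

/-- For a platform point of `d`, `outMap` selects the circle through a point of `c` or `b` at the
same level, or an extra circle. The selected circle is reached by connections of the surgered
picture, and these stay within one cycle of the new orientation. -/
theorem out_left_inv (G : Gluing T₂ T₁ T place) (x : Vertex T₂ ⊕ Vertex T₁) :
    Sum.elim (Quot.lift (fun x => Cyc.mk (outPerm T₂ T₁ hcd hdb) (placeVertex place x))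
      fun _ _ h => (mk_outPerm_respects hcd hdb).out G hcd hdb h)
      (fun e : ExtraCircle c d b => Cyc.mk _ (.inl (.lower e.1))) (outMap G hcd hdb x) =
    Cyc.mk (outPerm T₂ T₁ hcd hdb) x := by
  have hc := c.k_le
  have hd := d.k_le
  have hb := b.k_le
  have hcd' := hcd
  have hdb' := hdb
  unfold Diagram.Compatible at hcd' hdb'
  have hR := mk_outPerm_respects (T₂ := T₂) (T₁ := T₁) hcd hdb
  have hmid : ∀ i : Fin (2 * s),
      Sum.elim (Quot.lift (fun x => Cyc.mk (outPerm T₂ T₁ hcd hdb) (placeVertex place x))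
        fun _ _ h => hR.out G hcd hdb h)
        (fun e : ExtraCircle c d b => Cyc.mk _ (.inl (.lower e.1))) (midCircle G hcd hdb i) =
      Cyc.mk (outPerm T₂ T₁ hcd hdb) (.inl (.lower i)) := by
    intro i
    have e1 := Fin.val_rev i
    rcases Nat.lt_or_ge i.val (s - d.k) with h | h
    · by_cases h1 : s - d.k ≤ i.val + (m - c.k)
      · let x : Fin (2 * m) := ⟨i.val + (m - c.k) - (s - d.k), by omega⟩
        have hx : x.val = i.val + (m - c.k) - (s - d.k) := rfl
        rw [midCircle_left_c G hcd hdb i x h (by omega)]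
        exact (hR.left₂ i x h (by omega) (by omega)).symm
      · by_cases h2 : s - d.k ≤ i.val + (n - b.k)
        · let x : Fin (2 * n) := ⟨i.val + (n - b.k) - (s - d.k), by omega⟩
          have hx : x.val = i.val + (n - b.k) - (s - d.k) := rfl
          rw [midCircle_left_b G hcd hdb i x h (by omega) (by omega)]
          exact (hR.left₁ x i (by omega) h (by omega)).trans (hR.glue i).symm
        · rw [midCircle_left_extra G hcd hdb ⟨i, by omega, by omega⟩]
          rfl
    · rcases Nat.lt_or_ge i.val (s - d.k + s) with h' | h'
      · let j : Fin s := ⟨i.val - (s - d.k), by omega⟩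
        have hj : j.val = i.val - (s - d.k) := rfl
        rw [midCircle_free G hcd hdb i j (by omega)]
        exact (hR.mid (G.place_q _)).trans (hR.bot₂ i j (by omega)).symm
      · by_cases h1 : s - d.k ≤ i.rev.val + (m - c.k)
        · let x : Fin (2 * m) := ⟨i.rev.val + (m - c.k) - (s - d.k), by omega⟩
          have hx : x.val = i.rev.val + (m - c.k) - (s - d.k) := rfl
          have hx' := Fin.val_rev x
          rw [midCircle_right_c G hcd hdb i x.rev (by omega) (by rw [Fin.rev_rev]; omega)]
          exact (hR.right₂ i x.rev (by omega) (by omega) (by omega)).symm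
        · by_cases h2 : s - d.k ≤ i.rev.val + (n - b.k)
          · let x : Fin (2 * n) := ⟨i.rev.val + (n - b.k) - (s - d.k), by omega⟩
            have hx : x.val = i.rev.val + (n - b.k) - (s - d.k) := rfl
            have hx' := Fin.val_rev x
            rw [midCircle_right_b G hcd hdb i x.rev (by omega) (by omega)
              (by rw [Fin.rev_rev]; omega)]
            exact (hR.right₁ x.rev i (by omega) (by omega) (by omega)).trans (hR.glue i).symm
          · have := midCircle_right_extra G hcd hdb ⟨i.rev, by omega, by omega⟩
            rw [Fin.rev_rev] at this
            rw [this]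
            have := hR.lowerExtra₂ i.rev (by omega)
            rwa [Fin.rev_rev] at this
  rcases x with (i | v | i) | (i | v | i)
  · rfl
  · exact hR.mid (G.place_q _)
  · exact hmid i
  · exact (hmid i).trans (hR.glue i)
  · exact hR.mid (G.place_q _)
  · rfl

/-- The outgoing circles are the cycles of the new orientation. -/
noncomputable def outEquiv (G : Gluing T₂ T₁ T place) :
    Cyc (outPerm T₂ T₁ hcd hdb) ≃ Circle c T b ⊕ ExtraCircle c d b where
  toFun := Cyc.lift _ (outMap G hcd hdb) ((outMap_respects G hcd hdb).outPerm hcd hdb)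
  invFun := Sum.elim (Quot.lift (fun x => Cyc.mk _ (placeVertex place x))
      fun _ _ h => (mk_outPerm_respects hcd hdb).out G hcd hdb h)
    fun e : ExtraCircle c d b => Cyc.mk _ (.inl (.lower e.1))
  left_inv z := by
    obtain ⟨x, rfl⟩ := Cyc.mk_surjective _ z
    exact out_left_inv hcd hdb G x
  right_inv z := by
    rcases z with z | z
    · obtain ⟨x, rfl⟩ := Quot.mk_surjective z
      exact outMap_place G hcd hdb x
    · exact midCircle_left_extra G hcd hdb z

variable (place) in
theorem surfaceOf_foot₂ (x : Saddle c d b) :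
    surfaceOf place c d b (foot₂ x) = saddleSurface place c d b x := by
  rcases x with i | i
  · change surfaceOf place c d b (.inl (.lower _)) = surfaceOf place c d b (.inl (.lower _))
    split_ifs
    · exact (Quot.sound (.above _ _ (.lowerArc i.1))).symm
    · rfl
  · have := Fin.val_rev i.1
    change surfaceOf place c d b (.inl (.upper _)) = surfaceOf place c d b (.inl (.upper _))
    split_ifs
    · exact (Quot.sound (.above _ _ (.upperExtra i.1 i.1.rev i.2.1 (by omega)))).symm
    · rfl

variable (place) in
theorem surfaceOf_foot₁ (x : Saddle c d b) :
    surfaceOf place c d b (foot₁ x) = saddleSurface place c d b x := by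
  rcases x with i | i
  · have hg : ∀ i, surfaceOf place c d b (.inr (.upper i)) = surfaceOf place c d b (.inl (.lower i)) :=
      fun i => (Quot.sound (.glue i)).symm
    change surfaceOf place c d b (.inr (.upper _)) = surfaceOf place c d b (.inl (.lower _))
    rw [hg]
    split_ifs
    · rfl
    · exact (Quot.sound (.above _ _ (.lowerArc i.1))).symm
  · have hi := i.2
    have hv : (saddleLower i).val = i.1.val + (n - b.k) - (m - c.k) := rfl
    have hr := Fin.val_rev (saddleLower i)
    have key : surfaceOf place c d b (.inr (.lower (saddleLower i))) =
        surfaceOf place c d b (.inl (.upper i.1)) :=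
      Quot.sound (.out _ _ (.leftVertical _ _ (by omega) (by omega) (by omega)))
    change surfaceOf place c d b (.inr (.lower _)) = surfaceOf place c d b (.inl (.upper _))
    rw [← key]
    split_ifs
    · rfl
    · exact (Quot.sound (.below _ _ (.lowerExtra _ _ (by omega) (by omega)))).symm

/-- For `univ`: the components are generated by the incoming circles, the gluing along `d` and the
vertical lines created by saddles. The latter two identifications follow from those of the feet,
since the ends of an arc lie on one incoming circle. -/
theorem saddleData (G : Gluing T₂ T₁ T place) : SaddleData (inPerm T₂ T₁ hcd hdb)
    (outPerm T₂ T₁ hcd hdb) (foot₂ (c := c) (d := d) (b := b)) (foot₁ (c := c) (d := d) (b := b))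
    (surfaceOf place c d b) where
  inj := foot_injective
  left := outPerm_foot₂ hcd hdb
  right := outPerm_foot₁ hcd hdb
  other x h2 h1 := outPerm_other hcd hdb x fun hx => by
    obtain ⟨y, hy | hy⟩ := exists_foot hcd hdb x hx
    · exact h2 y hy
    · exact h1 y hy
  surj := Quot.mk_surjective
  step x := by
    rcases x with x | x
    · exact congrArg (fun z => boundarySurface place c d b (.inl (.inl z))) (circleOf_rho hcd x)
    · exact congrArg (fun z => boundarySurface place c d b (.inl (.inr z))) (circleOf_rho hdb x)
  feet x := (surfaceOf_foot₂ place x).trans (surfaceOf_foot₁ place x).symm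
  univ h h1 h2 := by
    have e₂ : ∀ u v, Edge c T₂ d u v → h (.inl u) = h (.inl v) := fun u v huv =>
      (huv.rho hcd).elim (fun e => by rw [← e]; exact propext (h1 (.inl u)).symm)
        fun e => by rw [← e]; exact propext (h1 (.inl v))
    have e₁ : ∀ u v, Edge d T₁ b u v → h (.inr u) = h (.inr v) := fun u v huv =>
      (huv.rho hdb).elim (fun e => by rw [← e]; exact propext (h1 (.inr u)).symm)
        fun e => by rw [← e]; exact propext (h1 (.inr v))
    have key : ∀ i' : {i : Fin (2 * s) // i < d.arc i},
        h (.inl (.lower i'.1)) = h (.inr (.upper i'.1)) := by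
      intro i'
      have e := propext (h2 (.inl i'))
      unfold foot₂ foot₁ at e
      by_cases hc : d.colour i'.1 = true
      · simp only [hc, if_true] at e
        exact (e₂ _ _ (.lowerArc _)).trans e
      · simp only [hc] at e
        exact e.trans (e₁ _ _ (.upperArc _)).symm
    have hg : ∀ i, h (.inl (.lower i)) = h (.inr (.upper i)) := by
      intro i
      rcases lt_trichotomy i (d.arc i) with hi | hi | hi
      · exact key ⟨i, hi⟩
      · exact (d.arc_ne i hi.symm).elim
      · exact (e₂ _ _ (.lowerArc i)).trans ((key ⟨d.arc i, by rwa [d.arc_arc]⟩).trans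
          (e₁ _ _ (.upperArc i)).symm)
    have hl : ∀ (i : Fin (2 * n)) (i' : Fin (2 * m)), i.val < n - b.k → i'.val < m - c.k →
        (n - b.k) + i'.val = (m - c.k) + i.val → i'.val + (s - d.k) < m - c.k →
        h (.inr (.lower i)) = h (.inl (.upper i')) := by
      intro i i' hi hi' hii hlev
      have hr := Fin.val_rev i
      have hr' := Fin.val_rev i'
      have e := propext (h2 (.inr ⟨i', hlev, by omega⟩))
      have hv : saddleLower (⟨i', hlev, by omega⟩ : {i : Fin (2 * m) //
          i.val + (s - d.k) < m - c.k ∧ m - c.k ≤ i.val + (n - b.k)}) = i :=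
        Fin.ext (by simp only [saddleLower]; omega)
      unfold foot₂ foot₁ at e
      have x₂ := e₂ _ _ (.upperExtra i' i'.rev hlev (by omega))
      have x₁ := e₁ _ _ (.lowerExtra i i.rev (by omega) (by omega))
      by_cases hc : c.colour i' = true
      · simp only [hc, if_true, hv] at e
        exact e.symm.trans x₂.symm
      · simp only [hc, hv] at e
        exact x₁.trans e.symm
    intro x y hxy hx
    have := congrArg (Quot.lift h (surface_edge_eq G hcd hdb h e₂ e₁ hg hl)) hxy
    exact this.mp hx

end

/-- The Euler characteristic of the components of the cobordism. -/
theorem surface_exact (G : Gluing T₂ T₁ T place) (hcd : c.Compatible d) (hdb : d.Compatible b) :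
    IsExact (push (saddleSurface place c d b) fun _ => 1) (push (boundarySurface place c d b) fun _ => 1) := by
  have h := cycCount_exact _ _ _ _ _ (saddleData hcd hdb G)
  have e1 : (fun x => surfaceOf place c d b (foot₂ x)) = saddleSurface place c d b :=
    funext (surfaceOf_foot₂ place)
  rw [e1] at h
  intro j
  obtain ⟨g, hg⟩ := h j
  refine ⟨g, ?_⟩
  -- The cycles of the two permutations are translated into incoming and outgoing circles.
  rw [← hg, push_sum, cycCount, cycCount, ← push_equiv (inEquiv hcd hdb),
    ← push_equiv (outEquiv hcd hdb G)]
  congr 3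
  · funext z
    obtain ⟨x | x, rfl⟩ := Cyc.mk_surjective _ z <;> rfl
  · funext z
    obtain ⟨z, rfl⟩ := (outEquiv hcd hdb G).symm.surjective z
    rw [Equiv.apply_symm_apply]
    rcases z with z | z
    · obtain ⟨x, rfl⟩ := Quot.mk_surjective z
      rfl
    · rfl

end Saddles

/-! ### Sums over the labels of intermediate circles -/

def Label.isX : Label → ℕ
  | .one => 0
  | .X => 1

def Label.isOne : Label → ℕ
  | .one => 1
  | .X => 0

instance : Finite Label :=
  Finite.of_surjective (fun b : Bool => if b then Label.one else Label.X) fun l => by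
    cases l
    exacts [⟨true, rfl⟩, ⟨false, rfl⟩]

theorem push_zero {J K : Type} (q : J → K) (k : K) : push q (fun _ => 0) k = 0 := by
  simp [push]

open Classical in
theorem push_subtype {J K : Type} [Finite J] (q : J → K) (P : J → Prop) (k : K) :
    push (fun j : {j // P j} => q j) (fun _ => 1) k = push q (fun j => if P j then 1 else 0) k := by
  rw [push_one, push_ite, ← Set.ncard_image_of_injective _ Subtype.val_injective]
  congr 1
  ext x
  simp

theorem push_ite_inl {E J₁ J₂ : Type} (a : E → J₁) (b : E → J₂) (x : E → Bool) (j : J₁) :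
    push (fun e => if x e then (Sum.inl (a e) : J₁ ⊕ J₂) else .inr (b e)) (fun _ => 1) (.inl j) =
      push a (fun e => if x e then 1 else 0) j := by
  unfold push
  refine finsum_congr fun e => ?_
  beta_reduce
  cases x e
  · simp
  · by_cases h : a e = j <;> simp [h]

theorem push_ite_inr {E J₁ J₂ : Type} (a : E → J₁) (b : E → J₂) (x : E → Bool) (j : J₂) :
    push (fun e => if x e then (Sum.inl (a e) : J₁ ⊕ J₂) else .inr (b e)) (fun _ => 1) (.inr j) =
      push b (fun e => if x e then 0 else 1) j := by
  unfold push
  refine finsum_congr fun e => ?_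
  beta_reduce
  cases x e
  · by_cases h : b e = j <;> simp [h]
  · simp

theorem weight_sum {J₁ J₂ : Type} [Finite J₁] [Finite J₂] (g ch : J₁ ⊕ J₂ → ℕ) :
    weight g ch = weight (fun j => g (.inl j)) (fun j => ch (.inl j)) *
      weight (fun j => g (.inr j)) fun j => ch (.inr j) := by
  have := Fintype.ofFinite J₁
  have := Fintype.ofFinite J₂
  simp only [weight, finprod_eq_prod_of_fintype]
  exact Fintype.prod_sum_type _

section

variable {J₁ J₂ K Z A B O X₁ X₂ S₁ S₂ : Type} [Finite J₁] [Finite J₂] [Finite K] [Finite Z]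
  [Finite A] [Finite B] [Finite O] [Finite X₁] [Finite X₂] [Finite S₁] [Finite S₂]

open Classical in
/-- Gluing two cobordisms along the circles `Z`. Some extra circles of the first cobordism, given
by `P`, are glued to the second one, too: as the component at the other end has an outgoing circle
with label `1`, such a tube carries its charge at the extra circle. -/
theorem exists_glue_weight (σ₁ : S₁ → J₁) (a : A → J₁) (z₁ : Z → J₁) (x₁ : X₁ → J₁)
    (σ₂ : S₂ → J₂) (z₂ : Z → J₂) (b : B → J₂) (o : O → J₂) (x₂ : X₂ → J₂)
    (g₁ : J₁ → ℕ) (g₂ : J₂ → ℕ)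
    (h₁ : ∀ j, 2 * g₁ j + (push a (fun _ => 1) j + (push z₁ (fun _ => 1) j +
      push x₁ (fun _ => 1) j)) = push σ₁ (fun _ => 1) j + 2)
    (h₂ : ∀ j, 2 * g₂ j + (push z₂ (fun _ => 1) j + push b (fun _ => 1) j +
      (push o (fun _ => 1) j + push x₂ (fun _ => 1) j)) = push σ₂ (fun _ => 1) j + 2)
    (P : X₁ → Prop) (y : {x // P x} → J₂) (q₁ : J₁ → K) (q₂ : J₂ → K)
    (hs : ∀ k, (∃ j, q₁ j = k) ∨ ∃ j, q₂ j = k)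
    (hz : ∀ z, q₁ (z₁ z) = q₂ (z₂ z)) (hp : ∀ p : {x // P x}, q₁ (x₁ p) = q₂ (y p))
    (hu : ∀ (h₁ : J₁ → Prop) (h₂ : J₂ → Prop), (∀ z, h₁ (z₁ z) ↔ h₂ (z₂ z)) →
      (∀ p : {x // P x}, h₁ (x₁ p) ↔ h₂ (y p)) →
      ∃ h : K → Prop, (∀ j, h (q₁ j) ↔ h₁ j) ∧ ∀ j, h (q₂ j) ↔ h₂ j) :
    ∃ G : K → ℕ,
      (∀ k, 2 * G k + (push (fun i => q₁ (a i)) (fun _ => 1) k +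
        push (fun i => q₁ (x₁ i)) (fun _ => 1) k + push (fun i => q₂ (b i)) (fun _ => 1) k +
        push (fun i => q₂ (o i)) (fun _ => 1) k + push (fun i => q₂ (x₂ i)) (fun _ => 1) k) =
        push (fun i => q₁ (σ₁ i)) (fun _ => 1) k + push (fun i => q₂ (σ₂ i)) (fun _ => 1) k +
        2 * push (fun i : {x // P x} => q₁ (x₁ i)) (fun _ => 1) k + 2) ∧
      ∀ (cA : A → ℕ) (cB : B → ℕ) (cO : O → ℕ), (∀ p, ∃ i, o i = y p ∧ cO i = 1) →
        (∑ᶠ l : Z → Label,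
          weight g₁ (fun j => push a cA j + (push z₁ (fun z => (l z).isOne) j +
            push x₁ (fun _ => 1) j)) *
          weight g₂ (fun j => push z₂ (fun z => (l z).isX) j + push b cB j +
            (push o cO j + push x₂ (fun _ => 1) j))) =
        weight G fun k => push (fun i => q₁ (a i)) cA k + push (fun i => q₂ (b i)) cB k +
          push (fun i => q₂ (o i)) cO k + push (fun i => q₂ (x₂ i)) (fun _ => 1) k +
          push (fun i => q₁ (x₁ i)) (fun i => if P i then 0 else 1) k := by
  have := Fintype.ofFinite Z
  have := Fintype.ofFinite {x // P x}
  have := Fintype.ofFinite Label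
  -- The tubes are the intermediate circles `Z` and the extra circles that satisfy `P`.
  let ea : Z ⊕ {x // P x} → J₁ := Sum.elim z₁ fun p => x₁ p
  let eb : Z ⊕ {x // P x} → J₂ := Sum.elim z₂ y
  let q : J₁ ⊕ J₂ → K := Sum.elim q₁ q₂
  obtain ⟨G, hG, hw⟩ := exists_glue (fun e => (Sum.inl (ea e) : J₁ ⊕ J₂)) (fun e => .inr (eb e)) q
    (fun k => (hs k).elim (fun ⟨j, hj⟩ => ⟨.inl j, hj⟩) fun ⟨j, hj⟩ => ⟨.inr j, hj⟩)
    (by rintro (z | p); exacts [hz z, hp p])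
    (by
      intro h hh i j hij hi
      obtain ⟨k, k1, k2⟩ := hu (fun j => h (.inl j)) (fun j => h (.inr j))
        (fun z => hh (.inl z)) fun p => hh (.inr p)
      have key : ∀ j, k (q j) ↔ h j := by rintro (j | j); exacts [k1 j, k2 j]
      rwa [← key, ← hij, key])
    (Sum.elim g₁ g₂)
  have hx : ∀ k, push (fun i : {x // P x} => x₁ i) (fun _ => 1) k +
      push x₁ (fun i => if P i then 0 else 1) k = push x₁ (fun _ => 1) k := by
    intro k
    rw [push_subtype, ← push_add]
    congr 1
    funext i
    split_ifs <;> rfl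
  refine ⟨G, fun k => ?_, fun cA cB cO hO => ?_⟩
  · have := glue_genus _ q (Sum.elim g₁ g₂)
      (Sum.elim (push σ₁ fun _ => 1) (push σ₂ fun _ => 1))
      (Sum.elim (fun j => push a (fun _ => 1) j + (push z₁ (fun _ => 1) j +
        push x₁ (fun _ => 1) j)) (fun j => push z₂ (fun _ => 1) j + push b (fun _ => 1) j +
      (push o (fun _ => 1) j + push x₂ (fun _ => 1) j)))
      (by rintro (j | j); exacts [h₁ j, h₂ j]) G hG k
    have hz' : (fun i => q₂ (z₂ i)) = fun i => q₁ (z₁ i) := funext fun z => (hz z).symm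
    rw [push_sum (fun e => q (Sum.inl (ea e)))] at this
    simp only [push_sum q, Sum.elim_inl, Sum.elim_inr, q, ea, push_add, ← push_comp, hz'] at this
    omega
  · let ch : J₁ ⊕ J₂ → ℕ := Sum.elim
      (fun j => push a cA j + push x₁ (fun i => if P i then 0 else 1) j)
      fun j => push b cB j + push o cO j + push x₂ (fun _ => 1) j
    have hch : push q ch = fun k => push (fun i => q₁ (a i)) cA k +
          push (fun i => q₂ (b i)) cB k +
          push (fun i => q₂ (o i)) cO k + push (fun i => q₂ (x₂ i)) (fun _ => 1) k +
          push (fun i => q₁ (x₁ i)) (fun i => if P i then 0 else 1) k := by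
      funext k
      simp only [push_sum q, Sum.elim_inl, Sum.elim_inr, q, ch, push_add, ← push_comp]
      omega
    rw [← hch, ← hw, finsum_eq_sum_of_fintype, finsum_eq_sum_of_fintype]
    -- A labelling determines at which end each tube is charged: label `1` means the first
    -- cobordism, where the circle is outgoing. The tubes at extra circles are always charged there.
    let X (l : Z → Label) : Z ⊕ {x // P x} → Bool :=
      Sum.elim (fun z => decide (l z = Label.one)) fun _ => true
    have hX₁ : ∀ l z, (if X l (.inl z) then 1 else 0) = (l z).isOne := fun l z => by
      change (if decide (l z = Label.one) then 1 else 0) = _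
      cases l z <;> simp [Label.isOne]
    have hX₂ : ∀ l z, (if X l (.inl z) then 0 else 1) = (l z).isX := fun l z => by
      change (if decide (l z = Label.one) then 0 else 1) = _
      cases l z <;> simp [Label.isX]
    have hX₃ : ∀ l p, X l (.inr p) = true := fun l p => rfl
    refine Fintype.sum_of_injective X ?_ _ _ ?_ ?_
    · intro l l' h
      funext z
      have := congrFun h (.inl z)
      simp only [X, Sum.elim_inl, decide_eq_decide] at this
      cases h1 : l z <;> cases h2 : l' z <;> simp [h1, h2] at this ⊢
    -- A choice that does not come from a labelling charges some extra tube at its end `y p`. The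
    -- component there is already charged by an outgoing circle with label `1`, so its total exceeds
    -- one and the weight vanishes.
    · intro x hx'
      obtain ⟨p, hp'⟩ : ∃ p, x (.inr p) = false := by
        by_contra hcon
        push Not at hcon
        refine hx' ⟨fun z => if x (.inl z) then Label.one else Label.X, ?_⟩
        funext e
        rcases e with z | p
        · cases h : x (.inl z) <;> simp [X, h]
        · exact (by simpa using (hcon p).symm : true = x (.inr p))
      obtain ⟨i, hi, hc⟩ := hO p
      refine weight_eq_zero _ _ (.inr (y p)) ?_
      have e1 := push_pos o cO i
      have e2 : tubeCharge (fun e => (Sum.inl (ea e) : J₁ ⊕ J₂)) (fun e => .inr (eb e)) x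
        (.inr (y p)) = _ := push_ite_inr ea eb x (y p)
      have e3 := push_pos eb (fun e => if x e then 0 else 1) (.inr p)
      have e4 : ch (.inr (y p)) = push b cB (y p) + push o cO (y p) + push x₂ (fun _ => 1) (y p) :=
        rfl
      have e5 : eb (.inr p) = y p := rfl
      simp only [hp', hi, e5] at e1 e3
      rw [e2, e4]
      simp only [Bool.false_eq_true, if_false] at e3
      omega
    · intro l
      rw [weight_sum]
      congr 2
      · funext j
        rw [show tubeCharge (fun e => (Sum.inl (ea e) : J₁ ⊕ J₂)) (fun e => .inr (eb e)) _
          (.inl j) = _ from push_ite_inl ea eb _ j, push_sum]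
        have := hx j
        simp only [hX₁, hX₃, ea, ch, Sum.elim_inl, Sum.elim_inr, if_true]
        eta_reduce
        change _ = push a cA j + _ + (_ + push (fun i : {x // P x} => x₁ i) (fun _ => 1) j)
        omega
      · funext j
        rw [show tubeCharge (fun e => (Sum.inl (ea e) : J₁ ⊕ J₂)) (fun e => .inr (eb e)) _
          (.inr j) = _ from push_ite_inr ea eb _ j, push_sum]
        simp only [hX₂, hX₃, eb, ch, Sum.elim_inl, Sum.elim_inr, if_true, push_zero]
        eta_reduce
        omega

end

/-! ### The coefficients as weights -/

section

variable {n s m : ℕ} {T₂ : FlatTangle s m} {T₁ : FlatTangle n s} {T : FlatTangle n m}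
  {place : T.Piece → T₂.Piece ⊕ T₁.Piece} {c : Diagram m} {d : Diagram s} {b : Diagram n}

/-- The number of charges of the boundary circles in a component. -/
noncomputable def charges (place : T.Piece → T₂.Piece ⊕ T₁.Piece) (l₂ : Circle c T₂ d → Label)
    (l₁ : Circle d T₁ b → Label) (l : Circle c T b → Label) (j : Surface place c d b) : ℕ :=
  push (fun z => boundarySurface place c d b (.inl (.inl z))) (fun z => (l₂ z).isX) j +
    push (fun z => boundarySurface place c d b (.inl (.inr z))) (fun z => (l₁ z).isX) j +
    (push (fun z => boundarySurface place c d b (.inr (.inl z))) (fun z => (l z).isOne) j +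
    push (fun z => boundarySurface place c d b (.inr (.inr z))) (fun _ => 1) j)

theorem coefficient_eq_weight (l₂ : Circle c T₂ d → Label) (l₁ : Circle d T₁ b → Label)
    (l : Circle c T b → Label) :
    coefficient place l₂ l₁ l = weight (genus place c d b) (charges place l₂ l₁ l) := by
  classical
  have key : charges place l₂ l₁ l = fun j =>
      {x | boundarySurface place c d b x = j ∧ Charged l₂ l₁ l x}.ncard := by
    funext j
    rw [← push_ite, push_sum, push_sum, push_sum]
    have hX : ∀ a : Label, a.isX = if a = Label.X then 1 else 0 := fun a => by
      cases a <;> simp [Label.isX]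
    have hO : ∀ a : Label, a.isOne = if a = Label.one then 1 else 0 := fun a => by
      cases a <;> simp [Label.isOne]
    simp only [charges, hX, hO]
    congr 3
    exact funext fun i => (if_pos trivial).symm
  rw [key]
  rfl

/-- This is the Euler characteristic formula behind `genus`, available by `surface_exact`. The
boundary circles are separated by kind because gluing treats the kinds differently. -/
theorem genus_spec (G : Gluing T₂ T₁ T place) (hcd : c.Compatible d) (hdb : d.Compatible b)
    (j : Surface place c d b) : 2 * genus place c d b j +
      (push (fun z => boundarySurface place c d b (.inl (.inl z))) (fun _ => 1) j +
        push (fun z => boundarySurface place c d b (.inl (.inr z))) (fun _ => 1) j +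
        (push (fun z => boundarySurface place c d b (.inr (.inl z))) (fun _ => 1) j +
        push (fun z => boundarySurface place c d b (.inr (.inr z))) (fun _ => 1) j)) =
      push (saddleSurface place c d b) (fun _ => 1) j + 2 := by
  rw [← push_sum (fun z => boundarySurface place c d b (.inl z)) fun _ => 1,
    ← push_sum (fun z => boundarySurface place c d b (.inr z)) fun _ => 1,
    ← push_sum (boundarySurface place c d b) fun _ => 1]
  have := (surface_exact G hcd hdb).genus_eq j
  rw [push_one, push_one] at this ⊢
  exact this

end

/-! ### Maps on the components of a cobordism -/

section

variable {n s m : ℕ} {T₂ : FlatTangle s m} {T₁ : FlatTangle n s} {T : FlatTangle n m}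
  {place : T.Piece → T₂.Piece ⊕ T₁.Piece} {c : Diagram m} {d : Diagram s} {b : Diagram n}

/-- A map on the pieces that is constant on the components of the cobordism. -/
structure CobordismMap (c : Diagram m) (d : Diagram s) (b : Diagram n) {X : Type}
    (f : Vertex T₂ ⊕ Vertex T₁ → X) : Prop where
  above : ∀ u v, Edge c T₂ d u v → f (.inl u) = f (.inl v)
  below : ∀ u v, Edge d T₁ b u v → f (.inr u) = f (.inr v)
  glue : ∀ i, f (.inl (.lower i)) = f (.inr (.upper i))
  level : ∀ (i : Fin (2 * n)) (i' : Fin (2 * m)), i.val < n - b.k → i'.val < m - c.k →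
      (n - b.k) + i'.val = (m - c.k) + i.val → i'.val + (s - d.k) < m - c.k →
      f (.inr (.lower i)) = f (.inl (.upper i'))

theorem CobordismMap.respects {X : Type} {f : Vertex T₂ ⊕ Vertex T₁ → X}
    (h : CobordismMap c d b f) : Respects c d b f :=
  surface_respects f h.above h.below h.glue h.level

/-- The induced map on the components. -/
def CobordismMap.lift {X : Type} {f : Vertex T₂ ⊕ Vertex T₁ → X} (h : CobordismMap c d b f)
    (G : Gluing T₂ T₁ T place) (hcd : c.Compatible d) (hdb : d.Compatible b) :
    Surface place c d b → X :=
  Quot.lift f (surface_edge_eq G hcd hdb f h.above h.below h.glue h.level)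

end

/-- Counting points of a platform by their levels. -/
theorem push_level {M N : ℕ} (p : ℕ) {K : Type} (Q : Fin M → Prop) (R : ℕ → Prop) [DecidablePred R] (F : ℕ → ℕ)
    (hpN : p ≤ N) (hpM : p ≤ M) (hQ : ∀ i, Q i ↔ i.val < p ∧ R (p - 1 - i.val))
    (κ : {i // Q i} → K) (f : {i // Q i} → ℕ) (lev : Fin N → K)
    (h : ∀ (i : {i // Q i}) (t : Fin N), t.val + i.1.val + 1 = p → κ i = lev t)
    (hf : ∀ i, f i = F (p - 1 - i.1.val)) (k : K) :
    push κ f k = push lev (fun t => if t.val < p ∧ R t.val then F t.val else 0) k := by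
  have hlt : ∀ i : {i // Q i}, i.1.val < p := fun i => ((hQ i.1).1 i.2).1
  -- Levels are counted from the free points outwards, starting at zero, so the point with number
  -- `i` of a platform of size `p` has level `p - 1 - i`.
  let ι : {i // Q i} → Fin N := fun i => ⟨p - 1 - i.1.val, by have := hlt i; omega⟩
  have hκ : κ = fun i => lev (ι i) := funext fun i => h i (ι i) (by
    have := hlt i
    change p - 1 - i.1.val + _ + 1 = p
    omega)
  rw [hκ, push_comp]
  congr 1
  funext t
  split_ifs with ht
  · have hi : Q ⟨p - 1 - t.val, by omega⟩ := (hQ _).2 ⟨by simp only; omega, by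
      simp only
      rw [show p - 1 - (p - 1 - t.val) = t.val by omega]
      exact ht.2⟩
    unfold push
    rw [finsum_eq_single _ ⟨_, hi⟩, if_pos, hf]
    · simp only
      congr
      omega
    · exact Fin.ext (by change p - 1 - (p - 1 - t.val) = _; omega)
    · intro i hne
      refine if_neg fun hit => hne ?_
      have := hlt i
      have e : p - 1 - i.1.val = t.val := congrArg Fin.val hit
      exact Subtype.ext (Fin.ext (by simp only; omega))
  · refine (finsum_congr fun i => if_neg ?_).trans finsum_zero
    rintro rfl
    have := (hQ i.1).1 i.2
    exact ht ⟨by change p - 1 - _ < p; omega, this.2⟩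

/-! ### Three tangles -/

section Triple

variable {n s r m : ℕ} {T₃ : FlatTangle r m} {T₂ : FlatTangle s r} {T₁ : FlatTangle n s}
  {T₃₂ : FlatTangle s m} {T₂₁ : FlatTangle n r} {T : FlatTangle n m}
  {p₃₂ : T₃₂.Piece → T₃.Piece ⊕ T₂.Piece} {p₂₁ : T₂₁.Piece → T₂.Piece ⊕ T₁.Piece}
  {pL : T.Piece → T₃₂.Piece ⊕ T₁.Piece} {pR : T.Piece → T₃.Piece ⊕ T₂₁.Piece}
  {c : Diagram m} {d : Diagram r} {e : Diagram s} {b : Diagram n}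

/-- The connections in the cobordism from `W(c) T₃ d ⊔ W(d) T₂ e ⊔ W(e) T₁ b` to
`W(c) T₃ T₂ T₁ b`. -/
inductive TripleEdge (c : Diagram m) (d : Diagram r) (e : Diagram s) (b : Diagram n) :
    Vertex T₃ ⊕ Vertex T₂ ⊕ Vertex T₁ → Vertex T₃ ⊕ Vertex T₂ ⊕ Vertex T₁ → Prop
  | edge₃ (u v) (h : Edge c T₃ d u v) : TripleEdge c d e b (.inl u) (.inl v)
  | edge₂ (u v) (h : Edge d T₂ e u v) : TripleEdge c d e b (.inr (.inl u)) (.inr (.inl v))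
  | edge₁ (u v) (h : Edge e T₁ b u v) : TripleEdge c d e b (.inr (.inr u)) (.inr (.inr v))
  | glue₃ (i) : TripleEdge c d e b (.inl (.lower i)) (.inr (.inl (.upper i)))
  | glue₂ (i) : TripleEdge c d e b (.inr (.inl (.lower i))) (.inr (.inr (.upper i)))
  -- Platform points of non-adjacent diagrams at the same level are connected even if no diagram
  -- between them reaches this level: both bracketings then produce a connection, by saddles or by
  -- tubes at extra circles.
  | levelCE (i : Fin (2 * m)) (i' : Fin (2 * s)) (hi : i.val < m - c.k) (hi' : i'.val < s - e.k)
      (h : (m - c.k) + i'.val = (s - e.k) + i.val) :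
      TripleEdge c d e b (.inl (.upper i)) (.inr (.inl (.lower i')))
  | levelDB (i : Fin (2 * r)) (i' : Fin (2 * n)) (hi : i.val < r - d.k) (hi' : i'.val < n - b.k)
      (h : (r - d.k) + i'.val = (n - b.k) + i.val) :
      TripleEdge c d e b (.inl (.lower i)) (.inr (.inr (.lower i')))
  | levelCB (i : Fin (2 * m)) (i' : Fin (2 * n)) (hi : i.val < m - c.k) (hi' : i'.val < n - b.k)
      (h : (m - c.k) + i'.val = (n - b.k) + i.val) :
      TripleEdge c d e b (.inl (.upper i)) (.inr (.inr (.lower i')))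

variable (T₃ T₂ T₁ c d e b) in
/-- The components of the cobordism for three tangles. -/
def Triple : Type := Quot (TripleEdge (T₃ := T₃) (T₂ := T₂) (T₁ := T₁) c d e b)

instance : Finite (Triple T₃ T₂ T₁ c d e b) := inferInstanceAs (Finite (Quot _))

def Triple.mk (x : Vertex T₃ ⊕ Vertex T₂ ⊕ Vertex T₁) : Triple T₃ T₂ T₁ c d e b := Quot.mk _ x

variable (T₁ c d e b) in
def Triple.mk₃₂ (x : Vertex T₃ ⊕ Vertex T₂) : Triple T₃ T₂ T₁ c d e b :=
  Triple.mk (Sum.elim .inl (fun x => .inr (.inl x)) x)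

variable (T₃ c d e b) in
def Triple.mk₂₁ (x : Vertex T₂ ⊕ Vertex T₁) : Triple T₃ T₂ T₁ c d e b := Triple.mk (.inr x)

variable (c d e b) in
/-- The components through the pieces of `T₃₂` and `T₁`. -/
def Triple.mapL (p₃₂ : T₃₂.Piece → T₃.Piece ⊕ T₂.Piece) (x : Vertex T₃₂ ⊕ Vertex T₁) :
    Triple T₃ T₂ T₁ c d e b :=
  Sum.elim (fun u => Triple.mk₃₂ T₁ c d e b (placeVertex p₃₂ u)) (fun u => .mk (.inr (.inr u))) x

variable (c d e b) in
/-- The components through the pieces of `T₃` and `T₂₁`. -/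
def Triple.mapR (p₂₁ : T₂₁.Piece → T₂.Piece ⊕ T₁.Piece) (x : Vertex T₃ ⊕ Vertex T₂₁) :
    Triple T₃ T₂ T₁ c d e b :=
  Sum.elim (fun u => .mk (.inl u)) (fun u => Triple.mk₂₁ T₃ c d e b (placeVertex p₂₁ u)) x

theorem Triple.sound {x y : Vertex T₃ ⊕ Vertex T₂ ⊕ Vertex T₁} (h : TripleEdge c d e b x y) :
    (Triple.mk x : Triple T₃ T₂ T₁ c d e b) = Triple.mk y :=
  Quot.sound h

theorem Triple.map₃₂ : CobordismMap c d e (Triple.mk₃₂ (T₃ := T₃) (T₂ := T₂) T₁ c d e b) where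
  above u v h := sound (.edge₃ u v h)
  below u v h := sound (.edge₂ u v h)
  glue i := sound (.glue₃ i)
  level i i' hi hi' h _ := (sound (.levelCE i' i hi' hi h.symm)).symm

theorem Triple.map₂₁ : CobordismMap d e b (Triple.mk₂₁ (T₂ := T₂) (T₁ := T₁) T₃ c d e b) where
  above u v h := sound (.edge₂ u v h)
  below u v h := sound (.edge₁ u v h)
  glue i := sound (.glue₂ i)
  level i i' hi hi' h _ := (sound (.levelDB i' i hi' hi h.symm)).symm.trans (sound (.glue₃ i'))

section

variable (G₃₂ : Gluing T₃ T₂ T₃₂ p₃₂) (G₂₁ : Gluing T₂ T₁ T₂₁ p₂₁) (HL : Gluing T₃₂ T₁ T pL)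
  (HR : Gluing T₃ T₂₁ T pR) (hcd : c.Compatible d) (hde : d.Compatible e) (heb : e.Compatible b)

-- A connection of `W(c) T₃₂ e` is composed of connections after the saddle moves for `T₃` and `T₂`,
-- hence stays in one component of the threefold picture (`Respects.out`).
include G₃₂ hcd hde in
theorem Triple.mapL_cobordismMap :
    CobordismMap c e b (Triple.mapL (T₂ := T₂) (T₁ := T₁) c d e b p₃₂) where
  above _ _ h := map₃₂.respects.out G₃₂ hcd hde h
  below u v h := sound (.edge₁ u v h)
  glue i := sound (.glue₂ i)
  level i i' hi hi' h _ := (sound (.levelCB i' i hi' hi h.symm)).symm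

include G₂₁ hde heb in
theorem Triple.mapR_cobordismMap :
    CobordismMap c d b (Triple.mapR (T₃ := T₃) (T₂ := T₂) c d e b p₂₁) where
  above u v h := sound (.edge₃ u v h)
  below _ _ h := map₂₁.respects.out G₂₁ hde heb h
  glue i := sound (.glue₃ i)
  level i i' hi hi' h _ := (sound (.levelCB i' i hi' hi h.symm)).symm

include HL HR G₃₂ G₂₁ hcd hde in
/-- The two inclusions of `W(c) T b` agree up to connections. -/
theorem Triple.mapL_eq_mapR
    (h₃ : ∀ u, HL.q (.inl (G₃₂.q (.inl u))) = HR.q (.inl u))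
    (h₂ : ∀ u, HL.q (.inl (G₃₂.q (.inr u))) = HR.q (.inr (G₂₁.q (.inl u))))
    (h₁ : ∀ u, HL.q (.inr u) = HR.q (.inr (G₂₁.q (.inr u)))) (u : Vertex T) :
    Triple.mapL (T₂ := T₂) (T₁ := T₁) c d e b p₃₂ (placeVertex pL u) =
      Triple.mapR c d e b p₂₁ (placeVertex pR u) := by
  rcases u with i | v | i
  · rfl
  · have kL : ∀ x, mapL (T₂ := T₂) (T₁ := T₁) c d e b p₃₂
        (placeVertex pL (.strand (HL.q x))) = mapL c d e b p₃₂ (Sum.map .strand .strand x) :=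
      fun x => (mapL_cobordismMap G₃₂ hcd hde).respects.mid (HL.place_q x)
    have k32 : ∀ x, mk₃₂ (T₃ := T₃) (T₂ := T₂) T₁ c d e b
        (placeVertex p₃₂ (.strand (G₃₂.q x))) = mk₃₂ T₁ c d e b (Sum.map .strand .strand x) :=
      fun x => map₃₂.respects.mid (G₃₂.place_q x)
    have hv := HR.q_place v
    change mapL c d e b p₃₂ _ = mapR c d e b p₂₁ (Sum.map .strand .strand (pR v))
    generalize pR v = x at hv
    subst hv
    rcases x with x | w
    · rw [← h₃, kL]
      exact k32 _
    · have hw := G₂₁.q_place w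
      change _ = mk₂₁ T₃ c d e b (Sum.map .strand .strand (p₂₁ w))
      generalize p₂₁ w = x at hw
      subst hw
      rcases x with x | x
      · rw [← h₂, kL]
        exact k32 _
      · rw [← h₁, kL]
        rfl
  · rfl

end

/-! ### Counting by levels of the left platforms -/

section Levels

local notation "N" => max (max (m - c.k) (r - d.k)) (max (s - e.k) (n - b.k))

theorem Triple.level_cd (i : Fin (2 * m)) (i' : Fin (2 * r)) (t : ℕ) (h : t + i.val + 1 = m - c.k)
    (h' : t + i'.val + 1 = r - d.k) :
    (Triple.mk (.inl (.upper i)) : Triple T₃ T₂ T₁ c d e b) = .mk (.inl (.lower i')) :=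
  (sound (.edge₃ _ _ (.leftVertical i' i (by omega) (by omega) (by omega)))).symm

theorem Triple.level_de (i : Fin (2 * r)) (i' : Fin (2 * s)) (t : ℕ) (h : t + i.val + 1 = r - d.k)
    (h' : t + i'.val + 1 = s - e.k) :
    (Triple.mk (.inl (.lower i)) : Triple T₃ T₂ T₁ c d e b) = .mk (.inr (.inl (.lower i'))) :=
  (sound (.glue₃ i)).trans
    (sound (.edge₂ _ _ (.leftVertical i' i (by omega) (by omega) (by omega)))).symm

variable (T₃ T₂ T₁ c d e b) in
/-- The component through the points of the left platforms at a given distance from the free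
points. -/
noncomputable def Triple.lev (t : Fin N) : Triple T₃ T₂ T₁ c d e b :=
  -- All platforms that reach the level give the same component; the first one in the order `c`,
  -- `d`, `e`, `b` is used. The index type ensures that one of them reaches it.
  if h : t.val < m - c.k then .mk (.inl (.upper ⟨m - c.k - 1 - t.val, by omega⟩))
  else if h : t.val < r - d.k then .mk (.inl (.lower ⟨r - d.k - 1 - t.val, by omega⟩))
  else if h : t.val < s - e.k then .mk (.inr (.inl (.lower ⟨s - e.k - 1 - t.val, by omega⟩)))
  else .mk (.inr (.inr (.lower ⟨n - b.k - 1 - t.val, by omega⟩)))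

theorem Triple.lev_c (i : Fin (2 * m)) (t : Fin N) (h : t.val + i.val + 1 = m - c.k) :
    .mk (.inl (.upper i)) = lev T₃ T₂ T₁ c d e b t := by
  rw [lev, dif_pos (by omega)]
  exact congrArg (fun x => mk (.inl (.upper x))) (Fin.ext (by simp only; omega))

theorem Triple.lev_d (i : Fin (2 * r)) (t : Fin N) (h : t.val + i.val + 1 = r - d.k) :
    .mk (.inl (.lower i)) = lev T₃ T₂ T₁ c d e b t := by
  unfold lev
  split_ifs with h1 h2
  · exact (level_cd _ i t.val (by simp only; omega) h).symm
  · exact congrArg (fun x => mk (.inl (.lower x))) (Fin.ext (by simp only; omega))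
  all_goals omega

theorem Triple.lev_e (i : Fin (2 * s)) (t : Fin N) (h : t.val + i.val + 1 = s - e.k) :
    .mk (.inr (.inl (.lower i))) = lev T₃ T₂ T₁ c d e b t := by
  unfold lev
  split_ifs with h1 h2
  · exact (sound (.levelCE _ i (by simp only; omega) (by omega) (by simp only; omega))).symm
  · exact (level_de _ i t.val (by simp only; omega) h).symm
  · exact congrArg (fun x => mk (.inr (.inl (.lower x)))) (Fin.ext (by simp only; omega))
  all_goals omega

variable (T₃ T₂ T₁ c d e b) in
/-- The weighted number of platform levels in a component. -/
noncomputable def Triple.count (F : ℕ → ℕ) (k : Triple T₃ T₂ T₁ c d e b) : ℕ :=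
  push (lev T₃ T₂ T₁ c d e b) (fun t => F t.val) k

theorem Triple.count_c (Q : Fin (2 * m) → Prop) (R : ℕ → Prop) [DecidablePred R]
    (F : ℕ → ℕ)
    (hQ : ∀ i, Q i ↔ i.val < m - c.k ∧ R (m - c.k - 1 - i.val)) (f : {i // Q i} → ℕ)
    (hf : ∀ i, f i = F (m - c.k - 1 - i.1.val)) (k : Triple T₃ T₂ T₁ c d e b) :
    push (fun i : {i // Q i} => Triple.mk (.inl (.upper i))) f k =
      count T₃ T₂ T₁ c d e b (fun t => if t < m - c.k ∧ R t then F t else 0) k :=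
  push_level (m - c.k) Q R F (by omega) (by omega) hQ _ f _ (fun i t h => lev_c i.1 t h) hf k

theorem Triple.count_d (Q : Fin (2 * r) → Prop) (R : ℕ → Prop) [DecidablePred R]
    (F : ℕ → ℕ)
    (hQ : ∀ i, Q i ↔ i.val < r - d.k ∧ R (r - d.k - 1 - i.val)) (f : {i // Q i} → ℕ)
    (hf : ∀ i, f i = F (r - d.k - 1 - i.1.val)) (k : Triple T₃ T₂ T₁ c d e b) :
    push (fun i : {i // Q i} => Triple.mk (.inl (.lower i))) f k =
      count T₃ T₂ T₁ c d e b (fun t => if t < r - d.k ∧ R t then F t else 0) k :=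
  push_level (r - d.k) Q R F (by omega) (by omega) hQ _ f _ (fun i t h => lev_d i.1 t h) hf k

theorem Triple.count_e (Q : Fin (2 * s) → Prop) (R : ℕ → Prop) [DecidablePred R]
    (F : ℕ → ℕ)
    (hQ : ∀ i, Q i ↔ i.val < s - e.k ∧ R (s - e.k - 1 - i.val)) (f : {i // Q i} → ℕ)
    (hf : ∀ i, f i = F (s - e.k - 1 - i.1.val)) (k : Triple T₃ T₂ T₁ c d e b) :
    push (fun i : {i // Q i} => Triple.mk (.inr (.inl (.lower i)))) f k =
      count T₃ T₂ T₁ c d e b (fun t => if t < s - e.k ∧ R t then F t else 0) k :=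
  push_level (s - e.k) Q R F (by omega) (by omega) hQ _ f _ (fun i t h => lev_e i.1 t h) hf k

theorem Triple.count_add (F F' : ℕ → ℕ) (k : Triple T₃ T₂ T₁ c d e b) :
    count T₃ T₂ T₁ c d e b (fun t => F t + F' t) k =
      count T₃ T₂ T₁ c d e b F k + count T₃ T₂ T₁ c d e b F' k :=
  push_add _ _ _ k

end Levels

variable (T₃ T₂ T₁ T₃₂ T₂₁ T p₃₂ p₂₁ pL pR) in
/-- The two ways of gluing three tangles. -/
structure TripleGluing where
  G₃₂ : Gluing T₃ T₂ T₃₂ p₃₂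
  G₂₁ : Gluing T₂ T₁ T₂₁ p₂₁
  HL : Gluing T₃₂ T₁ T pL
  HR : Gluing T₃ T₂₁ T pR
  h₃ : ∀ u, HL.q (.inl (G₃₂.q (.inl u))) = HR.q (.inl u)
  h₂ : ∀ u, HL.q (.inl (G₃₂.q (.inr u))) = HR.q (.inr (G₂₁.q (.inl u)))
  h₁ : ∀ u, HL.q (.inr u) = HR.q (.inr (G₂₁.q (.inr u)))

variable (T₃ T₂ T₁ c d e b) in
def Triple.circle₃ : Circle c T₃ d → Triple T₃ T₂ T₁ c d e b :=
  Quot.lift (fun u => .mk (.inl u)) fun u v h => sound (.edge₃ u v h)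

variable (T₃ T₂ T₁ c d e b) in
def Triple.circle₂ : Circle d T₂ e → Triple T₃ T₂ T₁ c d e b :=
  Quot.lift (fun u => .mk (.inr (.inl u))) fun u v h => sound (.edge₂ u v h)

variable (T₃ T₂ T₁ c d e b) in
def Triple.circle₁ : Circle e T₁ b → Triple T₃ T₂ T₁ c d e b :=
  Quot.lift (fun u => .mk (.inr (.inr u))) fun u v h => sound (.edge₁ u v h)

end Triple

/-! ### Associativity of the coefficients -/

section Triple

variable {n s r m : ℕ} {T₃ : FlatTangle r m} {T₂ : FlatTangle s r} {T₁ : FlatTangle n s}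
  {T₃₂ : FlatTangle s m} {T₂₁ : FlatTangle n r} {T : FlatTangle n m}
  {p₃₂ : T₃₂.Piece → T₃.Piece ⊕ T₂.Piece} {p₂₁ : T₂₁.Piece → T₂.Piece ⊕ T₁.Piece}
  {pL : T.Piece → T₃₂.Piece ⊕ T₁.Piece} {pR : T.Piece → T₃.Piece ⊕ T₂₁.Piece}
  {c : Diagram m} {d : Diagram r} {e : Diagram s} {b : Diagram n}

theorem push_saddleSurface {place : T₃₂.Piece → T₃.Piece ⊕ T₂.Piece} {K : Type}
    (q : Surface place c d e → K) (k : K) :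
    push (fun x => q (saddleSurface place c d e x)) (fun _ => 1) k =
      push (fun i : {i : Fin (2 * r) // i < d.arc i} => q (surfaceOf place c d e (.inl (.lower i.1))))
        (fun _ => 1) k +
      push (fun i : {i : Fin (2 * m) // i.val + (r - d.k) < m - c.k ∧
        m - c.k ≤ i.val + (s - e.k)} => q (surfaceOf place c d e (.inl (.upper i.1))))
        (fun _ => 1) k :=
  push_sum (I := {i : Fin (2 * r) // i < d.arc i}) (J := {i : Fin (2 * m) //
    i.val + (r - d.k) < m - c.k ∧ m - c.k ≤ i.val + (s - e.k)})
    (fun x => q (saddleSurface place c d e x)) (fun _ => 1) k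

section

variable (G₃₂ : Gluing T₃ T₂ T₃₂ p₃₂) (HL : Gluing T₃₂ T₁ T pL)
  (hcd : c.Compatible d) (hde : d.Compatible e) (heb : e.Compatible b)

/-- The components of the threefold picture form the pushout of those of the two cobordisms along
the intermediate circles (`hz`) and certain extra circles (`hp`). The latter are needed exactly for
a connection between `d` and `b` at a level that neither `c` nor `e` reaches; at other levels it
runs through `e` or `c`. -/
theorem Triple.universalL (h₁ : Surface p₃₂ c d e → Prop) (h₂ : Surface pL c e b → Prop)
    (hz : ∀ u, h₁ (surfaceOf p₃₂ c d e (placeVertex p₃₂ u)) ↔ h₂ (surfaceOf pL c e b (.inl u)))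
    (hp : ∀ (i : Fin (2 * r)) (i' : Fin (2 * n)), i.val + (m - c.k) < r - d.k →
      i.val + (s - e.k) < r - d.k → i'.val < n - b.k → (r - d.k) + i'.val = (n - b.k) + i.val →
      (h₁ (surfaceOf p₃₂ c d e (.inl (.lower i))) ↔ h₂ (surfaceOf pL c e b (.inr (.lower i'))))) :
    ∃ h : Triple T₃ T₂ T₁ c d e b → Prop,
      (∀ j, h (map₃₂.lift G₃₂ hcd hde j) ↔ h₁ j) ∧
      ∀ j, h ((mapL_cobordismMap G₃₂ hcd hde).lift HL (hcd.trans hde) heb j) ↔ h₂ j := by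
  have hc := c.k_le
  have hd := d.k_le
  have he := e.k_le
  have hb := b.k_le
  have a₁ : ∀ {x y}, SurfaceEdge p₃₂ c d e x y →
      h₁ (surfaceOf p₃₂ c d e x) = h₁ (surfaceOf p₃₂ c d e y) := fun h => congrArg h₁ (Quot.sound h)
  have a₂ : ∀ {x y}, SurfaceEdge pL c e b x y →
      h₂ (surfaceOf pL c e b x) = h₂ (surfaceOf pL c e b y) := fun h => congrArg h₂ (Quot.sound h)
  have hz' := fun u => propext (hz u)
  have hcb : ∀ (i : Fin (2 * m)) (i' : Fin (2 * n)), i.val < m - c.k → i'.val < n - b.k →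
      (m - c.k) + i'.val = (n - b.k) + i.val →
      h₁ (surfaceOf p₃₂ c d e (.inl (.upper i))) = h₂ (surfaceOf pL c e b (.inr (.lower i'))) :=
    fun i i' hi hi' h => (hz' (.upper i)).trans
      (a₂ (.out _ _ (.leftVertical i' i hi' hi h.symm))).symm
  let f : Vertex T₃ ⊕ Vertex T₂ ⊕ Vertex T₁ → Prop :=
    Sum.elim (fun u => h₁ (surfaceOf p₃₂ c d e (.inl u)))
      (Sum.elim (fun u => h₁ (surfaceOf p₃₂ c d e (.inr u)))
        fun u => h₂ (surfaceOf pL c e b (.inr u)))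
  have hf : ∀ x y, TripleEdge c d e b x y → f x = f y := by
    intro x y hxy
    cases hxy with
    | edge₃ u v h => exact a₁ (.above u v h)
    | edge₂ u v h => exact a₁ (.below u v h)
    | edge₁ u v h => exact a₂ (.below u v h)
    | glue₃ i => exact a₁ (.glue i)
    | glue₂ i => exact (hz' (.lower i)).trans (a₂ (.glue i))
    | levelCE i i' hi hi' h => exact (a₁ (.out _ _ (.leftVertical i' i hi' hi h.symm))).symm
    | levelCB i i' hi hi' h => exact hcb i i' hi hi' h
    | levelDB i i' hi hi' h =>
      by_cases h1 : i.val + (m - c.k) < r - d.k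
      · by_cases h2 : i.val + (s - e.k) < r - d.k
        · exact propext (hp i i' h1 h2 hi' h)
        · let x : Fin (2 * s) := ⟨i.val + (s - e.k) - (r - d.k), by omega⟩
          have hx : x.val = i.val + (s - e.k) - (r - d.k) := rfl
          exact (a₁ (.glue i)).trans ((a₁ (.below _ _ (.leftVertical x i (by omega) hi
            (by omega)))).symm.trans ((hz' (.lower x)).trans ((a₂ (.glue x)).trans
            (a₂ (.below _ _ (.leftVertical i' x hi' (by omega) (by omega)))).symm)))
      · let x : Fin (2 * m) := ⟨i.val + (m - c.k) - (r - d.k), by omega⟩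
        have hx : x.val = i.val + (m - c.k) - (r - d.k) := rfl
        exact (a₁ (.above _ _ (.leftVertical i x hi (by omega) (by omega)))).trans
          (hcb x i' (by omega) hi' (by omega))
  refine ⟨Quot.lift f hf, ?_, ?_⟩
  · rintro ⟨u | u⟩ <;> exact Iff.rfl
  · rintro ⟨u | u⟩
    · have key : ∀ x, f (Sum.elim .inl (fun x => .inr (.inl x)) x) ↔ h₁ (surfaceOf p₃₂ c d e x) := by
        rintro (x | x) <;> exact Iff.rfl
      exact (key _).trans (hz u)
    · exact Iff.rfl

/-- For the other bracketing the exceptional connection is between `e` and `c`, at levels that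
neither `d` nor `b` reaches. -/
theorem Triple.universalR (G₂₁ : Gluing T₂ T₁ T₂₁ p₂₁) (HR : Gluing T₃ T₂₁ T pR)
    (h₁ : Surface p₂₁ d e b → Prop) (h₂ : Surface pR c d b → Prop)
    (hz : ∀ u, h₁ (surfaceOf p₂₁ d e b (placeVertex p₂₁ u)) ↔ h₂ (surfaceOf pR c d b (.inr u)))
    (hp : ∀ (i : Fin (2 * s)) (i' : Fin (2 * m)), i.val + (r - d.k) < s - e.k →
      i.val + (n - b.k) < s - e.k → i'.val < m - c.k → (s - e.k) + i'.val = (m - c.k) + i.val →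
      (h₁ (surfaceOf p₂₁ d e b (.inl (.lower i))) ↔ h₂ (surfaceOf pR c d b (.inl (.upper i'))))) :
    ∃ h : Triple T₃ T₂ T₁ c d e b → Prop,
      (∀ j, h (map₂₁.lift G₂₁ hde heb j) ↔ h₁ j) ∧
      ∀ j, h ((mapR_cobordismMap G₂₁ hde heb).lift HR hcd (hde.trans heb) j) ↔ h₂ j := by
  have hc := c.k_le
  have hd := d.k_le
  have he := e.k_le
  have hb := b.k_le
  have a₁ : ∀ {x y}, SurfaceEdge p₂₁ d e b x y →
      h₁ (surfaceOf p₂₁ d e b x) = h₁ (surfaceOf p₂₁ d e b y) := fun h => congrArg h₁ (Quot.sound h)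
  have a₂ : ∀ {x y}, SurfaceEdge pR c d b x y →
      h₂ (surfaceOf pR c d b x) = h₂ (surfaceOf pR c d b y) := fun h => congrArg h₂ (Quot.sound h)
  have hz' := fun u => propext (hz u)
  have hcb : ∀ (i : Fin (2 * m)) (i' : Fin (2 * n)), i.val < m - c.k → i'.val < n - b.k →
      (m - c.k) + i'.val = (n - b.k) + i.val →
      h₂ (surfaceOf pR c d b (.inl (.upper i))) = h₁ (surfaceOf p₂₁ d e b (.inr (.lower i'))) :=
    fun i i' hi hi' h => (a₂ (.out _ _ (.leftVertical i' i hi' hi h.symm))).symm.trans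
      (hz' (.lower i')).symm
  let f : Vertex T₃ ⊕ Vertex T₂ ⊕ Vertex T₁ → Prop :=
    Sum.elim (fun u => h₂ (surfaceOf pR c d b (.inl u))) fun u => h₁ (surfaceOf p₂₁ d e b u)
  have hf : ∀ x y, TripleEdge c d e b x y → f x = f y := by
    intro x y hxy
    cases hxy with
    | edge₃ u v h => exact a₂ (.above u v h)
    | edge₂ u v h => exact a₁ (.above u v h)
    | edge₁ u v h => exact a₁ (.below u v h)
    | glue₃ i => exact (a₂ (.glue i)).trans (hz' (.upper i)).symm
    | glue₂ i => exact a₁ (.glue i)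
    | levelDB i i' hi hi' h =>
      exact (a₂ (.glue i)).trans ((a₂ (.below _ _ (.leftVertical i' i hi' hi h.symm))).symm.trans
        (hz' (.lower i')).symm)
    | levelCB i i' hi hi' h => exact hcb i i' hi hi' h
    | levelCE i' i hi' hi h =>
      by_cases h1 : i.val + (n - b.k) < s - e.k
      · by_cases h2 : i.val + (r - d.k) < s - e.k
        · exact (propext (hp i i' h2 h1 hi' h.symm)).symm
        · let x : Fin (2 * r) := ⟨i.val + (r - d.k) - (s - e.k), by omega⟩
          have hx : x.val = i.val + (r - d.k) - (s - e.k) := rfl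
          exact (a₂ (.above _ _ (.leftVertical x i' (by omega) hi' (by omega)))).symm.trans
            ((a₂ (.glue x)).trans ((hz' (.upper x)).symm.trans
            (a₁ (.above _ _ (.leftVertical i x hi (by omega) (by omega)))).symm))
      · let x : Fin (2 * n) := ⟨i.val + (n - b.k) - (s - e.k), by omega⟩
        have hx : x.val = i.val + (n - b.k) - (s - e.k) := rfl
        exact (hcb i' x hi' (by omega) (by omega)).trans
          ((a₁ (.below _ _ (.leftVertical x i (by omega) hi (by omega)))).trans
            (a₁ (.glue i)).symm)
  refine ⟨Quot.lift f hf, ?_, ?_⟩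
  · rintro ⟨u⟩
    exact Iff.rfl
  · rintro ⟨u | u⟩
    · exact Iff.rfl
    · exact hz u

/-- The coefficients of `(x y) z`. -/
theorem Triple.exists_weightL (G₃₂ : Gluing T₃ T₂ T₃₂ p₃₂) (HL : Gluing T₃₂ T₁ T pL)
    (hcd : c.Compatible d) (hde : d.Compatible e) (heb : e.Compatible b) (κ : Circle c T b → Triple T₃ T₂ T₁ c d e b)
    (hκ : ∀ u, κ (circleOf c T b u) = mapL c d e b p₃₂ (placeVertex pL u)) :
    ∃ G : Triple T₃ T₂ T₁ c d e b → ℕ,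
      (∀ k, 2 * G k + (push (circle₃ T₃ T₂ T₁ c d e b) (fun _ => 1) k +
          push (circle₂ T₃ T₂ T₁ c d e b) (fun _ => 1) k +
          push (circle₁ T₃ T₂ T₁ c d e b) (fun _ => 1) k + push κ (fun _ => 1) k) +
        (count T₃ T₂ T₁ c d e b (fun t => if t < r - d.k ∧ ¬ t < m - c.k ∧ ¬ t < s - e.k
            then 1 else 0) k +
          count T₃ T₂ T₁ c d e b (fun t => if t < s - e.k ∧ ¬ t < m - c.k ∧ ¬ t < n - b.k
            then 1 else 0) k) =
        push (fun i : {i : Fin (2 * r) // i < d.arc i} => mk (.inl (.lower i.1))) (fun _ => 1) k +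
        push (fun i : {i : Fin (2 * s) // i < e.arc i} => mk (.inr (.inl (.lower i.1))))
          (fun _ => 1) k +
        (count T₃ T₂ T₁ c d e b (fun t => if t < m - c.k ∧ ¬ t < r - d.k ∧ t < s - e.k
            then 1 else 0) k +
          count T₃ T₂ T₁ c d e b (fun t => if t < m - c.k ∧ ¬ t < s - e.k ∧ t < n - b.k
            then 1 else 0) k) +
        2 * count T₃ T₂ T₁ c d e b (fun t => if t < r - d.k ∧ ¬ t < m - c.k ∧ ¬ t < s - e.k
            then (if t < n - b.k then 1 else 0) else 0) k + 2) ∧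
      ∀ (l₃ : Circle c T₃ d → Label) (l₂ : Circle d T₂ e → Label) (l₁ : Circle e T₁ b → Label)
        (l : Circle c T b → Label), (∀ u, SamePlatform c b u u → l (circleOf c T b u) = Label.one) →
        (∑ᶠ l' : Circle c T₃₂ e → Label, coefficient p₃₂ l₃ l₂ l' * coefficient pL l' l₁ l) =
          weight G fun k => push (circle₃ T₃ T₂ T₁ c d e b) (fun z => (l₃ z).isX) k +
            push (circle₂ T₃ T₂ T₁ c d e b) (fun z => (l₂ z).isX) k +
            push (circle₁ T₃ T₂ T₁ c d e b) (fun z => (l₁ z).isX) k +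
            push κ (fun z => (l z).isOne) k +
            count T₃ T₂ T₁ c d e b (fun t => if t < s - e.k ∧ ¬ t < m - c.k ∧ ¬ t < n - b.k
              then 1 else 0) k +
            count T₃ T₂ T₁ c d e b (fun t => if t < r - d.k ∧ ¬ t < m - c.k ∧ ¬ t < s - e.k
              then (if t < n - b.k then 0 else 1) else 0) k := by
  have hc := c.k_le
  have hd := d.k_le
  have he := e.k_le
  have hb := b.k_le
  let q₁ := (map₃₂ (T₁ := T₁) (b := b)).lift G₃₂ hcd hde
  let q₂ := (mapL_cobordismMap (T₁ := T₁) (b := b) G₃₂ hcd hde).lift HL (hcd.trans hde) heb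
  -- The extra circles of the first product at levels which `b` reaches. There `b` has a closing arc
  -- in the output, and `y` is the component through it.
  let P : ExtraCircle c d e → Prop := fun i => r - d.k ≤ i.1.val + (n - b.k)
  let y : {i // P i} → Surface pL c e b := fun p => surfaceOf pL c e b (.inr (.lower
    ⟨p.1.1.val + (n - b.k) - (r - d.k), by have := p.1.2; omega⟩))
  obtain ⟨G, h1, h2⟩ := exists_glue_weight (saddleSurface p₃₂ c d e)
    (fun z => boundarySurface p₃₂ c d e (.inl z))
    (fun z => boundarySurface p₃₂ c d e (.inr (.inl z)))
    (fun z => boundarySurface p₃₂ c d e (.inr (.inr z))) (saddleSurface pL c e b)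
    (fun z => boundarySurface pL c e b (.inl (.inl z)))
    (fun z => boundarySurface pL c e b (.inl (.inr z)))
    (fun z => boundarySurface pL c e b (.inr (.inl z)))
    (fun z => boundarySurface pL c e b (.inr (.inr z)))
    (genus p₃₂ c d e) (genus pL c e b)
    (fun j => by
      rw [push_sum]
      exact genus_spec G₃₂ hcd hde j)
    (genus_spec HL (hcd.trans hde) heb) P y q₁ q₂
    (by
      rintro ⟨u | u | u⟩
      · exact .inl ⟨surfaceOf _ _ _ _ (.inl u), rfl⟩
      · exact .inl ⟨surfaceOf _ _ _ _ (.inr u), rfl⟩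
      · exact .inr ⟨surfaceOf _ _ _ _ (.inr u), rfl⟩)
    (by
      rintro ⟨u⟩
      rfl)
    (fun p => sound (.levelDB _ _ (by have := p.1.2; omega)
      (by have := p.1.2; simp only; omega) (by have := p.2; simp only [P] at this ⊢; omega)))
    (fun h₁ h₂ hz hp => universalL G₃₂ HL hcd hde heb h₁ h₂ (fun u => hz (circleOf c T₃₂ e u))
      fun i i' hi1 hi2 hi' hii => by
        have := hp ⟨⟨i, hi1, hi2⟩, by simp only [P]; omega⟩
        have hi : (⟨i.val + (n - b.k) - (r - d.k), by omega⟩ : Fin (2 * n)) = i' :=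
          Fin.ext (by simp only; omega)
        simp only [y, hi] at this
        exact this)
  have eA : (fun z => q₁ (boundarySurface p₃₂ c d e (.inl z))) =
      Sum.elim (circle₃ T₃ T₂ T₁ c d e b) (circle₂ T₃ T₂ T₁ c d e b) := by
    funext z
    rcases z with z | z <;> obtain ⟨z, rfl⟩ := Quot.exists_rep z <;> rfl
  have eB : (fun z => q₂ (boundarySurface pL c e b (.inl (.inr z)))) =
      circle₁ T₃ T₂ T₁ c d e b := by
    funext z
    obtain ⟨z, rfl⟩ := Quot.exists_rep z
    rfl
  have eO : (fun z => q₂ (boundarySurface pL c e b (.inr (.inl z)))) = κ := by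
    funext z
    obtain ⟨z, rfl⟩ := Quot.exists_rep z
    exact (hκ z).symm
  have eX₁ : ∀ (f : ExtraCircle c d e → ℕ) (F : ℕ → ℕ) (_ : ∀ i, f i = F (r - d.k - 1 - i.1.val)) k,
      push (fun z => q₁ (boundarySurface p₃₂ c d e (.inr (.inr z)))) f k =
      count T₃ T₂ T₁ c d e b (fun t => if t < r - d.k ∧ ¬ t < m - c.k ∧ ¬ t < s - e.k
            then F t else 0) k := fun f F hf k =>
    count_d (fun i => i.val + (m - c.k) < r - d.k ∧ i.val + (s - e.k) < r - d.k)
      (fun t => ¬ t < m - c.k ∧ ¬ t < s - e.k) F (fun i => by omega) f hf k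
  have eX₂ : ∀ k, push (fun z => q₂ (boundarySurface pL c e b (.inr (.inr z)))) (fun _ => 1) k =
      count T₃ T₂ T₁ c d e b (fun t => if t < s - e.k ∧ ¬ t < m - c.k ∧ ¬ t < n - b.k
            then 1 else 0) k := fun k =>
    count_e (fun i => i.val + (m - c.k) < s - e.k ∧ i.val + (n - b.k) < s - e.k)
      (fun t => ¬ t < m - c.k ∧ ¬ t < n - b.k) (fun _ => 1) (fun i => by omega) _ (fun _ => rfl) k
  have hP : ∀ i : ExtraCircle c d e, P i ↔ r - d.k - 1 - i.1.val < n - b.k := fun i => by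
    have := i.2
    simp only [P]
    omega
  refine ⟨G, fun k => ?_, fun l₃ l₂ l₁ l hl => ?_⟩
  · have hS₁ : push (fun i => q₁ (saddleSurface p₃₂ c d e i)) (fun _ => 1) k =
        push (fun i : {i : Fin (2 * r) // i < d.arc i} => mk (.inl (.lower i.1))) (fun _ => 1) k +
        count T₃ T₂ T₁ c d e b (fun t => if t < m - c.k ∧ ¬ t < r - d.k ∧ t < s - e.k
            then 1 else 0) k := by
      rw [push_saddleSurface]
      congr 1
      exact count_c (fun i => i.val + (r - d.k) < m - c.k ∧ m - c.k ≤ i.val + (s - e.k))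
        (fun t => ¬ t < r - d.k ∧ t < s - e.k) (fun _ => 1) (fun i => by omega) _ (fun _ => rfl) k
    have hS₂ : push (fun i => q₂ (saddleSurface pL c e b i)) (fun _ => 1) k =
        push (fun i : {i : Fin (2 * s) // i < e.arc i} => mk (.inr (.inl (.lower i.1))))
          (fun _ => 1) k +
        count T₃ T₂ T₁ c d e b (fun t => if t < m - c.k ∧ ¬ t < s - e.k ∧ t < n - b.k
            then 1 else 0) k := by
      rw [push_saddleSurface]
      congr 1
      exact count_c (fun i => i.val + (s - e.k) < m - c.k ∧ m - c.k ≤ i.val + (n - b.k))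
        (fun t => ¬ t < s - e.k ∧ t < n - b.k) (fun _ => 1) (fun i => by omega) _ (fun _ => rfl) k
    have := h1 k
    rw [eA, push_sum, eB, eO, hS₁, hS₂, eX₂ k, eX₁ _ (fun _ => 1) (fun _ => rfl),
      push_subtype (fun i => q₁ (boundarySurface p₃₂ c d e (.inr (.inr i)))) P,
      eX₁ _ (fun t => if t < n - b.k then 1 else 0) fun i => @if_congr _ _ _ (Classical.propDecidable _) _ _ _ _ _
        (hP i) rfl rfl] at this
    simp only [Sum.elim_inl, Sum.elim_inr] at this
    eta_reduce at this
    omega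
  · have := h2 (Sum.elim (fun z => (l₃ z).isX) fun z => (l₂ z).isX) (fun z => (l₁ z).isX)
      (fun z => (l z).isOne) fun p => by
        have h1 := p.1.2
        have h2 := p.2
        simp only [P] at h2
        have hlt : p.1.1.val + (n - b.k) - (r - d.k) < n - b.k := by omega
        -- The circle of the output through this platform point of `b` has label `1` by `hl`; it
        -- provides the charge at the far end of the tube.
        exact ⟨circleOf c T b (.lower ⟨_, by omega⟩), rfl, congrArg Label.isOne (hl (.lower
          ⟨p.1.1.val + (n - b.k) - (r - d.k), by omega⟩)
          (show b.SamePlatform _ _ from .inl ⟨hlt, hlt⟩))⟩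
    refine Eq.trans ?_ (this.trans ?_)
    · refine finsum_congr fun l' => ?_
      rw [coefficient_eq_weight, coefficient_eq_weight]
      congr 2
      funext j
      rw [push_sum]
      rfl
    · congr 1
      funext k
      rw [eA, push_sum, eB, eO, eX₂ k,
        eX₁ _ (fun t => if t < n - b.k then 0 else 1) fun i => @if_congr _ _ _ (Classical.propDecidable _) _ _ _ _ _
        (hP i) rfl rfl]
      rfl

/-- The coefficients of `x (y z)`. -/
theorem Triple.exists_weightR (G₂₁ : Gluing T₂ T₁ T₂₁ p₂₁) (HR : Gluing T₃ T₂₁ T pR)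
    (hcd : c.Compatible d) (hde : d.Compatible e) (heb : e.Compatible b)
    (κ : Circle c T b → Triple T₃ T₂ T₁ c d e b)
    (hκ : ∀ u, κ (circleOf c T b u) = mapR c d e b p₂₁ (placeVertex pR u)) :
    ∃ G : Triple T₃ T₂ T₁ c d e b → ℕ,
      (∀ k, 2 * G k + (push (circle₃ T₃ T₂ T₁ c d e b) (fun _ => 1) k +
          push (circle₂ T₃ T₂ T₁ c d e b) (fun _ => 1) k +
          push (circle₁ T₃ T₂ T₁ c d e b) (fun _ => 1) k + push κ (fun _ => 1) k) +
        (count T₃ T₂ T₁ c d e b (fun t => if t < s - e.k ∧ ¬ t < r - d.k ∧ ¬ t < n - b.k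
            then 1 else 0) k +
          count T₃ T₂ T₁ c d e b (fun t => if t < r - d.k ∧ ¬ t < m - c.k ∧ ¬ t < n - b.k
            then 1 else 0) k) =
        push (fun i : {i : Fin (2 * r) // i < d.arc i} => mk (.inl (.lower i.1))) (fun _ => 1) k +
        push (fun i : {i : Fin (2 * s) // i < e.arc i} => mk (.inr (.inl (.lower i.1))))
          (fun _ => 1) k +
        (count T₃ T₂ T₁ c d e b (fun t => if t < r - d.k ∧ ¬ t < s - e.k ∧ t < n - b.k
            then 1 else 0) k +
          count T₃ T₂ T₁ c d e b (fun t => if t < m - c.k ∧ ¬ t < r - d.k ∧ t < n - b.k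
            then 1 else 0) k) +
        2 * count T₃ T₂ T₁ c d e b (fun t => if t < s - e.k ∧ ¬ t < r - d.k ∧ ¬ t < n - b.k
            then (if t < m - c.k then 1 else 0) else 0) k + 2) ∧
      ∀ (l₃ : Circle c T₃ d → Label) (l₂ : Circle d T₂ e → Label) (l₁ : Circle e T₁ b → Label)
        (l : Circle c T b → Label), (∀ u, SamePlatform c b u u → l (circleOf c T b u) = Label.one) →
        (∑ᶠ l' : Circle d T₂₁ b → Label, coefficient p₂₁ l₂ l₁ l' * coefficient pR l₃ l' l) =
          weight G fun k => push (circle₃ T₃ T₂ T₁ c d e b) (fun z => (l₃ z).isX) k +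
            push (circle₂ T₃ T₂ T₁ c d e b) (fun z => (l₂ z).isX) k +
            push (circle₁ T₃ T₂ T₁ c d e b) (fun z => (l₁ z).isX) k +
            push κ (fun z => (l z).isOne) k +
            count T₃ T₂ T₁ c d e b (fun t => if t < r - d.k ∧ ¬ t < m - c.k ∧ ¬ t < n - b.k
              then 1 else 0) k +
            count T₃ T₂ T₁ c d e b (fun t => if t < s - e.k ∧ ¬ t < r - d.k ∧ ¬ t < n - b.k
              then (if t < m - c.k then 0 else 1) else 0) k := by
  have hc := c.k_le
  have hd := d.k_le
  have he := e.k_le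
  have hb := b.k_le
  let q₁ := (map₂₁ (T₃ := T₃) (c := c)).lift G₂₁ hde heb
  let q₂ := (mapR_cobordismMap (T₃ := T₃) (c := c) G₂₁ hde heb).lift HR hcd (hde.trans heb)
  -- Now the extra circles arise from the product of the two lower factors, and those at levels
  -- which `c` reaches are glued.
  let P : ExtraCircle d e b → Prop := fun i => s - e.k ≤ i.1.val + (m - c.k)
  let y : {i // P i} → Surface pR c d b := fun p => surfaceOf pR c d b (.inl (.upper
    ⟨p.1.1.val + (m - c.k) - (s - e.k), by have := p.1.2; omega⟩))
  obtain ⟨G, h1, h2⟩ := exists_glue_weight (saddleSurface p₂₁ d e b)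
    (fun z => boundarySurface p₂₁ d e b (.inl z))
    (fun z => boundarySurface p₂₁ d e b (.inr (.inl z)))
    (fun z => boundarySurface p₂₁ d e b (.inr (.inr z))) (saddleSurface pR c d b)
    (fun z => boundarySurface pR c d b (.inl (.inr z)))
    (fun z => boundarySurface pR c d b (.inl (.inl z)))
    (fun z => boundarySurface pR c d b (.inr (.inl z)))
    (fun z => boundarySurface pR c d b (.inr (.inr z)))
    (genus p₂₁ d e b) (genus pR c d b)
    (fun j => by
      rw [push_sum]
      exact genus_spec G₂₁ hde heb j)
    (fun j => by
      have := genus_spec HR hcd (hde.trans heb) j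
      omega) P y q₁ q₂
    (by
      rintro ⟨u | u⟩
      · exact .inr ⟨surfaceOf _ _ _ _ (.inl u), rfl⟩
      · exact .inl ⟨surfaceOf _ _ _ _ u, rfl⟩)
    (by
      rintro ⟨u⟩
      rfl)
    (fun p => (sound (.levelCE _ _ (by have := p.1.2; have := p.2; simp only [P] at this ⊢; omega)
      (by have := p.1.2; omega) (by have := p.2; simp only [P] at this ⊢; omega))).symm)
    (fun h₁ h₂ hz hp => universalR hcd hde heb G₂₁ HR h₁ h₂ (fun u => hz (circleOf d T₂₁ b u))
      fun i i' hi1 hi2 hi' hii => by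
        have := hp ⟨⟨i, hi1, hi2⟩, by simp only [P]; omega⟩
        have hi : (⟨i.val + (m - c.k) - (s - e.k), by omega⟩ : Fin (2 * m)) = i' :=
          Fin.ext (by simp only; omega)
        simp only [y, hi] at this
        exact this)
  have eA : (fun z => q₁ (boundarySurface p₂₁ d e b (.inl z))) =
      Sum.elim (circle₂ T₃ T₂ T₁ c d e b) (circle₁ T₃ T₂ T₁ c d e b) := by
    funext z
    rcases z with z | z <;> obtain ⟨z, rfl⟩ := Quot.exists_rep z <;> rfl
  have eB : (fun z => q₂ (boundarySurface pR c d b (.inl (.inl z)))) =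
      circle₃ T₃ T₂ T₁ c d e b := by
    funext z
    obtain ⟨z, rfl⟩ := Quot.exists_rep z
    rfl
  have eO : (fun z => q₂ (boundarySurface pR c d b (.inr (.inl z)))) = κ := by
    funext z
    obtain ⟨z, rfl⟩ := Quot.exists_rep z
    exact (hκ z).symm
  have eX₁ : ∀ (f : ExtraCircle d e b → ℕ) (F : ℕ → ℕ) (_ : ∀ i, f i = F (s - e.k - 1 - i.1.val)) k,
      push (fun z => q₁ (boundarySurface p₂₁ d e b (.inr (.inr z)))) f k =
      count T₃ T₂ T₁ c d e b (fun t => if t < s - e.k ∧ ¬ t < r - d.k ∧ ¬ t < n - b.k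
            then F t else 0) k := fun f F hf k =>
    count_e (fun i => i.val + (r - d.k) < s - e.k ∧ i.val + (n - b.k) < s - e.k)
      (fun t => ¬ t < r - d.k ∧ ¬ t < n - b.k) F (fun i => by omega) f hf k
  have eX₂ : ∀ k, push (fun z => q₂ (boundarySurface pR c d b (.inr (.inr z)))) (fun _ => 1) k =
      count T₃ T₂ T₁ c d e b (fun t => if t < r - d.k ∧ ¬ t < m - c.k ∧ ¬ t < n - b.k
            then 1 else 0) k := fun k =>
    count_d (fun i => i.val + (m - c.k) < r - d.k ∧ i.val + (n - b.k) < r - d.k)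
      (fun t => ¬ t < m - c.k ∧ ¬ t < n - b.k) (fun _ => 1) (fun i => by omega) _ (fun _ => rfl) k
  have hP : ∀ i : ExtraCircle d e b, P i ↔ s - e.k - 1 - i.1.val < m - c.k := fun i => by
    have := i.2
    simp only [P]
    omega
  refine ⟨G, fun k => ?_, fun l₃ l₂ l₁ l hl => ?_⟩
  · have hS₁ : push (fun i => q₁ (saddleSurface p₂₁ d e b i)) (fun _ => 1) k =
        push (fun i : {i : Fin (2 * s) // i < e.arc i} => mk (.inr (.inl (.lower i.1))))
          (fun _ => 1) k +
        count T₃ T₂ T₁ c d e b (fun t => if t < r - d.k ∧ ¬ t < s - e.k ∧ t < n - b.k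
            then 1 else 0) k := by
      rw [push_saddleSurface]
      congr 1
      rw [← count_d (fun i => i.val + (s - e.k) < r - d.k ∧ r - d.k ≤ i.val + (n - b.k))
        (fun t => ¬ t < s - e.k ∧ t < n - b.k) (fun _ => 1) (fun i => by omega) (fun _ => 1)
        (fun _ => rfl) k]
      congr 1
      funext i
      exact (sound (.glue₃ i.1)).symm
    have hS₂ : push (fun i => q₂ (saddleSurface pR c d b i)) (fun _ => 1) k =
        push (fun i : {i : Fin (2 * r) // i < d.arc i} => mk (.inl (.lower i.1))) (fun _ => 1) k +
        count T₃ T₂ T₁ c d e b (fun t => if t < m - c.k ∧ ¬ t < r - d.k ∧ t < n - b.k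
            then 1 else 0) k := by
      rw [push_saddleSurface]
      congr 1
      exact count_c (fun i => i.val + (r - d.k) < m - c.k ∧ m - c.k ≤ i.val + (n - b.k))
        (fun t => ¬ t < r - d.k ∧ t < n - b.k) (fun _ => 1) (fun i => by omega) _ (fun _ => rfl) k
    have := h1 k
    rw [eA, push_sum, eB, eO, hS₁, hS₂, eX₂ k, eX₁ _ (fun _ => 1) (fun _ => rfl),
      push_subtype (fun i => q₁ (boundarySurface p₂₁ d e b (.inr (.inr i)))) P,
      eX₁ _ (fun t => if t < m - c.k then 1 else 0) fun i => @if_congr _ _ _ (Classical.propDecidable _) _ _ _ _ _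
        (hP i) rfl rfl] at this
    simp only [Sum.elim_inl, Sum.elim_inr] at this
    eta_reduce at this
    omega
  · have := h2 (Sum.elim (fun z => (l₂ z).isX) fun z => (l₁ z).isX) (fun z => (l₃ z).isX)
      (fun z => (l z).isOne) fun p => by
        have h1 := p.1.2
        have h2 := p.2
        simp only [P] at h2
        have hlt : p.1.1.val + (m - c.k) - (s - e.k) < m - c.k := by omega
        exact ⟨circleOf c T b (.upper ⟨_, by omega⟩), rfl, congrArg Label.isOne (hl (.upper
          ⟨p.1.1.val + (m - c.k) - (s - e.k), by omega⟩)
          (show c.SamePlatform _ _ from .inl ⟨hlt, hlt⟩))⟩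
    refine Eq.trans ?_ (this.trans ?_)
    · refine finsum_congr fun l' => ?_
      rw [coefficient_eq_weight, coefficient_eq_weight]
      congr 2
      · funext j
        rw [push_sum]
        rfl
      · funext j
        exact congrArg (· + _) (add_comm _ _)
    · congr 1
      funext k
      rw [eA, push_sum, eB, eO, eX₂ k,
        eX₁ _ (fun t => if t < m - c.k then 0 else 1) fun i => @if_congr _ _ _ (Classical.propDecidable _) _ _ _ _ _
        (hP i) rfl rfl]
      simp only [Sum.elim_inl, Sum.elim_inr]
      eta_reduce
      omega

/-- The matrix coefficients of the multiplication are associative, up to `I(T)`. -/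
theorem coefficient_assoc (G : TripleGluing T₃ T₂ T₁ T₃₂ T₂₁ T p₃₂ p₂₁ pL pR)
    (hcd : c.Compatible d) (hde : d.Compatible e) (heb : e.Compatible b)
    (l₃ : Circle c T₃ d → Label) (l₂ : Circle d T₂ e → Label) (l₁ : Circle e T₁ b → Label)
    (l : Circle c T b → Label) (hl : ∀ u, SamePlatform c b u u → l (circleOf c T b u) = Label.one) :
    (∑ᶠ l' : Circle c T₃₂ e → Label, coefficient p₃₂ l₃ l₂ l' * coefficient pL l' l₁ l) =
      ∑ᶠ l' : Circle d T₂₁ b → Label, coefficient p₂₁ l₂ l₁ l' * coefficient pR l₃ l' l := by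
  let κ : Circle c T b → Triple T₃ T₂ T₁ c d e b := fun z =>
    (Triple.mapL_cobordismMap G.G₃₂ hcd hde).lift G.HL (hcd.trans hde) heb
      (boundarySurface pL c e b (.inr (.inl z)))
  obtain ⟨gL, hL, hL'⟩ := Triple.exists_weightL G.G₃₂ G.HL hcd hde heb κ fun _ => rfl
  obtain ⟨gR, hR, hR'⟩ := Triple.exists_weightR G.G₂₁ G.HR hcd hde heb κ fun u =>
    Triple.mapL_eq_mapR G.G₃₂ G.G₂₁ G.HL G.HR hcd hde G.h₃ G.h₂ G.h₁ u
  rw [hL' l₃ l₂ l₁ l hl, hR' l₃ l₂ l₁ l hl]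
  -- By the two Euler characteristic formulas it suffices to compare the contributions of the
  -- levels. At each level this is a check over the sixteen possibilities for which of the four
  -- platforms reach it.
  have hG : gL = gR := by
    funext k
    have h1 := hL k
    have h2 := hR k
    have key : Triple.count T₃ T₂ T₁ c d e b (fun t =>
          (if t < m - c.k ∧ ¬ t < r - d.k ∧ t < s - e.k then 1 else 0) +
          (if t < m - c.k ∧ ¬ t < s - e.k ∧ t < n - b.k then 1 else 0) +
          (if t < r - d.k ∧ ¬ t < m - c.k ∧ ¬ t < s - e.k then (if t < n - b.k then 1 else 0) else 0) +
          (if t < r - d.k ∧ ¬ t < m - c.k ∧ ¬ t < s - e.k then (if t < n - b.k then 1 else 0) else 0) +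
          (if t < s - e.k ∧ ¬ t < r - d.k ∧ ¬ t < n - b.k then 1 else 0) +
          (if t < r - d.k ∧ ¬ t < m - c.k ∧ ¬ t < n - b.k then 1 else 0)) k =
        Triple.count T₃ T₂ T₁ c d e b (fun t =>
          (if t < r - d.k ∧ ¬ t < s - e.k ∧ t < n - b.k then 1 else 0) +
          (if t < m - c.k ∧ ¬ t < r - d.k ∧ t < n - b.k then 1 else 0) +
          (if t < s - e.k ∧ ¬ t < r - d.k ∧ ¬ t < n - b.k then (if t < m - c.k then 1 else 0) else 0) +
          (if t < s - e.k ∧ ¬ t < r - d.k ∧ ¬ t < n - b.k then (if t < m - c.k then 1 else 0) else 0) +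
          (if t < r - d.k ∧ ¬ t < m - c.k ∧ ¬ t < s - e.k then 1 else 0) +
          (if t < s - e.k ∧ ¬ t < m - c.k ∧ ¬ t < n - b.k then 1 else 0)) k := by
      congr 1
      funext t
      by_cases hc : t < m - c.k <;> by_cases hd : t < r - d.k <;>
        by_cases he : t < s - e.k <;> by_cases hb : t < n - b.k <;> simp [hc, hd, he, hb]
    simp only [Triple.count_add] at key
    omega
  rw [hG]
  congr 1
  funext k
  -- The charges from the extra circles that are not glued are compared in the same way. The number
  -- of extra circles at a level need not be the same for the two bracketings before the glued ones
  -- are removed.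
  have key : Triple.count T₃ T₂ T₁ c d e b (fun t =>
        (if t < s - e.k ∧ ¬ t < m - c.k ∧ ¬ t < n - b.k then 1 else 0) +
        (if t < r - d.k ∧ ¬ t < m - c.k ∧ ¬ t < s - e.k then (if t < n - b.k then 0 else 1) else 0)) k =
      Triple.count T₃ T₂ T₁ c d e b (fun t =>
        (if t < r - d.k ∧ ¬ t < m - c.k ∧ ¬ t < n - b.k then 1 else 0) +
        (if t < s - e.k ∧ ¬ t < r - d.k ∧ ¬ t < n - b.k then (if t < m - c.k then 0 else 1) else 0)) k := by
    congr 1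
    funext t
    by_cases hc : t < m - c.k <;> by_cases hd : t < r - d.k <;>
      by_cases he : t < s - e.k <;> by_cases hb : t < n - b.k <;> simp [hc, hd, he, hb]
  simp only [Triple.count_add] at key
  omega

end

end Triple

/-! ### The classes of the basis elements, and associativity -/

section Classes

variable {n m : ℕ} {T : FlatTangle n m}

/-- The class of a basis element in `F(T)`. -/
noncomputable def cls (β : LabelledDiagram T) : F T := (I T).mkQ (Finsupp.single β 1)

theorem cls_of_killed {β : LabelledDiagram T} (h : β.Killed) : cls β = 0 :=
  (Submodule.Quotient.mk_eq_zero _).2 (Submodule.subset_span ⟨β, h, rfl⟩)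

theorem mkQ_single (β : LabelledDiagram T) (r : ℤ) :
    (I T).mkQ (Finsupp.single β r) = r • cls β := by
  rw [cls, ← map_smul, Finsupp.smul_single, smul_eq_mul, mul_one]

theorem F_induction {P : F T → Prop} (h : ∀ β, P (cls β)) (zero : P 0)
    (add : ∀ x y, P x → P y → P (x + y)) (smul : ∀ (r : ℤ) x, P x → P (r • x)) (x : F T) : P x := by
  obtain ⟨x, rfl⟩ := Submodule.mkQ_surjective _ x
  induction x using Finsupp.induction_linear with
  | zero => rw [map_zero]; exact zero
  | add f g hf hg => rw [map_add]; exact add _ _ hf hg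
  | single β r => rw [mkQ_single]; exact smul r _ (h β)

theorem F_hom_ext {M : Type} [AddCommGroup M] {f g : F T →ₗ[ℤ] M}
    (h : ∀ β : LabelledDiagram T, f (cls β) = g (cls β)) : f = g := by
  refine LinearMap.ext fun x => ?_
  induction x using F_induction with
  | h β => exact h β
  | zero => rw [map_zero, map_zero]
  | add x y hx hy => rw [map_add, map_add, hx, hy]
  | smul r x hx => rw [map_smul, map_smul, hx]

theorem label_eq_one_of_not_killed {β : LabelledDiagram T} (h : ¬ β.Killed) (u : Vertex T)
    (hu : SamePlatform β.c β.b u u) : β.label (circleOf β.c T β.b u) = Label.one :=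
  (label_cases _).resolve_right fun hX => h (.inr ⟨u, hu, hX⟩)

end Classes

section

variable {n s m : ℕ} {T₂ : FlatTangle s m} {T₁ : FlatTangle n s} {T : FlatTangle n m}
  {place : T.Piece → T₂.Piece ⊕ T₁.Piece} {c : Diagram m} {d d' : Diagram s} {b : Diagram n}

theorem mulF_mk (x : FTilde T₂) (y : FTilde T₁) :
    mulF place ((I T₂).mkQ x) ((I T₁).mkQ y) = (I T).mkQ (mulTilde place x y) := rfl

theorem mulF_cls (β₂ : LabelledDiagram T₂) (β₁ : LabelledDiagram T₁) :
    mulF place (cls β₂) (cls β₁) = (I T).mkQ (mulBasis place β₂ β₁) := by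
  rw [cls, cls, mulF_mk]
  simp [mulTilde]

theorem mulF_cls_of_ne {hcd : c.Compatible d} {hdb : d'.Compatible b} (h : d ≠ d')
    (l₂ : Circle c T₂ d → Label) (l₁ : Circle d' T₁ b → Label) :
    mulF place (cls ⟨c, d, hcd, l₂⟩) (cls ⟨d', b, hdb, l₁⟩) = 0 := by
  rw [mulF_cls, mulBasis, dif_neg h, map_zero]

instance (c : Diagram m) (T : FlatTangle n m) (b : Diagram n) : Finite (Circle c T b → Label) :=
  Pi.finite

theorem Diagram.Compatible.trans (h : c.Compatible d) (h' : d.Compatible b) : c.Compatible b :=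
  Eq.trans h h'

theorem mulF_cls_self {hcd : c.Compatible d} {hdb : d.Compatible b} (hcb : c.Compatible b)
    (l₂ : Circle c T₂ d → Label) (l₁ : Circle d T₁ b → Label) :
    mulF place (cls ⟨c, d, hcd, l₂⟩) (cls ⟨d, b, hdb, l₁⟩) =
      ∑ᶠ l, coefficient place l₂ l₁ l • cls (⟨c, b, hcb, l⟩ : LabelledDiagram T) := by
  have := Fintype.ofFinite (Circle c T b → Label)
  rw [mulF_cls, mulBasis, dif_pos rfl, finsum_eq_sum_of_fintype, finsum_eq_sum_of_fintype, map_sum]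
  exact Finset.sum_congr rfl fun l _ => mkQ_single _ _

end

section

variable {n s r m : ℕ} {T₃ : FlatTangle r m} {T₂ : FlatTangle s r} {T₁ : FlatTangle n s}
  {T₃₂ : FlatTangle s m} {T₂₁ : FlatTangle n r} {T : FlatTangle n m}
  {p₃₂ : T₃₂.Piece → T₃.Piece ⊕ T₂.Piece} {p₂₁ : T₂₁.Piece → T₂.Piece ⊕ T₁.Piece}
  {pL : T.Piece → T₃₂.Piece ⊕ T₁.Piece} {pR : T.Piece → T₃.Piece ⊕ T₂₁.Piece}

theorem mulF_assoc_cls (G : TripleGluing T₃ T₂ T₁ T₃₂ T₂₁ T p₃₂ p₂₁ pL pR)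
    (β₃ : LabelledDiagram T₃) (β₂ : LabelledDiagram T₂) (β₁ : LabelledDiagram T₁) :
    mulF pL (mulF p₃₂ (cls β₃) (cls β₂)) (cls β₁) =
      mulF pR (cls β₃) (mulF p₂₁ (cls β₂) (cls β₁)) := by
  obtain ⟨c, d, hcd, l₃⟩ := β₃
  obtain ⟨d', e, hde, l₂⟩ := β₂
  obtain ⟨e', b, heb, l₁⟩ := β₁
  by_cases hd : d = d'
  · subst hd
    have hce : c.Compatible e := hcd.trans hde
    have := Fintype.ofFinite (Circle c T₃₂ e → Label)
    by_cases he : e = e'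
    · subst he
      have hdb : d.Compatible b := hde.trans heb
      have hcb : c.Compatible b := hcd.trans hdb
      have := Fintype.ofFinite (Circle d T₂₁ b → Label)
      have := Fintype.ofFinite (Circle c T b → Label)
      rw [mulF_cls_self hce, mulF_cls_self hdb, finsum_eq_sum_of_fintype, finsum_eq_sum_of_fintype,
        map_sum, LinearMap.sum_apply, map_sum]
      simp only [map_smul, LinearMap.smul_apply, mulF_cls_self hcb, finsum_eq_sum_of_fintype,
        Finset.smul_sum, smul_smul]
      rw [Finset.sum_comm, Finset.sum_comm (s := (Finset.univ : Finset (Circle d T₂₁ b → Label)))]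
      refine Finset.sum_congr rfl fun l _ => ?_
      -- A killed output contributes zero on both sides. Any other output has label `1` on all
      -- circles through platform points, as `coefficient_assoc` requires.
      by_cases hk : LabelledDiagram.Killed (⟨c, b, hcb, l⟩ : LabelledDiagram T)
      · simp only [cls_of_killed hk, smul_zero, Finset.sum_const_zero]
      · rw [← Finset.sum_smul, ← Finset.sum_smul, ← finsum_eq_sum_of_fintype,
          ← finsum_eq_sum_of_fintype,
          coefficient_assoc G hcd hde heb l₃ l₂ l₁ l (label_eq_one_of_not_killed hk)]
    · rw [mulF_cls_of_ne he, map_zero, mulF_cls_self hce, finsum_eq_sum_of_fintype, map_sum,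
        LinearMap.sum_apply]
      exact Finset.sum_eq_zero fun l _ => by
        rw [map_smul, LinearMap.smul_apply, mulF_cls_of_ne he, smul_zero]
  · rw [mulF_cls_of_ne hd, map_zero, LinearMap.zero_apply]
    by_cases he : e = e'
    · subst he
      have := Fintype.ofFinite (Circle d' T₂₁ b → Label)
      rw [mulF_cls_self (hde.trans heb), finsum_eq_sum_of_fintype, map_sum]
      exact (Finset.sum_eq_zero fun l _ => by
        rw [map_smul, mulF_cls_of_ne hd, smul_zero]).symm
    · rw [mulF_cls_of_ne he, map_zero]

/-- The products that are induced by minimal cobordisms are associative. -/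
theorem mulF_assoc (G : TripleGluing T₃ T₂ T₁ T₃₂ T₂₁ T p₃₂ p₂₁ pL pR) (x : F T₃) (y : F T₂)
    (z : F T₁) : mulF pL (mulF p₃₂ x y) z = mulF pR x (mulF p₂₁ y z) := by
  induction x using F_induction with
  | zero => simp only [map_zero, LinearMap.zero_apply]
  | add x x' h h' => simp only [map_add, LinearMap.add_apply, h, h']
  | smul r x h => simp only [map_smul, LinearMap.smul_apply, h]
  | h β₃ =>
    induction y using F_induction with
    | zero => simp only [map_zero, LinearMap.zero_apply]
    | add x x' h h' => simp only [map_add, LinearMap.add_apply, h, h']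
    | smul r x h => simp only [map_smul, LinearMap.smul_apply, h]
    | h β₂ =>
      induction z using F_induction with
      | zero => simp only [map_zero]
      | add x x' h h' => simp only [map_add, h, h']
      | smul r x h => simp only [map_smul, h]
      | h β₁ => exact mulF_assoc_cls G β₃ β₂ β₁

end

/-! ### Gluings with identity tangles and of composite tangles -/

section

variable {n s r m : ℕ}

/-- An identity tangle on top. -/
def Gluing.idLeft (T : FlatTangle n m) : Gluing .id T T Sum.inr where
  q := Sum.elim T.top id
  q_place _ := rfl
  place_q x := by
    rcases x with j | v
    · exact .symm _ _ (.rel _ _ (.mk j))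
    · exact .refl _
  mid _ := rfl
  top _ := rfl
  bot _ := rfl
  joined u v := ⟨fun h => .inr ⟨u, v, h, rfl, rfl⟩, by
    rintro (⟨_, _, h, -, -⟩ | ⟨u, v, h, rfl, rfl⟩)
    · exact h.elim
    · exact h⟩

/-- An identity tangle below. -/
def Gluing.idRight (T : FlatTangle n m) : Gluing T .id T Sum.inl where
  q := Sum.elim id T.bot
  q_place _ := rfl
  place_q x := by
    rcases x with v | j
    · exact .refl _
    · exact .rel _ _ (.mk j)
  mid _ := rfl
  top _ := rfl
  bot _ := rfl
  joined u v := ⟨fun h => .inl ⟨u, v, h, rfl, rfl⟩, by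
    rintro (⟨u, v, h, rfl, rfl⟩ | ⟨_, _, h, -, -⟩)
    · exact h
    · exact h.elim⟩

variable {T₂ : FlatTangle s m} {T₁ : FlatTangle n s} {T : FlatTangle n m}
  {place : T.Piece → T₂.Piece ⊕ T₁.Piece}

theorem eqvGen_map {α β : Type} {R : α → α → Prop} {S : β → β → Prop} (f : α → β)
    (h : ∀ x y, R x y → Relation.EqvGen S (f x) (f y)) {x y : α} (hxy : Relation.EqvGen R x y) :
    Relation.EqvGen S (f x) (f y) := by
  induction hxy with
  | rel x y h' => exact h x y h'
  | refl => exact .refl _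
  | symm _ _ _ ih => exact .symm _ _ ih
  | trans _ _ _ _ _ ih ih' => exact .trans _ _ _ ih ih'

/-- A local minimum is added at the top. -/
def Gluing.cup (G : Gluing T₂ T₁ T place) (i : Fin (m + 1)) :
    Gluing (.cup T₂ i) T₁ (.cup T i) (fun v : Option T.Piece =>
      v.elim (Sum.inl (none : Option T₂.Piece)) fun v' =>
        Sum.map (some : T₂.Piece → Option T₂.Piece) (fun w => w) (place v')) where
  q := Sum.elim (Option.map fun u => G.q (.inl u)) fun v => some (G.q (.inr v))
  q_place v := by
    rcases v with _ | v
    · rfl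
    · have h := G.q_place v
      change Sum.elim _ _ (Sum.map some _ (place v)) = some v
      generalize place v = x at h
      rcases x with x | x <;> exact congrArg some h
  place_q := by
    have key : ∀ x, Relation.EqvGen (Mid (.cup T₂ i) T₁)
        (Sum.map (some : T₂.Piece → Option T₂.Piece) (fun w => w) (place (G.q x)))
        (Sum.map (some : T₂.Piece → Option T₂.Piece) (fun w => w) x) := fun x =>
      eqvGen_map (Sum.map (some : T₂.Piece → Option T₂.Piece) (fun w => w))
        (fun _ _ ⟨j⟩ => .rel _ _ (.mk (T₂ := .cup T₂ i) j)) (G.place_q x)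
    rintro ((_ | u) | v)
    · exact .refl _
    · exact key (.inl u)
    · exact key (.inr v)
  mid j := congrArg some (G.mid j)
  top j := by
    change Option.map _ (FlatTangle.top (.cup T₂ i) j) = FlatTangle.top (.cup T i) j
    let f : Option T₂.Piece → Option T.Piece := Option.map fun u => G.q (.inl u)
    by_cases h : j.val < i.val
    · exact (congrArg f (T₂.top_cup_lt i j h)).trans
        ((congrArg some (G.top _)).trans (T.top_cup_lt i j h).symm)
    by_cases h' : j.val ≤ i.val + 1
    · exact (congrArg f (T₂.top_cup_mid i j (by omega) h')).trans
        (T.top_cup_mid i j (by omega) h').symm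
    · exact (congrArg f (T₂.top_cup_gt i j (by omega))).trans
        ((congrArg some (G.top _)).trans (T.top_cup_gt i j (by omega)).symm)
  bot j := congrArg some (G.bot j)
  joined u v := by
    constructor
    · rintro ⟨u, v, rfl, rfl, h⟩
      rcases (G.joined u v).1 h with ⟨u', v', h', rfl, rfl⟩ | ⟨u', v', h', rfl, rfl⟩
      · exact .inl ⟨_, _, ⟨u', v', rfl, rfl, h'⟩, rfl, rfl⟩
      · exact .inr ⟨u', v', h', rfl, rfl⟩
    · rintro (⟨_, _, ⟨u', v', rfl, rfl, h⟩, rfl, rfl⟩ | ⟨u', v', h, rfl, rfl⟩)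
      · exact ⟨_, _, rfl, rfl, (G.joined _ _).2 (.inl ⟨u', v', h, rfl, rfl⟩)⟩
      · exact ⟨_, _, rfl, rfl, (G.joined _ _).2 (.inr ⟨u', v', h, rfl, rfl⟩)⟩

/-- A local maximum is added at the top. -/
def Gluing.cap {T₂ : FlatTangle s (m + 2)} {T₁ : FlatTangle n s} {T : FlatTangle n (m + 2)}
    {place : T.Piece → T₂.Piece ⊕ T₁.Piece} (G : Gluing T₂ T₁ T place) (i : Fin (m + 1)) :
    Gluing (.cap T₂ i) T₁ (.cap T i) (place : T.Piece → T₂.Piece ⊕ T₁.Piece) where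
  q := G.q
  q_place := G.q_place
  place_q x := eqvGen_map (R := Mid T₂ T₁) (S := Mid (.cap T₂ i) T₁) id
    (fun _ _ ⟨j⟩ => .rel _ _ (.mk (T₂ := .cap T₂ i) j)) (G.place_q x)
  mid := G.mid
  top j := by
    change G.q (.inl (FlatTangle.top (.cap T₂ i) j)) = FlatTangle.top (.cap T i) j
    let f : T₂.Piece → T.Piece := fun u => G.q (.inl u)
    by_cases h : j.val < i.val
    · exact (congrArg f (T₂.top_cap_lt i j h)).trans ((G.top _).trans (T.top_cap_lt i j h).symm)
    · exact (congrArg f (T₂.top_cap_ge i j (by omega))).trans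
        ((G.top _).trans (T.top_cap_ge i j (by omega)).symm)
  bot := G.bot
  joined u v := by
    constructor
    · rintro (h | ⟨rfl, rfl⟩)
      · rcases (G.joined u v).1 h with ⟨u', v', h', rfl, rfl⟩ | ⟨u', v', h', rfl, rfl⟩
        · exact .inl ⟨u', v', .inl h', rfl, rfl⟩
        · exact .inr ⟨u', v', h', rfl, rfl⟩
      · exact .inl ⟨_, _, .inr ⟨rfl, rfl⟩, G.top _, G.top _⟩
    · rintro (⟨u', v', h | ⟨rfl, rfl⟩, rfl, rfl⟩ | ⟨u', v', h, rfl, rfl⟩)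
      · exact .inl ((G.joined _ _).2 (.inl ⟨u', v', h, rfl, rfl⟩))
      · exact .inr ⟨G.top _, G.top _⟩
      · exact .inl ((G.joined _ _).2 (.inr ⟨u', v', h, rfl, rfl⟩))

/-- The concatenation of two tangles. -/
def Gluing.comp : {m : ℕ} → (T₂ : FlatTangle s m) → (T₁ : FlatTangle n s) →
    Gluing T₂ T₁ (T₂.comp T₁) (T₂.compPiece T₁)
  | _, .id, T₁ => .idLeft T₁
  | _, .cup T₂ i, T₁ => (Gluing.comp T₂ T₁).cup i
  | _, .cap T₂ i, T₁ => (Gluing.comp T₂ T₁).cap i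

/-- With the identity tangle on top, in the middle or below, associativity becomes left linearity,
balancedness and right linearity of the product, respectively. -/
def TripleGluing.left (G : Gluing T₂ T₁ T place) :
    TripleGluing .id T₂ T₁ T₂ T T Sum.inr place place Sum.inr where
  G₃₂ := .idLeft T₂
  G₂₁ := G
  HL := G
  HR := .idLeft T
  h₃ := G.top
  h₂ _ := rfl
  h₁ _ := rfl

def TripleGluing.middle (G : Gluing T₂ T₁ T place) :
    TripleGluing T₂ .id T₁ T₂ T₁ T Sum.inl Sum.inr place place where
  G₃₂ := .idRight T₂
  G₂₁ := .idLeft T₁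
  HL := G
  HR := G
  h₃ _ := rfl
  h₂ := G.mid
  h₁ _ := rfl

def TripleGluing.right (G : Gluing T₂ T₁ T place) :
    TripleGluing T₂ T₁ .id T T₁ T place Sum.inl Sum.inl place where
  G₃₂ := G
  G₂₁ := .idRight T₁
  HL := .idRight T
  HR := G
  h₃ _ := rfl
  h₂ _ := rfl
  h₁ j := (G.bot j).symm

end

section

variable {n s r m : ℕ} {T₃ : FlatTangle r m} {T₂ : FlatTangle s r} {T₁ : FlatTangle n s}
  {T₃₂ : FlatTangle s m} {T₂₁ : FlatTangle n r} {T : FlatTangle n m}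
  {p₃₂ : T₃₂.Piece → T₃.Piece ⊕ T₂.Piece} {p₂₁ : T₂₁.Piece → T₂.Piece ⊕ T₁.Piece}
  {pR : T.Piece → T₃.Piece ⊕ T₂₁.Piece}

theorem eq_of_eqvGen {α β : Type} {R : α → α → Prop} (f : α → β) (h : ∀ x y, R x y → f x = f y)
    {x y : α} (hxy : Relation.EqvGen R x y) : f x = f y := by
  induction hxy with
  | rel x y h' => exact h x y h'
  | refl => rfl
  | symm _ _ _ ih => exact ih.symm
  | trans _ _ _ _ _ ih ih' => exact ih.trans ih'

/-- If `T` arises from `T₃` and the composite of `T₂` and `T₁`, then also from the composite of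
`T₃` and `T₂`, and `T₁`. -/
theorem exists_tripleGluing (G₃₂ : Gluing T₃ T₂ T₃₂ p₃₂) (G₂₁ : Gluing T₂ T₁ T₂₁ p₂₁)
    (HR : Gluing T₃ T₂₁ T pR) :
    ∃ pL, Nonempty (TripleGluing T₃ T₂ T₁ T₃₂ T₂₁ T p₃₂ p₂₁ pL pR) := by
  -- Pieces of `T₃` and `T₂` that meet at their middle level lie in one piece of `T`, so `f` does
  -- not depend on the representative that `p₃₂` selects. This defines the quotient map for the
  -- other bracketing.
  let f : T₃.Piece ⊕ T₂.Piece → T.Piece :=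
    Sum.elim (fun u => HR.q (.inl u)) fun u => HR.q (.inr (G₂₁.q (.inl u)))
  have hf : ∀ x, f (p₃₂ (G₃₂.q x)) = f x := fun x => eq_of_eqvGen f (fun _ _ ⟨j⟩ => by
    change HR.q _ = HR.q (.inr (G₂₁.q _))
    rw [G₂₁.top]
    exact HR.mid j) (G₃₂.place_q x)
  let g : T₂.Piece ⊕ T₁.Piece → T₃₂.Piece ⊕ T₁.Piece :=
    Sum.map (fun u => G₃₂.q (.inr u)) id
  let pL : T.Piece → T₃₂.Piece ⊕ T₁.Piece := fun v =>
    Sum.elim (fun u => .inl (G₃₂.q (.inl u))) (fun w => g (p₂₁ w)) (pR v)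
  let q : T₃₂.Piece ⊕ T₁.Piece → T.Piece :=
    Sum.elim (fun w => f (p₃₂ w)) fun u => HR.q (.inr (G₂₁.q (.inr u)))
  have hg : ∀ x, q (g x) = HR.q (.inr (G₂₁.q x)) := by
    rintro (x | x)
    · exact hf (.inr x)
    · rfl
  have hgm : ∀ {x y}, Relation.EqvGen (Mid T₂ T₁) x y →
      Relation.EqvGen (Mid T₃₂ T₁) (g x) (g y) := fun h =>
    eqvGen_map g (fun _ _ ⟨j⟩ => .rel _ _ (by
      change Mid T₃₂ T₁ (.inl (G₃₂.q (.inr (T₂.bot j)))) (.inr _)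
      rw [G₃₂.bot]
      exact .mk j)) h
  let k : T₃.Piece ⊕ T₂₁.Piece → T₃₂.Piece ⊕ T₁.Piece :=
    Sum.elim (fun u => .inl (G₃₂.q (.inl u))) fun w => g (p₂₁ w)
  have hk : ∀ x, Relation.EqvGen (Mid T₃₂ T₁) (k (pR (HR.q x))) (k x) := fun x =>
    eqvGen_map k (fun _ _ ⟨j⟩ => by
      change Relation.EqvGen _ (.inl (G₃₂.q (.inl (T₃.bot j)))) (g (p₂₁ (T₂₁.top j)))
      rw [G₃₂.mid, ← G₂₁.top]
      exact .symm _ _ (hgm (G₂₁.place_q (.inl (T₂.top j))))) (HR.place_q x)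
  refine ⟨pL, ⟨⟨G₃₂, G₂₁, ⟨q, ?_, ?_, ?_, ?_, ?_, ?_⟩, HR, fun u => hf (.inl u),
    fun u => hf (.inr u), fun u => rfl⟩⟩⟩
  · intro v
    have h := HR.q_place v
    change q (k (pR v)) = v
    generalize pR v = x at h
    rcases x with x | w
    · exact (hf (.inl x)).trans h
    · exact (hg _).trans ((congrArg (fun w => HR.q (.inr w)) (G₂₁.q_place w)).trans h)
  · have key : ∀ x, Relation.EqvGen (Mid T₃₂ T₁) (k (pR (f x))) (.inl (G₃₂.q x)) := by
      rintro (x | x)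
      · exact hk (.inl x)
      · exact .trans _ _ _ (hk _) (hgm (G₂₁.place_q (.inl x)))
    rintro (w | u)
    · have := key (p₃₂ w)
      rwa [G₃₂.q_place] at this
    · exact .trans _ _ _ (hk _) (hgm (G₂₁.place_q (.inr u)))
  · intro j
    change f (p₃₂ _) = _
    rw [← G₃₂.bot, hf]
    change HR.q (.inr (G₂₁.q _)) = HR.q (.inr (G₂₁.q _))
    rw [G₂₁.mid]
  · intro j
    change f (p₃₂ _) = _
    rw [← G₃₂.top, hf]
    exact HR.top j
  · intro j
    change HR.q (.inr (G₂₁.q _)) = _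
    rw [G₂₁.bot, HR.bot]
  · intro u v
    rw [HR.joined]
    constructor
    · rintro (⟨u, v, h, rfl, rfl⟩ | ⟨u, v, h, rfl, rfl⟩)
      · exact .inl ⟨_, _, (G₃₂.joined _ _).2 (.inl ⟨u, v, h, rfl, rfl⟩), hf (.inl u), hf (.inl v)⟩
      · rcases (G₂₁.joined u v).1 h with ⟨u, v, h', rfl, rfl⟩ | ⟨u, v, h', rfl, rfl⟩
        · exact .inl ⟨_, _, (G₃₂.joined _ _).2 (.inr ⟨u, v, h', rfl, rfl⟩), hf (.inr u), hf (.inr v)⟩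
        · exact .inr ⟨u, v, h', rfl, rfl⟩
    · rintro (⟨u, v, h, rfl, rfl⟩ | ⟨u, v, h, rfl, rfl⟩)
      · rcases (G₃₂.joined u v).1 h with ⟨u, v, h', rfl, rfl⟩ | ⟨u, v, h', rfl, rfl⟩
        · exact .inl ⟨u, v, h', (hf (.inl u)).symm, (hf (.inl v)).symm⟩
        · exact .inr ⟨_, _, (G₂₁.joined _ _).2 (.inl ⟨u, v, h', rfl, rfl⟩), (hf (.inr u)).symm,
            (hf (.inr v)).symm⟩
      · exact .inr ⟨_, _, (G₂₁.joined _ _).2 (.inr ⟨u, v, h, rfl, rfl⟩), rfl, rfl⟩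

end

/-! ### Cobordisms that are cylinders up to a choice of labels -/

section Abstract

variable {S A B J O : Type}

/-- The set `J` arises from `A` and `B` by identifying the two ends of every element of `S`. -/
structure IsPushout (footA : S → A) (footB : S → B) (α : A → J) (β : B → J) : Prop where
  comm : ∀ s, α (footA s) = β (footB s)
  surj : ∀ j, (∃ a, α a = j) ∨ ∃ b, β b = j
  desc : ∀ {X : Type} (f : A → X) (g : B → X), (∀ s, f (footA s) = g (footB s)) →
    ∃ h : J → X, (∀ a, h (α a) = f a) ∧ ∀ b, h (β b) = g b

variable {footA : S → A} {footB : S → B} {α : A → J} {β : B → J}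

theorem IsPushout.symm (h : IsPushout footA footB α β) : IsPushout footB footA β α where
  comm s := (h.comm s).symm
  surj j := (h.surj j).symm
  desc f g hfg := by
    obtain ⟨k, h1, h2⟩ := h.desc g f fun s => (hfg s).symm
    exact ⟨k, h2, h1⟩

/-- If `S` embeds into `B`, then `J` is the disjoint union of `A` and the complement of `S`. -/
theorem IsPushout.bijective (h : IsPushout footA footB α β) (hf : Function.Injective footB) :
    Function.Bijective (Sum.elim α fun z : {z // z ∉ Set.range footB} => β z.1) := by
  classical
  let ret : B → A ⊕ {z // z ∉ Set.range footB} := fun z =>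
    if hz : z ∈ Set.range footB then .inl (footA hz.choose) else .inr ⟨z, hz⟩
  have hret : ∀ s, ret (footB s) = .inl (footA s) := fun s => by
    have hz : footB s ∈ Set.range footB := ⟨s, rfl⟩
    change dite _ _ _ = _
    rw [dif_pos hz, hf hz.choose_spec]
  obtain ⟨k, hk, hk'⟩ := h.desc (X := A ⊕ {z // z ∉ Set.range footB}) .inl ret
    fun s => (hret s).symm
  constructor
  · refine Function.LeftInverse.injective (g := k) ?_
    rintro (a | z)
    · exact hk a
    · exact (hk' z.1).trans (dif_neg z.2)
  · intro j
    rcases h.surj j with ⟨a, rfl⟩ | ⟨z, rfl⟩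
    · exact ⟨.inl a, rfl⟩
    · by_cases hz : z ∈ Set.range footB
      · obtain ⟨s, rfl⟩ := hz
        exact ⟨.inl (footA s), h.comm s⟩
      · exact ⟨.inr ⟨z, hz⟩, rfl⟩

variable [Finite S] [Finite A] [Finite B]

theorem push_split (hf : Function.Injective footB) (β : B → J) (f : B → ℕ) (j : J) :
    push β f j = push (fun s => β (footB s)) (fun s => f (footB s)) j +
      push (fun z : {z // z ∉ Set.range footB} => β z.1) (fun z => f z.1) j := by
  classical
  let e : S ⊕ {z // z ∉ Set.range footB} ≃ B :=
    (Equiv.sumCongr (Equiv.ofInjective footB hf) (Equiv.refl _)).trans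
      (Equiv.Set.sumCompl (Set.range footB))
  rw [← push_equiv e, push_sum]
  rfl

variable {σ : S → J} {ω : O → J} {g : J → ℕ}

/-- A component contains exactly one circle that is in `A` or is a circle of `B` without a saddle;
its other circles in `B` correspond to its saddles. So the Euler characteristic formula reduces to
`2 g` plus the number of outgoing circles being one. -/
theorem IsPushout.genus_eq_zero [Finite O] (h : IsPushout footA footB α β) (hf : Function.Injective footB)
    (hσ : ∀ s, β (footB s) = σ s)
    (hg : ∀ j, 2 * g j + (push α (fun _ => 1) j + push β (fun _ => 1) j + push ω (fun _ => 1) j) =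
      push σ (fun _ => 1) j + 2) : (∀ j, g j = 0) ∧ Function.Bijective ω := by
  have key : ∀ j, g j = 0 ∧ push ω (fun _ => 1) j = 1 := fun j => by
    have h1 := hg j
    rw [push_split hf β] at h1
    obtain ⟨x, rfl⟩ := (h.bijective hf).2 j
    have h2 := push_bijective _ (h.bijective hf) (fun _ => 1) x
    rw [push_sum] at h2
    simp only [hσ] at h1
    simp only [Sum.elim_inl, Sum.elim_inr] at h2
    eta_reduce at h1 h2
    omega
  refine ⟨fun j => (key j).1, fun o o' ho => ?_, fun j => ?_⟩
  · have := (key (ω o)).2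
    rw [push_one, Set.ncard_eq_one] at this
    obtain ⟨x, hx⟩ := this
    have h1 : o ∈ {i | ω i = ω o} := rfl
    have h2 : o' ∈ {i | ω i = ω o} := ho.symm
    rw [hx] at h1 h2
    exact h1.trans h2.symm
  · have := (key j).2
    rw [push_one, Set.ncard_eq_one] at this
    obtain ⟨x, hx⟩ := this
    have h1 : x ∈ {i | ω i = j} := by rw [hx]; rfl
    exact ⟨x, h1⟩

-- All incoming circles of a component but one carry the unit `1`. As the genus is zero and there is
-- one outgoing circle, the component acts as the identity on the label of the remaining incoming
-- circle.
open Classical in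
theorem IsPushout.weight_eq [Finite J] (h : IsPushout footA footB α β) (hf : Function.Injective footB)
    (hg : ∀ j, g j = 0) (hω : Function.Bijective ω) (lA : A → Label) (lB : B → Label)
    (lO : O → Label) (hone : ∀ s, lB (footB s) = .one) (a : J → Label) (hA : ∀ x, a (α x) = lA x)
    (hB : ∀ z, z ∉ Set.range footB → a (β z) = lB z) :
    weight g (fun j => push α (fun x => (lA x).isX) j + push β (fun z => (lB z).isX) j +
      push ω (fun o => (lO o).isOne) j) = if ∀ o, lO o = a (ω o) then 1 else 0 := by
  have hin : ∀ j, push α (fun x => (lA x).isX) j + push β (fun z => (lB z).isX) j = (a j).isX := by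
    intro j
    rw [push_split hf β]
    obtain ⟨x, rfl⟩ := (h.bijective hf).2 j
    have h2 := push_bijective _ (h.bijective hf) (fun y => (a (Sum.elim α (fun z => β z.1) y)).isX) x
    rw [push_sum] at h2
    simp only [Sum.elim_inl, Sum.elim_inr, hA] at h2
    have h3 : (fun z : {z // z ∉ Set.range footB} => (a (β z.1)).isX) =
        fun z => (lB z.1).isX := funext fun z => by rw [hB z.1 z.2]
    rw [h3] at h2
    simp only [hone]
    have h4 : ∀ q : S → J, ∀ j, push q (fun _ => Label.one.isX) j = 0 := fun q j => push_zero q j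
    rw [h4, ← h2]
    eta_reduce
    omega
  have hout : ∀ o, push ω (fun o => (lO o).isOne) (ω o) = (lO o).isOne := fun o =>
    push_bijective ω hω (fun o => (lO o).isOne) o
  simp only [hin]
  split_ifs with hl
  · refine (finprod_congr fun j => ?_).trans finprod_one
    obtain ⟨o, rfl⟩ := hω.2 j
    beta_reduce
    rw [hout, ← hl o, hg]
    cases lO o <;> rfl
  · push Not at hl
    obtain ⟨o, ho⟩ := hl
    refine weight_eq_zero _ _ (ω o) ?_
    rw [hout, hg]
    revert ho
    cases lO o <;> cases a (ω o) <;> simp [Label.isX, Label.isOne]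

end Abstract

/-! ### Minimal cobordisms with one saddle per circle on one side -/

section

variable {n s m : ℕ} {T₂ : FlatTangle s m} {T₁ : FlatTangle n s} {T : FlatTangle n m}
  {place : T.Piece → T₂.Piece ⊕ T₁.Piece} {c : Diagram m} {d : Diagram s} {b : Diagram n}

variable (T₂) in
/-- The circle above through a foot of a saddle. -/
def footAbove : Saddle c d b → Circle c T₂ d
  | .inl i => circleOf c T₂ d (.lower i.1)
  | .inr i => circleOf c T₂ d (.upper i.1)

variable (T₁) in
/-- The circle below through a foot of a saddle. -/
def footBelow : Saddle c d b → Circle d T₁ b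
  | .inl i => circleOf d T₁ b (.upper i.1)
  | .inr i => circleOf d T₁ b (.lower (saddleLower i))

theorem exists_left_end (d : Diagram s) (i : Fin (2 * s)) :
    ∃ x : {i : Fin (2 * s) // i < d.arc i}, i = x.1 ∨ i = d.arc x.1 := by
  rcases lt_or_gt_of_ne (d.arc_ne i) with h | h
  · exact ⟨⟨d.arc i, by rwa [d.arc_arc]⟩, .inr (d.arc_arc i).symm⟩
  · exact ⟨⟨i, h⟩, .inl rfl⟩

/-- The components of the cobordism arise from the incoming circles by attaching the saddles. -/
theorem surface_isPushout (G : Gluing T₂ T₁ T place) (hcd : c.Compatible d)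
    (hdb : d.Compatible b) :
    IsPushout (footAbove T₂) (footBelow T₁)
      (fun z => boundarySurface place c d b (.inl (.inl z)))
      (fun z => boundarySurface place c d b (.inl (.inr z))) where
  comm x := by
    rcases x with i | i
    · exact Quot.sound (.glue i.1)
    · have := i.2
      exact (Quot.sound (SurfaceEdge.out _ _ (Edge.leftVertical (saddleLower i) i.1
        (by simp only [saddleLower]; omega) (by omega) (by simp only [saddleLower]; omega)))).symm
  surj j := by
    obtain ⟨u | v, rfl⟩ := Quot.exists_rep j
    · exact .inl ⟨circleOf c T₂ d u, rfl⟩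
    · exact .inr ⟨circleOf d T₁ b v, rfl⟩
  desc f g hfg := by
    have key : CobordismMap c d b
        (Sum.elim (fun u => f (circleOf c T₂ d u)) fun v => g (circleOf d T₁ b v)) :=
      { above := fun u v h => congrArg f (Quot.sound h)
        below := fun u v h => congrArg g (Quot.sound h)
        glue := fun i => by
          obtain ⟨x, rfl | rfl⟩ := exists_left_end d i
          · exact hfg (.inl x)
          · have h1 : circleOf c T₂ d (.lower x.1) = circleOf c T₂ d (.lower (d.arc x.1)) :=
              Quot.sound (.lowerArc _)
            have h2 : circleOf d T₁ b (.upper x.1) = circleOf d T₁ b (.upper (d.arc x.1)) :=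
              Quot.sound (.upperArc _)
            have h3 := hfg (.inl x)
            change f (circleOf c T₂ d (.lower x.1)) = g (circleOf d T₁ b (.upper x.1)) at h3
            rwa [h1, h2] at h3
        level := fun i i' hi hi' h h' => by
          let x : {i : Fin (2 * m) // i.val + (s - d.k) < m - c.k ∧
            m - c.k ≤ i.val + (n - b.k)} := ⟨i', h', by omega⟩
          have h3 := hfg (.inr x)
          have h4 : saddleLower x = i := Fin.ext (by
            simp only [saddleLower, x]
            omega)
          change f (circleOf c T₂ d (.upper i')) = g (circleOf d T₁ b (.lower (saddleLower x))) at h3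
          rw [h4] at h3
          exact h3.symm }
    refine ⟨key.lift G hcd hdb, fun z => ?_, fun z => ?_⟩
    · obtain ⟨u, rfl⟩ := Quot.exists_rep z
      rfl
    · obtain ⟨u, rfl⟩ := Quot.exists_rep z
      rfl

theorem genus_spec_out (G : Gluing T₂ T₁ T place) (hcd : c.Compatible d) (hdb : d.Compatible b)
    (j : Surface place c d b) : 2 * genus place c d b j +
      (push (fun z => boundarySurface place c d b (.inl (.inl z))) (fun _ => 1) j +
        push (fun z => boundarySurface place c d b (.inl (.inr z))) (fun _ => 1) j +
        push (fun z => boundarySurface place c d b (.inr z)) (fun _ => 1) j) =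
      push (saddleSurface place c d b) (fun _ => 1) j + 2 := by
  rw [push_sum (fun z => boundarySurface place c d b (.inr z))]
  exact genus_spec G hcd hdb j

/-- The labels of the outgoing circles, with label `1` at the extra circles. -/
def outLabel {c : Diagram m} {b : Diagram n} (d : Diagram s) (l : Circle c T b → Label) :
    Circle c T b ⊕ ExtraCircle c d b → Label :=
  Sum.elim l fun _ => .one

theorem charges_eq (l₂ : Circle c T₂ d → Label) (l₁ : Circle d T₁ b → Label)
    (l : Circle c T b → Label) : charges place l₂ l₁ l = fun j =>
      push (fun z => boundarySurface place c d b (.inl (.inl z))) (fun z => (l₂ z).isX) j +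
      push (fun z => boundarySurface place c d b (.inl (.inr z))) (fun z => (l₁ z).isX) j +
      push (fun z => boundarySurface place c d b (.inr z)) (fun z => (outLabel d l z).isOne) j := by
  funext j
  rw [push_sum (fun z => boundarySurface place c d b (.inr z))]
  rfl

open Classical in
/-- The matrix coefficients if the circles below meet at most one saddle each, and carry the
label `1` if they meet a saddle. -/
theorem coefficient_of_below (G : Gluing T₂ T₁ T place) (hcd : c.Compatible d)
    (hdb : d.Compatible b) (hf : Function.Injective (footBelow T₁ : Saddle c d b → _))
    (l₂ : Circle c T₂ d → Label) (l₁ : Circle d T₁ b → Label) (l : Circle c T b → Label)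
    (hone : ∀ x : Saddle c d b, l₁ (footBelow T₁ x) = .one) (a : Surface place c d b → Label)
    (ha₂ : ∀ z, a (boundarySurface place c d b (.inl (.inl z))) = l₂ z)
    (ha₁ : ∀ z, z ∉ Set.range (footBelow T₁ : Saddle c d b → _) →
      a (boundarySurface place c d b (.inl (.inr z))) = l₁ z) :
    coefficient place l₂ l₁ l = if ∀ o, outLabel d l o = a (boundarySurface place c d b (.inr o))
      then 1 else 0 := by
  have h := surface_isPushout G hcd hdb
  have h0 := h.genus_eq_zero hf (fun x => by
    rw [← h.comm]
    rcases x with x | x <;> rfl) (genus_spec_out G hcd hdb)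
  rw [coefficient_eq_weight, charges_eq]
  exact h.weight_eq hf h0.1 h0.2 l₂ l₁ (outLabel d l) hone a ha₂ ha₁

theorem outgoing_bijective (G : Gluing T₂ T₁ T place) (hcd : c.Compatible d)
    (hdb : d.Compatible b) (hf : Function.Injective (footBelow T₁ : Saddle c d b → _)) :
    Function.Bijective fun o => boundarySurface (T₂ := T₂) (T₁ := T₁) place c d b (.inr o) := by
  have h := surface_isPushout G hcd hdb
  exact (h.genus_eq_zero hf (fun x => by
    rw [← h.comm]
    rcases x with x | x <;> rfl) (genus_spec_out G hcd hdb)).2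

open Classical in
/-- The matrix coefficients if the circles above meet at most one saddle each, and carry the
label `1` if they meet a saddle. -/
theorem coefficient_of_above (G : Gluing T₂ T₁ T place) (hcd : c.Compatible d)
    (hdb : d.Compatible b) (hf : Function.Injective (footAbove T₂ : Saddle c d b → _))
    (l₂ : Circle c T₂ d → Label) (l₁ : Circle d T₁ b → Label) (l : Circle c T b → Label)
    (hone : ∀ x : Saddle c d b, l₂ (footAbove T₂ x) = .one) (a : Surface place c d b → Label)
    (ha₁ : ∀ z, a (boundarySurface place c d b (.inl (.inr z))) = l₁ z)
    (ha₂ : ∀ z, z ∉ Set.range (footAbove T₂ : Saddle c d b → _) →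
      a (boundarySurface place c d b (.inl (.inl z))) = l₂ z) :
    coefficient place l₂ l₁ l = if ∀ o, outLabel d l o = a (boundarySurface place c d b (.inr o))
      then 1 else 0 := by
  have h := (surface_isPushout G hcd hdb).symm
  have h0 := h.genus_eq_zero (g := genus place c d b) (σ := saddleSurface place c d b)
    (ω := fun z => boundarySurface place c d b (.inr z)) hf (fun x => by
      rcases x with x | x <;> rfl) (fun j => by
      rw [add_comm (push _ _ _) (push _ _ _)]
      exact genus_spec_out G hcd hdb j)
  have h1 := h.weight_eq hf h0.1 h0.2 l₁ l₂ (outLabel d l) hone a ha₁ ha₂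
  rw [coefficient_eq_weight, charges_eq, ← h1]
  congr 1
  funext j
  rw [add_comm (push _ _ _) (push _ _ _)]

end

/-! ### Adapted diagrams -/

section Adapted

variable {n s m : ℕ} {T₂ : FlatTangle s m} {T₁ : FlatTangle n s} {T : FlatTangle n m}
  {place : T.Piece → T₂.Piece ⊕ T₁.Piece} {c : Diagram m} {d : Diagram s} {b : Diagram n}

/-- The circle of `W(d) T b` through an arc of `d` or through a closing arc of `b`. -/
def adaptedFoot (d : Diagram s) (T : FlatTangle n s) (b : Diagram n) :
    {i : Fin (2 * s) // i < d.arc i} ⊕ {i : Fin (2 * n) // i.val + (s - d.k) < n - b.k} →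
      Circle d T b
  | .inl i => circleOf d T b (.upper i.1)
  | .inr i => circleOf d T b (.lower i.1)

/-- No circle of `W(d) T b` contains two arcs of `d` or closing arcs of `b`. -/
structure Adapted (d : Diagram s) (T : FlatTangle n s) (b : Diagram n) : Prop where
  compatible : d.Compatible b
  injective : Function.Injective (adaptedFoot d T b)

/-- Which closing arcs of `b` carry saddles depends on `c`. In `Adapted` all of them are taken into
account, so that one `d` serves for all `c`. -/
theorem Adapted.footBelow_injective (h : Adapted d T₁ b) :
    Function.Injective (footBelow T₁ : Saddle c d b → _) := by
  let ι : Saddle c d b → {i : Fin (2 * s) // i < d.arc i} ⊕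
      {i : Fin (2 * n) // i.val + (s - d.k) < n - b.k} :=
    Sum.map id fun i => ⟨saddleLower i, by
      have := i.2
      simp only [saddleLower]
      omega⟩
  have hι : Function.Injective ι := Sum.map_injective.2 ⟨Function.injective_id, fun i j hij => by
    have h1 := congrArg (fun x => x.1.val) hij
    have hi := i.2
    have hj := j.2
    simp only [saddleLower] at h1
    exact Subtype.ext (Fin.ext (by omega))⟩
  have : (footBelow T₁ : Saddle c d b → _) = adaptedFoot d T₁ b ∘ ι := by
    funext x
    rcases x with x | x <;> rfl
  rw [this]
  exact h.injective.comp hι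

theorem Adapted.footBelow_eq (l₁ : Circle d T₁ b → Label)
    (hone : ∀ x, l₁ (adaptedFoot d T₁ b x) = .one) (x : Saddle c d b) :
    l₁ (footBelow T₁ x) = .one := by
  rcases x with x | x
  · exact hone (.inl x)
  · have := x.2
    exact hone (.inr ⟨saddleLower x, by simp only [saddleLower]; omega⟩)

/-- Labels of the components from labels above, and labels below away from the saddles. -/
theorem IsPushout.exists_label {S A B J X : Type} {footA : S → A} {footB : S → B} {α : A → J}
    {β : B → J} (h : IsPushout footA footB α β) (hf : Function.Injective footB) (lA : A → X)
    (lB : B → X) : ∃ a : J → X, (∀ x, a (α x) = lA x) ∧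
      ∀ z, z ∉ Set.range footB → a (β z) = lB z := by
  let e := Equiv.ofBijective _ (h.bijective hf)
  refine ⟨fun j => Sum.elim lA (fun z => lB z.1) (e.symm j), fun x => ?_, fun z hz => ?_⟩
  · have : e.symm (α x) = .inl x := e.symm_apply_eq.2 rfl
    exact congrArg (Sum.elim lA fun z => lB z.1) this
  · have : e.symm (β z) = .inr ⟨z, hz⟩ := e.symm_apply_eq.2 rfl
    exact congrArg (Sum.elim lA fun z => lB z.1) this

theorem mulF_cls_of_coefficient {hcd : c.Compatible d} {hdb : d.Compatible b}
    (hcb : c.Compatible b) (l₂ : Circle c T₂ d → Label) (l₁ : Circle d T₁ b → Label)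
    (l : Circle c T b → Label) (h1 : coefficient place l₂ l₁ l = 1)
    (h0 : ∀ l', l' ≠ l → coefficient place l₂ l₁ l' = 0) :
    mulF place (cls ⟨c, d, hcd, l₂⟩) (cls ⟨d, b, hdb, l₁⟩) =
      cls (⟨c, b, hcb, l⟩ : LabelledDiagram T) := by
  rw [mulF_cls_self hcb, finsum_eq_single _ l fun l' h => by rw [h0 l' h, zero_smul], h1, one_smul]

/-- The product with a basis element at an adapted diagram is a basis element. -/
theorem Adapted.mulF_cls (h : Adapted d T₁ b) (G : Gluing T₂ T₁ T place) {hcd : c.Compatible d}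
    (hcb : c.Compatible b) (l₂ : Circle c T₂ d → Label) (l₁ : Circle d T₁ b → Label)
    (hone : ∀ x, l₁ (adaptedFoot d T₁ b x) = .one) (a : Surface place c d b → Label)
    (ha₂ : ∀ z, a (boundarySurface place c d b (.inl (.inl z))) = l₂ z)
    (ha₁ : ∀ z, z ∉ Set.range (footBelow T₁ : Saddle c d b → _) →
      a (boundarySurface place c d b (.inl (.inr z))) = l₁ z)
    (hx : ∀ e : ExtraCircle c d b,
      a (boundarySurface (T₂ := T₂) (T₁ := T₁) place c d b (.inr (.inr e))) = .one) :
    mulF place (cls ⟨c, d, hcd, l₂⟩) (cls ⟨d, b, h.compatible, l₁⟩) =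
      cls (⟨c, b, hcb, fun z =>
        a (boundarySurface place c d b (.inr (.inl z)))⟩ : LabelledDiagram T) := by
  have key := fun l => coefficient_of_below G hcd h.compatible h.footBelow_injective l₂ l₁ l
    (footBelow_eq l₁ hone) a ha₂ ha₁
  refine mulF_cls_of_coefficient hcb l₂ l₁ _ ?_ fun l' hl' => ?_
  · rw [key, if_pos]
    rintro (z | e)
    · rfl
    · exact (hx e).symm
  · rw [key, if_neg]
    exact fun hl => hl' (funext fun z => hl (.inl z))

end Adapted

/-! ### The unit of `A^n` -/

section Unit

variable {n m : ℕ}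

theorem circleOf_id (b : Diagram n) (i : Fin (2 * n)) :
    circleOf b .id b (.upper i) = circleOf b .id b (.lower i) := by
  have := b.k_le
  have := i.2
  by_cases h1 : i.val < n - b.k
  · exact (Quot.sound (.leftVertical i i h1 h1 rfl)).symm
  by_cases h2 : 2 * n - b.k ≤ i.val
  · exact (Quot.sound (.rightVertical i i h2 h2 rfl)).symm
  · let j : Fin n := ⟨i.val - (n - b.k), by omega⟩
    have hj : i.val = n - b.k + j.val := by simp only [j]; omega
    exact (Quot.sound (Edge.top i j hj)).trans
      (Quot.sound (Edge.bot (c := b) (T := .id) i j hj)).symm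

/-- The arc through a point, given by its left end. -/
def Diagram.leftEnd (b : Diagram n) (i : Fin (2 * n)) : Fin (2 * n) := min i (b.arc i)

theorem Diagram.leftEnd_arc (b : Diagram n) (i : Fin (2 * n)) :
    b.leftEnd (b.arc i) = b.leftEnd i := by
  rw [leftEnd, leftEnd, b.arc_arc, min_comm]

theorem Diagram.leftEnd_of_lt {b : Diagram n} {i : Fin (2 * n)} (h : i < b.arc i) :
    b.leftEnd i = i :=
  min_eq_left h.le

/-- The map from the circles of `W(b) b` to the arcs of `b`. -/
def idArc (b : Diagram n) : Vertex (.id : FlatTangle n n) → Fin (2 * n)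
  | .upper i => b.leftEnd i
  | .lower i => b.leftEnd i
  | .strand j => b.leftEnd ⟨(n - b.k) + (show Fin n from j).val, by
      have := (show Fin n from j).2
      omega⟩

theorem idArc_eq (b : Diagram n) (u v : Vertex (.id : FlatTangle n n)) (h : Edge b .id b u v) :
    idArc b u = idArc b v := by
  cases h with
  | lowerArc i => exact (b.leftEnd_arc i).symm
  | upperArc i => exact (b.leftEnd_arc i).symm
  | tangle u v h => exact h.elim
  | bot i j h => exact congrArg b.leftEnd (Fin.ext h)
  | top i j h => exact congrArg b.leftEnd (Fin.ext h)
  | leftVertical i i' _ _ h => exact congrArg b.leftEnd (Fin.ext (by omega))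
  | rightVertical i i' _ _ h => exact congrArg b.leftEnd (Fin.ext (by omega))
  | lowerExtra i j hi h => omega
  | upperExtra i j hi h => omega

/-- A circle of `W(b) b` consists of one arc of `b` and its mirror image, and `idArc` recovers this
arc. There are no closing arcs, as the platforms have equal size. -/
theorem adapted_id (b : Diagram n) : Adapted b .id b where
  compatible := rfl
  injective := by
    rintro (i | i) (j | j) h
    · have := congrArg (Quot.lift (idArc b) (idArc_eq b)) h
      change b.leftEnd i.1 = b.leftEnd j.1 at this
      rw [Diagram.leftEnd_of_lt i.2, Diagram.leftEnd_of_lt j.2] at this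
      rw [Subtype.ext this]
    · have := j.2
      omega
    · have := i.2
      omega
    · have := i.2
      omega

/-- The element `1_b`. -/
noncomputable def idem (b : Diagram n) : F (.id : FlatTangle n n) := cls ⟨b, b, rfl, fun _ => .one⟩

variable (T : FlatTangle n m) {c : Diagram m} {b : Diagram n}

/-- The circles of `W(b) b` all carry the unit and are attached by one saddle each. The hypothesis
`hplace` covers both placements that occur: in the upper tangle for the right action, and, for `T =
id`, in the lower one for the multiplication of `A n`. -/
theorem mulF_idem {place : T.Piece → T.Piece ⊕ (FlatTangle.id : FlatTangle n n).Piece}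
    (G : Gluing T .id T place) (hcb : c.Compatible b)
    (hplace : ∀ v, surfaceOf place c b b (placeVertex place (.strand v)) =
      surfaceOf place c b b (.inl (.strand v))) (l : Circle c T b → Label) :
    mulF place (cls ⟨c, b, hcb, l⟩) (idem b) = cls ⟨c, b, hcb, l⟩ := by
  have hA := adapted_id b
  obtain ⟨a, ha₂, ha₁⟩ := (surface_isPushout G hcb
    hA.compatible).exists_label hA.footBelow_injective l fun _ => Label.one
  have hs : ∀ z : Circle c T b, boundarySurface (T₂ := T) (T₁ := .id) (T := T) place c b b
      (.inr (.inl z)) = boundarySurface place c b b (.inl (.inl z)) := fun z => by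
    obtain ⟨u, rfl⟩ := Quot.exists_rep z
    rcases u with i | v | i
    · rfl
    · exact hplace v
    · exact (congrArg (fun z => boundarySurface place c b b (.inl (.inr z)))
        (circleOf_id b i)).symm.trans (Quot.sound (.glue i)).symm
  have := hA.mulF_cls G (hcd := hcb) hcb l (fun _ => .one) (fun _ => rfl) a ha₂ ha₁
    fun e => by
      have := e.2
      omega
  simp only [hs, ha₂] at this
  exact this

/-- Here the circles of `W(c) c` lie above, so the roles of the two sides in the pushout are
exchanged. -/
theorem idem_mulF (hcb : c.Compatible b) (l : Circle c T b → Label) :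
    mulF (T₂ := .id) (T₁ := T) (T := T) Sum.inr (idem c) (cls ⟨c, b, hcb, l⟩) =
      cls ⟨c, b, hcb, l⟩ := by
  have hA := adapted_id c
  have hcc : c.Compatible c := hA.compatible
  have hf : Function.Injective (footAbove .id : Saddle c c b → _) := by
    have : (footAbove .id : Saddle c c b → _) = fun x => Sum.elim
        (fun i => adaptedFoot c .id c (.inl i)) (fun i => by have := i.2; omega) x := by
      funext x
      rcases x with x | x
      · exact (circleOf_id c x.1).symm
      · have := x.2
        omega
    rw [this]
    rintro (x | x) (y | y) h
    · rw [Sum.inl_injective (hA.injective h)]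
    · have := y.2
      omega
    · have := x.2
      omega
    · have := x.2
      omega
  obtain ⟨a, ha₁, ha₂⟩ := (surface_isPushout (Gluing.idLeft T) hcc
    hcb).symm.exists_label hf l fun _ => Label.one
  have hs : ∀ z : Circle c T b, boundarySurface (T₂ := .id) (T₁ := T) (T := T) Sum.inr c c b
      (.inr (.inl z)) = boundarySurface Sum.inr c c b (.inl (.inr z)) := fun z => by
    obtain ⟨u, rfl⟩ := Quot.exists_rep z
    rcases u with i | v | i
    · exact (congrArg (fun z => boundarySurface Sum.inr c c b (.inl (.inl z)))
        (circleOf_id c i)).trans (Quot.sound (.glue i))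
    · rfl
    · rfl
  have key := fun l' => coefficient_of_above (Gluing.idLeft T) hcc hcb hf (fun _ => .one) l l'
    (fun _ => rfl) a ha₁ ha₂
  refine mulF_cls_of_coefficient hcb _ l l ?_ fun l' hl' => ?_
  · rw [key, if_pos]
    rintro (z | e)
    · rw [hs, ha₁]
      rfl
    · have := e.2
      omega
  · rw [key, if_neg]
    intro hl
    refine hl' (funext fun z => ?_)
    have := hl (.inl z)
    rwa [hs, ha₁] at this

theorem one_eq [Fintype (Diagram n)] :
    (1 : A n) = (∑ a : Diagram n, idem a : F (.id : FlatTangle n n)) := by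
  change (I (FlatTangle.id : FlatTangle n n)).mkQ _ = _
  rw [finsum_eq_sum_of_fintype, map_sum]
  rfl

theorem mulF_one {place : T.Piece → T.Piece ⊕ (FlatTangle.id : FlatTangle n n).Piece}
    (G : Gluing T .id T place)
    (hplace : ∀ c b v, surfaceOf place c b b (placeVertex place (.strand v)) =
      surfaceOf place c b b (.inl (.strand v))) (x : F T) : mulF place x (1 : A n) = x := by
  have := Fintype.ofFinite (Diagram n)
  induction x using F_induction with
  | zero => rw [map_zero]; rfl
  | add x y hx hy => rw [map_add]; exact congrArg₂ (· + ·) hx hy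
  | smul r x hx => rw [map_smul]; exact congrArg _ hx
  | h β =>
    obtain ⟨c, b, hcb, l⟩ := β
    rw [one_eq, map_sum, Finset.sum_eq_single b]
    · exact mulF_idem T G hcb (hplace c b) l
    · intro a _ ha
      exact mulF_cls_of_ne (Ne.symm ha) _ _
    · exact fun h => absurd (Finset.mem_univ b) h

theorem rightAct_one (x : F T) : rightAct T x 1 = x :=
  mulF_one T (.idRight T) (fun _ _ _ => rfl) x

theorem leftAct_one (x : F T) : leftAct T 1 x = x := by
  have := Fintype.ofFinite (Diagram m)
  have key : leftAct T 1 = LinearMap.id := F_hom_ext fun β => by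
    obtain ⟨c, b, hcb, l⟩ := β
    change mulF Sum.inr _ _ = _
    rw [one_eq, map_sum, LinearMap.sum_apply, Finset.sum_eq_single c]
    · exact idem_mulF T hcb l
    · intro a _ ha
      exact mulF_cls_of_ne ha _ _
    · exact fun h => absurd (Finset.mem_univ c) h
  exact LinearMap.congr_fun key x

theorem isUnitalRing (n : ℕ) : IsUnitalRing n where
  mul_assoc x y z := mulF_assoc (.left (.idLeft .id)) x y z
  one_mul x := leftAct_one .id x
  -- The multiplication of `A n` places the strands in the lower identity tangle; the strand above
  -- is connected with the one below through a free point of the middle diagram.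
  mul_one x := mulF_one .id (.idLeft .id) (fun c b v => by
    let j : Fin n := v
    have := b.k_le
    let i : Fin (2 * n) := ⟨(n - b.k) + j.val, by omega⟩
    exact (Quot.sound (.below _ _ (Edge.top i j rfl))).symm.trans ((Quot.sound (.glue i)).symm.trans
      (Quot.sound (.above _ _ (Edge.bot i j rfl))))) x

theorem isBimodule : IsBimodule T where
  mul_left a a' x := mulF_assoc (.left (.idLeft T)) a a' x
  one_left := leftAct_one T
  mul_right x a a' := (mulF_assoc (.middle (.idRight T)) x a a').symm
  one_right := rightAct_one T
  left_right a x a' := mulF_assoc (.left (.idRight T)) a x a'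

end Unit

/-! ### Factorizations at an adapted diagram -/

/-- Points of the platforms of two diagrams at the same distance from the free points. -/
def Diagram.Aligned {n m : ℕ} (b : Diagram n) (c : Diagram m) (i : Fin (2 * n))
    (i' : Fin (2 * m)) : Prop :=
  (i.val < n - b.k ∧ i'.val < m - c.k ∧ (n - b.k) + i'.val = (m - c.k) + i.val) ∨
  (2 * n - b.k ≤ i.val ∧ 2 * m - c.k ≤ i'.val ∧ (2 * n - b.k) + i'.val = (2 * m - c.k) + i.val)

/-- The point of a platform of `b` is further away from the free points than all points of the
platforms of `c`. -/
def Diagram.Beyond {n m : ℕ} (b : Diagram n) (c : Diagram m) (i : Fin (2 * n)) : Prop :=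
  i.val + (m - c.k) < n - b.k ∨ i.rev.val + (m - c.k) < n - b.k

section

variable {n m : ℕ} {b : Diagram n} {c : Diagram m}

theorem Diagram.aligned_or_beyond (h : c.Compatible b) {i : Fin (2 * n)}
    (hi : b.SamePlatform i i) : (∃ i', b.Aligned c i i') ∨ b.Beyond c i := by
  have hb := b.k_le
  have hc := c.k_le
  have h2 := i.2
  have h3 := Fin.val_rev i
  replace h : (m : ℤ) - 2 * c.k = n - 2 * b.k := h
  rcases hi with ⟨hi, -⟩ | ⟨hi, -⟩
  · by_cases h1 : i.val + (m - c.k) < n - b.k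
    · exact .inr (.inl h1)
    · exact .inl ⟨⟨i.val + (m - c.k) - (n - b.k), by omega⟩, .inl ⟨hi, by simp only; omega, by
        simp only; omega⟩⟩
  · by_cases h1 : i.rev.val + (m - c.k) < n - b.k
    · exact .inr (.inr h1)
    · exact .inl ⟨⟨i.val + (2 * m - c.k) - (2 * n - b.k), by omega⟩, .inr ⟨hi, by simp only; omega,
        by simp only; omega⟩⟩

theorem Diagram.Aligned.samePlatform {i j : Fin (2 * n)} {i' j' : Fin (2 * m)}
    (h : b.Aligned c i i') (h' : b.Aligned c j j') (hij : b.SamePlatform i j) :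
    c.SamePlatform i' j' := by
  have hb := b.k_le
  unfold SamePlatform at *
  unfold Aligned at *
  omega

theorem Diagram.Aligned.eq {i j : Fin (2 * n)} {i' : Fin (2 * m)}
    (h : b.Aligned c i i') (h' : b.Aligned c j i') : i = j := by
  have hc := c.k_le
  unfold Aligned at *
  exact Fin.ext (by omega)

theorem Diagram.Aligned.edge {T : FlatTangle n m} {i : Fin (2 * n)} {i' : Fin (2 * m)}
    (h : b.Aligned c i i') : Edge c T b (.lower i) (.upper i') := by
  rcases h with ⟨h1, h2, h3⟩ | ⟨h1, h2, h3⟩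
  · exact .leftVertical _ _ h1 h2 h3
  · exact .rightVertical _ _ h1 h2 h3

end

/-! ### Unique factorization of basis elements -/

section

variable {n s m : ℕ} {T₂ : FlatTangle s m} {T₁ : FlatTangle n s} {T : FlatTangle n m}
  {place : T.Piece → T₂.Piece ⊕ T₁.Piece} {c : Diagram m} {d : Diagram s} {b : Diagram n}

theorem circleOf_beyond {i : Fin (2 * n)} (h : b.Beyond d i) :
    ∃ x, x.1 + (s - d.k) < n - b.k ∧ (x = i ∨ x = i.rev) ∧ ∃ h',
      circleOf d T₁ b (.lower i) = adaptedFoot d T₁ b (.inr ⟨x, h'⟩) := by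
  have h3 := Fin.val_rev i
  rcases h with h | h
  · exact ⟨i, h, .inl rfl, h, rfl⟩
  · exact ⟨i.rev, h, .inr rfl, h, (Quot.sound (.lowerExtra i.rev i h (by omega))).symm⟩

/-- A closing arc of `b` at a level that `c` does not reach carries no saddle. By adaptedness its
circle contains no other arc at which a saddle could be attached. -/
theorem Adapted.not_mem_range (hA : Adapted d T₁ b) {i : Fin (2 * n)} (h : b.Beyond d i)
    (h' : b.Beyond c i) :
    circleOf d T₁ b (.lower i) ∉ Set.range (footBelow T₁ : Saddle c d b → _) := by
  obtain ⟨x, hx, hxi, hx', e⟩ := circleOf_beyond (T₁ := T₁) h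
  rintro ⟨y | y, hy⟩
  · cases hA.injective (a₁ := .inl y) (hy.trans e)
  · have hy2 := y.2
    have h1 : (saddleLower y).val + (s - d.k) < n - b.k := by
      simp only [saddleLower]
      omega
    have h2 := Sum.inr_injective (hA.injective (a₁ := .inr ⟨saddleLower y, h1⟩) (hy.trans e))
    have h3 := congrArg (fun x => x.1.val) h2
    simp only [saddleLower] at h3
    have h4 := Fin.val_rev i
    unfold Diagram.Beyond at h h'
    rcases hxi with rfl | rfl <;> omega

/-- Labels of the circles of `W(c) T₂ d`, `W(d) T₁ b` and `W(c) T b` that are induced by labels `a`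
of the components of the cobordism. -/
structure Factors (l₂ : Circle c T₂ d → Label) (l₁ : Circle d T₁ b → Label)
    (l : Circle c T b → Label) (a : Surface place c d b → Label) : Prop where
  one : ∀ x, l₁ (adaptedFoot d T₁ b x) = .one
  above : ∀ z, a (boundarySurface place c d b (.inl (.inl z))) = l₂ z
  below : ∀ z, z ∉ Set.range (footBelow T₁ : Saddle c d b → _) →
    a (boundarySurface place c d b (.inl (.inr z))) = l₁ z
  extra : ∀ e : ExtraCircle c d b,
    a (boundarySurface (T₂ := T₂) (T₁ := T₁) place c d b (.inr (.inr e))) = .one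
  out : ∀ z, a (boundarySurface place c d b (.inr (.inl z))) = l z

variable {l₂ l₂' : Circle c T₂ d → Label} {l₁ l₁' : Circle d T₁ b → Label}
  {l : Circle c T b → Label} {a a' : Surface place c d b → Label}

theorem Factors.mulF_eq (h : Factors l₂ l₁ l a) (hA : Adapted d T₁ b) (G : Gluing T₂ T₁ T place)
    (hcd : c.Compatible d) (hcb : c.Compatible b) :
    mulF place (cls ⟨c, d, hcd, l₂⟩) (cls ⟨d, b, hA.compatible, l₁⟩) = cls ⟨c, b, hcb, l⟩ := by
  rw [hA.mulF_cls G hcb l₂ l₁ h.one a h.above h.below h.extra]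
  simp only [h.out]

/-- Components correspond to outgoing circles, so `l`, together with the label `1` at the extra
circles, determines `a`. The labels of all incoming circles follow from `a`, or are `1` at the
saddles below. -/
theorem Factors.unique (h : Factors l₂ l₁ l a) (h' : Factors l₂' l₁' l a') (hA : Adapted d T₁ b)
    (G : Gluing T₂ T₁ T place) (hcd : c.Compatible d) : l₂ = l₂' ∧ l₁ = l₁' := by
  have ha : a = a' := funext fun j => by
    obtain ⟨z | e, rfl⟩ := (outgoing_bijective G hcd hA.compatible hA.footBelow_injective).2 j
    · exact (h.out z).trans (h'.out z).symm
    · exact (h.extra e).trans (h'.extra e).symm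
  subst ha
  refine ⟨funext fun z => (h.above z).symm.trans (h'.above z), funext fun z => ?_⟩
  by_cases hz : z ∈ Set.range (footBelow T₁ : Saddle c d b → _)
  · obtain ⟨x, rfl⟩ := hz
    rw [Adapted.footBelow_eq l₁ h.one, Adapted.footBelow_eq l₁' h'.one]
  · exact (h.below z hz).symm.trans (h'.below z hz)

/-- The labels above and those below away from the saddles can be prescribed on the components. An
extra circle lies on a circle of `W(c) T₂ d` through a platform point, whose label is `1` as this
basis element is not killed. -/
theorem exists_factors_above (hA : Adapted d T₁ b) (G : Gluing T₂ T₁ T place)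
    (hcd : c.Compatible d) (hk : ¬ (⟨c, d, hcd, l₂⟩ : LabelledDiagram T₂).Killed)
    (hone : ∀ x, l₁ (adaptedFoot d T₁ b x) = .one) :
    ∃ (l : Circle c T b → Label) (a : Surface place c d b → Label), Factors l₂ l₁ l a := by
  obtain ⟨a, ha₂, ha₁⟩ := (surface_isPushout G hcd
    hA.compatible).exists_label hA.footBelow_injective l₂ l₁
  refine ⟨_, a, hone, ha₂, ha₁, fun e => ?_, fun z => rfl⟩
  refine (ha₂ (circleOf c T₂ d (.lower e.1))).trans
    (label_eq_one_of_not_killed hk (.lower e.1) (.inl ?_))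
  have := e.2
  simp only
  omega

/-- The labels of the components are read off from the outgoing circles, with label `1` at the extra
ones. Circles below that meet a saddle are given the label `1`. -/
theorem exists_factors_out (hA : Adapted d T₁ b) (G : Gluing T₂ T₁ T place)
    (hcd : c.Compatible d) (hcb : c.Compatible b)
    (hk : ¬ (⟨c, b, hcb, l⟩ : LabelledDiagram T).Killed) :
    ∃ (l₂ : Circle c T₂ d → Label) (l₁ : Circle d T₁ b → Label)
      (a : Surface place c d b → Label), Factors l₂ l₁ l a := by
  classical
  let e := Equiv.ofBijective _ (outgoing_bijective G hcd hA.compatible hA.footBelow_injective)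
  let a : Surface place c d b → Label := fun j => outLabel d l (e.symm j)
  have ha : ∀ o, a (boundarySurface place c d b (.inr o)) = outLabel d l o := fun o =>
    congrArg (outLabel d l) (e.symm_apply_apply o)
  refine ⟨fun z => a (boundarySurface place c d b (.inl (.inl z))), fun z =>
    if z ∈ Set.range (footBelow T₁ : Saddle c d b → _) then .one else
      a (boundarySurface place c d b (.inl (.inr z))), a, fun x => ?_, fun z => rfl, fun z hz =>
      (if_neg hz).symm, fun e => ha (.inr e), fun z => ha (.inl z)⟩
  split_ifs with hx
  · rfl
  · rcases x with x | x
    · exact absurd ⟨.inl x, rfl⟩ hx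
    -- This is a closing arc of `b` whose circle meets no saddle. Its component has the label of an
    -- outgoing circle through a platform point, and that label is `1` since the output is not
    -- killed.
    · refine (ha (.inl (circleOf c T b (.lower x.1)))).trans
        (label_eq_one_of_not_killed hk (.lower x.1) (.inl ?_))
      have := x.2
      simp only
      omega

/-- A point of `W(c) T₂ d` in the component of a platform point of `W(c) T b`. -/
def Token (c : Diagram m) (d : Diagram s) (b : Diagram n) : Vertex T → Vertex T₂ → Prop
  | .upper i, v => v = .upper i
  | .lower i, v => (s - d.k ≤ m - c.k ∧ ∃ i', v = .upper i' ∧ b.Aligned c i i') ∨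
      (m - c.k < s - d.k ∧ ∃ i', v = .lower i' ∧ b.Aligned d i i')
  | .strand _, _ => False

theorem exists_token (hcb : c.Compatible b) (hdb : d.Compatible b) (u : Vertex T)
    (hu : SamePlatform c b u u) : (∃ v : Vertex T₂, Token c d b u v) ∨
      ∃ i, u = .lower i ∧ b.Beyond d i ∧ b.Beyond c i := by
  rcases u with i | v | i
  · exact .inl ⟨_, rfl⟩
  · exact hu.elim
  · rcases le_or_gt (s - d.k) (m - c.k) with h | h
    · rcases Diagram.aligned_or_beyond hcb hu with ⟨i', hi'⟩ | hi
      · exact .inl ⟨_, .inl ⟨h, i', rfl, hi'⟩⟩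
      · exact .inr ⟨i, rfl, by unfold Diagram.Beyond at *; omega, hi⟩
    · rcases Diagram.aligned_or_beyond hdb hu with ⟨i', hi'⟩ | hi
      · exact .inl ⟨_, .inr ⟨h, i', rfl, hi'⟩⟩
      · exact .inr ⟨i, rfl, hi, by unfold Diagram.Beyond at *; omega⟩

theorem Token.surface {u : Vertex T} {v : Vertex T₂} (h : Token c d b u v) :
    surfaceOf place c d b (placeVertex place u) = surfaceOf place c d b (.inl v) := by
  rcases u with i | w | i
  · obtain rfl : v = _ := h
    rfl
  · exact h.elim
  · rcases h with ⟨-, i', rfl, h⟩ | ⟨-, i', rfl, h⟩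
    · exact Quot.sound (.out _ _ h.edge)
    · exact (Quot.sound (.below _ _ h.edge)).trans (Quot.sound (.glue i')).symm

theorem Token.samePlatform {u u' : Vertex T} {v v' : Vertex T₂} (h : Token c d b u v)
    (h' : Token c d b u' v') (hu : SamePlatform c b u u') :
    SamePlatform c d v v' ∧ (v = v' → u = u') := by
  rcases u with i | w | i <;> rcases u' with j | w' | j <;> try exact hu.elim
  · obtain rfl : v = _ := h
    obtain rfl : v' = _ := h'
    exact ⟨hu, fun e => by cases e; rfl⟩
  · rcases h with ⟨h0, i', rfl, h⟩ | ⟨h0, i', rfl, h⟩ <;>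
      rcases h' with ⟨h0', j', rfl, h'⟩ | ⟨h0', j', rfl, h'⟩
    · exact ⟨h.samePlatform h' hu, fun e => by cases e; rw [h.eq h']⟩
    · omega
    · omega
    · exact ⟨h.samePlatform h' hu, fun e => by cases e; rw [h.eq h']⟩

/-- A product of basis elements at an adapted diagram lies in `I(T)` only if one of the factors
lies in `I(T₂)` or `I(T₁)`. -/
theorem Factors.killed (h : Factors l₂ l₁ l a) (hA : Adapted d T₁ b) (G : Gluing T₂ T₁ T place)
    (hcd : c.Compatible d) (hcb : c.Compatible b)
    (hk : (⟨c, b, hcb, l⟩ : LabelledDiagram T).Killed) :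
    (⟨c, d, hcd, l₂⟩ : LabelledDiagram T₂).Killed ∨
      (⟨d, b, hA.compatible, l₁⟩ : LabelledDiagram T₁).Killed := by
  have hinj := ((surface_isPushout G hcd hA.compatible).bijective hA.footBelow_injective).1
  have hb : ∀ i, b.Beyond d i → b.Beyond c i → ∃ x : {z // z ∉ Set.range
      (footBelow T₁ : Saddle c d b → _)}, x.1 = circleOf d T₁ b (.lower i) := fun i h1 h2 =>
    ⟨⟨_, hA.not_mem_range h1 h2⟩, rfl⟩
  rcases hk with ⟨u, u', hne, hu, he⟩ | ⟨u, hu, hX⟩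
  · have hs : surfaceOf place c d b (placeVertex place u) =
        surfaceOf place c d b (placeVertex place u') :=
      congrArg (fun z => boundarySurface place c d b (.inr (.inl z))) he
    have hu1 : SamePlatform c b u u := by
      rcases u with i | w | i <;> rcases u' with j | w' | j <;> try exact hu.elim
      · exact hu.imp (fun h => ⟨h.1, h.1⟩) fun h => ⟨h.1, h.1⟩
      · exact hu.imp (fun h => ⟨h.1, h.1⟩) fun h => ⟨h.1, h.1⟩
    have hu2 : SamePlatform c b u' u' := by
      rcases u with i | w | i <;> rcases u' with j | w' | j <;> try exact hu.elim
      · exact hu.imp (fun h => ⟨h.2, h.2⟩) fun h => ⟨h.2, h.2⟩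
      · exact hu.imp (fun h => ⟨h.2, h.2⟩) fun h => ⟨h.2, h.2⟩
    -- Each platform point of the output has a counterpart on the circles above, or lies beyond the
    -- platforms of both `c` and `d`. By `hinj`, two points of the first type on one component lie
    -- on one circle above, two of the second type on one circle below, and the mixed case is
    -- impossible.
    rcases exists_token (T₂ := T₂) hcb hA.compatible u hu1 with ⟨v, hv⟩ | ⟨i, rfl, h1, h2⟩ <;>
      rcases exists_token (T₂ := T₂) hcb hA.compatible u' hu2 with ⟨v', hv'⟩ | ⟨j, rfl, g1, g2⟩
    · obtain ⟨h1, h2⟩ := hv.samePlatform hv' hu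
      refine .inl (.inl ⟨v, v', fun e => hne (h2 e), h1, ?_⟩)
      have := hv.surface.symm.trans (hs.trans hv'.surface)
      exact Sum.inl_injective (hinj (a₁ := .inl (circleOf c T₂ d v))
        (a₂ := .inl (circleOf c T₂ d v')) this)
    · obtain ⟨x, hx⟩ := hb j g1 g2
      have : boundarySurface place c d b (.inl (.inl (circleOf c T₂ d v))) =
          boundarySurface place c d b (.inl (.inr x.1)) := by
        rw [hx]
        exact hv.surface.symm.trans hs
      cases hinj (a₁ := .inl (circleOf c T₂ d v)) (a₂ := .inr x) this
    · obtain ⟨x, hx⟩ := hb i h1 h2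
      have : boundarySurface place c d b (.inl (.inl (circleOf c T₂ d v'))) =
          boundarySurface place c d b (.inl (.inr x.1)) := by
        rw [hx]
        exact hv'.surface.symm.trans hs.symm
      cases hinj (a₁ := .inl (circleOf c T₂ d v')) (a₂ := .inr x) this
    · obtain ⟨x, hx⟩ := hb i h1 h2
      obtain ⟨y, hy⟩ := hb j g1 g2
      have : boundarySurface (T₂ := T₂) place c d b (.inl (.inr x.1)) =
          boundarySurface place c d b (.inl (.inr y.1)) := by
        rw [hx, hy]
        exact hs
      have := Sum.inr_injective (hinj (a₁ := .inr x) (a₂ := .inr y) this)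
      refine .inr (.inl ⟨.lower i, .lower j, fun e => hne (by cases e; rfl), hu, ?_⟩)
      rw [← hx, ← hy, this]
  · have hX' : a (surfaceOf place c d b (placeVertex place u)) = Label.X :=
      (h.out (circleOf c T b u)).trans hX
    rcases exists_token (T₂ := T₂) hcb hA.compatible u hu with ⟨v, hv⟩ | ⟨i, rfl, h1, h2⟩
    · refine .inl (.inr ⟨v, (hv.samePlatform hv hu).1, ?_⟩)
      rw [hv.surface] at hX'
      exact (h.above (circleOf c T₂ d v)).symm.trans hX'
    · have h3 := (h.below _ (hA.not_mem_range h1 h2)).symm.trans hX'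
      obtain ⟨x, -, -, h', e⟩ := circleOf_beyond (T₁ := T₁) h1
      rw [e, h.one] at h3
      cases h3

end

/-! ### Maps on tensor products -/

section Tensor

variable {n s m : ℕ} {T₂ : FlatTangle s m} {T₁ : FlatTangle n s} {M : Type} [AddCommGroup M]

theorem tensor_add_left (x x' : F T₂) (y : F T₁) :
    tensor (x + x') y = tensor x y + tensor x' y :=
  congrArg (Submodule.mkQ _) (TensorProduct.add_tmul x x' y)

theorem tensor_add_right (x : F T₂) (y y' : F T₁) :
    tensor x (y + y') = tensor x y + tensor x y' :=
  congrArg (Submodule.mkQ _) (TensorProduct.tmul_add x y y')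

theorem tensor_smul_left (r : ℤ) (x : F T₂) (y : F T₁) : tensor (r • x) y = r • tensor x y :=
  congrArg (Submodule.mkQ _) (TensorProduct.smul_tmul' r x y).symm

theorem tensor_smul_right (r : ℤ) (x : F T₂) (y : F T₁) : tensor x (r • y) = r • tensor x y :=
  congrArg (Submodule.mkQ _) (TensorProduct.tmul_smul r x y)

theorem tensor_zero_left (y : F T₁) : tensor (0 : F T₂) y = 0 :=
  congrArg (Submodule.mkQ _) (TensorProduct.zero_tmul _ y)

theorem tensor_zero_right (x : F T₂) : tensor x (0 : F T₁) = 0 :=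
  congrArg (Submodule.mkQ _) (TensorProduct.tmul_zero _ x)

theorem tensor_balanced (x : F T₂) (a : A s) (y : F T₁) :
    tensor (rightAct T₂ x a) y = tensor x (leftAct T₁ a y) :=
  (Submodule.Quotient.eq _).2 (Submodule.subset_span ⟨x, a, y, rfl⟩)

variable (T₂ T₁) in
/-- The map `(x, y) ↦ x ⊗ y`. -/
noncomputable def tensorHom : F T₂ →ₗ[ℤ] F T₁ →ₗ[ℤ] TensorF T₂ T₁ :=
  LinearMap.mk₂ ℤ tensor tensor_add_left tensor_smul_left tensor_add_right
    fun r x y => tensor_smul_right r x y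

theorem tensor_induction {P : TensorF T₂ T₁ → Prop} (h : ∀ x y, P (tensor x y))
    (add : ∀ x y, P x → P y → P (x + y)) (x : TensorF T₂ T₁) : P x := by
  obtain ⟨x, rfl⟩ := Submodule.mkQ_surjective _ x
  induction x using TensorProduct.induction_on with
  | zero => rw [map_zero, ← tensor_zero_left (T₂ := T₂) (0 : F T₁)]; exact h _ _
  | tmul x y => exact h x y
  | add x y hx hy => rw [map_add]; exact add _ _ hx hy

/-- The map on the tensor product that is induced by a balanced bilinear map. -/
noncomputable def tensorLift (f : F T₂ →ₗ[ℤ] F T₁ →ₗ[ℤ] M)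
    (h : ∀ x a y, f (rightAct T₂ x a) y = f x (leftAct T₁ a y)) : TensorF T₂ T₁ →ₗ[ℤ] M :=
  Submodule.liftQ _ (TensorProduct.lift f) (Submodule.span_le.2 (by
    rintro _ ⟨x, a, y, rfl⟩
    change TensorProduct.lift f _ = 0
    rw [map_sub, TensorProduct.lift.tmul, TensorProduct.lift.tmul, h, sub_self]))

theorem tensorLift_tensor (f : F T₂ →ₗ[ℤ] F T₁ →ₗ[ℤ] M)
    (h : ∀ x a y, f (rightAct T₂ x a) y = f x (leftAct T₁ a y)) (x : F T₂) (y : F T₁) :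
    tensorLift f h (tensor x y) = f x y := by
  change TensorProduct.lift f (x ⊗ₜ y) = _
  rw [TensorProduct.lift.tmul]

variable {T : FlatTangle n m} {place : T.Piece → T₂.Piece ⊕ T₁.Piece}

/-- The map `F(T₂) ⊗ F(T₁) → F(T)` that is induced by the minimal cobordisms. -/
noncomputable def tensorMap (G : Gluing T₂ T₁ T place) : TensorF T₂ T₁ →ₗ[ℤ] F T :=
  tensorLift (mulF place) (mulF_assoc (.middle G))

theorem tensorMap_tensor (G : Gluing T₂ T₁ T place) (x : F T₂) (y : F T₁) :
    tensorMap G (tensor x y) = mulF place x y :=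
  tensorLift_tensor _ _ x y

end Tensor

/-! ### Tangles with adapted diagrams -/

/-- The diagram of nested arcs that join the left platform to the free points. -/
def Diagram.nested (n : ℕ) : Diagram n where
  k := 0
  k_le := Nat.zero_le n
  arc := Fin.rev
  arc_arc := Fin.rev_rev
  arc_ne i h := by
    have := congrArg Fin.val h
    rw [Fin.val_rev] at this
    omega
  noncrossing i j := by
    rw [Fin.lt_def, Fin.lt_def, Fin.lt_def, Fin.val_rev, Fin.val_rev]
    omega
  left_platform i hi := by
    rw [Fin.val_rev]
    omega
  right_platform i hi := by omega

section Bijective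

variable {n s : ℕ}

/-- There is an adapted diagram for every `b`, unless all diagrams `W(c) T b` have a circle that
meets a platform twice, and this also holds for all tangles `T` that start with `T₁`. -/
def HasAdapted (T₁ : FlatTangle n s) : Prop :=
  ∀ b : Diagram n, (∃ d, Adapted d T₁ b) ∨
    ∀ {m : ℕ} (T₂ : FlatTangle s m) (T : FlatTangle n m) (place : T.Piece → T₂.Piece ⊕ T₁.Piece),
      Gluing T₂ T₁ T place → ∀ β : LabelledDiagram T, β.b = b → β.Killed

/-- The map from `F(T₂) ⊗ F(T₁)` is bijective for all tangles `T₂`. -/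
def IsFlat (T₁ : FlatTangle n s) : Prop :=
  ∀ {m : ℕ} (T₂ : FlatTangle s m) (T : FlatTangle n m) (place : T.Piece → T₂.Piece ⊕ T₁.Piece)
    (G : Gluing T₂ T₁ T place), Function.Bijective (tensorMap G)

variable {m : ℕ} {T₂ : FlatTangle s m} {T₁ : FlatTangle n s} {T : FlatTangle n m}
  {place : T.Piece → T₂.Piece ⊕ T₁.Piece}

/-- The tensor product is spanned by products at adapted diagrams. -/
theorem tensor_induction_adapted (hT : HasAdapted T₁) (d₀ : Diagram n → Diagram s)
    (hd : ∀ b, (∃ d, Adapted d T₁ b) → Adapted (d₀ b) T₁ b) {P : TensorF T₂ T₁ → Prop}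
    (zero : P 0) (add : ∀ x y, P x → P y → P (x + y)) (smul : ∀ (r : ℤ) x, P x → P (r • x))
    (basis : ∀ (c : Diagram m) (b : Diagram n) (hA : Adapted (d₀ b) T₁ b)
      (hcd : c.Compatible (d₀ b)) (l₂ : Circle c T₂ (d₀ b) → Label)
      (l₁ : Circle (d₀ b) T₁ b → Label), (∀ x, l₁ (adaptedFoot (d₀ b) T₁ b x) = .one) →
      P (tensor (cls ⟨c, d₀ b, hcd, l₂⟩) (cls ⟨d₀ b, b, hA.compatible, l₁⟩)))
    (z : TensorF T₂ T₁) : P z := by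
  induction z using tensor_induction with
  | add x y hx hy => exact add x y hx hy
  | h x y =>
  induction y using F_induction with
  | zero => rw [tensor_zero_right]; exact zero
  | add y y' hy hy' => rw [tensor_add_right]; exact add _ _ hy hy'
  | smul r y hy => rw [tensor_smul_right]; exact smul r _ hy
  | h β =>
  by_cases hk : β.Killed
  · rw [cls_of_killed hk, tensor_zero_right]; exact zero
  obtain ⟨d, b, hdb, l⟩ := β
  rcases hT b with hb | hb
  · have hA := hd b hb
    have hdd : d.Compatible (d₀ b) := hdb.trans (Eq.symm hA.compatible)
    -- Factorization with an identity tangle on top writes the right tensor factor as an element of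
    -- `A s` times a basis element at the adapted diagram. The ring element is then moved to the
    -- left factor.
    obtain ⟨l', l₁, a, hf⟩ := exists_factors_out hA (.idLeft T₁) hdd hdb hk
    rw [← hf.mulF_eq hA (.idLeft T₁) hdd hdb]
    refine (congrArg P (tensor_balanced x (cls ⟨d, d₀ b, hdd, l'⟩ : F _)
      (cls ⟨d₀ b, b, hA.compatible, l₁⟩))).mp ?_
    change P (tensor (mulF (T₂ := T₂) (T₁ := .id) (T := T₂) Sum.inl x _) _)
    induction x using F_induction with
    | zero => rw [map_zero, LinearMap.zero_apply, tensor_zero_left]; exact zero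
    | add x x' hx hx' =>
      rw [map_add, LinearMap.add_apply, tensor_add_left]; exact add _ _ hx hx'
    | smul r x hx => rw [map_smul, LinearMap.smul_apply, tensor_smul_left]; exact smul r _ hx
    | h β₂ =>
      obtain ⟨c, d', hcd', l₂⟩ := β₂
      by_cases hdd' : d' = d
      · subst hdd'
        have hc : c.Compatible (d₀ b) := hcd'.trans hdd
        have := Fintype.ofFinite (Circle c T₂ (d₀ b) → Label)
        rw [mulF_cls_self hc, finsum_eq_sum_of_fintype]
        refine Finset.sum_induction _ (fun v => P (tensor v _)) (fun v v' hv hv' => ?_) ?_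
          fun l _ => ?_
        · rw [tensor_add_left]; exact add _ _ hv hv'
        · rw [tensor_zero_left]; exact zero
        · rw [tensor_smul_left]; exact smul _ _ (basis c b hA hc l l₁ hf.one)
      · rw [mulF_cls_of_ne hdd', tensor_zero_left]; exact zero
  · exact absurd (hb .id T₁ Sum.inr (.idLeft T₁) ⟨d, b, hdb, l⟩ rfl) hk

/-- A basis element that is not killed is itself a product at an adapted diagram. If `b` has no
adapted diagram, there is no such basis element. -/
theorem tensorMap_surjective (hT : HasAdapted T₁) (G : Gluing T₂ T₁ T place) :
    Function.Surjective (tensorMap G) := by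
  intro z
  induction z using F_induction with
  | zero => exact ⟨0, map_zero _⟩
  | add x y hx hy =>
    obtain ⟨x, rfl⟩ := hx
    obtain ⟨y, rfl⟩ := hy
    exact ⟨x + y, map_add _ _ _⟩
  | smul r x hx =>
    obtain ⟨x, rfl⟩ := hx
    exact ⟨r • x, map_smul _ _ _⟩
  | h β =>
    by_cases hk : β.Killed
    · exact ⟨0, by rw [map_zero, cls_of_killed hk]⟩
    obtain ⟨c, b, hcb, l⟩ := β
    rcases hT b with ⟨d, hA⟩ | hb
    · have hcd : c.Compatible d := hcb.trans (Eq.symm hA.compatible)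
      obtain ⟨l₂, l₁, a, hf⟩ := exists_factors_out hA G hcd hcb hk
      exact ⟨_, (tensorMap_tensor G _ _).trans (hf.mulF_eq hA G hcd hcb)⟩
    · exact absurd (hb T₂ T place G ⟨c, b, hcb, l⟩ rfl) hk

/-- A map on `F(T)` is given by its values on the basis elements that are not in `I(T)`. -/
theorem exists_F_hom {M : Type} [AddCommGroup M] (t : LabelledDiagram T → M)
    (ht : ∀ β, β.Killed → t β = 0) : ∃ f : F T →ₗ[ℤ] M, ∀ β, f (cls β) = t β := by
  refine ⟨Submodule.liftQ (I T) (Finsupp.linearCombination ℤ t) (Submodule.span_le.2 ?_),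
    fun β => ?_⟩
  · rintro _ ⟨β, hβ, rfl⟩
    change Finsupp.linearCombination ℤ t (Finsupp.single β 1) = 0
    rw [Finsupp.linearCombination_single, one_smul, ht β hβ]
  · change Finsupp.linearCombination ℤ t (Finsupp.single β 1) = t β
    rw [Finsupp.linearCombination_single, one_smul]

/-- The left inverse sends a basis element that is not killed to the tensor of its unique factors,
and killed ones to zero. On the spanning products it is an inverse because, by `Factors.killed`, a
product is killed only if one of its factors is. -/
theorem tensorMap_injective (hT : HasAdapted T₁) (G : Gluing T₂ T₁ T place) :
    Function.Injective (tensorMap G) := by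
  classical
  obtain ⟨d₀, hd⟩ : ∃ d₀ : Diagram n → Diagram s,
      ∀ b, (∃ d, Adapted d T₁ b) → Adapted (d₀ b) T₁ b := by
    choose d₀ hd using fun b : Diagram n => show ∃ d₀ : Diagram s,
        (∃ d, Adapted d T₁ b) → Adapted d₀ T₁ b by
      by_cases hb : ∃ d, Adapted d T₁ b
      · exact ⟨hb.choose, fun _ => hb.choose_spec⟩
      -- An arbitrary default value, used only where no adapted diagram exists.
      · exact ⟨Diagram.nested s, fun h => absurd h hb⟩
    exact ⟨d₀, hd⟩
  have key : ∀ β : LabelledDiagram T, ∃ t : TensorF T₂ T₁, (β.Killed → t = 0) ∧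
      (¬ β.Killed → ∀ (hA : Adapted (d₀ β.b) T₁ β.b) (hcd : β.c.Compatible (d₀ β.b))
        (l₂ : Circle β.c T₂ (d₀ β.b) → Label) (l₁ : Circle (d₀ β.b) T₁ β.b → Label)
        (a : Surface place β.c (d₀ β.b) β.b → Label), Factors l₂ l₁ β.label a →
        t = tensor (cls ⟨β.c, d₀ β.b, hcd, l₂⟩) (cls ⟨d₀ β.b, β.b, hA.compatible, l₁⟩)) := by
    intro β
    by_cases hk : β.Killed
    · exact ⟨0, fun _ => rfl, fun h => absurd hk h⟩
    by_cases hA : Adapted (d₀ β.b) T₁ β.b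
    · have hcd : β.c.Compatible (d₀ β.b) := β.compatible.trans (Eq.symm hA.compatible)
      obtain ⟨l₂, l₁, a, hf⟩ := exists_factors_out hA G hcd β.compatible hk
      refine ⟨tensor (cls ⟨β.c, d₀ β.b, hcd, l₂⟩) (cls ⟨d₀ β.b, β.b, hA.compatible, l₁⟩),
        fun h => absurd h hk, fun _ _ _ l₂' l₁' a' hf' => ?_⟩
      obtain ⟨rfl, rfl⟩ := hf.unique hf' hA G hcd
      rfl
    · exact ⟨0, fun _ => rfl, fun _ h => absurd h hA⟩
  choose t ht0 ht using key
  obtain ⟨f, hf⟩ := exists_F_hom t ht0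
  refine Function.LeftInverse.injective (g := f) fun z => ?_
  induction z using tensor_induction_adapted hT d₀ hd with
  | zero => rw [map_zero, map_zero]
  | add x y hx hy => rw [map_add, map_add, hx, hy]
  | smul r x hx => rw [map_smul, map_smul, hx]
  | basis c b hA hcd l₂ l₁ hone =>
    by_cases hk : (⟨c, d₀ b, hcd, l₂⟩ : LabelledDiagram T₂).Killed
    · rw [cls_of_killed hk, tensor_zero_left, map_zero, map_zero]
    have hcb : c.Compatible b := hcd.trans hA.compatible
    obtain ⟨l, a, hl⟩ := exists_factors_above hA G hcd hk hone
    rw [tensorMap_tensor, hl.mulF_eq hA G hcd hcb, hf]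
    by_cases hk' : (⟨c, b, hcb, l⟩ : LabelledDiagram T).Killed
    · rw [ht0 _ hk', cls_of_killed ((hl.killed hA G hcd hcb hk').resolve_left hk),
        tensor_zero_right]
    · exact ht _ hk' hA hcd l₂ l₁ a hl

theorem HasAdapted.isFlat (hT : HasAdapted T₁) : IsFlat T₁ :=
  fun _ _ _ G => ⟨tensorMap_injective hT G, tensorMap_surjective hT G⟩

end Bijective

/-! ### Composition -/

section

variable {n s r m : ℕ} {T₃ : FlatTangle r m} {T₂ : FlatTangle s r} {T₁ : FlatTangle n s}
  {T₃₂ : FlatTangle s m} {T₂₁ : FlatTangle n r} {T : FlatTangle n m}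
  {p₃₂ : T₃₂.Piece → T₃.Piece ⊕ T₂.Piece} {p₂₁ : T₂₁.Piece → T₂.Piece ⊕ T₁.Piece}
  {pL : T.Piece → T₃₂.Piece ⊕ T₁.Piece} {pR : T.Piece → T₃.Piece ⊕ T₂₁.Piece}

/-- This is the associativity of tensor products: by assumption `F T` is the tensor product of `F
T₃₂` and `F T₁`, and `F T₃₂` that of `F T₃` and `F T₂`. Sending the product of `x`, `y`, `z` to `x ⊗
(y z)` gives the inverse, and surjectivity onto `F T₂₁` suffices to see this. -/
theorem tensorMap_bijective_of_triple (G : TripleGluing T₃ T₂ T₁ T₃₂ T₂₁ T p₃₂ p₂₁ pL pR)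
    (h₃₂ : Function.Bijective (tensorMap G.G₃₂)) (h₂₁ : Function.Surjective (tensorMap G.G₂₁))
    (hL : Function.Bijective (tensorMap G.HL)) : Function.Bijective (tensorMap G.HR) := by
  have hassoc := mulF_assoc G
  let e₃₂ : TensorF T₃ T₂ ≃ₗ[ℤ] F T₃₂ := LinearEquiv.ofBijective _ h₃₂
  let eL : TensorF T₃₂ T₁ ≃ₗ[ℤ] F T := LinearEquiv.ofBijective _ hL
  have he : ∀ x y, e₃₂.symm (mulF p₃₂ x y) = tensor x y := fun x y =>
    e₃₂.symm_apply_eq.2 (tensorMap_tensor G.G₃₂ x y).symm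
  have heL : ∀ x y, eL.symm (mulF pL x y) = tensor x y := fun x y =>
    eL.symm_apply_eq.2 (tensorMap_tensor G.HL x y).symm
  let f : F T₃ →ₗ[ℤ] F T₂ →ₗ[ℤ] F T₁ →ₗ[ℤ] TensorF T₃ T₂₁ :=
    LinearMap.mk₂ ℤ (fun x y => (tensorHom T₃ T₂₁ x).comp (mulF p₂₁ y))
      (fun x x' y => by rw [map_add, LinearMap.add_comp])
      (fun r x y => by rw [map_smul, LinearMap.smul_comp])
      (fun x y y' => by rw [map_add, LinearMap.comp_add])
      (fun r x y => by rw [map_smul, LinearMap.comp_smul])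
  have hf : ∀ x y z, f x y z = tensor x (mulF p₂₁ y z) := fun x y z => rfl
  -- The map that sends `x ⊗ y` to `z ↦ x ⊗ (y z)`. It is balanced over `A r`, as `(a y) z = a (y
  -- z)`; the map `D` is its version on the tensor product with `F T₃₂`, balanced over `A s`.
  let C : TensorF T₃ T₂ →ₗ[ℤ] F T₁ →ₗ[ℤ] TensorF T₃ T₂₁ := tensorLift f fun x a y =>
    LinearMap.ext fun z => by
      rw [hf, hf, tensor_balanced]
      exact congrArg (tensor x) (mulF_assoc (.left G.G₂₁) a y z).symm
  have hC : ∀ x y z, C (tensor x y) z = tensor x (mulF p₂₁ y z) := fun x y z => by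
    rw [tensorLift_tensor, hf]
  let D : TensorF T₃₂ T₁ →ₗ[ℤ] TensorF T₃ T₂₁ := tensorLift (C.comp e₃₂.symm.toLinearMap)
    fun u a z => by
      obtain ⟨w, rfl⟩ := e₃₂.surjective u
      induction w using tensor_induction with
      | add w w' h h' => simp only [map_add, LinearMap.add_apply] at h h' ⊢; rw [h, h']
      | h x y =>
        have h1 : e₃₂ (tensor x y) = mulF p₃₂ x y := tensorMap_tensor G.G₃₂ x y
        have h2 : rightAct T₃₂ (mulF p₃₂ x y) a = mulF p₃₂ x (rightAct T₂ y a) :=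
          mulF_assoc (.right G.G₃₂) x y a
        have h3 : mulF p₂₁ (rightAct T₂ y a) z = mulF p₂₁ y (leftAct T₁ a z) :=
          mulF_assoc (.middle G.G₂₁) y a z
        change C (e₃₂.symm _) z = C (e₃₂.symm _) _
        rw [h1, h2, he, he, hC, hC, h3]
  have hD : ∀ x y z, D (tensor (mulF p₃₂ x y) z) = tensor x (mulF p₂₁ y z) := fun x y z => by
    rw [tensorLift_tensor]
    change C (e₃₂.symm _) z = _
    rw [he, hC]
  constructor
  · refine Function.LeftInverse.injective (g := fun u => D (eL.symm u)) fun w => ?_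
    change D (eL.symm _) = w
    induction w using tensor_induction with
    | add w w' h h' => rw [map_add, map_add, map_add, h, h']
    | h x v =>
      obtain ⟨w, rfl⟩ := h₂₁ v
      induction w using tensor_induction with
      | add w w' h h' => rw [map_add, tensor_add_right, map_add, map_add, map_add, h, h']
      | h y z => rw [tensorMap_tensor, tensorMap_tensor, ← hassoc, heL, hD]
  · intro u
    obtain ⟨w, rfl⟩ := hL.2 u
    have hadd : ∀ u u', (∃ a, tensorMap G.HR a = u) → (∃ a, tensorMap G.HR a = u') →
        ∃ a, tensorMap G.HR a = u + u' := by
      rintro _ _ ⟨a, rfl⟩ ⟨a', rfl⟩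
      exact ⟨a + a', map_add _ _ _⟩
    induction w using tensor_induction with
    | add w w' h h' => rw [map_add]; exact hadd _ _ h h'
    | h v z =>
      obtain ⟨w, rfl⟩ := h₃₂.2 v
      induction w using tensor_induction with
      | add w w' h h' => rw [map_add, tensor_add_left, map_add]; exact hadd _ _ h h'
      | h x y =>
        exact ⟨tensor x (mulF p₂₁ y z), by
          rw [tensorMap_tensor, tensorMap_tensor, tensorMap_tensor, hassoc]⟩

/-- Because `IsFlat` quantifies over the upper tangle, it applies to `T₂` below `T₃`, and to `T₁`
below both `T₂` and the composite of `T₃` and `T₂`. -/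
theorem IsFlat.comp {n s r : ℕ} {T₂ : FlatTangle s r} {T₁ : FlatTangle n s} (h₂ : IsFlat T₂)
    (h₁ : IsFlat T₁) : IsFlat (T₂.comp T₁) := by
  intro m T₃ T place HR
  obtain ⟨pL, ⟨G⟩⟩ := exists_tripleGluing (Gluing.comp T₃ T₂) (Gluing.comp T₂ T₁) HR
  exact tensorMap_bijective_of_triple G (h₂ _ _ _ _) (h₁ _ _ _ _).2 (h₁ _ _ _ _)

theorem isFlat_of_elementary {n : ℕ} (hid : ∀ n, IsFlat (.id : FlatTangle n n))
    (hcup : ∀ m (i : Fin (m + 1)), IsFlat (.cup (.id : FlatTangle m m) i))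
    (hcap : ∀ m (i : Fin (m + 1)), IsFlat (.cap (.id : FlatTangle (m + 2) (m + 2)) i)) {m : ℕ}
    (T : FlatTangle n m) : IsFlat T := by
  induction T with
  | id => exact hid n
  -- Adding a local minimum is, by definition of `comp`, composition with an elementary tangle on
  -- top.
  | cup T i ih => exact IsFlat.comp (T₂ := .cup .id i) (hcup _ i) ih
  | cap T i ih => exact IsFlat.comp (T₂ := .cap .id i) (hcap _ i) ih

end

/-! ### Adapted diagrams for the elementary tangles -/

theorem hasAdapted_id (n : ℕ) : HasAdapted (.id : FlatTangle n n) := fun b => .inl ⟨b, adapted_id b⟩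

/-- The embedding that omits the two outermost points and two points in the middle. -/
def skip {m : ℕ} (q : ℕ) (t : Fin (2 * m)) : Fin (2 * (m + 2)) :=
  ⟨if t.val < q then t.val + 1 else t.val + 3, by split_ifs <;> omega⟩

section Skip

variable {m q : ℕ}

theorem skip_val (t : Fin (2 * m)) :
    t.val < q ∧ (skip q t).val = t.val + 1 ∨ q ≤ t.val ∧ (skip q t).val = t.val + 3 := by
  unfold skip
  split_ifs with h
  · exact .inl ⟨h, rfl⟩
  · exact .inr ⟨by omega, rfl⟩

theorem skip_lt_skip {t u : Fin (2 * m)} : skip q t < skip q u ↔ t < u := by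
  have h1 := skip_val (q := q) t
  have h2 := skip_val (q := q) u
  rw [Fin.lt_def, Fin.lt_def]
  omega

theorem skip_injective : Function.Injective (skip (m := m) q) := fun t u h => by
  have h1 := skip_val (q := q) t
  have h2 := skip_val (q := q) u
  have h3 := congrArg Fin.val h
  exact Fin.ext (by omega)

theorem exists_skip (hq : q ≤ 2 * m) (x : Fin (2 * (m + 2))) (h0 : x.val ≠ 0) (h1 : x.val ≠ q + 1)
    (h2 : x.val ≠ q + 2) (h3 : x.val ≠ 2 * m + 3) : ∃ t, x = skip q t := by
  by_cases h : x.val < q + 1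
  · refine ⟨⟨x.val - 1, by omega⟩, Fin.ext ?_⟩
    have := skip_val (q := q) (m := m) ⟨x.val - 1, by omega⟩
    simp only at this
    omega
  · refine ⟨⟨x.val - 3, by omega⟩, Fin.ext ?_⟩
    have := skip_val (q := q) (m := m) ⟨x.val - 3, by omega⟩
    simp only at this
    omega

end Skip

/-- A diagram with an additional small arc and an additional outermost arc. -/
theorem exists_cup {n : ℕ} (b : Diagram n) (i : Fin (n + 1)) :
    ∃ d : Diagram (n + 2), d.k = b.k + 1 ∧
      (∀ t, d.arc (skip ((n - b.k) + i.val) t) = skip ((n - b.k) + i.val) (b.arc t)) ∧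
      (∀ x y : Fin (2 * (n + 2)), x.val + y.val + 1 = 2 * (n + 2) → (x.val = 0 ∨ y.val = 0) →
        d.arc x = y) ∧
      ∀ x y : Fin (2 * (n + 2)), (x.val = (n - b.k) + i.val + 1 ∧ y.val = (n - b.k) + i.val + 2 ∨
        x.val = (n - b.k) + i.val + 2 ∧ y.val = (n - b.k) + i.val + 1) → d.arc x = y := by
  have hk := b.k_le
  -- The number of points of `b` to the left of the minimum. With the new outermost point in front,
  -- the small arc occupies the positions `q + 1` and `q + 2`.
  obtain ⟨q, hq⟩ : ∃ q, q = (n - b.k) + i.val := ⟨_, rfl⟩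
  rw [← hq]
  have hq2 : q ≤ 2 * n := by omega
  have key : ∀ x : Fin (2 * (n + 2)), ∃ y : Fin (2 * (n + 2)),
      (∃ t, x = skip q t ∧ y = skip q (b.arc t)) ∨
      (x.val + y.val + 1 = 2 * (n + 2) ∧ (x.val = 0 ∨ y.val = 0)) ∨
      (x.val = q + 1 ∧ y.val = q + 2 ∨ x.val = q + 2 ∧ y.val = q + 1) := by
    intro x
    by_cases h0 : x.val = 0
    · exact ⟨⟨2 * n + 3, by omega⟩, .inr (.inl ⟨by simp only; omega, .inl h0⟩)⟩
    by_cases h1 : x.val = q + 1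
    · exact ⟨⟨q + 2, by omega⟩, .inr (.inr (.inl ⟨h1, rfl⟩))⟩
    by_cases h2 : x.val = q + 2
    · exact ⟨⟨q + 1, by omega⟩, .inr (.inr (.inr ⟨h2, rfl⟩))⟩
    by_cases h3 : x.val = 2 * n + 3
    · exact ⟨⟨0, by omega⟩, .inr (.inl ⟨by simp only; omega, .inr rfl⟩)⟩
    · obtain ⟨t, rfl⟩ := exists_skip hq2 x h0 h1 h2 h3
      exact ⟨_, .inl ⟨t, rfl, rfl⟩⟩
  choose arc harc using key
  have hs : ∀ t, arc (skip q t) = skip q (b.arc t) := fun t => by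
    have ht := skip_val (q := q) t
    rcases harc (skip q t) with ⟨u, hu, h⟩ | h | h
    · rw [h, skip_injective hu]
    · omega
    · omega
  have huniq : ∀ x y : Fin (2 * (n + 2)),
      ((x.val + y.val + 1 = 2 * (n + 2) ∧ (x.val = 0 ∨ y.val = 0)) ∨
      (x.val = q + 1 ∧ y.val = q + 2 ∨ x.val = q + 2 ∧ y.val = q + 1)) → arc x = y := by
    intro x y hxy
    rcases harc x with ⟨t, rfl, h⟩ | h
    · have := skip_val (q := q) t
      omega
    · exact Fin.ext (by omega)
  refine ⟨⟨b.k + 1, by omega, arc, ?_, ?_, ?_, ?_, ?_⟩, rfl, hs, fun x y h h' =>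
    huniq x y (.inl ⟨h, h'⟩), fun x y h => huniq x y (.inr h)⟩
  · intro x
    rcases harc x with ⟨t, rfl, h⟩ | h
    · rw [hs, hs, b.arc_arc]
    · exact huniq _ _ (by omega)
  · intro x hx
    rcases harc x with ⟨t, rfl, h⟩ | h
    · rw [hs] at hx
      exact b.arc_ne t (skip_injective hx)
    · rw [hx] at h
      omega
  · rintro x y ⟨h1, h2, h3⟩
    rcases harc x with ⟨t, rfl, h⟩ | h <;> rcases harc y with ⟨u, rfl, h'⟩ | h'
    · rw [hs] at h2 h3
      rw [hs] at h3
      exact b.noncrossing t u ⟨skip_lt_skip.1 h1, skip_lt_skip.1 h2, skip_lt_skip.1 h3⟩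
    · have := skip_val (q := q) t
      rw [hs] at h2 h3
      have := skip_val (q := q) (b.arc t)
      rw [Fin.lt_def] at h1 h2 h3
      omega
    · rw [hs] at h3
      have := skip_val (q := q) u
      have := skip_val (q := q) (b.arc u)
      rw [Fin.lt_def] at h1 h2 h3
      omega
    · rw [Fin.lt_def] at h1 h2 h3
      omega
  · intro x hx hx'
    rcases harc x with ⟨t, rfl, h⟩ | h
    · rw [hs] at hx'
      have h1 := skip_val (q := q) t
      have h2 := skip_val (q := q) (b.arc t)
      exact b.left_platform t (by omega) (by omega)
    · omega
  · intro x hx hx'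
    rcases harc x with ⟨t, rfl, h⟩ | h
    · rw [hs] at hx'
      have h1 := skip_val (q := q) t
      have h2 := skip_val (q := q) (b.arc t)
      exact b.right_platform t (by omega) (by omega)
    · omega

/-- A circle of `W(d) T b` consists of an arc of `b` and its copy in `d`, or of the small arc and
the minimum, or of the outermost arc of `d` and its closing arc. So each contains one arc of `d`,
whose left end is recorded by `f`. -/
theorem hasAdapted_cup (n : ℕ) (i : Fin (n + 1)) :
    HasAdapted (.cup (.id : FlatTangle n n) i) := by
  intro b
  obtain ⟨d, hdk, hs, hout, hin⟩ := exists_cup b i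
  have hk := b.k_le
  have hi := i.2
  obtain ⟨q, hq⟩ : ∃ q, q = (n - b.k) + i.val := ⟨_, rfl⟩
  rw [← hq] at hs hin
  have hl : ∀ t, d.leftEnd (skip q (b.arc t)) = d.leftEnd (skip q t) := fun t => by
    rw [← hs, d.leftEnd_arc]
  let f : Vertex (.cup (.id : FlatTangle n n) i) → Fin (2 * (n + 2)) := fun u =>
    match u with
    | .upper x => d.leftEnd x
    | .lower t => d.leftEnd (skip q t)
    | .strand v => Option.elim (α := Fin n) v (d.leftEnd ⟨q + 1, by omega⟩) fun j =>
        d.leftEnd (skip q ⟨(n - b.k) + j.val, by omega⟩)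
  have hf : ∀ u v, Edge d (.cup .id i) b u v → f u = f v := by
    intro u v h
    cases h with
    | lowerArc t => exact (hl t).symm
    | upperArc x => exact (d.leftEnd_arc x).symm
    | tangle u v h =>
      obtain ⟨_, _, -, -, h⟩ := h
      exact h.elim
    | bot t j h => exact congrArg (fun t => d.leftEnd (skip q t)) (Fin.ext h)
    | top x j h =>
      by_cases h1 : j.val < i.val
      · rw [FlatTangle.top_cup_lt _ _ _ h1]
        refine congrArg d.leftEnd (Fin.ext ?_)
        have := skip_val (q := q) (m := n) ⟨(n - b.k) + j.val, by omega⟩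
        simp only at this
        change x.val = (skip q ⟨(n - b.k) + j.val, _⟩).val
        omega
      by_cases h2 : j.val ≤ i.val + 1
      · rw [FlatTangle.top_cup_mid _ _ _ (by omega) h2]
        change d.leftEnd x = d.leftEnd ⟨q + 1, _⟩
        by_cases h3 : x.val = q + 1
        · exact congrArg d.leftEnd (Fin.ext h3)
        · rw [← d.leftEnd_arc x, hin x ⟨q + 1, by omega⟩ (.inr ⟨by omega, rfl⟩)]
      · rw [FlatTangle.top_cup_gt _ _ _ (by omega)]
        refine congrArg d.leftEnd (Fin.ext ?_)
        have := skip_val (q := q) (m := n) ⟨(n - b.k) + (j.val - 2), by omega⟩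
        simp only at this
        change x.val = (skip q ⟨(n - b.k) + (j.val - 2), _⟩).val
        omega
    | leftVertical t x h1 h2 h =>
      refine congrArg d.leftEnd (Fin.ext ?_)
      have := skip_val (q := q) t
      omega
    | rightVertical t x h1 h2 h =>
      refine congrArg d.leftEnd (Fin.ext ?_)
      have := skip_val (q := q) t
      omega
    -- Each platform of `d` is larger by one than that of `b`, so `b` has no closing arcs.
    | lowerExtra t t' h1 h => omega
    | upperExtra x y h1 h =>
      change d.leftEnd x = d.leftEnd y
      rw [← d.leftEnd_arc x, hout x y h (by omega)]
  refine .inl ⟨d, ⟨?_, ?_⟩⟩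
  · unfold Diagram.Compatible
    omega
  · rintro (x | x) (y | y) h
    · have := congrArg (Quot.lift f hf) h
      change d.leftEnd x.1 = d.leftEnd y.1 at this
      rw [Diagram.leftEnd_of_lt x.2, Diagram.leftEnd_of_lt y.2] at this
      rw [Subtype.ext this]
    · have := y.2
      omega
    · have := x.2
      omega
    · have := x.2
      omega

/-! ### The adapted diagram for a local maximum -/

section Cap

variable {m : ℕ} (b : Diagram (m + 2)) (f f' : Fin (2 * (m + 2)))

/-- The arcs of a diagram after joining the points `f` and `f'`. -/
def capArc (x : Fin (2 * (m + 2))) : Fin (2 * (m + 2)) :=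
  if b.arc x = f then b.arc f' else if b.arc x = f' then b.arc f else b.arc x

variable {b f f'} {x : Fin (2 * (m + 2))}

theorem capArc_cases (hx : x ≠ f) (hx' : x ≠ f') :
    (b.arc x ≠ f ∧ b.arc x ≠ f' ∧ capArc b f f' x = b.arc x) ∨
    (b.arc f ≠ f' ∧ x = b.arc f ∧ capArc b f f' x = b.arc f') ∨
    (b.arc f ≠ f' ∧ x = b.arc f' ∧ capArc b f f' x = b.arc f) := by
  unfold capArc
  split_ifs with h h'
  · subst h
    refine .inr (.inl ⟨?_, (b.arc_arc x).symm, rfl⟩)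
    rw [b.arc_arc]
    exact hx'
  · subst h'
    exact .inr (.inr ⟨fun h1 => hx (by rw [← b.arc_arc x, ← h1, b.arc_arc]),
      (b.arc_arc x).symm, rfl⟩)
  · exact .inl ⟨h, h', rfl⟩

theorem capArc_ne (hx : x ≠ f) (hx' : x ≠ f') :
    capArc b f f' x ≠ f ∧ capArc b f f' x ≠ f' := by
  rcases capArc_cases hx hx' with ⟨h1, h2, h⟩ | ⟨h1, h2, h⟩ | ⟨h1, h2, h⟩ <;> rw [h]
  · exact ⟨h1, h2⟩
  · exact ⟨fun h3 => h1 (by rw [← h3, b.arc_arc]), b.arc_ne f'⟩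
  · exact ⟨b.arc_ne f, h1⟩

theorem capArc_arc_left : capArc b f f' (b.arc f) = b.arc f' := by
  unfold capArc
  rw [b.arc_arc, if_pos rfl]

theorem capArc_arc_right : capArc b f f' (b.arc f') = b.arc f := by
  unfold capArc
  rw [b.arc_arc]
  split_ifs with h1 h2
  · rw [h1]
  · rfl
  · exact absurd rfl h2

theorem capArc_capArc (hx : x ≠ f) (hx' : x ≠ f') :
    capArc b f f' (capArc b f f' x) = x := by
  rcases capArc_cases hx hx' with ⟨h1, h2, h⟩ | ⟨h1, h2, h⟩ | ⟨h1, h2, h⟩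
  · rw [h, capArc, b.arc_arc, if_neg hx, if_neg hx']
  · rw [h, capArc_arc_right, h2]
  · rw [h, capArc_arc_left, h2]

theorem capArc_ne_self (hff : f ≠ f') (hx : x ≠ f) (hx' : x ≠ f') : capArc b f f' x ≠ x := by
  rcases capArc_cases hx hx' with ⟨h1, h2, h⟩ | ⟨h1, h2, h⟩ | ⟨h1, h2, h⟩ <;> rw [h]
  · exact b.arc_ne x
  · rw [h2]
    exact fun h3 => hff (by rw [← b.arc_arc f', h3, b.arc_arc])
  · rw [h2]
    exact fun h3 => hff (by rw [← b.arc_arc f', ← h3, b.arc_arc])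

/-- Two arcs do not separate each other. -/
theorem Diagram.between_iff {n : ℕ} (b : Diagram n) (i j : Fin (2 * n)) (h : j ≠ i)
    (h' : j ≠ b.arc i) :
    ((i < j ∧ j < b.arc i) ∨ (b.arc i < j ∧ j < i)) ↔
      ((i < b.arc j ∧ b.arc j < b.arc i) ∨ (b.arc i < b.arc j ∧ b.arc j < i)) := by
  have h1 := b.noncrossing i j
  have h2 := b.noncrossing j i
  have h3 := b.noncrossing (b.arc i) j
  have h4 := b.noncrossing j (b.arc i)
  have h5 := b.noncrossing i (b.arc j)
  have h6 := b.noncrossing (b.arc j) i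
  have h7 := b.noncrossing (b.arc i) (b.arc j)
  have h8 := b.noncrossing (b.arc j) (b.arc i)
  have g1 : b.arc j ≠ i := fun h0 => h' (by rw [← h0, b.arc_arc])
  have g2 : b.arc j ≠ b.arc i := fun h0 => h (by rw [← b.arc_arc j, h0, b.arc_arc])
  simp only [b.arc_arc, Fin.lt_def, Ne, Fin.ext_iff] at *
  omega

theorem capArc_noncrossing (hf : f'.val = f.val + 1) (x y : Fin (2 * (m + 2))) (hx : x ≠ f)
    (hx' : x ≠ f') (hy : y ≠ f) (hy' : y ≠ f') :
    ¬ (x < y ∧ y < capArc b f f' x ∧ capArc b f f' x < capArc b f f' y) := by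
  -- As `f` and `f'` are neighbours, a point lies between their partners if and only if it lies
  -- under exactly one of the two old arcs. An untouched arc has both ends on the same side of each
  -- of these (`between_iff`).
  have key : ∀ z, z ≠ f → z ≠ f' → b.arc z ≠ f → b.arc z ≠ f' → b.arc f ≠ f' →
      (((b.arc f < z ∧ z < b.arc f') ∨ (b.arc f' < z ∧ z < b.arc f)) ↔
      ((b.arc f < b.arc z ∧ b.arc z < b.arc f') ∨ (b.arc f' < b.arc z ∧ b.arc z < b.arc f))) := by
    intro z h1 h2 h3 h4 h5
    have e1 : z ≠ b.arc f := fun h => h3 (by rw [h, b.arc_arc])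
    have e2 : z ≠ b.arc f' := fun h => h4 (by rw [h, b.arc_arc])
    have e3 : b.arc z ≠ b.arc f := fun h => h1 (by rw [← b.arc_arc z, h, b.arc_arc])
    have e4 : b.arc z ≠ b.arc f' := fun h => h2 (by rw [← b.arc_arc z, h, b.arc_arc])
    have k1 := b.between_iff f z h1 e1
    have k2 := b.between_iff f' z h2 e2
    simp only [Fin.lt_def, Ne, Fin.ext_iff] at *
    omega
  rcases capArc_cases hx hx' with ⟨h1, h2, h⟩ | ⟨h1, h2, h⟩ | ⟨h1, h2, h⟩ <;>
    rcases capArc_cases hy hy' with ⟨g1, g2, g⟩ | ⟨g1, g2, g⟩ | ⟨g1, g2, g⟩ <;> rw [h, g]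
  · exact b.noncrossing x y
  · have := key x hx hx' h1 h2 g1
    rw [g2]
    simp only [Fin.lt_def] at *
    omega
  · have := key x hx hx' h1 h2 g1
    rw [g2]
    simp only [Fin.lt_def] at *
    omega
  · have := key y hy hy' g1 g2 h1
    rw [h2]
    simp only [Fin.lt_def] at *
    omega
  · exact fun h3 => lt_irrefl _ h3.2.2
  · rw [g2]
    exact fun h3 => lt_irrefl _ h3.2.1
  · have := key y hy hy' g1 g2 h1
    rw [h2]
    simp only [Fin.lt_def] at *
    omega
  · rw [g2]
    exact fun h3 => lt_irrefl _ h3.2.1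
  · exact fun h3 => lt_irrefl _ h3.2.2

/-- If no two points of one platform are joined, then some point of the left platform is joined to
a point of the right platform. -/
theorem exists_left_right (hf : f'.val = f.val + 1) (hfl : m + 2 - b.k ≤ f.val)
    (hfr : f'.val < 2 * (m + 2) - b.k)
    (hns : ∀ x, x ≠ f → x ≠ f' → ¬ b.SamePlatform x (capArc b f f' x)) :
    ∃ x, x ≠ f ∧ x ≠ f' ∧ x.val < m + 2 - b.k ∧ 2 * (m + 2) - b.k ≤ (capArc b f f' x).val := by
  have hk := b.k_le
  have hff : f ≠ f' := fun h => by
    have := congrArg Fin.val h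
    omega
  by_contra hno
  push Not at hno
  -- An enumeration of all `m + 2` platform points. If no arc ran from one platform to the other,
  -- `capArc` would map them injectively to the `m` free points other than `f` and `f'`.
  let π : Fin (m + 2) → Fin (2 * (m + 2)) := fun j =>
    ⟨if j.val < m + 2 - b.k then j.val else j.val + (m + 2), by split_ifs <;> omega⟩
  have hπ : ∀ j, (j.val < m + 2 - b.k ∧ (π j).val = j.val) ∨
      (m + 2 - b.k ≤ j.val ∧ (π j).val = j.val + (m + 2)) := fun j => by
    simp only [π]
    split_ifs with h
    · exact .inl ⟨h, rfl⟩
    · exact .inr ⟨by omega, rfl⟩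
  have hπf : ∀ j, π j ≠ f ∧ π j ≠ f' := fun j => by
    have := hπ j
    constructor <;> intro h <;> have := congrArg Fin.val h <;> omega
  have hfree : ∀ j, m + 2 - b.k ≤ (capArc b f f' (π j)).val ∧
      (capArc b f f' (π j)).val < 2 * (m + 2) - b.k ∧ (capArc b f f' (π j)).val ≠ f.val ∧
      (capArc b f f' (π j)).val ≠ f'.val := fun j => by
    have h1 := hπ j
    obtain ⟨h2, h3⟩ := hπf j
    obtain ⟨h4, h5⟩ := capArc_ne (b := b) h2 h3
    have h6 := hns _ h2 h3
    have h7 := hno _ h2 h3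
    have h8 := hno _ h4 h5
    rw [capArc_capArc h2 h3] at h8
    unfold Diagram.SamePlatform at h6
    have h9 := fun h => h4 (Fin.ext h)
    have h10 := fun h => h5 (Fin.ext h)
    refine ⟨?_, ?_, h9, h10⟩ <;> omega
  have hb : ∀ y : Fin (2 * (m + 2)), (m + 2 - b.k ≤ y.val ∧
      y.val < 2 * (m + 2) - b.k ∧ y.val ≠ f.val ∧ y.val ≠ f'.val) → ∃ z : Fin m,
      (y.val < f.val ∧ z.val + (m + 2 - b.k) = y.val) ∨
      (f.val < y.val ∧ z.val + 2 + (m + 2 - b.k) = y.val) := fun y hy => by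
    rcases lt_or_ge y.val f.val with h | h
    · exact ⟨⟨y.val - (m + 2 - b.k), by omega⟩, .inl ⟨h, by simp only; omega⟩⟩
    · exact ⟨⟨y.val - 2 - (m + 2 - b.k), by omega⟩, .inr ⟨by omega, by simp only; omega⟩⟩
  choose φ hφ using fun j => hb _ (hfree j)
  have hinj : Function.Injective φ := fun i j hij => by
    have h1 := hφ i
    have h2 := hφ j
    have h3 := hfree i
    have h4 := hfree j
    rw [hij] at h1
    have h5 : capArc b f f' (π i) = capArc b f f' (π j) := Fin.ext (by omega)
    have h6 : π i = π j := by
      rw [← capArc_capArc (hπf i).1 (hπf i).2, h5, capArc_capArc (hπf j).1 (hπf j).2]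
    have h7 := hπ i
    have h8 := hπ j
    have h9 := congrArg Fin.val h6
    exact Fin.ext (by omega)
  have := Fintype.card_le_of_injective φ hinj
  rw [Fintype.card_fin, Fintype.card_fin] at this
  omega

/-- If no two points of one platform are joined, then the two outermost points are joined. -/
theorem capArc_outer (hf : f'.val = f.val + 1) (hfl : m + 2 - b.k ≤ f.val)
    (hfr : f'.val < 2 * (m + 2) - b.k)
    (hns : ∀ x, x ≠ f → x ≠ f' → ¬ b.SamePlatform x (capArc b f f' x)) :
    0 < m + 2 - b.k ∧ 0 < b.k ∧ ∀ x y : Fin (2 * (m + 2)), x.val + y.val + 1 = 2 * (m + 2) →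
      (x.val = 0 ∨ y.val = 0) → capArc b f f' x = y := by
  have hk := b.k_le
  have hff : f ≠ f' := fun h => by
    have := congrArg Fin.val h
    omega
  obtain ⟨x, hx, hx', hxl, hxr⟩ := exists_left_right hf hfl hfr hns
  obtain ⟨y, hy⟩ : ∃ y, y = capArc b f f' x := ⟨_, rfl⟩
  rw [← hy] at hxr
  have hyf := capArc_ne (b := b) hx hx'
  rw [← hy] at hyf
  have hyx : capArc b f f' y = x := by rw [hy, capArc_capArc hx hx']
  have h0 : ∃ o : Fin (2 * (m + 2)), o.val = 0 := ⟨⟨0, by omega⟩, rfl⟩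
  have h1 : ∃ t : Fin (2 * (m + 2)), t.val + 1 = 2 * (m + 2) := ⟨⟨2 * m + 3, by omega⟩, by
    simp only
    omega⟩
  obtain ⟨o, ho⟩ := h0
  obtain ⟨t, ht⟩ := h1
  have hof : o ≠ f ∧ o ≠ f' := ⟨fun h => by have := congrArg Fin.val h; omega,
    fun h => by have := congrArg Fin.val h; omega⟩
  have htf : t ≠ f ∧ t ≠ f' := ⟨fun h => by have := congrArg Fin.val h; omega,
    fun h => by have := congrArg Fin.val h; omega⟩
  have hzf := capArc_ne (b := b) hof.1 hof.2
  have hwf := capArc_ne (b := b) htf.1 htf.2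
  have hzo := capArc_capArc (b := b) hof.1 hof.2
  have hwt := capArc_capArc (b := b) htf.1 htf.2
  have n1 := capArc_noncrossing (b := b) hf o x hof.1 hof.2 hx hx'
  have n2 := capArc_noncrossing (b := b) hf x _ hx hx' hwf.1 hwf.2
  have n3 := capArc_noncrossing (b := b) hf o _ hof.1 hof.2 hwf.1 hwf.2
  rw [hwt] at n2 n3
  have s1 := hns o hof.1 hof.2
  have s2 := hns t htf.1 htf.2
  unfold Diagram.SamePlatform at s1 s2
  rw [← hy] at n1 n2
  -- The partner of `o` is not on the left platform, and its arc does not cross the one from `x` to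
  -- `y`; hence it lies on the right platform. The same holds for `t` with sides exchanged, and the
  -- two arcs do not cross, so they agree.
  have hot : capArc b f f' o = t := by
    by_contra hne
    have e1 : x = o → capArc b f f' o = y := fun h => by rw [hy, h]
    have e2 : y = t → capArc b f f' t = x := fun h => by rw [← hyx, h]
    have e3 : capArc b f f' t ≠ o := fun h => hne (by rw [← h, hwt])
    have e4 : capArc b f f' o = y → x = o := fun h => by rw [← hyx, ← h, hzo]
    have e5 : capArc b f f' t = x → y = t := fun h => by rw [hy, ← h, hwt]
    simp only [Fin.lt_def, Ne, Fin.ext_iff] at n1 n2 n3 hne e1 e2 e3 e4 e5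
    omega
  refine ⟨by omega, by omega, fun u v huv h => ?_⟩
  rcases h with h | h
  · have h2 : u = o := Fin.ext (by omega)
    have h3 : v = t := Fin.ext (by omega)
    rw [h2, h3, hot]
  · have h2 : u = t := Fin.ext (by omega)
    have h3 : v = o := Fin.ext (by omega)
    rw [h2, h3, ← hot, hzo]

end Cap

/-- The diagram that arises by joining two neighbouring free points and removing the outermost
arc. -/
theorem exists_cap {m : ℕ} (b : Diagram (m + 2)) {f f' : Fin (2 * (m + 2))} {q : ℕ}
    (hf : f'.val = f.val + 1) (hfq : f.val = q + 1) (hfl : m + 2 - b.k ≤ f.val)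
    (hfr : f'.val < 2 * (m + 2) - b.k)
    (hns : ∀ x, x ≠ f → x ≠ f' → ¬ b.SamePlatform x (capArc b f f' x)) :
    ∃ d : Diagram m, d.k + 1 = b.k ∧ ∀ t, capArc b f f' (skip q t) = skip q (d.arc t) := by
  obtain ⟨hp, hk0, hout⟩ := capArc_outer hf hfl hfr hns
  have hk := b.k_le
  have hff : f ≠ f' := fun h => by
    have := congrArg Fin.val h
    omega
  have hsf : ∀ t : Fin (2 * m), skip q t ≠ f ∧ skip q t ≠ f' := fun t => by
    have := skip_val (q := q) t
    constructor <;> intro h <;> have := congrArg Fin.val h <;> omega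
  have key : ∀ t : Fin (2 * m), ∃ u, capArc b f f' (skip q t) = skip q u := by
    intro t
    obtain ⟨h1, h2⟩ := capArc_ne (b := b) (hsf t).1 (hsf t).2
    have h3 := capArc_capArc (b := b) (hsf t).1 (hsf t).2
    have h4 := skip_val (q := q) t
    refine exists_skip (by omega) _ (fun h => ?_) (fun h => h1 (Fin.ext (by omega)))
      (fun h => h2 (Fin.ext (by omega))) fun h => ?_
    · have h5 := hout (capArc b f f' (skip q t)) ⟨2 * m + 3, by omega⟩ (by simp only; omega) (.inl h)
      rw [h3] at h5
      have := congrArg Fin.val h5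
      simp only at this
      omega
    · have h5 := hout (capArc b f f' (skip q t)) ⟨0, by omega⟩ (by simp only; omega) (.inr rfl)
      rw [h3] at h5
      have := congrArg Fin.val h5
      simp only at this
      omega
  choose arc harc using key
  refine ⟨⟨b.k - 1, by omega, arc, ?_, ?_, ?_, ?_, ?_⟩, by simp only; omega, harc⟩
  · intro t
    refine skip_injective (q := q) ?_
    rw [← harc, ← harc, capArc_capArc (hsf t).1 (hsf t).2]
  · intro t ht
    refine capArc_ne_self (b := b) hff (hsf t).1 (hsf t).2 ?_
    rw [harc, ht]
  · rintro t u ⟨h1, h2, h3⟩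
    refine capArc_noncrossing (b := b) hf _ _ (hsf t).1 (hsf t).2 (hsf u).1 (hsf u).2 ?_
    rw [harc, harc]
    exact ⟨skip_lt_skip.2 h1, skip_lt_skip.2 h2, skip_lt_skip.2 h3⟩
  · intro t ht ht'
    refine hns _ (hsf t).1 (hsf t).2 (.inl ?_)
    rw [harc]
    have h1 := skip_val (q := q) t
    have h2 := skip_val (q := q) (arc t)
    omega
  · intro t ht ht'
    refine hns _ (hsf t).1 (hsf t).2 (.inr ?_)
    rw [harc]
    have h1 := skip_val (q := q) t
    have h2 := skip_val (q := q) (arc t)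
    omega

/-- Whatever is put on top, `T` contains the maximum, which connects the arcs at `f` and `f'`. So
their partners lie on one circle, and it meets a platform twice. -/
theorem killed_of_cap {m r : ℕ} {i : Fin (m + 1)} {b : Diagram (m + 2)}
    {f f' : Fin (2 * (m + 2))} (hf : f.val = (m + 2 - b.k) + i.val) (hf' : f'.val = f.val + 1)
    (h : b.SamePlatform (b.arc f) (b.arc f')) {T₂ : FlatTangle m r} {T : FlatTangle (m + 2) r}
    {place : T.Piece → T₂.Piece ⊕ (FlatTangle.cap .id i).Piece}
    (G : Gluing T₂ (.cap .id i) T place) (β : LabelledDiagram T) (hb : β.b = b) : β.Killed := by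
  subst hb
  refine .inl ⟨.lower (β.b.arc f), .lower (β.b.arc f'), fun e => ?_, h, ?_⟩
  · have e1 : β.b.arc f = β.b.arc f' := by
      cases e' : β.b.arc f
      simp_all
    have e2 : f = f' := by rw [← β.b.arc_arc f, e1, β.b.arc_arc]
    have := congrArg Fin.val e2
    omega
  · have h1 : ∀ x, circleOf β.c T β.b (.lower x) = circleOf β.c T β.b (.lower (β.b.arc x)) :=
      fun x => Quot.sound (.lowerArc x)
    have h2 : circleOf β.c T β.b (.lower f) = circleOf β.c T β.b (.strand (T.bot i.castSucc)) :=
      Quot.sound (.bot f i.castSucc hf)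
    have h3 : circleOf β.c T β.b (.lower f') = circleOf β.c T β.b (.strand (T.bot i.succ)) :=
      Quot.sound (.bot f' i.succ (by rw [Fin.val_succ]; omega))
    have h4 : T.Joined (T.bot i.castSucc) (T.bot i.succ) :=
      (G.joined _ _).2 (.inr ⟨_, _, .inr ⟨rfl, rfl⟩, G.bot _, G.bot _⟩)
    have h5 : circleOf β.c T β.b (.strand (T.bot i.castSucc)) =
        circleOf β.c T β.b (.strand (T.bot i.succ)) := Quot.sound (.tangle _ _ h4)
    rw [← h1, ← h1, h2, h3, h5]

/-- If the two partners do not lie on one platform, `capArc` joins no two points of a platform, and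
counting forces an outermost arc, which is removed to obtain `d`. A circle of `W(d) T b` then
contains one arc of `d`, or the outermost arc with its closing arc, or only the arc from `f` to `f'`
and the maximum. -/
theorem hasAdapted_cap (m : ℕ) (i : Fin (m + 1)) :
    HasAdapted (.cap (.id : FlatTangle (m + 2) (m + 2)) i) := by
  intro b
  have hk := b.k_le
  have hi := i.2
  obtain ⟨f, hf⟩ : ∃ f : Fin (2 * (m + 2)), f.val = (m + 2 - b.k) + i.val :=
    ⟨⟨(m + 2 - b.k) + i.val, by omega⟩, rfl⟩
  obtain ⟨f', hf'⟩ : ∃ f' : Fin (2 * (m + 2)), f'.val = f.val + 1 :=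
    ⟨⟨f.val + 1, by omega⟩, rfl⟩
  by_cases hs : b.SamePlatform (b.arc f) (b.arc f')
  · exact .inr fun T₂ T place G β hb => killed_of_cap hf hf' hs G β hb
  have hns : ∀ x, x ≠ f → x ≠ f' → ¬ b.SamePlatform x (capArc b f f' x) := by
    intro x hx hx' h
    rcases capArc_cases hx hx' with ⟨h1, h2, e⟩ | ⟨h1, h2, e⟩ | ⟨h1, h2, e⟩ <;> rw [e] at h
    · exact h.elim (fun h => b.left_platform x h.1 h.2) fun h => b.right_platform x h.1 h.2
    · rw [h2] at h
      exact hs h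
    · rw [h2] at h
      exact hs (h.imp And.symm And.symm)
  obtain ⟨hp, hk0, hout⟩ := capArc_outer hf' (by omega) (by omega) hns
  obtain ⟨q, hq⟩ : ∃ q, f.val = q + 1 := ⟨f.val - 1, by omega⟩
  obtain ⟨d, hdk, hd⟩ := exists_cap b hf' hq (by omega) (by omega) hns
  have hff : f ≠ f' := fun h => by
    have := congrArg Fin.val h
    omega
  -- The name of the circle through a point of `b`: the left end of its arc after capping. If `f`
  -- and `f'` are joined already, they form a circle of their own, named `f`.
  let κ : Fin (2 * (m + 2)) → Fin (2 * (m + 2)) := fun x =>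
    if x = f ∨ x = f' then if b.arc f = f' then f else min (b.arc f) (b.arc f')
    else min x (capArc b f f' x)
  have hκf : κ f = κ f' := by simp [κ]
  have hκ : ∀ x, x ≠ f → x ≠ f' → κ x = min x (capArc b f f' x) := fun x h h' => by
    simp [κ, h, h']
  have hκc : ∀ x, x ≠ f → x ≠ f' → κ (capArc b f f' x) = κ x := fun x h h' => by
    obtain ⟨h1, h2⟩ := capArc_ne (b := b) h h'
    rw [hκ _ h1 h2, hκ _ h h', capArc_capArc h h', min_comm]
  have hκa : ∀ x, κ (b.arc x) = κ x := by
    have h1 : κ (b.arc f) = κ f := by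
      by_cases h : b.arc f = f'
      · rw [h, hκf]
      · rw [hκ _ (b.arc_ne f) h, capArc_arc_left]
        simp [κ, h]
    have h2 : κ (b.arc f') = κ f' := by
      by_cases h : b.arc f = f'
      · rw [← h, b.arc_arc, h, hκf]
      · rw [hκ _ (fun e => h (by rw [← e, b.arc_arc])) (b.arc_ne f'), capArc_arc_right]
        simp [κ, h, min_comm]
    intro x
    by_cases hx : x = f
    · rw [hx, h1]
    by_cases hx' : x = f'
    · rw [hx', h2]
    rcases capArc_cases (b := b) hx hx' with ⟨_, _, e⟩ | ⟨_, e, _⟩ | ⟨_, e, _⟩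
    · rw [← e, hκc x hx hx']
    · rw [e, b.arc_arc, h1]
    · rw [e, b.arc_arc, h2]
  have hsf : ∀ t : Fin (2 * m), skip q t ≠ f ∧ skip q t ≠ f' := fun t => by
    have := skip_val (q := q) t
    constructor <;> intro h <;> have := congrArg Fin.val h <;> omega
  have hκd : ∀ t : Fin (2 * m), κ (skip q (d.arc t)) = κ (skip q t) := fun t => by
    rw [← hd, hκc _ (hsf t).1 (hsf t).2]
  let g : Vertex (.cap (.id : FlatTangle (m + 2) (m + 2)) i) → Fin (2 * (m + 2)) := fun u =>
    match u with
    | .upper t => κ (skip q t)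
    | .lower x => κ x
    | .strand v => κ ⟨(m + 2 - b.k) + (show Fin (m + 2) from v).val, by
        have := (show Fin (m + 2) from v).2
        omega⟩
  have hg : ∀ u v, Edge d (.cap .id i) b u v → g u = g v := by
    intro u v h
    cases h with
    | lowerArc x => exact (hκa x).symm
    | upperArc t => exact (hκd t).symm
    | tangle u v h =>
      rcases h with h | ⟨rfl, rfl⟩
      · exact h.elim
      · have e1 : f = ⟨(m + 2 - b.k) + i.castSucc.val, by rw [Fin.val_castSucc]; omega⟩ := Fin.ext hf
        have e2 : f' = ⟨(m + 2 - b.k) + i.succ.val, by rw [Fin.val_succ]; omega⟩ := Fin.ext (by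
          simp only [Fin.val_succ]
          omega)
        exact (congrArg κ e1).symm.trans (hκf.trans (congrArg κ e2))
    | bot x j h => exact congrArg κ (Fin.ext h)
    | top t j h =>
      have ht := skip_val (q := q) t
      by_cases h1 : j.val < i.val
      · rw [FlatTangle.top_cap_lt _ _ _ h1]
        refine congrArg κ (Fin.ext ?_)
        change (skip q t).val = (m + 2 - b.k) + j.val
        omega
      · rw [FlatTangle.top_cap_ge _ _ _ (by omega)]
        refine congrArg κ (Fin.ext ?_)
        change (skip q t).val = (m + 2 - b.k) + (j.val + 2)
        omega
    | leftVertical x t h1 h2 h =>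
      refine congrArg κ (Fin.ext ?_)
      have := skip_val (q := q) t
      omega
    | rightVertical x t h1 h2 h =>
      refine congrArg κ (Fin.ext ?_)
      have := skip_val (q := q) t
      omega
    | lowerExtra x y h1 h =>
      have hxf : x ≠ f := fun e => by have := congrArg Fin.val e; omega
      have hxf' : x ≠ f' := fun e => by have := congrArg Fin.val e; omega
      have := hκc x hxf hxf'
      rw [hout x y h (by omega)] at this
      exact this.symm
    | upperExtra t t' h1 h => omega
  have hκs : ∀ t : {t : Fin (2 * m) // t < d.arc t}, κ (skip q t.1) = skip q t.1 := fun t => by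
    rw [hκ _ (hsf _).1 (hsf _).2, hd]
    exact min_eq_left (skip_lt_skip.2 t.2).le
  -- Each platform of `d` is smaller by one than that of `b`, so the only closing arc is at the
  -- outermost points, which `capArc` joins.
  have hκ0 : ∀ x : {x : Fin (2 * (m + 2)) // x.val + (m - d.k) < m + 2 - b.k},
      κ x.1 = x.1 := fun x => by
    have hx := x.2
    have hxf : x.1 ≠ f := fun e => by have := congrArg Fin.val e; omega
    have hxf' : x.1 ≠ f' := fun e => by have := congrArg Fin.val e; omega
    rw [hκ _ hxf hxf']
    exact min_eq_left (Fin.le_def.2 (by omega))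
  refine .inl ⟨d, ⟨?_, ?_⟩⟩
  · unfold Diagram.Compatible
    omega
  · rintro (x | x) (y | y) h
    · have := congrArg (Quot.lift g hg) h
      change κ (skip q x.1) = κ (skip q y.1) at this
      rw [hκs, hκs] at this
      rw [Subtype.ext (skip_injective this)]
    · have := congrArg (Quot.lift g hg) h
      change κ (skip q x.1) = κ y.1 at this
      rw [hκs, hκ0] at this
      have h1 := y.2
      have h2 := congrArg Fin.val this
      have h3 := skip_val (q := q) x.1
      omega
    · have := congrArg (Quot.lift g hg) h
      change κ x.1 = κ (skip q y.1) at this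
      rw [hκs, hκ0] at this
      have h1 := x.2
      have h2 := congrArg Fin.val this
      have h3 := skip_val (q := q) y.1
      omega
    · have h1 := x.2
      have h2 := y.2
      rw [Subtype.ext (Fin.ext (by omega : x.1.val = y.1.val))]

theorem isFlat {n m : ℕ} (T : FlatTangle n m) : IsFlat T :=
  isFlat_of_elementary (fun n => (hasAdapted_id n).isFlat) (fun m i => (hasAdapted_cup m i).isFlat)
    (fun m i => (hasAdapted_cap m i).isFlat) T

/-! ### Degrees -/

section Degree

variable {n s m : ℕ} {T₂ : FlatTangle s m} {T₁ : FlatTangle n s} {T : FlatTangle n m}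
  {place : T.Piece → T₂.Piece ⊕ T₁.Piece} {c : Diagram m} {d : Diagram s} {b : Diagram n}

theorem card_interval {N a k : ℕ} (P : Fin N → Prop) (h : a + k ≤ N)
    (hP : ∀ i, P i ↔ a ≤ i.val ∧ i.val < a + k) : Nat.card {i // P i} = k := by
  have e : {i // P i} ≃ Fin k :=
    { toFun := fun i => ⟨i.1.val - a, by have := (hP i.1).1 i.2; omega⟩
      invFun := fun j => ⟨⟨a + j.val, by omega⟩, (hP _).2 ⟨by simp only; omega, by
        simp only; omega⟩⟩
      left_inv := fun i => Subtype.ext (Fin.ext (by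
        have := (hP i.1).1 i.2
        simp only
        omega))
      right_inv := fun j => Fin.ext (by simp only; omega) }
  rw [Nat.card_congr e, Nat.card_fin]

theorem card_left_ends (d : Diagram s) : Nat.card {i : Fin (2 * s) // i < d.arc i} = s := by
  have e : {i : Fin (2 * s) // i < d.arc i} ≃ {i : Fin (2 * s) // ¬ i < d.arc i} :=
    { toFun := fun i => ⟨d.arc i.1, by rw [d.arc_arc]; exact i.2.not_gt⟩
      invFun := fun i => ⟨d.arc i.1, by
        rw [d.arc_arc]
        exact lt_of_le_of_ne (not_lt.1 i.2) (d.arc_ne _)⟩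
      left_inv := fun i => Subtype.ext (d.arc_arc _)
      right_inv := fun i => Subtype.ext (d.arc_arc _) }
  have h := Nat.card_congr (Equiv.sumCompl fun i : Fin (2 * s) => i < d.arc i)
  rw [Nat.card_sum, ← Nat.card_congr e, Nat.card_fin] at h
  omega

/-- There are `s` saddles at arcs of `d`, and one for each level beyond `d` that both `c` and `b`
reach; the extra circles correspond to the levels of `d` beyond both `c` and `b`. By compatibility,
differences of left platform sizes are half the differences of `n`, `s`, `m`. -/
theorem card_saddle_add_extra (hcd : c.Compatible d) (hdb : d.Compatible b) :
    (Nat.card (Saddle c d b) + Nat.card (ExtraCircle c d b) - s : ℤ) =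
      (max (n : ℤ) s + max (s : ℤ) m - max (n : ℤ) m - s) / 2 := by
  have hb := b.k_le
  have hc := c.k_le
  have hd := d.k_le
  replace hcd : (m : ℤ) - 2 * c.k = s - 2 * d.k := hcd
  replace hdb : (s : ℤ) - 2 * d.k = n - 2 * b.k := hdb
  have h1 : Nat.card (Saddle c d b) = s + (min (m - c.k) (n - b.k) - (s - d.k)) := by
    have h2 := card_interval (N := 2 * m) (a := (m - c.k) - (n - b.k))
      (k := min (m - c.k) (n - b.k) - (s - d.k))
      (fun i => i.val + (s - d.k) < m - c.k ∧ m - c.k ≤ i.val + (n - b.k)) (by omega)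
      (fun i => by omega)
    rw [Saddle, Nat.card_sum, card_left_ends, h2]
  have h2 : Nat.card (ExtraCircle c d b) = (s - d.k) - max (m - c.k) (n - b.k) :=
    card_interval (N := 2 * s) (a := 0)
      (fun i => i.val + (m - c.k) < s - d.k ∧ i.val + (n - b.k) < s - d.k) (by omega)
      (fun i => by omega)
  omega

theorem degree_eq (β : LabelledDiagram T) [Fintype (Circle β.c T β.b)] :
    β.degree = (∑ z, (β.label z).isX : ℕ) - (∑ z, (β.label z).isOne : ℕ) + n := by
  classical
  have hX : ∀ a : Label, a.isX = if a = Label.X then 1 else 0 := fun a => by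
    cases a <;> simp [Label.isX]
  have hO : ∀ a : Label, a.isOne = if a = Label.one then 1 else 0 := fun a => by
    cases a <;> simp [Label.isOne]
  simp only [LabelledDiagram.degree, Set.ncard_eq_toFinset_card', hX, hO, Finset.sum_boole]
  simp

/-- The minimal cobordisms are homogeneous. -/
theorem degree_of_coefficient (G : Gluing T₂ T₁ T place) (hcd : c.Compatible d)
    (hdb : d.Compatible b) (hcb : c.Compatible b) {l₂ : Circle c T₂ d → Label}
    {l₁ : Circle d T₁ b → Label} {l : Circle c T b → Label} (h : coefficient place l₂ l₁ l ≠ 0) :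
    (⟨c, b, hcb, l⟩ : LabelledDiagram T).degree =
      (⟨c, d, hcd, l₂⟩ : LabelledDiagram T₂).degree +
      (⟨d, b, hdb, l₁⟩ : LabelledDiagram T₁).degree +
      (max (n : ℤ) s + max (s : ℤ) m - max (n : ℤ) m - s) / 2 := by
  have := Fintype.ofFinite (Circle c T₂ d)
  have := Fintype.ofFinite (Circle d T₁ b)
  have := Fintype.ofFinite (Circle c T b)
  have := Fintype.ofFinite (ExtraCircle c d b)
  have := Fintype.ofFinite (Saddle c d b)
  have := Fintype.ofFinite (Surface place c d b)
  have h1 : ∀ j, genus place c d b j + charges place l₂ l₁ l j = 1 := fun j => by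
    by_contra hj
    exact h (by rw [coefficient_eq_weight, weight_eq_zero _ _ j hj])
  -- Summing over the components the condition for a nonzero coefficient (`h2`) and the Euler
  -- characteristic formula (`h3`), and eliminating genera and the number of components, shows that
  -- the degree grows by the number of saddles plus extra circles, minus the shift `s`.
  have h2 := Finset.sum_congr (rfl : (Finset.univ : Finset (Surface place c d b)) = _)
    fun j _ => h1 j
  have h3 := Finset.sum_congr (rfl : (Finset.univ : Finset (Surface place c d b)) = _)
    fun j _ => genus_spec G hcd hdb j
  simp only [charges, Finset.sum_add_distrib, sum_push, ← Finset.mul_sum, Finset.sum_const,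
    Finset.card_univ, smul_eq_mul, mul_one] at h2 h3
  have hl : ∀ {Z : Type} [Fintype Z] (f : Z → Label),
      ∑ z, (f z).isX + ∑ z, (f z).isOne = Fintype.card Z := fun f => by
    rw [← Finset.sum_add_distrib, Finset.sum_congr rfl fun z _ => show (f z).isX + (f z).isOne = 1 by
      cases f z <;> rfl, Finset.sum_const, Finset.card_univ, smul_eq_mul, mul_one]
  have e2 := hl l₂
  have e1 := hl l₁
  have e0 := hl l
  have hS := card_saddle_add_extra hcd hdb
  rw [Nat.card_eq_fintype_card, Nat.card_eq_fintype_card] at hS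
  rw [degree_eq, degree_eq, degree_eq, ← hS]
  simp only
  omega

theorem component_eq (i : ℤ) :
    component T i = Submodule.span ℤ (cls '' {β : LabelledDiagram T | β.degree = i}) := by
  rw [component, Submodule.map_span, Set.image_image]
  rfl

theorem mulF_mem_component (G : Gluing T₂ T₁ T place) {i j : ℤ} {x : F T₂} {y : F T₁}
    (hx : x ∈ component T₂ i) (hy : y ∈ component T₁ j) : mulF place x y ∈
      component T (i + j + (max (n : ℤ) s + max (s : ℤ) m - max (n : ℤ) m - s) / 2) := by
  rw [component_eq] at hx hy
  induction hx using Submodule.span_induction with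
  | zero => rw [map_zero, LinearMap.zero_apply]; exact Submodule.zero_mem _
  | add x x' _ _ h h' => rw [map_add, LinearMap.add_apply]; exact Submodule.add_mem _ h h'
  | smul r x _ h => rw [map_smul, LinearMap.smul_apply]; exact Submodule.smul_mem _ r h
  | mem x hx =>
    obtain ⟨β₂, rfl, rfl⟩ := hx
    induction hy using Submodule.span_induction with
    | zero => rw [map_zero]; exact Submodule.zero_mem _
    | add y y' _ _ h h' => rw [map_add]; exact Submodule.add_mem _ h h'
    | smul r y _ h => rw [map_smul]; exact Submodule.smul_mem _ r h
    | mem y hy =>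
      obtain ⟨β₁, rfl, rfl⟩ := hy
      obtain ⟨c, d, hcd, l₂⟩ := β₂
      obtain ⟨d', b, hdb, l₁⟩ := β₁
      by_cases hd : d = d'
      · subst hd
        have hcb : c.Compatible b := hcd.trans hdb
        have := Fintype.ofFinite (Circle c T b → Label)
        rw [mulF_cls_self hcb, finsum_eq_sum_of_fintype, component_eq]
        refine Submodule.sum_mem _ fun l _ => ?_
        by_cases h0 : coefficient place l₂ l₁ l = 0
        · rw [h0, zero_smul]
          exact Submodule.zero_mem _
        · exact Submodule.smul_mem _ _ (Submodule.subset_span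
            ⟨_, degree_of_coefficient G hcd hdb hcb h0, rfl⟩)
      · rw [mulF_cls_of_ne hd]
        exact Submodule.zero_mem _

end Degree

end FlatTangleBimodule

theorem mainTheorem4 {n s m : ℕ} (T₁ : FlatTangle n s) (T₂ : FlatTangle s m) :
    (IsUnitalRing n ∧ IsUnitalRing s ∧ IsUnitalRing m) ∧
    (IsBimodule T₁ ∧ IsBimodule T₂ ∧ IsBimodule (T₂.comp T₁)) ∧
    ∃ e : TensorF T₂ T₁ ≃+ F (T₂.comp T₁),
      (∀ (x : F T₂) (y : F T₁), e (tensor x y) = composeF T₂ T₁ x y) ∧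
      (∀ (a : A m) (x : F T₂) (y : F T₁),
        e (tensor (leftAct T₂ a x) y) = leftAct (T₂.comp T₁) a (e (tensor x y))) ∧
      (∀ (x : F T₂) (y : F T₁) (a : A n),
        e (tensor x (rightAct T₁ y a)) = rightAct (T₂.comp T₁) (e (tensor x y)) a) ∧
      (∀ (i j : ℤ), ∀ x ∈ component T₂ i, ∀ y ∈ component T₁ j,
        e (tensor x y) ∈ component (T₂.comp T₁)
          (i + j + (max (n : ℤ) s + max (s : ℤ) m - max (n : ℤ) m - s) / 2)) := by
  let G := Gluing.comp T₂ T₁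
  let e : TensorF T₂ T₁ ≃+ F (T₂.comp T₁) :=
    (LinearEquiv.ofBijective (tensorMap G) (isFlat T₁ T₂ _ _ G)).toAddEquiv
  have he : ∀ x y, e (tensor x y) = composeF T₂ T₁ x y := tensorMap_tensor G
  refine ⟨⟨isUnitalRing n, isUnitalRing s, isUnitalRing m⟩,
    ⟨isBimodule T₁, isBimodule T₂, isBimodule (T₂.comp T₁)⟩, e, he, fun a x y => ?_,
    fun x y a => ?_, fun i j x hx y hy => ?_⟩
  · rw [he, he]
    exact mulF_assoc (.left G) a x y
  · rw [he, he]
    exact (mulF_assoc (.right G) x y a).symm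
  · rw [he]
    exact mulF_mem_component G hx hy
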